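/- **Theorem 1.1 (Vertigan).** Let $P_L(a,z)\in\mathbb Z[a^{\pm1},z^{\pm1}]$ be the skein (Homflypt) polynomial of nonempty oriented links in $\mathbb R^3$: the isotopy invariant with $P=1$ on the unknot and $aP_{L_+}+a^{-1}P_{L_-}=zP_{L_0}$. Let $\mathrm{com}(L)$ be the number of components of $L$. Then $z^{\mathrm{com}(L)-1}P_L(a,z)=\sum_{i=0}^{M}P_{2i}(a)(L)\,z^{2i}$ for some $M$ and some $P_{2i}(a)(L)\in\mathbb Z[a^{\pm1}]$ (take $P_{2i}(a)(L)=0$ for $i>M$). For every fixed $i\ge 0$, $P_{2i}(a)(L)$ can be computed in polynomial time; more precisely, in time $O(n^{2+3i})$ from a diagram $D$ of $L$ with $n$ crossings, provided that $\mathrm{com}(L)\le n$. Explicitly: there are a program and constants $C,d$, depending only on $i$, such that for every such $D$, given by its signed Gauss code with the crossings numbered $0,\dots,n-1$, the program halts after at most $C\,n^{2+3i}$ steps with the output $P_{2i}(a)(L)$, and at all times all integers stored are at most $Cn^d$ in absolute value, and all elements of $\mathbb Z[a^{\pm1}]$ stored have exponents of absolute value at most $Cn^d$ and coefficients of absolute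 value at most $2^{Cn^d}$. Here programs run on a random access machine with registers and indirectly addressed memory for integers and for elements of $\mathbb Z[a^{\pm1}]$. A step is one addition, subtraction or multiplication of two integers or of two elements of $\mathbb Z[a^{\pm1}]$, the loading of a constant, one move between a register and memory, or one test whether an integer is positive. -/

import Mathlib

namespace Skein

/-! ### Oriented link diagrams

An oriented link diagram on the sphere is recorded by its signed Gauss code: one cyclic word per
component, listing the passages met while travelling along the component. -/

/-- A passage through a crossing: the name of the crossing, whether the strand passes over
(`true`) or under (`false`), and whether the crossing is positive (`true`) or negative. -/
structure Passage where
  label : ℕ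
  isOver : Bool
  isPos : Bool
deriving DecidableEq

/-- The other passage through the same crossing. -/
def Passage.partner (l : Passage) : Passage := ⟨l.label, !l.isOver, l.isPos⟩

/-- One word per component. An empty word is a component without crossings. -/
abbrev Code := List (List Passage)

/-- The set of (names of) crossings of a code. -/
def Code.crossings (D : Code) : Finset ℕ := (D.flatten.map Passage.label).toFinset

/-- The passage `q` comes immediately after `p` on some component (components are cyclic). -/
def Code.Follows (D : Code) (p q : Passage) : Prop :=
  ∃ w ∈ D, ∃ k < w.length, w[k]? = some p ∧ w[(k + 1) % w.length]? = some q

/-- A dart is an end of an edge at a crossing: `(p, true)` is the end by which the strand leaves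
the passage `p`, and `(p, false)` is the end by which it enters. -/
abbrev Dart := Passage × Bool

/-- The next dart counterclockwise around the crossing. At a positive crossing the
counterclockwise order is: over-out, under-out, over-in, under-in; at a negative crossing it is:
over-out, under-in, over-in, under-out. -/
def Dart.rot (d : Dart) : Dart :=
  (d.1.partner, if d.1.isOver = d.1.isPos then d.2 else !d.2)

/-- One step along the boundary of a face: cross an edge to its other end, then turn to the next
dart at the crossing reached there. -/
inductive Code.FaceStep (D : Code) : Dart → Dart → Prop
  | forward {p q : Passage} : D.Follows p q → Code.FaceStep D (p, true) (Dart.rot (q, false))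
  | backward {p q : Passage} : D.Follows p q → Code.FaceStep D (q, false) (Dart.rot (p, true))

/-- Two crossings lie on a common component. -/
def Code.Share (D : Code) (c c' : ℕ) : Prop :=
  ∃ w ∈ D, ∃ p ∈ w, ∃ q ∈ w, p.label = c ∧ q.label = c'

/-- The number of classes, of the equivalence relation generated by `r`, that meet `S`. -/
noncomputable def numClasses {α : Type} (r : α → α → Prop) (S : Set α) : ℕ :=
  ((fun x => {y | Relation.EqvGen r x y}) '' S).ncard

/-- The number of faces of the surface into which the code is canonically embedded. -/
noncomputable def Code.numFaces (D : Code) : ℕ :=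
  numClasses D.FaceStep {d | d.1 ∈ D.flatten}

/-- The number of connected components of the 4-valent graph formed by the crossings. -/
noncomputable def Code.numPieces (D : Code) : ℕ :=
  numClasses D.Share {c | c ∈ D.crossings}

/-- Each crossing is passed exactly twice, once over and once under, with the same sign. -/
def Code.WellFormed (D : Code) : Prop :=
  D.flatten.Nodup ∧ (∀ l ∈ D.flatten, l.partner ∈ D.flatten) ∧
    ∀ l ∈ D.flatten, ∀ l' ∈ D.flatten, l.label = l'.label → l' = l ∨ l' = l.partner

/-- The canonical surface is a disjoint union of spheres: `V - E + F = 2 C`, where the 4-valent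
graph with `V` vertices has `E = 2 V` edges. -/
def Code.Planar (D : Code) : Prop :=
  D.numFaces = D.crossings.card + 2 * D.numPieces

/-- A diagram of a nonempty oriented link: the Gauss code of a planar diagram. -/
structure LinkDiagram where
  code : Code
  nonempty : code ≠ []
  wellFormed : code.WellFormed
  planar : code.Planar

/-- The number of components of the link. -/
def LinkDiagram.com (D : LinkDiagram) : ℕ := D.code.length

/-- The number of crossings of the diagram. -/
def LinkDiagram.numCrossings (D : LinkDiagram) : ℕ := D.code.crossings.card

/-- The crossings are numbered `0, …, n - 1`. -/
def LinkDiagram.Numbered (D : LinkDiagram) : Prop := ∀ c ∈ D.code.crossings, c < D.numCrossings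

/-- The diagram of the unknot without crossings. -/
def LinkDiagram.circle : LinkDiagram where
  code := [[]]
  nonempty := by simp
  wellFormed := by simp [Code.WellFormed]
  planar := by simp [Code.Planar, Code.numFaces, Code.numPieces, Code.crossings, numClasses]

/-! ### Isotopy of links, on diagrams -/

/-- Delete from a code all crossings that the arc `A` passes through. -/
def Code.erase (A : List Passage) (D : Code) : Code :=
  D.map (List.filter fun l => l.label ∉ A.map Passage.label)

/-- The moves that generate isotopy of links. The first three only change how a diagram is written
as a code. In the last one, an arc `A` that passes over everything it meets is replaced by
another arc `A'` that has the same ends and also passes over everything it meets, the rest of the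
diagram being kept. The three Reidemeister moves are the cases where `A` and `A'` have at most
two crossings each: `A` with one crossing and `A'` with none (first move), `A` with two crossings
and `A'` with none (second move), and a strand with two crossings that is pushed over a third
crossing (third move). -/
inductive Code.Move : Code → Code → Prop
  | relabel (f : Equiv.Perm ℕ) (D : Code) :
      Code.Move D (D.map (List.map fun l => { l with label := f l.label }))
  | rotate {w w' : List Passage} (L : Code) (h : w.IsRotated w') : Code.Move (w :: L) (w' :: L)
  | reorder {D D' : Code} (h : D.Perm D') : Code.Move D D'
  | overpass {A A' X X' : List Passage} {L L' : Code}
      (hA : ∀ l ∈ A, l.isOver = true) (hA' : ∀ l ∈ A', l.isOver = true)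
      (h : Code.erase A (X :: L) = Code.erase A' (X' :: L')) :
      Code.Move ((A ++ X) :: L) ((A' ++ X') :: L')

/-- Skein triples `D₊, D₋, D₀`: the three diagrams agree except near one crossing `c`, which is
positive in `D₊`, negative in `D₋` and smoothed according to the orientation in `D₀`. -/
inductive Code.SkeinTriple : Code → Code → Code → Prop
  | self (c : ℕ) (X Y : List Passage) (L : Code) : Code.SkeinTriple
      ((⟨c, true, true⟩ :: X ++ ⟨c, false, true⟩ :: Y) :: L)
      ((⟨c, false, false⟩ :: X ++ ⟨c, true, false⟩ :: Y) :: L)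
      (X :: Y :: L)
  | mixed (c : ℕ) (X Y : List Passage) (L : Code) : Code.SkeinTriple
      ((⟨c, true, true⟩ :: X) :: (⟨c, false, true⟩ :: Y) :: L)
      ((⟨c, false, false⟩ :: X) :: (⟨c, true, false⟩ :: Y) :: L)
      ((X ++ Y) :: L)

/-! ### The skein polynomial -/

/-- The ring `ℤ[a, a⁻¹]`. -/
abbrev RingA := LaurentPolynomial ℤ

/-- The ring `ℤ[a, a⁻¹, z, z⁻¹]`, as Laurent polynomials in `z` over `ℤ[a, a⁻¹]`. -/
abbrev RingAZ := LaurentPolynomial RingA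

/-- The variable `a`, to the power `k`. -/
noncomputable def aPow (k : ℤ) : RingAZ := LaurentPolynomial.C (LaurentPolynomial.T k)

/-- The variable `z`, to the power `k`. -/
noncomputable def zPow (k : ℤ) : RingAZ := LaurentPolynomial.T k

/-- The recursive definition of the skein polynomial: an invariant of links with value `1` on the
unknot and `a P(L₊) + a⁻¹ P(L₋) = z P(L₀)`. -/
structure IsSkeinPolynomial (P : LinkDiagram → RingAZ) : Prop where
  isotopy : ∀ D D' : LinkDiagram, D.code.Move D'.code → P D = P D'
  unknot : P LinkDiagram.circle = 1
  skein : ∀ Dp Dm D0 : LinkDiagram, Code.SkeinTriple Dp.code Dm.code D0.code →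
    aPow 1 * P Dp + aPow (-1) * P Dm = zPow 1 * P D0

open Classical in
/-- The skein (Homflypt) polynomial: the function determined by the recursive definition. (It is a
classical theorem that there is exactly one such function; the value `0` is never used.) -/
noncomputable def homflypt : LinkDiagram → RingAZ :=
  if h : ∃ P, IsSkeinPolynomial P then h.choose else 0

/-- `z ^ (com(L) - 1) * P_L(a, z)`. -/
noncomputable def normalizedHomflypt (D : LinkDiagram) : RingAZ :=
  zPow ((D.com : ℤ) - 1) * homflypt D

/-- `P_{2i}(a)`, the coefficient of `z ^ (2 i)` in `z ^ (com(L) - 1) * P_L(a, z)`. -/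
noncomputable def homflyptCoeff (i : ℕ) (D : LinkDiagram) : RingA :=
  (normalizedHomflypt D).coeff (2 * (i : ℤ))

/-! ### The machine

A random access machine with integer registers and memory, and with further registers and memory
for elements of `ℤ[a, a⁻¹]`, which it can only add, subtract, multiply and move. -/

/-- The contents of the machine. -/
structure State where
  reg : ℕ → ℤ
  mem : ℤ → ℤ
  polyReg : ℕ → RingA
  polyMem : ℤ → RingA

/-- The basic instructions; the first argument is the target register, except for `store` and
`polyStore`, where the first argument is the register that holds the address. -/
inductive Instr where
  | const (r : ℕ) (k : ℤ)
  | add (r s t : ℕ)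
  | sub (r s t : ℕ)
  | mul (r s t : ℕ)
  | load (r s : ℕ)
  | store (r s : ℕ)
  | polyConst (r : ℕ) (q : RingA)
  | polyAdd (r s t : ℕ)
  | polySub (r s t : ℕ)
  | polyMul (r s t : ℕ)
  | polyLoad (r s : ℕ)
  | polyStore (r s : ℕ)

/-- The effect of an instruction. -/
noncomputable def Instr.run : Instr → State → State
  | const r k, S => { S with reg := Function.update S.reg r k }
  | add r s t, S => { S with reg := Function.update S.reg r (S.reg s + S.reg t) }
  | sub r s t, S => { S with reg := Function.update S.reg r (S.reg s - S.reg t) }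
  | mul r s t, S => { S with reg := Function.update S.reg r (S.reg s * S.reg t) }
  | load r s, S => { S with reg := Function.update S.reg r (S.mem (S.reg s)) }
  | store r s, S => { S with mem := Function.update S.mem (S.reg r) (S.reg s) }
  | polyConst r q, S => { S with polyReg := Function.update S.polyReg r q }
  | polyAdd r s t, S =>
      { S with polyReg := Function.update S.polyReg r (S.polyReg s + S.polyReg t) }
  | polySub r s t, S =>
      { S with polyReg := Function.update S.polyReg r (S.polyReg s - S.polyReg t) }
  | polyMul r s t, S =>
      { S with polyReg := Function.update S.polyReg r (S.polyReg s * S.polyReg t) }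
  | polyLoad r s, S => { S with polyReg := Function.update S.polyReg r (S.polyMem (S.reg s)) }
  | polyStore r s, S => { S with polyMem := Function.update S.polyMem (S.reg r) (S.polyReg s) }

/-- Programs. The conditions of `ite` and `loop` are that register `r` is positive; `loop r p` repeats `p`
while the condition holds. -/
inductive Program where
  | instr (o : Instr)
  | seq (p q : Program)
  | ite (r : ℕ) (p q : Program)
  | loop (r : ℕ) (p : Program)

/-- `Exec ok p S t S'`: started in state `S`, the program `p` halts in state `S'` after exactly `t`
steps, and every state that it produces on the way satisfies `ok`. Each basic instruction and
each test of a condition is one step. -/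
inductive Exec (ok : State → Prop) : Program → State → ℕ → State → Prop
  | instr {o : Instr} {S : State} (h : ok (o.run S)) : Exec ok (.instr o) S 1 (o.run S)
  | seq {p q : Program} {S S' S'' : State} {t t' : ℕ} (h : Exec ok p S t S')
      (h' : Exec ok q S' t' S'') : Exec ok (.seq p q) S (t + t') S''
  | ite_pos {r : ℕ} {p q : Program} {S S' : State} {t : ℕ} (hr : 0 < S.reg r)
      (h : Exec ok p S t S') : Exec ok (.ite r p q) S (t + 1) S'
  | ite_neg {r : ℕ} {p q : Program} {S S' : State} {t : ℕ} (hr : ¬ 0 < S.reg r)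
      (h : Exec ok q S t S') : Exec ok (.ite r p q) S (t + 1) S'
  | loop_pos {r : ℕ} {p : Program} {S S' S'' : State} {t t' : ℕ} (hr : 0 < S.reg r)
      (h : Exec ok p S t S') (h' : Exec ok (.loop r p) S' t' S'') :
      Exec ok (.loop r p) S (t + t' + 1) S''
  | loop_neg {r : ℕ} {p : Program} {S : State} (hr : ¬ 0 < S.reg r) :
      Exec ok (.loop r p) S 1 S

/-- Everything stored has size at most `B`: the integers are at most `B` in absolute value, and
the Laurent polynomials have exponents of absolute value at most `B` and coefficients of absolute
value at most `2 ^ B`. -/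
def State.SizeLE (B : ℕ) (S : State) : Prop :=
  (∀ r, |S.reg r| ≤ B) ∧ (∀ k, |S.mem k| ≤ B) ∧
  (∀ r e, (S.polyReg r).coeff e ≠ 0 → |e| ≤ B ∧ |(S.polyReg r).coeff e| ≤ 2 ^ B) ∧
  (∀ k e, (S.polyMem k).coeff e ≠ 0 → |e| ≤ B ∧ |(S.polyMem k).coeff e| ≤ 2 ^ B)

/-- A passage as three integers: crossing, over (`1`) or under (`0`), sign (`1` or `-1`). -/
def Passage.encode (l : Passage) : List ℤ :=
  [(l.label : ℤ), if l.isOver then 1 else 0, if l.isPos then 1 else -1]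

/-- A diagram as a list of integers: the number of components, and then for every component the
number of its passages followed by the passages. -/
def LinkDiagram.encode (D : LinkDiagram) : List ℤ :=
  (D.com : ℤ) :: D.code.flatMap fun w => (w.length : ℤ) :: w.flatMap Passage.encode

/-- The initial state: the diagram is in the memory cells `0, 1, 2, …`, all else is zero. -/
noncomputable def LinkDiagram.input (D : LinkDiagram) : State where
  reg := 0
  mem := fun k => if 0 ≤ k then D.encode.getD k.toNat 0 else 0
  polyReg := 0
  polyMem := 0

end Skein

namespace Skein

/-! ### Planarity as colourability of regions -/

section Passages

/-! Normalise the skein polynomial by `z ^ (com - 1)`. In the skein relation the smoothing of a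
crossing of a component with itself then has a coefficient free of `z`, and the smoothing of a
crossing of two components has a factor `z ^ 2`, written `X`. Travel along the components from base
points and switch each crossing that is first met on its under passage. This ends in a descending
diagram, which is an unlink with value `circleValue ^ (com - 1)`. The recursion `descend` records
this process, and `value_eq_descend` shows that every function with the skein properties agrees with
it; hence the expansion in even powers of `z`.

As it stands the recursion is exponential. To compute modulo `X ^ (k + 1)`, first expand at the
crossings of different components, until each component lies over all later ones (`Sorting`). Each
smoothing carries a factor `X`, so it is needed only modulo `X ^ k`, and there are at most as many
smoothings as positions. Stacked components are evaluated separately (`descend_append`). On a single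
component, switching the first crossing shortens the arc by its first passage, and smoothing it
leaves two shorter arcs (`descend_seg_expand`). All of these arcs are intervals of positions, so a
table of quadratically many arc values suffices. An entry requires sorting two arcs, that is,
linearly many evaluations at level `k - 1`. One level therefore costs a factor `n ^ 3`. At level
zero sorting only multiplies by switch coefficients; along a row of the table this product is
updated one factor at a time, which gives `n ^ 2`. Hence the exponent `2 + 3 * i` (`deg_evalCode`).

Sorting expands at crossings that are not the first ones met on the way. This is legitimate only
because the polynomial is an invariant. An arc with unpaired passages has a meaning as the
untravelled rest of a planar diagram (`Code.Good`). The travelled part can be made descending by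
switches that `descend` does not see, and the power of `circleValue` that it contributes can be
cancelled; this gives `Code.Good.expand`.

All diagrams that occur must be planar. The Euler characteristic condition is replaced by a mod 2
condition, `Code.Colorable`: every flow on the edges is the change of a colouring of the faces. A
dimension count gives the equivalence, and the new condition can be checked locally for switching,
smoothing, deleting a component and adding a kink.

The algorithm is written in a small language with loops and arrays, verified by weakest
preconditions, and compiled to the machine. Running time is bounded by the depth of nested loops,
and sizes by counting signed monomials (`Bd`). The existence of the skein polynomial is not needed:
if there is none, `homflypt` is zero and a constant program will do. -/

@[simp] theorem Passage.partner_partner (p : Passage) : p.partner.partner = p := by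
  simp [Passage.partner]

@[simp] theorem Passage.label_partner (p : Passage) : p.partner.label = p.label := rfl

@[simp] theorem Passage.isOver_partner (p : Passage) : p.partner.isOver = !p.isOver := rfl

@[simp] theorem Passage.isPos_partner (p : Passage) : p.partner.isPos = p.isPos := rfl

theorem Passage.partner_ne (p : Passage) : p.partner ≠ p := by
  intro h
  have := congrArg Passage.isOver h
  simp at this

end Passages

/-! ### Successors along the components -/

section Follows

variable {D : Code} {p q p' q' : Passage}

theorem Code.Follows.mem_left (h : D.Follows p q) : p ∈ D.flatten := by
  obtain ⟨w, hw, k, hk, h1, h2⟩ := h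
  exact List.mem_flatten.2 ⟨w, hw, List.mem_of_getElem? h1⟩

theorem Code.Follows.mem_right (h : D.Follows p q) : q ∈ D.flatten := by
  obtain ⟨w, hw, k, hk, h1, h2⟩ := h
  exact List.mem_flatten.2 ⟨w, hw, List.mem_of_getElem? h2⟩

theorem Code.exists_follows (h : p ∈ D.flatten) : ∃ q, D.Follows p q := by
  obtain ⟨w, hw, hp⟩ := List.mem_flatten.1 h
  obtain ⟨k, hk, rfl⟩ := List.mem_iff_getElem.1 hp
  have : (k + 1) % w.length < w.length := Nat.mod_lt _ (by omega)
  exact ⟨w[(k + 1) % w.length], w, hw, k, hk, by simp, by simp⟩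

theorem eq_of_mem_of_nodup_flatten (hD : D.flatten.Nodup) {w w' : List Passage} (hw : w ∈ D)
    (hw' : w' ∈ D) (h : p ∈ w) (h' : p ∈ w') : w = w' := by
  by_contra hne
  have hp := (List.nodup_flatten.1 hD).2
  have : Std.Symm (List.Disjoint (α := Passage)) := ⟨fun _ _ h => h.symm⟩
  exact (hp.forall hw hw' hne) h h'

theorem nodup_of_mem_of_nodup_flatten (hD : D.flatten.Nodup) {w : List Passage} (hw : w ∈ D) :
    w.Nodup := (List.nodup_flatten.1 hD).1 w hw

theorem Code.Follows.unique (hD : D.flatten.Nodup) (h : D.Follows p q) (h' : D.Follows p q') :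
    q = q' := by
  obtain ⟨w, hw, k, hk, h1, h2⟩ := h
  obtain ⟨w', hw', k', hk', h1', h2'⟩ := h'
  obtain rfl := eq_of_mem_of_nodup_flatten hD hw hw' (List.mem_of_getElem? h1)
    (List.mem_of_getElem? h1')
  have hn := nodup_of_mem_of_nodup_flatten hD hw
  have : k = k' := by
    rw [← h1'] at h1
    exact (List.getElem?_inj hk hn).1 h1
  subst this
  rw [h2] at h2'
  exact Option.some.inj h2'

theorem Code.Follows.injective (hD : D.flatten.Nodup) (h : D.Follows p q) (h' : D.Follows p' q) :
    p = p' := by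
  obtain ⟨w, hw, k, hk, h1, h2⟩ := h
  obtain ⟨w', hw', k', hk', h1', h2'⟩ := h'
  obtain rfl := eq_of_mem_of_nodup_flatten hD hw hw' (List.mem_of_getElem? h2)
    (List.mem_of_getElem? h2')
  have hn := nodup_of_mem_of_nodup_flatten hD hw
  have hlt : (k + 1) % w.length < w.length := Nat.mod_lt _ (by omega)
  have : (k + 1) % w.length = (k' + 1) % w.length := by
    rw [← h2'] at h2
    exact (List.getElem?_inj hlt hn).1 h2
  have : k = k' := by
    have h3 : k + 1 ≡ k' + 1 [MOD w.length] := this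
    have h4 := Nat.ModEq.add_right_cancel' 1 h3
    rwa [Nat.ModEq, Nat.mod_eq_of_lt hk, Nat.mod_eq_of_lt hk'] at h4
  subst this
  rw [h1] at h1'
  exact Option.some.inj h1'

/-- Relations that hold for consecutive passages are cyclic chains. -/
theorem Code.forall_follows_iff (D : Code) (R : Passage → Passage → Prop) :
    (∀ p q, D.Follows p q → R p q) ↔ ∀ w ∈ D, Cycle.Chain R (w : Cycle Passage) := by
  have key : ∀ w : List Passage, (∀ k < w.length, ∀ p q, w[k]? = some p →
      w[(k + 1) % w.length]? = some q → R p q) ↔ Cycle.Chain R (w : Cycle Passage) := by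
    intro w
    cases w with
    | nil => simp
    | cons a l =>
      have e1 : ∀ k < l.length + 1, (a :: (l ++ [a]))[k]? = (a :: l)[k]? := fun k hk => by
        grind
      have e2 : ∀ k < l.length + 1,
          (a :: (l ++ [a]))[k + 1]? = (a :: l)[(k + 1) % (a :: l).length]? := fun k hk => by
        rcases Nat.lt_or_ge (k + 1) (l.length + 1) with h1 | h1
        · rw [e1 _ h1, List.length_cons, Nat.mod_eq_of_lt h1]
        · have : k = l.length := by omega
          subst this
          simp
      rw [Cycle.chain_coe_cons, List.isChain_iff_getElem]
      grind
  constructor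
  · intro h w hw
    exact (key w).1 fun k hk p q h1 h2 => h p q ⟨w, hw, k, hk, h1, h2⟩
  · rintro h p q ⟨w, hw, k, hk, h1, h2⟩
    exact (key w).2 (h w hw) k hk p q h1 h2

end Follows

/-- A flow modulo two on the edges of the code, as a function on their ends. -/
structure Code.IsFlow (D : Code) (x : Dart → ZMod 2) : Prop where
  edge : ∀ p q, D.Follows p q → x (p, true) = x (q, false)
  vertex : ∀ p ∈ D.flatten,
    x (p, true) + x (p, false) + x (p.partner, true) + x (p.partner, false) = 0

/-- A colouring of the faces that changes across each edge by the value of the flow. -/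
def Code.IsColoring (D : Code) (x φ : Dart → ZMod 2) : Prop :=
  ∀ p q, D.Follows p q → φ (p, true) = φ (Dart.rot (q, false)) ∧
    φ (q, false) = φ (Dart.rot (p, true)) ∧ φ (p, true) + φ (q, false) = x (p, true)

/-- Every flow comes from a colouring of the faces. -/
def Code.Colorable (D : Code) : Prop := ∀ x, D.IsFlow x → ∃ φ, D.IsColoring x φ

/-! ### Numbers of classes as dimensions over `ZMod 2` -/

section Classes

variable {α : Type}

/-- The functions on `S` that are constant on the classes generated by `r`. -/
def invFun (r : α → α → Prop) (S : Set α) : Submodule (ZMod 2) (S → ZMod 2) where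
  carrier := {f | ∀ x y : S, Relation.EqvGen r x y → f x = f y}
  add_mem' := fun hf hg x y h => by simp [hf x y h, hg x y h]
  zero_mem' := fun _ _ _ => rfl
  smul_mem' := fun c f hf x y h => by simp [hf x y h]

/-- The generated equivalence lives on the whole type. As no step leaves or enters `S`, extension by
zero is invariant under every step, so checking single steps inside `S` is enough. -/
theorem invFun_of_step {r : α → α → Prop} {S : Set α} (hr : ∀ x y, r x y → x ∈ S ∧ y ∈ S)
    (f : S → ZMod 2) (hf : ∀ x y (hx : x ∈ S) (hy : y ∈ S), r x y → f ⟨x, hx⟩ = f ⟨y, hy⟩) :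
    f ∈ invFun r S := by
  classical
  let g : α → ZMod 2 := fun x => if h : x ∈ S then f ⟨x, h⟩ else 0
  have hg : ∀ x y, Relation.EqvGen r x y → g x = g y := by
    intro x y h
    induction h with
    | rel x y h =>
      grind
    | refl => rfl
    | symm _ _ _ ih => exact ih.symm
    | trans _ _ _ _ _ h1 h2 => exact h1.trans h2
  intro x y h
  have := hg x y h
  simpa [g] using this

/-- A function that is constant on classes is a function on the set of classes. This turns
`numFaces` and `numPieces` into dimensions, which linear algebra can compare. -/
theorem finrank_invFun (r : α → α → Prop) (S : Set α) [Finite S] :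
    Module.finrank (ZMod 2) (invFun r S) = numClasses r S := by
  classical
  let cls : α → Set α := fun x => {y | Relation.EqvGen r x y}
  have hcls : ∀ x y, cls x = cls y ↔ Relation.EqvGen r x y := by
    intro x y
    constructor
    · intro h
      have : y ∈ cls y := Relation.EqvGen.refl y
      rw [← h] at this
      exact this
    · intro h
      ext z
      exact ⟨fun hz => (h.symm).trans _ _ _ hz, fun hz => h.trans _ _ _ hz⟩
  let T : ((cls '' S : Set (Set α)) → ZMod 2) →ₗ[ZMod 2] invFun r S :=
    { toFun := fun f => ⟨fun x => f ⟨cls x, x, x.2, rfl⟩, fun x y h => by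
        have : cls x = cls y := (hcls x y).2 h
        simp only [this]⟩
      map_add' := fun f g => rfl
      map_smul' := fun c f => rfl }
  have hT : Function.Bijective T := by
    constructor
    · intro f g h
      funext ⟨_, x, hx, rfl⟩
      have := congrArg (fun u : invFun r S => u.1 ⟨x, hx⟩) h
      exact this
    · rintro ⟨f, hf⟩
      refine ⟨fun c => f ⟨c.2.choose, c.2.choose_spec.1⟩, ?_⟩
      apply Subtype.ext
      funext x
      have h : (cls x : Set α) ∈ cls '' S := ⟨x, x.2, rfl⟩
      exact hf _ _ ((hcls _ _).1 h.choose_spec.2)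
  have : Finite (cls '' S : Set (Set α)) := inferInstance
  have := Fintype.ofFinite (cls '' S : Set (Set α))
  rw [← (LinearEquiv.ofBijective T hT).finrank_eq, Module.finrank_fintype_fun_eq_card,
    ← Nat.card_eq_fintype_card]
  rfl

end Classes

end Skein

namespace Skein

/-! ### The incidence matrix of edges and crossings -/

section Criterion

variable {D : Code}

theorem Code.FaceStep.mem (hD : D.WellFormed) {d d' : Dart} (h : D.FaceStep d d') :
    d.1 ∈ D.flatten ∧ d'.1 ∈ D.flatten := by
  cases h with
  | forward h => exact ⟨h.mem_left, hD.2.1 _ h.mem_right⟩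
  | backward h => exact ⟨h.mem_right, hD.2.1 _ h.mem_left⟩

theorem Code.mem_crossings {c : ℕ} : c ∈ D.crossings ↔ ∃ p ∈ D.flatten, p.label = c := by
  simp only [Code.crossings, List.mem_toFinset, List.mem_map]

theorem Code.Follows.eqvGen_share {p q : Passage} (h : D.Follows p q) : D.Share p.label q.label := by
  obtain ⟨w, hw, k, hk, h1, h2⟩ := h
  exact ⟨w, hw, p, List.mem_of_getElem? h1, q, List.mem_of_getElem? h2, rfl, rfl⟩

/-- Functions of crossings that agree on consecutive passages are constant on pieces. -/
theorem Code.share_invariant {β : Type} (g : ℕ → β)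
    (hg : ∀ p q, D.Follows p q → g p.label = g q.label) {c c' : ℕ} (h : D.Share c c') :
    g c = g c' := by
  obtain ⟨w, hw, p, hp, q, hq, rfl, rfl⟩ := h
  have := (D.forall_follows_iff (fun p q => g p.label = g q.label)).1 hg w hw
  have : IsTrans Passage (fun p q => g p.label = g q.label) := ⟨fun _ _ _ h1 h2 => h1.trans h2⟩
  have h3 := (Cycle.chain_iff_pairwise (r := fun p q : Passage => g p.label = g q.label)
    (s := (w : Cycle Passage))).1 (by assumption)
  exact h3 p (by simpa using hp) q (by simpa using hq)

variable (D) in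
/-- The passages of a code. -/
abbrev Code.Pass : Type := {p // p ∈ D.flatten.toFinset}

variable (D) in
/-- The crossings of a code, as a type. -/
abbrev Code.Cross : Type := ({c | c ∈ D.crossings} : Set ℕ)

/-- The darts of a code. -/
def Code.darts (D : Code) : Set Dart := {d | d.1 ∈ D.flatten}

instance : Finite D.darts := by
  have : D.darts = ((D.flatten.toFinset ×ˢ Finset.univ : Finset (Passage × Bool)) : Set Dart) := by
    ext ⟨p, b⟩
    simp [Code.darts]
  rw [this]
  infer_instance

/-- The passage that comes after a given one. -/
noncomputable def Code.nextFun (D : Code) (p : D.Pass) : D.Pass :=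
  ⟨(D.exists_follows (List.mem_toFinset.1 p.2)).choose,
    List.mem_toFinset.2 (D.exists_follows (List.mem_toFinset.1 p.2)).choose_spec.mem_right⟩

theorem Code.follows_nextFun (p : D.Pass) : D.Follows p.1 (D.nextFun p).1 :=
  (D.exists_follows (List.mem_toFinset.1 p.2)).choose_spec

/-- The permutation of the passages that takes each one to the one after it. -/
noncomputable def Code.next (D : Code) (hD : D.flatten.Nodup) : Equiv.Perm D.Pass :=
  Equiv.ofBijective D.nextFun <| Finite.injective_iff_bijective.1 fun p q h => by
    have h1 := D.follows_nextFun p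
    rw [h] at h1
    exact Subtype.ext (h1.injective hD (D.follows_nextFun q))

theorem Code.follows_next (hD : D.flatten.Nodup) (p : D.Pass) : D.Follows p.1 (D.next hD p).1 :=
  D.follows_nextFun p

theorem Code.follows_iff_next (hD : D.flatten.Nodup) (p q : D.Pass) :
    D.Follows p.1 q.1 ↔ q = D.next hD p :=
  ⟨fun h => Subtype.ext (h.unique hD (D.follows_next hD p)), fun h => h ▸ D.follows_next hD p⟩

/-- The passage and the passage after it, against the crossings. -/
noncomputable def Code.incidence (D : Code) (hD : D.flatten.Nodup) :
    Matrix D.Pass D.Cross (ZMod 2) := fun p c =>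
  (if p.1.label = c.1 then 1 else 0) + if (D.next hD p).1.label = c.1 then 1 else 0

theorem Code.Pass.label_mem (p : D.Pass) : p.1.label ∈ {c | c ∈ D.crossings} :=
  Code.mem_crossings.2 ⟨p.1, List.mem_toFinset.1 p.2, rfl⟩

instance : Fintype D.Cross := inferInstanceAs (Fintype {c // c ∈ D.crossings})

theorem Code.incidence_mulVec (hD : D.flatten.Nodup) (g : D.Cross → ZMod 2) (p : D.Pass) :
    (D.incidence hD).mulVec g p = g ⟨p.1.label, p.label_mem⟩ +
      g ⟨(D.next hD p).1.label, (D.next hD p).label_mem⟩ := by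
  simp only [Matrix.mulVec, dotProduct, Code.incidence, add_mul, ite_mul, one_mul, zero_mul,
    Finset.sum_add_distrib]
  congr 1
  · rw [Finset.sum_eq_single ⟨p.1.label, p.label_mem⟩]
    · simp
    · intro c _ hc
      rw [if_neg]
      exact fun h => hc (Subtype.ext h.symm)
    · simp
  · rw [Finset.sum_eq_single ⟨(D.next hD p).1.label, (D.next hD p).label_mem⟩]
    all_goals grind

theorem Code.add_eq_zero_iff_mod_two {a b : ZMod 2} : a + b = 0 ↔ a = b := by
  rw [CharTwo.add_eq_zero]

/-- The matrix takes a function of crossings to its differences along the edges, so its kernel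
consists of the functions that are constant on the pieces of the graph. -/
theorem Code.ker_incidence (hD : D.flatten.Nodup) :
    LinearMap.ker (D.incidence hD).mulVecLin = invFun D.Share {c | c ∈ D.crossings} := by
  classical
  ext g
  rw [LinearMap.mem_ker, Matrix.mulVecLin_apply]
  constructor
  · intro h
    let G : ℕ → ZMod 2 := fun c => if hc : c ∈ {c | c ∈ D.crossings} then g ⟨c, hc⟩ else 0
    have hG : ∀ p q, D.Follows p q → G p.label = G q.label := by
      intro p q hpq
      have hp : p ∈ D.flatten.toFinset := List.mem_toFinset.2 hpq.mem_left
      have hq : q ∈ D.flatten.toFinset := List.mem_toFinset.2 hpq.mem_right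
      have h1 := congrFun h ⟨p, hp⟩
      rw [Code.incidence_mulVec, ← (D.follows_iff_next hD ⟨p, hp⟩ ⟨q, hq⟩).1 hpq] at h1
      have h2 : p.label ∈ {c | c ∈ D.crossings} := Code.Pass.label_mem ⟨p, hp⟩
      have h3 : q.label ∈ {c | c ∈ D.crossings} := Code.Pass.label_mem ⟨q, hq⟩
      simp only [G, dif_pos h2, dif_pos h3]
      exact Code.add_eq_zero_iff_mod_two.1 h1
    refine invFun_of_step ?_ g ?_
    · rintro c c' ⟨w, hw, p, hp, q, hq, rfl, rfl⟩
      exact ⟨Code.mem_crossings.2 ⟨p, List.mem_flatten.2 ⟨w, hw, hp⟩, rfl⟩,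
        Code.mem_crossings.2 ⟨q, List.mem_flatten.2 ⟨w, hw, hq⟩, rfl⟩⟩
    · intro c c' hc hc' hs
      have := D.share_invariant G hG hs
      simpa only [G, dif_pos hc, dif_pos hc'] using this
  · intro h
    funext p
    rw [Code.incidence_mulVec]
    exact Code.add_eq_zero_iff_mod_two.2
      (h _ _ (Relation.EqvGen.rel _ _ (D.follows_next hD p).eqvGen_share))

/-- The other passage of a crossing. -/
def Code.WellFormed.partner (hD : D.WellFormed) (p : D.Pass) : D.Pass :=
  ⟨p.1.partner, List.mem_toFinset.2 (hD.2.1 _ (List.mem_toFinset.1 p.2))⟩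

theorem Code.WellFormed.label_eq_iff (hD : D.WellFormed) (p q : D.Pass) :
    q.1.label = p.1.label ↔ q = p ∨ q = hD.partner p := by
  constructor
  · intro h
    rcases hD.2.2 p.1 (List.mem_toFinset.1 p.2) q.1 (List.mem_toFinset.1 q.2) h.symm with h | h
    · exact Or.inl (Subtype.ext h)
    · exact Or.inr (Subtype.ext h)
  · rintro (rfl | rfl)
    · rfl
    · rfl

theorem Code.WellFormed.partner_ne (hD : D.WellFormed) (p : D.Pass) : p ≠ hD.partner p :=
  fun h => p.1.partner_ne (congrArg Subtype.val h).symm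

theorem Code.WellFormed.sum_label (hD : D.WellFormed) (p : D.Pass) (f : D.Pass → ZMod 2) :
    ∑ q : D.Pass, (if q.1.label = p.1.label then f q else 0) = f p + f (hD.partner p) := by
  rw [← Finset.sum_filter]
  have : Finset.univ.filter (fun q : D.Pass => q.1.label = p.1.label) = {p, hD.partner p} := by
    ext q
    simp [hD.label_eq_iff]
  rw [this, Finset.sum_pair (hD.partner_ne p)]

/-- An edge is named by the passage where it starts. Two edges leave the crossing of `p`, and the
two that enter it start at the preceding passages; so the kernel of the transpose is the space of
flows. -/
theorem Code.WellFormed.incidence_transpose_mulVec (hD : D.WellFormed) (z : D.Pass → ZMod 2)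
    (p : D.Pass) : (D.incidence hD.1).transpose.mulVec z ⟨p.1.label, p.label_mem⟩ =
      z p + z (hD.partner p) + (z ((D.next hD.1).symm p) +
        z ((D.next hD.1).symm (hD.partner p))) := by
  simp only [Matrix.mulVec, dotProduct, Code.incidence, Matrix.transpose_apply, add_mul, ite_mul,
    one_mul, zero_mul, Finset.sum_add_distrib]
  congr 1
  · exact hD.sum_label p z
  · rw [← hD.sum_label p fun q => z ((D.next hD.1).symm q)]
    exact Fintype.sum_equiv (D.next hD.1) _ _ fun q => by simp

theorem Code.WellFormed.card_pass (hD : D.WellFormed) :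
    Fintype.card D.Pass = 2 * D.crossings.card := by
  rw [Fintype.card_coe, Finset.card_eq_sum_card_fiberwise (f := Passage.label) (t := D.crossings)]
  · rw [Finset.sum_const_nat (m := 2), mul_comm]
    intro c hc
    obtain ⟨p, hp, rfl⟩ := Code.mem_crossings.1 hc
    have : D.flatten.toFinset.filter (fun q => q.label = p.label) = {p, p.partner} := by
      ext q
      simp only [Finset.mem_filter, List.mem_toFinset, Finset.mem_insert, Finset.mem_singleton]
      constructor
      · rintro ⟨h1, h2⟩
        exact hD.2.2 p hp q h1 h2.symm
      · rintro (rfl | rfl)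
        · exact ⟨hp, rfl⟩
        · exact ⟨hD.2.1 _ hp, rfl⟩
    rw [this, Finset.card_pair p.partner_ne.symm]
  · intro p hp
    exact Code.mem_crossings.2 ⟨p, List.mem_toFinset.1 hp, rfl⟩

/-- The change of a colouring of the faces across the edges. -/
noncomputable def Code.coboundary (D : Code) (hD : D.flatten.Nodup) :
    invFun D.FaceStep D.darts →ₗ[ZMod 2] (D.Pass → ZMod 2) where
  toFun φ p := φ.1 ⟨(p.1, true), List.mem_toFinset.1 p.2⟩ +
    φ.1 ⟨((D.next hD p).1, false), List.mem_toFinset.1 (D.next hD p).2⟩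
  map_add' φ ψ := by
    funext p
    simp only [Submodule.coe_add, Pi.add_apply]
    ring
  map_smul' c φ := by
    funext p
    simp only [SetLike.val_smul, Pi.smul_apply, smul_eq_mul, RingHom.id_apply]
    ring

theorem Code.coboundary_apply_face (hD : D.WellFormed) (φ : invFun D.FaceStep D.darts)
    {p q : Passage} (h : D.Follows p q) :
    φ.1 ⟨(p, true), h.mem_left⟩ = φ.1 ⟨Dart.rot (q, false), hD.2.1 _ h.mem_right⟩ ∧
    φ.1 ⟨(q, false), h.mem_right⟩ = φ.1 ⟨Dart.rot (p, true), hD.2.1 _ h.mem_left⟩ :=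
  ⟨φ.2 _ _ (Relation.EqvGen.rel _ _ (Code.FaceStep.forward h)),
    φ.2 _ _ (Relation.EqvGen.rel _ _ (Code.FaceStep.backward h))⟩

/-- The four ends at a crossing, as seen from the turning of the darts. -/
theorem Dart.sum_rot {β : Type} [AddCommMonoid β] (f : Dart → β) (p : Passage) :
    f (p, true) + f (p, false) + (f (p.partner, true) + f (p.partner, false)) =
      f (Dart.rot (p, true)) + f (Dart.rot (p, false)) +
        (f (Dart.rot (p.partner, true)) + f (Dart.rot (p.partner, false))) := by
  rcases p with ⟨c, _ | _, _ | _⟩ <;> simp [Dart.rot, Passage.partner] <;> abel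

end Criterion

end Skein

namespace Skein

/-! ### Face colourings and the dimension formula -/

section Criterion

variable {D : Code}

/-- A function that is unchanged by turning at a crossing is constant at this crossing. -/
theorem Dart.eq_of_rot {β : Type} (f : Dart → β) (p : Passage)
    (h : ∀ q b, q = p ∨ q = p.partner → f (q, b) = f (Dart.rot (q, b))) (q : Passage) (b b' : Bool)
    (hq : q = p ∨ q = p.partner) : f (q, b) = f (p, b') := by
  have h1 := h p true (Or.inl rfl)
  have h2 := h p false (Or.inl rfl)
  have h3 := h p.partner true (Or.inr rfl)
  have h4 := h p.partner false (Or.inr rfl)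
  clear h
  rcases hq with rfl | rfl
  · rcases q with ⟨c, _ | _, _ | _⟩ <;> simp [Dart.rot, Passage.partner] at h1 h2 h3 h4 <;>
      cases b <;> cases b' <;> simp_all
  · rcases p with ⟨c, _ | _, _ | _⟩ <;> simp [Dart.rot, Passage.partner] at h1 h2 h3 h4 <;>
      cases b <;> cases b' <;> simp_all [Passage.partner]

open Classical in
/-- Extension of a function on the darts of a code by zero. -/
noncomputable def extendDart (φ : D.darts → ZMod 2) (d : Dart) : ZMod 2 :=
  if h : d ∈ D.darts then φ ⟨d, h⟩ else 0

theorem extendDart_of_mem (φ : D.darts → ZMod 2) {d : Dart} (h : d ∈ D.darts) :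
    extendDart φ d = φ ⟨d, h⟩ := dif_pos h

theorem Code.WellFormed.extendDart_face (hD : D.WellFormed) (φ : invFun D.FaceStep D.darts)
    {p q : Passage} (h : D.Follows p q) :
    extendDart φ.1 (p, true) = extendDart φ.1 (Dart.rot (q, false)) ∧
      extendDart φ.1 (q, false) = extendDart φ.1 (Dart.rot (p, true)) := by
  have := Code.coboundary_apply_face hD φ h
  rwa [extendDart_of_mem φ.1 (show (p, true) ∈ D.darts from h.mem_left),
    extendDart_of_mem φ.1 (show (q, false) ∈ D.darts from h.mem_right),
    extendDart_of_mem φ.1 (show Dart.rot (q, false) ∈ D.darts from hD.2.1 _ h.mem_right),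
    extendDart_of_mem φ.1 (show Dart.rot (p, true) ∈ D.darts from hD.2.1 _ h.mem_left)]

theorem Code.coboundary_apply (hD : D.flatten.Nodup) (φ : invFun D.FaceStep D.darts)
    (p : D.Pass) : D.coboundary hD φ p =
      extendDart φ.1 (p.1, true) + extendDart φ.1 ((D.next hD p).1, false) := by
  rw [extendDart_of_mem φ.1 (List.mem_toFinset.1 p.2),
    extendDart_of_mem φ.1 (List.mem_toFinset.1 (D.next hD p).2)]
  rfl

/-- A colouring that does not change across any edge is unchanged by turning at a crossing, because
a face step is an edge followed by a turn. It is therefore a function of the crossings that agrees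
on consecutive ones. -/
theorem Code.WellFormed.ker_coboundary (hD : D.WellFormed) :
    Module.finrank (ZMod 2) (LinearMap.ker (D.coboundary hD.1)) = D.numPieces := by
  rw [Code.numPieces, ← finrank_invFun]
  have hface : ∀ x y, D.FaceStep x y → x ∈ D.darts ∧ y ∈ D.darts := fun _ _ h => h.mem hD
  have hlab : ∀ d : D.darts, d.1.1.label ∈ {c | c ∈ D.crossings} := fun d =>
    Code.mem_crossings.2 ⟨_, d.2, rfl⟩
  have hmem : ∀ g : invFun D.Share {c | c ∈ D.crossings},
      (fun d : D.darts => g.1 ⟨d.1.1.label, hlab d⟩) ∈ invFun D.FaceStep D.darts := by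
    intro g
    refine invFun_of_step hface _ ?_
    intro x y hx hy hxy
    cases hxy with
    | forward h => exact g.2 _ _ (Relation.EqvGen.rel _ _ h.eqvGen_share)
    | backward h => exact g.2 _ _ (Relation.EqvGen.symm _ _ (Relation.EqvGen.rel _ _ h.eqvGen_share))
  let T : invFun D.Share {c | c ∈ D.crossings} →ₗ[ZMod 2] LinearMap.ker (D.coboundary hD.1) :=
    { toFun := fun g => ⟨⟨_, hmem g⟩, by
        rw [LinearMap.mem_ker]
        funext p
        exact Code.add_eq_zero_iff_mod_two.2
          (g.2 _ _ (Relation.EqvGen.rel _ _ (D.follows_next hD.1 p).eqvGen_share))⟩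
      map_add' := fun f g => rfl
      map_smul' := fun c f => rfl }
  have hT : Function.Bijective T := by
    constructor
    · intro f g h
      apply Subtype.ext
      funext ⟨c, hc⟩
      obtain ⟨p, hp, rfl⟩ := Code.mem_crossings.1 hc
      exact congrFun (congrArg (fun u : LinearMap.ker (D.coboundary hD.1) => u.1.1) h)
        ⟨(p, true), hp⟩
    · rintro ⟨φ, hφ⟩
      set f := extendDart φ.1 with hf
      have hedge : ∀ p q, D.Follows p q → f (p, true) = f (q, false) := by
        intro p q h
        have h1 := congrFun hφ ⟨p, List.mem_toFinset.2 h.mem_left⟩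
        rw [Code.coboundary_apply, ← (D.follows_iff_next hD.1 ⟨p, List.mem_toFinset.2 h.mem_left⟩
          ⟨q, List.mem_toFinset.2 h.mem_right⟩).1 h] at h1
        exact Code.add_eq_zero_iff_mod_two.1 h1
      have hrot : ∀ p ∈ D.flatten, ∀ b, f (p, b) = f (Dart.rot (p, b)) := by
        intro p hp b
        cases b
        · have h1 := D.follows_next hD.1 ((D.next hD.1).symm ⟨p, List.mem_toFinset.2 hp⟩)
          rw [Equiv.apply_symm_apply] at h1
          exact (hedge _ _ h1).symm.trans (hD.extendDart_face φ h1).1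
        · have h1 := D.follows_next hD.1 ⟨p, List.mem_toFinset.2 hp⟩
          exact (hedge _ _ h1).trans (hD.extendDart_face φ h1).2
      have hconst : ∀ p ∈ D.flatten, ∀ q b b', (q = p ∨ q = p.partner) →
          f (q, b) = f (p, b') := by
        intro p hp q b b' hq
        refine Dart.eq_of_rot f p ?_ q b b' hq
        rintro q b (rfl | rfl)
        · exact hrot _ hp b
        · exact hrot _ (hD.2.1 _ hp) b
      have hex : ∀ c : ({c | c ∈ D.crossings} : Set ℕ), ∃ p ∈ D.flatten, p.label = c.1 :=
        fun c => Code.mem_crossings.1 c.2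
      choose pc hpc hpl using hex
      have hval : ∀ p (hp : p ∈ D.flatten) b, f (pc ⟨p.label, Code.mem_crossings.2 ⟨p, hp, rfl⟩⟩, true) = f (p, b) := by
        intro p hp b
        exact hconst p hp _ _ _ (hD.2.2 _ hp _ (hpc _) (hpl ⟨p.label, _⟩).symm)
      refine ⟨⟨fun c => f (pc c, true), ?_⟩, ?_⟩
      · refine invFun_of_step ?_ _ ?_
        · rintro c c' ⟨w, hw, p, hp, q, hq, rfl, rfl⟩
          exact ⟨Code.mem_crossings.2 ⟨p, List.mem_flatten.2 ⟨w, hw, hp⟩, rfl⟩,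
            Code.mem_crossings.2 ⟨q, List.mem_flatten.2 ⟨w, hw, hq⟩, rfl⟩⟩
        · intro c c' hc hc' hs
          classical
          let G : ℕ → ZMod 2 := fun c => if hc : c ∈ {c | c ∈ D.crossings} then f (pc ⟨c, hc⟩, true) else 0
          have := D.share_invariant G (fun p q h => by
            have h2 : p.label ∈ {c | c ∈ D.crossings} := Code.mem_crossings.2 ⟨p, h.mem_left, rfl⟩
            have h3 : q.label ∈ {c | c ∈ D.crossings} := Code.mem_crossings.2 ⟨q, h.mem_right, rfl⟩
            simp only [G, dif_pos h2, dif_pos h3]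
            rw [hval p h.mem_left true, hval q h.mem_right false, hedge p q h]) hs
          simpa only [G, dif_pos hc, dif_pos hc'] using this
      · apply Subtype.ext
        apply Subtype.ext
        funext ⟨⟨p, b⟩, hp⟩
        change f (pc _, true) = _
        exact (hval p hp b).trans (extendDart_of_mem φ.1 hp)
  exact ((LinearEquiv.ofBijective T hT).finrank_eq).symm

/-- Around a crossing the changes of colour cancel: each of the four darts occurs twice, once by
itself and once as the turn of another dart (`Dart.sum_rot`). -/
theorem Code.WellFormed.range_coboundary_le (hD : D.WellFormed) :
    LinearMap.range (D.coboundary hD.1) ≤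
      LinearMap.ker (D.incidence hD.1).transpose.mulVecLin := by
  rintro _ ⟨φ, rfl⟩
  rw [LinearMap.mem_ker, Matrix.mulVecLin_apply]
  funext ⟨c, hc⟩
  obtain ⟨p, hp, rfl⟩ := Code.mem_crossings.1 hc
  have := hD.incidence_transpose_mulVec (D.coboundary hD.1 φ) ⟨p, List.mem_toFinset.2 hp⟩
  refine this.trans ?_
  set f := extendDart φ.1 with hf
  have hout : ∀ p : D.Pass, D.coboundary hD.1 φ p = f (p.1, true) + f (Dart.rot (p.1, true)) := by
    intro p
    rw [Code.coboundary_apply, (hD.extendDart_face φ (D.follows_next hD.1 p)).2]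
  have hin : ∀ p : D.Pass, D.coboundary hD.1 φ ((D.next hD.1).symm p) =
      f (p.1, false) + f (Dart.rot (p.1, false)) := by
    intro p
    have h1 := D.follows_next hD.1 ((D.next hD.1).symm p)
    rw [Equiv.apply_symm_apply] at h1
    rw [Code.coboundary_apply, (hD.extendDart_face φ h1).1, Equiv.apply_symm_apply, add_comm]
  rw [hout, hout, hin, hin]
  have h4 := Dart.sum_rot f p
  change f (p, true) + f (Dart.rot (p, true)) + (f (p.partner, true) + f (Dart.rot (p.partner, true)))
    + (f (p, false) + f (Dart.rot (p, false)) + (f (p.partner, false) + f (Dart.rot (p.partner, false)))) = 0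
  grind

/-- The space of flows has dimension `E - V + C`, because row rank equals column rank; and `E = 2
V`. -/
theorem Code.WellFormed.finrank_ker_transpose (hD : D.WellFormed) :
    Module.finrank (ZMod 2) (LinearMap.ker (D.incidence hD.1).transpose.mulVecLin) =
      D.crossings.card + D.numPieces := by
  have h1 := LinearMap.finrank_range_add_finrank_ker (D.incidence hD.1).transpose.mulVecLin
  have h2 := LinearMap.finrank_range_add_finrank_ker (D.incidence hD.1).mulVecLin
  have h3 : (D.incidence hD.1).transpose.rank = (D.incidence hD.1).rank := Matrix.rank_transpose _
  rw [Matrix.rank, Matrix.rank] at h3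
  rw [Code.ker_incidence, finrank_invFun] at h2
  rw [Module.finrank_fintype_fun_eq_card] at h1 h2
  rw [hD.card_pass] at h1
  have h4 : Fintype.card D.Cross = D.crossings.card := by
    rw [← Fintype.card_coe]
    rfl
  rw [h4] at h2
  change _ + D.numPieces = _ at h2
  omega

/-- The colourings modulo the trivial ones have dimension `F - C` and the flows have dimension `V +
C`. Given the inclusion, equality of the two spaces is equality of dimensions, which is the Euler
formula. -/
theorem Code.WellFormed.planar_iff_range (hD : D.WellFormed) :
    D.Planar ↔ LinearMap.range (D.coboundary hD.1) =
      LinearMap.ker (D.incidence hD.1).transpose.mulVecLin := by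
  have h1 := LinearMap.finrank_range_add_finrank_ker (D.coboundary hD.1)
  rw [hD.ker_coboundary, finrank_invFun] at h1
  change _ = D.numFaces at h1
  have h2 := hD.finrank_ker_transpose
  rw [Code.Planar]
  constructor
  · intro h
    apply Submodule.eq_of_le_of_finrank_eq hD.range_coboundary_le
    omega
  · intro h
    rw [h] at h1
    omega

/-- A code is planar if and only if every flow on its edges comes from a colouring of the faces. -/
theorem Code.WellFormed.planar_iff_colorable (hD : D.WellFormed) : D.Planar ↔ D.Colorable := by
  rw [hD.planar_iff_range]
  have hprev : ∀ p : D.Pass, D.Follows ((D.next hD.1).symm p).1 p.1 := fun p => by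
    have h1 := D.follows_next hD.1 ((D.next hD.1).symm p)
    rwa [Equiv.apply_symm_apply] at h1
  constructor
  · intro h x hx
    have hz : (fun p : D.Pass => x (p.1, true)) ∈ LinearMap.range (D.coboundary hD.1) := by
      rw [h, LinearMap.mem_ker, Matrix.mulVecLin_apply]
      funext ⟨c, hc⟩
      obtain ⟨p, hp, rfl⟩ := Code.mem_crossings.1 hc
      have h0 := hD.incidence_transpose_mulVec (fun p : D.Pass => x (p.1, true))
        ⟨p, List.mem_toFinset.2 hp⟩
      refine h0.trans ?_
      have h1 := hx.edge _ _ (hprev ⟨p, List.mem_toFinset.2 hp⟩)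
      have h2 := hx.edge _ _ (hprev (hD.partner ⟨p, List.mem_toFinset.2 hp⟩))
      simp only [h1, h2]
      rw [Pi.zero_apply, ← hx.vertex p hp]
      change x (p, true) + x (p.partner, true) + (x (p, false) + x (p.partner, false)) = _
      ring
    obtain ⟨φ, hφ⟩ := hz
    refine ⟨extendDart φ.1, fun p q h => ⟨(hD.extendDart_face φ h).1, (hD.extendDart_face φ h).2, ?_⟩⟩
    have h1 := congrFun hφ ⟨p, List.mem_toFinset.2 h.mem_left⟩
    rw [Code.coboundary_apply, ← (D.follows_iff_next hD.1 ⟨p, List.mem_toFinset.2 h.mem_left⟩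
      ⟨q, List.mem_toFinset.2 h.mem_right⟩).1 h] at h1
    exact h1
  · intro h
    refine le_antisymm hD.range_coboundary_le fun z hz => ?_
    rw [LinearMap.mem_ker, Matrix.mulVecLin_apply] at hz
    classical
    -- The flow given by the edge values `z`: an outgoing end carries the value of its own edge, an
    -- incoming end that of the edge starting at the previous passage.
    let x : Dart → ZMod 2 := fun d => if hd : d.1 ∈ D.flatten.toFinset then
      (if d.2 then z ⟨d.1, hd⟩ else z ((D.next hD.1).symm ⟨d.1, hd⟩)) else 0
    have hx : D.IsFlow x := by
      constructor
      · intro p q h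
        have hp := List.mem_toFinset.2 h.mem_left
        have hq := List.mem_toFinset.2 h.mem_right
        have h1 := (D.follows_iff_next hD.1 ⟨p, hp⟩ ⟨q, hq⟩).1 h
        grind
      · intro p hp
        have hp' := List.mem_toFinset.2 hp
        have hq' := List.mem_toFinset.2 (hD.2.1 _ hp)
        have h0 := hD.incidence_transpose_mulVec z ⟨p, hp'⟩
        rw [hz] at h0
        simp only [x, dif_pos hp', dif_pos hq', if_true]
        rw [Pi.zero_apply] at h0
        rw [h0]
        simp only [Bool.false_eq_true, if_false]
        change z ⟨p, hp'⟩ + z ((D.next hD.1).symm ⟨p, hp'⟩) + z (hD.partner ⟨p, hp'⟩) +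
          z ((D.next hD.1).symm (hD.partner ⟨p, hp'⟩)) = _
        ring
    obtain ⟨φ, hφ⟩ := h x hx
    refine ⟨⟨fun d => φ d.1, invFun_of_step (fun _ _ h => h.mem hD) _ ?_⟩, ?_⟩
    · intro d d' hd hd' hs
      cases hs with
      | forward h => exact (hφ _ _ h).1
      | backward h => exact (hφ _ _ h).2.1
    · funext p
      have h1 := (hφ _ _ (D.follows_next hD.1 p)).2.2
      simp only [x, dif_pos p.2, if_true] at h1
      exact h1

end Criterion

end Skein

namespace Skein

/-! ### Operations that preserve planarity -/

section Chains

variable {α : Type} {R R' : α → α → Prop}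

theorem cycle_chain_imp_mem {w : List α} (h : Cycle.Chain R (w : Cycle α))
    (hR : ∀ p ∈ w, ∀ q ∈ w, R p q → R' p q) : Cycle.Chain R' (w : Cycle α) := by
  cases w with
  | nil => simp
  | cons a l =>
    rw [Cycle.chain_coe_cons] at h ⊢
    rw [List.isChain_iff_getElem] at h ⊢
    grind

theorem cycle_chain_append_comm {l l' : List α} :
    Cycle.Chain R ((l ++ l' : List α) : Cycle α) ↔ Cycle.Chain R ((l' ++ l : List α) : Cycle α) := by
  have : ((l ++ l' : List α) : Cycle α) = ((l' ++ l : List α) : Cycle α) :=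
    Quotient.sound' List.isRotated_append
  rw [this]

theorem cycle_chain_append {l l' : List α} (hl : l ≠ []) (hl' : l' ≠ []) :
    Cycle.Chain R ((l ++ l' : List α) : Cycle α) ↔ List.IsChain R l ∧ List.IsChain R l' ∧
      (∀ a ∈ l.getLast?, ∀ b ∈ l'.head?, R a b) ∧ ∀ a ∈ l'.getLast?, ∀ b ∈ l.head?, R a b := by
  obtain ⟨a, l, rfl⟩ := List.exists_cons_of_ne_nil hl
  obtain ⟨b, l', rfl⟩ := List.exists_cons_of_ne_nil hl'
  rw [List.cons_append, Cycle.chain_coe_cons]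
  have : a :: (l ++ b :: l' ++ [a]) = (a :: l) ++ ((b :: l') ++ [a]) := by simp
  rw [this, List.isChain_append, List.isChain_append]
  simp
  tauto

theorem cycle_chain_self {l : List α} (hl : l ≠ []) :
    Cycle.Chain R (l : Cycle α) ↔ List.IsChain R l ∧ ∀ a ∈ l.getLast?, ∀ b ∈ l.head?, R a b := by
  obtain ⟨a, l, rfl⟩ := List.exists_cons_of_ne_nil hl
  rw [Cycle.chain_coe_cons]
  have : a :: (l ++ [a]) = (a :: l) ++ [a] := by simp
  rw [this, List.isChain_append]
  simp

/-- Elements that can be skipped can be deleted from a chain. -/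
theorem isChain_filter_append {P : α → Bool} (hR : ∀ p r q, P r = false → R p r → R r q → R p q)
    {a : α} {l m : List α} (h : List.IsChain R (a :: (l ++ m))) (hm : m ≠ []) :
    List.IsChain R (a :: (l.filter P ++ m)) := by
  induction l generalizing a with
  | nil => simpa using h
  | cons b l ih =>
    rw [List.cons_append, List.isChain_cons_cons] at h
    cases hb : P b with
    | true =>
      grind
    | false =>
      rw [List.filter_cons_of_neg (by simp [hb])]
      refine ih ?_
      obtain ⟨c, l', hc⟩ : ∃ c l', l ++ m = c :: l' := by
        apply List.exists_cons_of_ne_nil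
        simp [hm]
      grind

theorem cycle_chain_filter {P : α → Bool} (hR : ∀ p r q, P r = false → R p r → R r q → R p q)
    {w : List α} (h : Cycle.Chain R (w : Cycle α)) :
    Cycle.Chain R ((w.filter P : List α) : Cycle α) := by
  by_cases hw : ∃ a ∈ w, P a = true
  · obtain ⟨a, ha, hPa⟩ := hw
    obtain ⟨s, t, rfl⟩ := List.append_of_mem ha
    rw [cycle_chain_append_comm, List.cons_append, Cycle.chain_coe_cons] at h
    have := isChain_filter_append hR h (by simp)
    rw [List.filter_append, List.filter_cons_of_pos hPa, cycle_chain_append_comm, List.cons_append,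
      Cycle.chain_coe_cons]
    simpa using this
  · have : w.filter P = [] := by
      rw [List.filter_eq_nil_iff]
      exact fun a ha hP => hw ⟨a, ha, hP⟩
    rw [this]
    simp

end Chains

/-! ### Well-formedness under deletion and insertion of a crossing -/

section WellFormedLists

/-- Well-formedness of the list of all passages. -/
def WellFormedList (l : List Passage) : Prop :=
  l.Nodup ∧ (∀ p ∈ l, p.partner ∈ l) ∧
    ∀ p ∈ l, ∀ q ∈ l, p.label = q.label → q = p ∨ q = p.partner

theorem Code.wellFormed_iff {D : Code} : D.WellFormed ↔ WellFormedList D.flatten := Iff.rfl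

theorem WellFormedList.perm {l l' : List Passage} (h : WellFormedList l) (hp : l.Perm l') :
    WellFormedList l' := by
  refine ⟨hp.nodup_iff.1 h.1, fun p hp' => ?_, fun p hp' q hq => ?_⟩
  · exact hp.mem_iff.1 (h.2.1 p (hp.mem_iff.2 hp'))
  · exact h.2.2 p (hp.mem_iff.2 hp') q (hp.mem_iff.2 hq)

theorem WellFormedList.filter {l : List Passage} (h : WellFormedList l) (P : ℕ → Bool) :
    WellFormedList (l.filter fun p => P p.label) := by
  refine ⟨h.1.filter _, fun p hp => ?_, fun p hp q hq => ?_⟩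
  · rw [List.mem_filter] at hp ⊢
    exact ⟨h.2.1 p hp.1, hp.2⟩
  · exact h.2.2 p (List.mem_of_mem_filter hp) q (List.mem_of_mem_filter hq)

theorem WellFormedList.of_cons_cons {l : List Passage} {p : Passage}
    (h : WellFormedList (p :: p.partner :: l)) : WellFormedList l ∧ ∀ q ∈ l, q.label ≠ p.label := by
  have hne : ∀ q ∈ l, q.label ≠ p.label := by
    intro q hq hlab
    have h1 := h.1
    rw [List.nodup_cons, List.nodup_cons] at h1
    rcases h.2.2 p (by simp) q (by simp [hq]) hlab.symm with rfl | rfl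
    · exact h1.1 (by simp [hq])
    · exact h1.2.1 hq
  refine ⟨?_, hne⟩
  have := h.filter fun c => c ≠ p.label
  rw [List.filter_cons_of_neg (by simp), List.filter_cons_of_neg (by simp),
    List.filter_eq_self.2 fun q hq => by simpa using hne q hq] at this
  exact this

theorem WellFormedList.cons_cons {l : List Passage} {p : Passage}
    (h : WellFormedList l) (hne : ∀ q ∈ l, q.label ≠ p.label) :
    WellFormedList (p :: p.partner :: l) := by
  refine ⟨?_, ?_, ?_⟩
  · rw [List.nodup_cons, List.nodup_cons]
    refine ⟨?_, fun hm => hne _ hm rfl, h.1⟩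
    rw [List.mem_cons, not_or]
    exact ⟨p.partner_ne.symm, fun hm => hne _ hm rfl⟩
  · intro q hq
    simp only [List.mem_cons] at hq ⊢
    rcases hq with rfl | rfl | hq
    · simp
    · simp
    · exact Or.inr (Or.inr (h.2.1 q hq))
  · intro q hq r hr hlab
    simp only [List.mem_cons] at hq hr
    rcases hq with rfl | rfl | hq <;> rcases hr with rfl | rfl | hr
    · simp
    · simp
    · exact absurd hlab.symm (hne _ hr)
    · simp
    · simp
    · exact absurd hlab.symm (hne _ hr)
    · exact absurd hlab (hne _ hq)
    · exact absurd hlab (hne _ hq)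
    · exact h.2.2 q hq r hr hlab

end WellFormedLists

/-- Consecutive passages see the same value of the flow on the edge between them. -/
def flowRel (x : Dart → ZMod 2) (p q : Passage) : Prop := x (p, true) = x (q, false)

/-- The conditions for a colouring at the edge between two consecutive passages. -/
def colorRel (x φ : Dart → ZMod 2) (p q : Passage) : Prop :=
  φ (p, true) = φ (Dart.rot (q, false)) ∧ φ (q, false) = φ (Dart.rot (p, true)) ∧
    φ (p, true) + φ (q, false) = x (p, true)

/-- The flow vanishes at each crossing. -/
def vertexRel (x : Dart → ZMod 2) (p : Passage) : Prop :=
  x (p, true) + x (p, false) + x (p.partner, true) + x (p.partner, false) = 0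

theorem Code.isFlow_iff {D : Code} {x : Dart → ZMod 2} : D.IsFlow x ↔
    (∀ w ∈ D, Cycle.Chain (flowRel x) (w : Cycle Passage)) ∧ ∀ p ∈ D.flatten, vertexRel x p := by
  rw [← D.forall_follows_iff]
  exact ⟨fun h => ⟨h.1, h.2⟩, fun h => ⟨h.1, h.2⟩⟩

theorem Code.isColoring_iff {D : Code} {x φ : Dart → ZMod 2} : D.IsColoring x φ ↔
    ∀ w ∈ D, Cycle.Chain (colorRel x φ) (w : Cycle Passage) := by
  rw [← D.forall_follows_iff]
  rfl

/-- Well-formed planar codes. -/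
def Code.PW (D : Code) : Prop := D.WellFormed ∧ D.Colorable

theorem Code.pw_iff {D : Code} : D.PW ↔ D.WellFormed ∧ D.Planar :=
  ⟨fun h => ⟨h.1, h.1.planar_iff_colorable.2 h.2⟩, fun h => ⟨h.1, h.1.planar_iff_colorable.1 h.2⟩⟩

theorem Code.PW.of_chains {D D' : Code} (h : D.PW) (hp : D.flatten.Perm D'.flatten)
    (hc : ∀ R : Passage → Passage → Prop, (∀ w ∈ D, Cycle.Chain R (w : Cycle Passage)) ↔
      ∀ w ∈ D', Cycle.Chain R (w : Cycle Passage)) : D'.PW := by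
  refine ⟨WellFormedList.perm h.1 hp, fun x hx => ?_⟩
  rw [Code.isFlow_iff, ← hc] at hx
  obtain ⟨φ, hφ⟩ := h.2 x (Code.isFlow_iff.2 ⟨hx.1, fun p hp' => hx.2 p (hp.mem_iff.1 hp')⟩)
  exact ⟨φ, Code.isColoring_iff.2 ((hc _).1 (Code.isColoring_iff.1 hφ))⟩

theorem Code.PW.perm {D D' : Code} (h : D.PW) (hp : D.Perm D') : D'.PW :=
  h.of_chains hp.flatten fun R => by simp only [hp.mem_iff]

theorem Code.PW.rotate {w w' : List Passage} {L : Code} (h : Code.PW (w :: L))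
    (hr : w.IsRotated w') : Code.PW (w' :: L) :=
  h.of_chains (by simpa using hr.perm.append_right L.flatten) fun R => by
    have : (w : Cycle Passage) = (w' : Cycle Passage) := Quotient.sound' hr
    simp [this]

/-! ### Colours next to a smoothed or deleted crossing -/

section Local

variable {x φ : Dart → ZMod 2}

/-- At the crossing, the edge entering `o` and the edge leaving its partner have a face in common.
As both carry the same flow, the faces on their other sides, which the smoothing merges, have the
same colour. -/
theorem colorRel.smooth {o a h : Passage} (h1 : colorRel x φ a o) (h2 : colorRel x φ o.partner h)
    (hx : x (a, true) = x (o.partner, true)) : colorRel x φ a h := by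
  obtain ⟨h11, h12, h13⟩ := h1
  obtain ⟨h21, h22, h23⟩ := h2
  unfold colorRel
  rw [← h21, ← h12]
  rcases o with ⟨c, _ | _, _ | _⟩ <;> simp [Dart.rot, Passage.partner] at * <;>
    revert h11 h12 h13 h21 h22 h23 hx <;>
    generalize φ (⟨c, _, _⟩, true) = φ1 <;>
    generalize φ (⟨c, _, _⟩, false) = φ2 <;>
    grind

/-- The strand through `o.partner` carries no flow, so the colours on its two sides agree and the
strand can be forgotten. -/
theorem colorRel.skip {o a b g h : Passage} (h1 : colorRel x φ a o) (h2 : colorRel x φ o b)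
    (h3 : colorRel x φ g o.partner) (h4 : colorRel x φ o.partner h)
    (hx : x (a, true) = x (o, true)) (hg : x (g, true) = 0) (hu : x (o.partner, true) = 0) :
    colorRel x φ a b := by
  obtain ⟨h11, h12, h13⟩ := h1
  obtain ⟨h21, h22, h23⟩ := h2
  obtain ⟨h31, h32, h33⟩ := h3
  obtain ⟨h41, h42, h43⟩ := h4
  unfold colorRel
  rw [hg, Code.add_eq_zero_iff_mod_two] at h33
  rw [hu, Code.add_eq_zero_iff_mod_two] at h43
  rcases o with ⟨c, _ | _, _ | _⟩ <;> simp [Dart.rot, Passage.partner] at * <;> grind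

end Local

end Skein

namespace Skein

theorem flowRel_congr {x y : Dart → ZMod 2} {D : Code}
    (h : ∀ p ∈ D.flatten, ∀ b, x (p, b) = y (p, b)) {w : List Passage} (hw : w ∈ D)
    (hx : Cycle.Chain (flowRel x) (w : Cycle Passage)) :
    Cycle.Chain (flowRel y) (w : Cycle Passage) := by
  refine cycle_chain_imp_mem hx fun p hp q hq hpq => ?_
  unfold flowRel
  rw [← h p (List.mem_flatten.2 ⟨w, hw, hp⟩), ← h q (List.mem_flatten.2 ⟨w, hw, hq⟩)]
  exact hpq

theorem Code.IsFlow.congr {x y : Dart → ZMod 2} {D : Code} (hx : D.IsFlow x) (hD : D.WellFormed)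
    (h : ∀ p ∈ D.flatten, ∀ b, x (p, b) = y (p, b)) : D.IsFlow y := by
  rw [Code.isFlow_iff] at hx ⊢
  refine ⟨fun w hw => flowRel_congr h hw (hx.1 w hw), fun p hp => ?_⟩
  have := hx.2 p hp
  unfold vertexRel at this ⊢
  rwa [h p hp, h p hp, h _ (hD.2.1 p hp), h _ (hD.2.1 p hp)] at this

/-- A flow can be given any values at a crossing outside the code. -/
theorem exists_flow_extension {D : Code} (hD : D.WellFormed) {x : Dart → ZMod 2} (hx : D.IsFlow x)
    {o : Passage} (ho : ∀ q ∈ D.flatten, q.label ≠ o.label) (s t u v : ZMod 2) :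
    ∃ y, D.IsFlow y ∧ (∀ p ∈ D.flatten, ∀ b, x (p, b) = y (p, b)) ∧ y (o, true) = s ∧
      y (o, false) = t ∧ y (o.partner, true) = u ∧ y (o.partner, false) = v := by
  let y : Dart → ZMod 2 := fun d => if d.1 = o then (if d.2 then s else t) else
    if d.1 = o.partner then (if d.2 then u else v) else x d
  have h : ∀ p ∈ D.flatten, ∀ b, x (p, b) = y (p, b) := by
    intro p hp b
    have h1 : p ≠ o := fun h => ho p hp (by rw [h])
    have h2 : p ≠ o.partner := fun h => ho p hp (by rw [h, Passage.label_partner])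
    simp [y, h1, h2]
  have h3 : o.partner ≠ o := o.partner_ne
  exact ⟨y, hx.congr hD h, h, by simp [y], by simp [y], by simp [y, h3], by simp [y, h3]⟩

theorem head?_append_of_ne_nil' {α : Type} {l l' : List α} (h : l ≠ []) :
    (l ++ l').head? = l.head? := by
  obtain ⟨a, l, rfl⟩ := List.exists_cons_of_ne_nil h
  rfl

/-- The value of a flow at the beginning of a word. -/
def headValue (x : Dart → ZMod 2) (w : List Passage) : ZMod 2 :=
  (w.head?.map fun p => x (p, false)).getD 0

theorem headValue_cons (x : Dart → ZMod 2) (p : Passage) (w : List Passage) :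
    headValue x (p :: w) = x (p, false) := rfl

theorem headValue_congr {x y : Dart → ZMod 2} {w : List Passage}
    (h : ∀ p ∈ w, ∀ b, x (p, b) = y (p, b)) : headValue x w = headValue y w := by
  cases w with
  | nil => rfl
  | cons p w => exact h p (by simp) false

theorem headValue_of_head? {x : Dart → ZMod 2} {w : List Passage} {p : Passage}
    (h : p ∈ w.head?) : headValue x w = x (p, false) := by
  rw [Option.mem_def] at h
  simp [headValue, h]

section Chains

variable {α : Type} {R : α → α → Prop} {o u : α} {X Y : List α}

theorem isChain_cons_concat (hX : X ≠ []) : List.IsChain R (o :: (X ++ [u])) ↔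
    List.IsChain R X ∧ (∀ b ∈ X.head?, R o b) ∧ ∀ g ∈ X.getLast?, R g u := by
  obtain ⟨b, X, rfl⟩ := List.exists_cons_of_ne_nil hX
  rw [List.isChain_cons, List.isChain_append]
  simp
  tauto

/-- `o` and `u` stand for the two passages of the crossing to be smoothed, and `h1` composes the
relation across the smoothing; the word between them then closes up. -/
theorem cycle_chain_of_isChain (h1 : ∀ g b, R g u → R o b → R g b)
    (h : List.IsChain R (o :: (X ++ [u]))) : Cycle.Chain R (X : Cycle α) := by
  by_cases hX : X = []
  · simp [hX]
  · rw [isChain_cons_concat hX] at h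
    rw [cycle_chain_self hX]
    exact ⟨h.1, fun a ha b hb => h1 _ _ (h.2.2 a ha) (h.2.1 b hb)⟩

theorem cycle_chain_of_isChain_of_isChain (h1 : ∀ g b, R g u → R o b → R g b)
    (h2 : ∀ g b, R g o → R u b → R g b) (h : List.IsChain R (o :: (X ++ [o])))
    (h' : List.IsChain R (u :: (Y ++ [u]))) : Cycle.Chain R ((X ++ Y : List α) : Cycle α) := by
  by_cases hX : X = []
  · subst hX
    refine cycle_chain_of_isChain (o := u) (u := u) (fun g b hg hb => ?_) h'
    grind
  · by_cases hY : Y = []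
    · subst hY
      rw [List.append_nil]
      refine cycle_chain_of_isChain (o := o) (u := o) (fun g b hg hb => ?_) h
      grind
    · rw [isChain_cons_concat hX] at h
      rw [isChain_cons_concat hY] at h'
      rw [cycle_chain_append hX hY]
      grind

end Chains

/-- The conditions for a flow and a colouring at an edge. -/
def fullRel (x φ : Dart → ZMod 2) (p q : Passage) : Prop := colorRel x φ p q ∧ flowRel x p q

theorem Code.PW.exists_full {D : Code} (h : D.PW) {x : Dart → ZMod 2} (hx : D.IsFlow x) :
    ∃ φ, ∀ w ∈ D, Cycle.Chain (fullRel x φ) (w : Cycle Passage) := by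
  obtain ⟨φ, hφ⟩ := h.2 x hx
  exact ⟨φ, (D.forall_follows_iff _).1 fun p q h => ⟨hφ p q h, hx.edge p q h⟩⟩

theorem Code.isColoring_of_full {D : Code} {x y φ : Dart → ZMod 2}
    (h : ∀ w ∈ D, Cycle.Chain (fullRel y φ) (w : Cycle Passage))
    (hxy : ∀ p ∈ D.flatten, ∀ b, x (p, b) = y (p, b)) : D.IsColoring x φ := by
  refine Code.isColoring_iff.2 fun w hw => cycle_chain_imp_mem (h w hw) fun p hp q _ hpq => ?_
  have := hpq.1
  unfold colorRel at this ⊢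
  rwa [hxy p (List.mem_flatten.2 ⟨w, hw, hp⟩)]

theorem fullRel.smooth {x φ : Dart → ZMod 2} {o a h : Passage} (h1 : fullRel x φ a o)
    (h2 : fullRel x φ o.partner h) (hx : x (o, false) = x (o.partner, true)) : fullRel x φ a h :=
  ⟨h1.1.smooth h2.1 (h1.2.trans hx), (h1.2.trans hx).trans h2.2⟩

theorem isChain_flowRel {x : Dart → ZMod 2} {o u : Passage} {X : List Passage}
    (h : Cycle.Chain (flowRel x) (X : Cycle Passage)) (ho : x (o, true) = headValue x X)
    (hu : x (u, false) = headValue x X) : List.IsChain (flowRel x) (o :: (X ++ [u])) := by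
  by_cases hX : X = []
  · subst hX
    simp [flowRel, ho, hu]
  · rw [isChain_cons_concat hX]
    rw [cycle_chain_self hX] at h
    refine ⟨h.1, fun b hb => ?_, fun g hg => ?_⟩
    · rw [flowRel, ho, headValue_of_head? hb]
    · obtain ⟨b, X, rfl⟩ := List.exists_cons_of_ne_nil hX
      have := h.2 g hg b (by simp)
      rw [flowRel, hu, headValue_cons]
      exact this

/-- Extend a flow of the smoothed code over the crossing, colour the original code, and read the
colours on the remaining darts. -/
theorem Code.PW.smooth_self {o : Passage} {X Y : List Passage} {L : Code}
    (h : Code.PW ((o :: X ++ o.partner :: Y) :: L)) : Code.PW (X :: Y :: L) := by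
  have hperm : (List.flatten ((o :: X ++ o.partner :: Y) :: L)).Perm
      (o :: o.partner :: List.flatten (X :: Y :: L)) := by
    simp [List.perm_middle]
  obtain ⟨hwf, hne⟩ := (WellFormedList.perm h.1 hperm).of_cons_cons
  refine ⟨hwf, fun x hx => ?_⟩
  -- `X` becomes a closed component, so the edge leaving `o` and the edge entering its partner both
  -- carry the value of `X`; likewise for `Y` with the other two ends. The four values then sum to
  -- zero. An empty word gets the value `0`.
  obtain ⟨y, hy, hxy, y1, y2, y3, y4⟩ := exists_flow_extension hwf hx hne (headValue x X)
    (headValue x Y) (headValue x Y) (headValue x X)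
  rw [headValue_congr fun p hp => hxy p (by simp [hp])] at y1 y4
  rw [headValue_congr fun p hp => hxy p (by simp [hp])] at y2 y3
  rw [Code.isFlow_iff] at hy
  have hyD : Code.IsFlow ((o :: X ++ o.partner :: Y) :: L) y := by
    rw [Code.isFlow_iff]
    constructor
    · intro w hw
      rw [List.mem_cons] at hw
      rcases hw with rfl | hw
      · rw [List.cons_append, Cycle.chain_coe_cons, List.append_assoc, List.cons_append,
          List.isChain_cons_split]
        exact ⟨isChain_flowRel (hy.1 X (by simp)) y1 y4, isChain_flowRel (hy.1 Y (by simp)) y3 y2⟩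
      · exact hy.1 w (by simp [hw])
    · intro p hp
      rw [hperm.mem_iff, List.mem_cons, List.mem_cons] at hp
      rcases hp with rfl | rfl | hp
      · rw [vertexRel, y1, y2, y3, y4]
        grind
      · rw [vertexRel, Passage.partner_partner, y1, y2, y3, y4]
        grind
      · exact hy.2 p hp
  obtain ⟨φ, hφ⟩ := h.exists_full hyD
  refine ⟨φ, Code.isColoring_of_full (y := y) ?_ hxy⟩
  have h0 := hφ _ (List.mem_cons_self)
  rw [List.cons_append, Cycle.chain_coe_cons, List.append_assoc, List.cons_append,
    List.isChain_cons_split] at h0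
  intro w hw
  simp only [List.mem_cons] at hw
  rcases hw with rfl | rfl | hw
  · refine cycle_chain_of_isChain (fun g b hg hb => hg.smooth (by simpa using hb) ?_) h0.1
    rw [y4, Passage.partner_partner, y1]
  · exact cycle_chain_of_isChain (fun g b hg hb => hg.smooth hb (by rw [y2, y3])) h0.2
  · exact hφ w (by simp [hw])

theorem Code.PW.smooth_mixed {o : Passage} {X Y : List Passage} {L : Code}
    (h : Code.PW ((o :: X) :: (o.partner :: Y) :: L)) : Code.PW ((X ++ Y) :: L) := by
  have hperm : (List.flatten ((o :: X) :: (o.partner :: Y) :: L)).Perm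
      (o :: o.partner :: List.flatten ((X ++ Y) :: L)) := by
    simp [List.perm_middle]
  obtain ⟨hwf, hne⟩ := (WellFormedList.perm h.1 hperm).of_cons_cons
  refine ⟨hwf, fun x hx => ?_⟩
  -- The values are read from `X ++ Y` and `Y ++ X`, so that an empty word takes over the value at
  -- the head of the other one.
  obtain ⟨y, hy, hxy, y1, y2, y3, y4⟩ := exists_flow_extension hwf hx hne (headValue x (X ++ Y))
    (headValue x (Y ++ X)) (headValue x (Y ++ X)) (headValue x (X ++ Y))
  rw [headValue_congr fun p hp => hxy p (by simp at hp ⊢; tauto)] at y1 y4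
  rw [headValue_congr fun p hp => hxy p (by simp at hp ⊢; tauto)] at y2 y3
  rw [Code.isFlow_iff] at hy
  have hXY := hy.1 (X ++ Y) (by simp)
  have hYX := cycle_chain_append_comm.1 hXY
  have key : ∀ (o : Passage) (X Y : List Passage), y (o, true) = headValue y (X ++ Y) →
      y (o, false) = headValue y (Y ++ X) →
      Cycle.Chain (flowRel y) ((X ++ Y : List Passage) : Cycle Passage) →
      List.IsChain (flowRel y) (o :: (X ++ [o])) := by
    intro o X Y e1 e2 hc
    by_cases hX : X = []
    · subst hX
      simp [flowRel, e1, e2]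
    · by_cases hY : Y = []
      · subst hY
        rw [List.append_nil] at hc e1
        exact isChain_flowRel hc e1 e2
      · rw [cycle_chain_append hX hY] at hc
        rw [isChain_cons_concat hX]
        refine ⟨hc.1, fun b hb => ?_, fun g hg => ?_⟩
        · rw [flowRel, e1, headValue_of_head? (p := b) (by rwa [head?_append_of_ne_nil' hX])]
        · obtain ⟨b, Y, rfl⟩ := List.exists_cons_of_ne_nil hY
          rw [flowRel, e2]
          exact hc.2.2.1 g hg b (by simp)
  have hyD : Code.IsFlow ((o :: X) :: (o.partner :: Y) :: L) y := by
    rw [Code.isFlow_iff]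
    constructor
    · intro w hw
      simp only [List.mem_cons] at hw
      rcases hw with rfl | rfl | hw
      · exact key o X Y y1 y2 hXY
      · exact key o.partner Y X y3 y4 hYX
      · exact hy.1 w (by simp [hw])
    · intro p hp
      rw [hperm.mem_iff, List.mem_cons, List.mem_cons] at hp
      rcases hp with rfl | rfl | hp
      · rw [vertexRel, y1, y2, y3, y4]
        grind
      · rw [vertexRel, Passage.partner_partner, y1, y2, y3, y4]
        grind
      · exact hy.2 p hp
  obtain ⟨φ, hφ⟩ := h.exists_full hyD
  refine ⟨φ, Code.isColoring_of_full (y := y) ?_ hxy⟩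
  intro w hw
  simp only [List.mem_cons] at hw
  rcases hw with rfl | hw
  · have h1 := hφ (o :: X) (by simp)
    have h2 := hφ (o.partner :: Y) (by simp)
    rw [Cycle.chain_coe_cons] at h1 h2
    refine cycle_chain_of_isChain_of_isChain (fun g b hg hb => hg.smooth (by simpa using hb) ?_)
      (fun g b hg hb => hg.smooth hb (by rw [y2, y3])) h1 h2
    rw [y4, Passage.partner_partner, y1]
  · exact hφ w (by simp [hw])

/-! ### Switching crossings -/

/-- Switch over and under at the crossings of the set `Z`. -/
def Passage.switch (Z : ℕ → Bool) (p : Passage) : Passage :=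
  if Z p.label then ⟨p.label, !p.isOver, !p.isPos⟩ else p

/-- Switch the crossings of the set `Z`. -/
def Code.switch (Z : ℕ → Bool) (D : Code) : Code := D.map (List.map (Passage.switch Z))

@[simp] theorem Passage.label_switch (Z : ℕ → Bool) (p : Passage) :
    (p.switch Z).label = p.label := by
  unfold Passage.switch
  split <;> rfl

@[simp] theorem Passage.switch_switch (Z : ℕ → Bool) (p : Passage) :
    (p.switch Z).switch Z = p := by
  rcases p with ⟨c, b, s⟩
  by_cases h : Z c <;> simp [Passage.switch, h]

theorem Passage.switch_injective (Z : ℕ → Bool) : Function.Injective (Passage.switch Z) :=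
  Function.LeftInverse.injective (Passage.switch_switch Z)

theorem Passage.partner_switch (Z : ℕ → Bool) (p : Passage) :
    (p.switch Z).partner = p.partner.switch Z := by
  rcases p with ⟨c, b, s⟩
  by_cases h : Z c <;> simp [Passage.switch, Passage.partner, h]

theorem Code.flatten_switch (Z : ℕ → Bool) (D : Code) :
    (D.switch Z).flatten = D.flatten.map (Passage.switch Z) := by
  simp [Code.switch, List.map_flatten]

theorem WellFormedList.switch {l : List Passage} (h : WellFormedList l) (Z : ℕ → Bool) :
    WellFormedList (l.map (Passage.switch Z)) := by
  refine ⟨h.1.map (Passage.switch_injective Z), ?_, ?_⟩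
  · intro p hp
    obtain ⟨q, hq, rfl⟩ := List.mem_map.1 hp
    rw [Passage.partner_switch]
    exact List.mem_map_of_mem (h.2.1 q hq)
  · intro p hp q hq hlab
    obtain ⟨p, hp', rfl⟩ := List.mem_map.1 hp
    obtain ⟨q, hq', rfl⟩ := List.mem_map.1 hq
    rw [Passage.partner_switch]
    rw [Passage.label_switch, Passage.label_switch] at hlab
    rcases h.2.2 p hp' q hq' hlab with rfl | rfl
    · exact Or.inl rfl
    · exact Or.inr rfl

/-- Over and sign change together, so the counterclockwise order of the four ends stays the same.
This is why switching preserves planarity. -/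
theorem Dart.rot_switch (Z : ℕ → Bool) (p : Passage) (b : Bool) :
    Dart.rot (p.switch Z, b) = ((Dart.rot (p, b)).1.switch Z, (Dart.rot (p, b)).2) := by
  rcases p with ⟨c, o, s⟩
  by_cases h : Z c <;> cases o <;> cases s <;> simp [Dart.rot, Passage.switch, Passage.partner, h]

theorem Code.PW.switch {D : Code} (h : D.PW) (Z : ℕ → Bool) : (D.switch Z).PW := by
  refine ⟨?_, fun x hx => ?_⟩
  · rw [Code.wellFormed_iff, Code.flatten_switch]
    exact WellFormedList.switch h.1 Z
  · rw [Code.isFlow_iff] at hx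
    obtain ⟨φ, hφ⟩ := h.2 (fun d => x (d.1.switch Z, d.2)) (by
      rw [Code.isFlow_iff]
      constructor
      · intro w hw
        have := hx.1 (w.map (Passage.switch Z)) (List.mem_map_of_mem hw)
        rw [← Cycle.map_coe, Cycle.chain_map] at this
        exact this
      · intro p hp
        have := hx.2 (p.switch Z) (by
          rw [Code.flatten_switch]
          exact List.mem_map_of_mem hp)
        unfold vertexRel at this ⊢
        rwa [Passage.partner_switch] at this)
    refine ⟨fun d => φ (d.1.switch Z, d.2), ?_⟩
    rw [Code.isColoring_iff] at hφ ⊢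
    intro w hw
    obtain ⟨v, hv, rfl⟩ := List.mem_map.1 hw
    rw [← Cycle.map_coe, Cycle.chain_map]
    refine (hφ v hv).imp fun p q hpq => ?_
    unfold colorRel at hpq ⊢
    rw [Dart.rot_switch, Dart.rot_switch]
    simpa using hpq

end Skein

namespace Skein

/-! ### Deleting a component -/

/-! ### Extending flows over deleted passages -/

section Lift

theorem flowRel_update {x y : Dart → ZMod 2} {w : List Passage}
    (h : ∀ p ∈ w, ∀ b, x (p, b) = y (p, b)) (hx : Cycle.Chain (flowRel x) (w : Cycle Passage)) :
    Cycle.Chain (flowRel y) (w : Cycle Passage) :=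
  flowRel_congr (D := [w]) (by simpa using h) (by simp) hx

/-- A flow along the kept passages of an arc extends to the whole arc. -/
theorem exists_lift_arc (P : Passage → Bool) (e : Passage) (he : P e = true) (l : List Passage)
    (hl : l.Nodup) (x : Dart → ZMod 2) (v : ZMod 2)
    (hv : ∀ b ∈ (l.filter P ++ [e]).head?, v = x (b, false))
    (hx : List.IsChain (flowRel x) (l.filter P ++ [e])) :
    ∃ y, (∀ p, (p ∉ l ∨ P p = true) → ∀ b, y (p, b) = x (p, b)) ∧
      List.IsChain (flowRel y) (l ++ [e]) ∧ (∀ b ∈ (l ++ [e]).head?, v = y (b, false)) ∧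
      ∀ r ∈ l, P r = false → y (r, true) = y (r, false) := by
  induction l generalizing v with
  | nil => exact ⟨x, fun _ _ _ => rfl, by simp, hv, by simp⟩
  | cons q l ih =>
    rw [List.nodup_cons] at hl
    cases hq : P q with
    | true =>
      rw [List.filter_cons_of_pos hq, List.cons_append] at hv hx
      rw [List.isChain_cons] at hx
      obtain ⟨y, h1, h2, h3, h4⟩ := ih hl.2 (x (q, true)) hx.1 hx.2
      refine ⟨y, fun p hp b => ?_, ?_, ?_, ?_⟩
      · by_cases hpq : p = q
        · subst hpq
          exact h1 p (Or.inr hq) b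
        · refine h1 p ?_ b
          simp only [List.mem_cons, hpq, false_or] at hp
          exact hp
      · rw [List.cons_append, List.isChain_cons]
        refine ⟨fun b hb => ?_, h2⟩
        rw [flowRel, h1 q (Or.inr hq)]
        exact h3 b hb
      · intro b hb
        rw [h1 b (by
          simp only [List.cons_append, List.head?_cons, Option.mem_some_iff] at hb
          exact Or.inr (hb ▸ hq))]
        exact hv b (by simpa using hb)
      · intro r hr hPr
        rw [List.mem_cons] at hr
        rcases hr with rfl | hr
        · rw [hq] at hPr
          exact absurd hPr (by simp)
        · exact h4 r hr hPr
    | false =>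
      rw [List.filter_cons_of_neg (by simp [hq])] at hv hx
      obtain ⟨y, h1, h2, h3, h4⟩ := ih hl.2 v hv hx
      have hqe : q ≠ e := fun h => by
        rw [h, he] at hq
        exact absurd hq (by simp)
      have hq' : q ∉ l ++ [e] := by simp [hl.1, hqe]
      -- A deleted passage transmits the value `v` that arrives at the beginning of the arc.
      let y' : Dart → ZMod 2 := fun d => if d.1 = q then v else y d
      have hy' : ∀ p, p ≠ q → ∀ b, y' (p, b) = y (p, b) := fun p hp b => by simp [y', hp]
      have hne : ∀ p ∈ l ++ [e], p ≠ q := fun p hp h => hq' (h ▸ hp)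
      refine ⟨y', fun p hp b => ?_, ?_, ?_, ?_⟩
      · have hpq : p ≠ q := by
          rintro rfl
          simp [hq] at hp
        rw [hy' p hpq]
        refine h1 p ?_ b
        simp only [List.mem_cons, hpq, false_or] at hp
        exact hp
      · rw [List.cons_append, List.isChain_cons]
        refine ⟨fun b hb => ?_, ?_⟩
        · rw [flowRel, hy' b (hne b (List.mem_of_mem_head? hb)), ← h3 b hb]
          simp [y']
        · rw [List.isChain_iff_getElem] at h2 ⊢
          intro i hi
          have := h2 i hi
          unfold flowRel at this ⊢
          rwa [hy' _ (hne _ (List.getElem_mem _)), hy' _ (hne _ (List.getElem_mem _))]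
      all_goals grind

theorem exists_lift_word (P : Passage → Bool) (w : List Passage) (hw : w.Nodup)
    (x : Dart → ZMod 2) (hx : Cycle.Chain (flowRel x) ((w.filter P : List Passage) : Cycle Passage)) :
    ∃ y, (∀ p, (p ∉ w ∨ P p = true) → ∀ b, y (p, b) = x (p, b)) ∧
      Cycle.Chain (flowRel y) (w : Cycle Passage) ∧
      ∀ r ∈ w, P r = false → y (r, true) = y (r, false) := by
  by_cases h : ∃ a ∈ w, P a = true
  · obtain ⟨a, ha, hPa⟩ := h
    obtain ⟨s, t, rfl⟩ := List.append_of_mem ha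
    have hperm : (s ++ a :: t).Perm (a :: (t ++ s)) := List.perm_append_comm
    rw [List.filter_append, List.filter_cons_of_pos hPa, cycle_chain_append_comm, List.cons_append,
      Cycle.chain_coe_cons, ← List.filter_append, List.isChain_cons] at hx
    have hn := hperm.nodup_iff.1 hw
    rw [List.nodup_cons] at hn
    obtain ⟨y, h1, h2, h3, h4⟩ := exists_lift_arc P a hPa (t ++ s) hn.2 x (x (a, true)) hx.1 hx.2
    refine ⟨y, fun p hp b => ?_, ?_, ?_⟩
    · grind
    · rw [cycle_chain_append_comm, List.cons_append, Cycle.chain_coe_cons, List.isChain_cons]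
      refine ⟨fun b hb => ?_, h2⟩
      rw [flowRel, h1 a (Or.inr hPa)]
      exact h3 b hb
    grind
  -- No passage of the word is kept, so there is no value to continue and the zero flow is chosen.
  · let y : Dart → ZMod 2 := fun d => if d.1 ∈ w then 0 else x d
    have hy : ∀ p ∈ w, ∀ b, y (p, b) = 0 := fun p hp b => by simp [y, hp]
    refine ⟨y, fun p hp b => ?_, ?_, ?_⟩
    · grind
    · refine (flowRel_update (x := 0) (fun p hp b => (hy p hp b).symm) ?_)
      cases w with
      | nil => simp
      | cons a l =>
        rw [Cycle.chain_coe_cons, List.isChain_iff_getElem]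
        intros
        rfl
    · intro r hr _
      rw [hy r hr, hy r hr]

theorem exists_lift_code (P : Passage → Bool) (L : Code) (hL : L.flatten.Nodup)
    (x : Dart → ZMod 2)
    (hx : ∀ w ∈ L, Cycle.Chain (flowRel x) ((w.filter P : List Passage) : Cycle Passage)) :
    ∃ y, (∀ p, (p ∉ L.flatten ∨ P p = true) → ∀ b, y (p, b) = x (p, b)) ∧
      (∀ w ∈ L, Cycle.Chain (flowRel y) (w : Cycle Passage)) ∧
      ∀ r ∈ L.flatten, P r = false → y (r, true) = y (r, false) := by
  induction L with
  | nil => exact ⟨x, fun _ _ _ => rfl, by simp, by simp⟩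
  | cons w L ih =>
    rw [List.flatten_cons, List.nodup_append] at hL
    obtain ⟨y, h1, h2, h3⟩ := ih hL.2.1 fun v hv => hx v (by simp [hv])
    have h0 := hx w (by simp)
    obtain ⟨y', h1', h2', h3'⟩ := exists_lift_word P w hL.1 y
      (flowRel_update (fun p hp b => (h1 p (Or.inr (List.mem_filter.1 hp).2) b).symm) h0)
    have hout : ∀ p ∈ L.flatten, ∀ b, y' (p, b) = y (p, b) := fun p hp b =>
      h1' p (Or.inl fun hpw => hL.2.2 p hpw p hp rfl) b
    refine ⟨y', fun p hp b => ?_, fun v hv => ?_, fun r hr hPr => ?_⟩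
    · grind
    · rw [List.mem_cons] at hv
      rcases hv with rfl | hv
      · exact h2'
      · exact flowRel_update (fun p hp b => (hout p (List.mem_flatten.2 ⟨v, hv, hp⟩) b).symm) (h2 v hv)
    grind

end Lift

theorem Code.flatten_erase (A : List Passage) (D : Code) :
    (Code.erase A D).flatten = D.flatten.filter fun l => l.label ∉ A.map Passage.label := by
  simp [Code.erase, List.filter_flatten]

/-- Elements that can be skipped can be deleted from a cycle. -/
theorem cycle_chain_filter_mem {α : Type} {R : α → α → Prop} {P : α → Bool} {w : List α}
    (hR : ∀ p, ∀ r ∈ w, ∀ q, P r = false → R p r → R r q → R p q)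
    (h : Cycle.Chain R (w : Cycle α)) : Cycle.Chain R ((w.filter P : List α) : Cycle α) := by
  classical
  have h1 : Cycle.Chain (fun p q => R p q) ((w.filter fun r => P r || r ∉ w : List α) : Cycle α) :=
    cycle_chain_filter (fun p r q hr hpr hrq => by
      simp only [Bool.or_eq_false_iff, decide_eq_false_iff_not, not_not] at hr
      exact hR p r hr.2 q hr.1 hpr hrq) h
  have : (w.filter fun r => P r || r ∉ w) = w.filter P := by
    apply List.filter_congr
    intro r hr
    simp [hr]
  rwa [this] at h1

theorem Code.exists_adjacent (D : Code) {p : Passage} (h : p ∈ D.flatten) :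
    (∃ q, D.Follows p q) ∧ ∃ q, D.Follows q p := by
  refine ⟨D.exists_follows h, ?_⟩
  obtain ⟨w, hw, hp⟩ := List.mem_flatten.1 h
  obtain ⟨k, hk, rfl⟩ := List.mem_iff_getElem.1 hp
  rcases Nat.eq_zero_or_pos k with rfl | hk0
  · refine ⟨w[w.length - 1], w, hw, w.length - 1, by omega, by simp, ?_⟩
    rw [Nat.sub_add_cancel (by omega), Nat.mod_self]
    simp
  · refine ⟨w[k - 1], w, hw, k - 1, by omega, by simp, ?_⟩
    rw [Nat.sub_add_cancel (by omega), Nat.mod_eq_of_lt hk]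
    simp

/-- Extend a flow of the rest by zero on the deleted component `B` and by transmission through its
crossings with the other components. In a colouring for this flow the strand `B` is invisible, so
`colorRel.skip` removes the deleted passages. -/
theorem Code.PW.erase_head {B : List Passage} {L : Code} (h : Code.PW (B :: L)) :
    (Code.erase B L).PW := by
  set P : Passage → Bool := fun l => l.label ∉ B.map Passage.label with hP
  have hPB : ∀ p ∈ B, P p = false := fun p hp => by
    grind
  have hPp : ∀ p, P p.partner = P p := fun p => rfl
  have hflat : (B :: L).flatten = B ++ L.flatten := rfl
  have hnd := h.1.1
  rw [hflat, List.nodup_append] at hnd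
  have hremoved : ∀ r ∈ L.flatten, P r = false → r.partner ∈ B := by
    intro r hr hPr
    simp only [hP, decide_eq_false_iff_not, not_not] at hPr
    obtain ⟨b, hb, hbr⟩ := List.mem_map.1 hPr
    rcases h.1.2.2 b (by rw [hflat]; simp [hb]) r (by rw [hflat, List.mem_append]; exact Or.inr hr) hbr
      with rfl | rfl
    · exact absurd rfl (hnd.2.2 r hb r hr)
    · rwa [Passage.partner_partner]
  have hwf : (Code.erase B L).WellFormed := by
    rw [Code.wellFormed_iff, Code.flatten_erase]
    have := WellFormedList.filter h.1 (fun c => c ∉ B.map Passage.label)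
    rw [hflat, List.filter_append, List.filter_eq_nil_iff.2 (fun p hp => by
      have := hPB p hp
      simpa [hP] using this), List.nil_append] at this
    exact this
  refine ⟨hwf, fun x hx => ?_⟩
  rw [Code.isFlow_iff] at hx
  obtain ⟨y, h1, h2, h3⟩ := exists_lift_code P L hnd.2.1 x fun w hw =>
    hx.1 _ (List.mem_map_of_mem hw)
  let z : Dart → ZMod 2 := fun d => if d.1 ∈ B then 0 else y d
  have hzB : ∀ p ∈ B, ∀ b, z (p, b) = 0 := fun p hp b => by simp [z, hp]
  have hzy : ∀ p ∈ L.flatten, ∀ b, z (p, b) = y (p, b) := fun p hp b => by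
    grind
  have hzx : ∀ p, P p = true → ∀ b, z (p, b) = x (p, b) := fun p hp b => by
    grind
  have hmem : ∀ p ∈ L.flatten, P p = true → p ∈ (Code.erase B L).flatten := by
    intro p hp hPp
    rw [Code.flatten_erase]
    exact List.mem_filter.2 ⟨hp, hPp⟩
  have hzD : Code.IsFlow (B :: L) z := by
    rw [Code.isFlow_iff]
    constructor
    · intro w hw
      rw [List.mem_cons] at hw
      rcases hw with rfl | hw
      · refine flowRel_update (x := 0) (fun p hp b => (hzB p hp b).symm) ?_
        cases w with
        | nil => simp
        | cons a l =>
          rw [Cycle.chain_coe_cons, List.isChain_iff_getElem]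
          intros
          rfl
      · exact flowRel_update (fun p hp b => (hzy p (List.mem_flatten.2 ⟨w, hw, hp⟩) b).symm) (h2 w hw)
    · intro p hp
      have hvert : ∀ r ∈ L.flatten, P r = false → vertexRel z r := by
        intro r hr hPr
        rw [vertexRel, hzB _ (hremoved r hr hPr), hzB _ (hremoved r hr hPr), hzy r hr, hzy r hr,
          h3 r hr hPr]
        grind
      rw [hflat, List.mem_append] at hp
      rcases hp with hp | hp
      · have hpp := h.1.2.1 p (by rw [hflat]; simp [hp])
        rw [hflat, List.mem_append] at hpp
        rcases hpp with hpp | hpp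
        · rw [vertexRel, hzB p hp, hzB p hp, hzB _ hpp, hzB _ hpp]
          rfl
        · have := hvert _ hpp (by rw [hPp]; exact hPB p hp)
          unfold vertexRel at this ⊢
          rw [Passage.partner_partner] at this
          grind
      · cases hPp' : P p with
        | true =>
          have := hx.2 p (hmem p hp hPp')
          unfold vertexRel at this ⊢
          grind
        | false => exact hvert p hp hPp'
  obtain ⟨φ, hφ⟩ := h.exists_full hzD
  have hφ' := (Code.forall_follows_iff (B :: L) (fullRel z φ)).2 hφ
  refine ⟨φ, Code.isColoring_of_full (y := z) ?_ ?_⟩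
  · intro w hw
    obtain ⟨w, hwL, rfl⟩ := List.mem_map.1 hw
    refine cycle_chain_filter_mem (P := P) ?_ (hφ w (by simp [hwL]))
    intro p r hr q hPr hpr hrq
    have hrL : r ∈ L.flatten := List.mem_flatten.2 ⟨w, hwL, hr⟩
    have hb := hremoved r hrL hPr
    obtain ⟨⟨h', hh⟩, ⟨g, hg⟩⟩ := Code.exists_adjacent (B :: L) (p := r.partner)
      (by rw [hflat]; simp [hb])
    have hh := hφ' _ _ hh
    have hg := hφ' _ _ hg
    have hrr : z (r, true) = z (r, false) := by
      rw [hzy r hrL, hzy r hrL, h3 r hrL hPr]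
    refine ⟨colorRel.skip hpr.1 hrq.1 hg.1 hh.1 (hpr.2.trans hrr.symm) ?_ (hzB _ hb _),
      (hpr.2.trans hrr.symm).trans hrq.2⟩
    rw [hg.2, hzB _ hb]
  · intro p hp b
    rw [Code.flatten_erase] at hp
    exact (hzx p (List.mem_filter.1 hp).2 b).symm

/-- A kink can be added to a planar code. -/
theorem Code.PW.add_kink {w : List Passage} {L : Code} (h : Code.PW (w :: L)) {o : Passage}
    (ho : ∀ q ∈ List.flatten (w :: L), q.label ≠ o.label) :
    Code.PW ((o :: o.partner :: w) :: L) := by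
  have hne : ∀ q ∈ List.flatten (w :: L), q ≠ o ∧ q ≠ o.partner := fun q hq =>
    ⟨fun h => ho q hq (by rw [h]), fun h => ho q hq (by rw [h, Passage.label_partner])⟩
  refine ⟨WellFormedList.cons_cons h.1 ho, fun x hx => ?_⟩
  have hx0 := hx
  rw [Code.isFlow_iff] at hx
  have hw := hx.1 _ List.mem_cons_self
  rw [Cycle.chain_coe_cons, List.cons_append, List.isChain_cons_cons] at hw
  have hou : x (o, true) = x (o.partner, false) := hw.1
  have hv := hx.2 o (by simp)
  have hio : x (o, false) = x (o.partner, true) := by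
    unfold vertexRel at hv
    rw [hou] at hv
    grind
  have hxD : Code.IsFlow (w :: L) x := by
    rw [Code.isFlow_iff]
    refine ⟨fun v hvm => ?_, fun p hp => hx.2 p (by
      rw [List.flatten_cons, List.cons_append, List.cons_append]
      exact List.mem_cons_of_mem _ (List.mem_cons_of_mem _ hp))⟩
    rw [List.mem_cons] at hvm
    rcases hvm with rfl | hvm
    · refine cycle_chain_of_isChain (fun g b hg hb => ?_) hw.2
      unfold flowRel at hg hb ⊢
      rw [hg, hio, hb]
    · exact hx.1 v (by simp [hvm])
  obtain ⟨φ, hφ⟩ := h.exists_full hxD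
  -- `r` and `l` are the colours on the two sides of the edge that receives the kink. If the
  -- component has no crossings, any pair with the right sum will do.
  obtain ⟨r, l, hrl, hhead, hlast⟩ : ∃ r l : ZMod 2, r + l = x (o, false) ∧
      (∀ b ∈ w.head?, φ (b, false) = l ∧ r = φ (Dart.rot (b, false))) ∧
      ∀ g ∈ w.getLast?, φ (g, true) = r ∧ l = φ (Dart.rot (g, true)) := by
    by_cases hwn : w = []
    · subst hwn
      exact ⟨x (o, false), 0, by simp, by simp, by simp⟩
    · have h1 := hφ w (by simp)
      rw [cycle_chain_self hwn] at h1
      rw [isChain_cons_concat hwn] at hw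
      obtain ⟨b, hb⟩ : ∃ b, b ∈ w.head? := by
        obtain ⟨b, t, rfl⟩ := List.exists_cons_of_ne_nil hwn
        exact ⟨b, by simp⟩
      obtain ⟨g, hg⟩ : ∃ g, g ∈ w.getLast? :=
        ⟨w.getLast hwn, by simp [List.getLast?_eq_some_getLast hwn]⟩
      have h2 := h1.2 g hg b hb
      refine ⟨φ (g, true), φ (b, false), ?_, fun b' hb' => ?_, fun g' hg' => ?_⟩
      · rw [h2.1.2.2]
        exact hw.2.2.2 g hg
      · rw [Option.mem_unique hb' hb]
        exact ⟨rfl, h2.1.1⟩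
      · rw [Option.mem_unique hg' hg]
        exact ⟨rfl, h2.1.2.1⟩
  -- The loop bounds one new face. Whether it lies next to the face coloured `r` or the one coloured
  -- `l` depends on `o.isOver = o.isPos`; its colour differs from that neighbour by the flow `x (o,
  -- true)` along the loop.
  let ψ : Dart → ZMod 2 := fun d =>
    if d.1 = o then (if d.2 then (if o.isOver = o.isPos then r + x (o, true) else l) else l)
    else if d.1 = o.partner then
      (if d.2 then r else (if o.isOver = o.isPos then r else l + x (o, true))) else φ d
  have hψ : ∀ q ∈ List.flatten (w :: L), ∀ b, ψ (q, b) = φ (q, b) := fun q hq b => by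
    simp [ψ, (hne q hq).1, (hne q hq).2]
  have hψrot : ∀ q ∈ List.flatten (w :: L), ∀ b, ψ (Dart.rot (q, b)) = φ (Dart.rot (q, b)) :=
    fun q hq b => hψ _ (h.1.2.1 q hq) _
  have hψ1 : ψ (o, true) = if o.isOver = o.isPos then r + x (o, true) else l := by simp [ψ]
  have hψ2 : ψ (o, false) = l := by simp [ψ]
  have hψ3 : ψ (o.partner, true) = r := by simp [ψ, o.partner_ne]
  have hψ4 : ψ (o.partner, false) = if o.isOver = o.isPos then r else l + x (o, true) := by
    simp [ψ, o.partner_ne]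
  have hcong : ∀ v ∈ w :: L, Cycle.Chain (colorRel x ψ) (v : Cycle Passage) := by
    intro v hvm
    refine cycle_chain_imp_mem (hφ v hvm) fun p hp q hq hpq => ?_
    have hp' : p ∈ List.flatten (w :: L) := List.mem_flatten.2 ⟨v, hvm, hp⟩
    have hq' : q ∈ List.flatten (w :: L) := List.mem_flatten.2 ⟨v, hvm, hq⟩
    unfold colorRel
    rw [hψ p hp', hψ q hq', hψrot p hp', hψrot q hq']
    exact hpq.1
  refine ⟨ψ, Code.isColoring_iff.2 fun v hvm => ?_⟩
  rw [List.mem_cons] at hvm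
  rcases hvm with rfl | hvm
  · have hloop : colorRel x ψ o o.partner := by
      unfold colorRel
      simp only [Dart.rot, Passage.partner_partner, Passage.isOver_partner, Passage.isPos_partner]
      grind
    have hin : ∀ φr φl : ZMod 2, φr = r → φl = l → φr = ψ (Dart.rot (o, false)) ∧
        ψ (o, false) = φl ∧ φr + ψ (o, false) = x (o, false) := by
      rintro _ _ rfl rfl
      simp only [Dart.rot]
      grind
    have hout : ∀ φr φl : ZMod 2, φr = r → φl = l → ψ (o.partner, true) = φr ∧
        φl = ψ (Dart.rot (o.partner, true)) ∧ ψ (o.partner, true) + φl = x (o.partner, true) := by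
      rintro _ _ rfl rfl
      simp only [Dart.rot, Passage.partner_partner, Passage.isOver_partner, Passage.isPos_partner,
        ← hio]
      grind
    rw [Cycle.chain_coe_cons, List.cons_append, List.isChain_cons_cons]
    refine ⟨hloop, ?_⟩
    by_cases hwn : w = []
    · subst hwn
      simp only [List.nil_append, List.isChain_cons_cons, List.isChain_singleton, and_true]
      obtain ⟨i1, i2, i3⟩ := hin r l rfl rfl
      obtain ⟨o1, o2, o3⟩ := hout r l rfl rfl
      exact ⟨o1.trans i1, i2.trans o2, by rw [i2]; exact o3⟩
    · have hw2 := hcong w (by simp)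
      rw [cycle_chain_self hwn] at hw2
      rw [isChain_cons_concat hwn]
      refine ⟨hw2.1, fun b hb => ?_, fun g hg => ?_⟩
      · have hb' : b ∈ List.flatten (w :: L) := by simp [List.mem_of_mem_head? hb]
        obtain ⟨e1, e2⟩ := hhead b hb
        obtain ⟨o1, o2, o3⟩ := hout _ _ rfl rfl
        unfold colorRel
        grind
      · have hg' : g ∈ List.flatten (w :: L) := by simp [List.mem_of_getLast? hg]
        obtain ⟨e1, e2⟩ := hlast g hg
        obtain ⟨o1, o2, o3⟩ := hin _ _ rfl rfl
        unfold colorRel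
        rw [hψ g hg', hψrot g hg', ← e2, e1]
        refine ⟨o1, o2, ?_⟩
        rw [o3]
        have := hw.2
        rw [isChain_cons_concat hwn] at this
        exact (this.2.2 g hg).symm
  · exact hcong v (by simp [hvm])

end Skein

namespace Skein

open Polynomial in
/-! ### The descending evaluation of a code -/

/-- The part of a word before the first occurrence of `q`. -/
def beforeIn (q : Passage) (w : List Passage) : List Passage := w.takeWhile fun p => p ≠ q

/-- The part of a word after the first occurrence of `q`. -/
def afterIn (q : Passage) (w : List Passage) : List Passage := (w.dropWhile fun p => p ≠ q).tail

/-- Cut open, at `q`, the first component that contains `q`, and take it out of the code. -/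
def extract (q : Passage) : Code → List Passage × Code
  | [] => ([], [])
  | w :: L => if q ∈ w then (afterIn q w ++ beforeIn q w, L) else
      ((extract q L).1, w :: (extract q L).2)

theorem beforeIn_append {q : Passage} {X Y : List Passage} (h : q ∉ X) :
    beforeIn q (X ++ q :: Y) = X := by
  unfold beforeIn
  induction X with
  | nil => simp
  | cons p X ih =>
    rw [List.mem_cons, not_or] at h
    rw [List.cons_append, List.takeWhile_cons_of_pos (by simpa using Ne.symm h.1), ih h.2]

theorem afterIn_append {q : Passage} {X Y : List Passage} (h : q ∉ X) :
    afterIn q (X ++ q :: Y) = Y := by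
  unfold afterIn
  induction X with
  | nil => simp
  | cons p X ih =>
    rw [List.mem_cons, not_or] at h
    rw [List.cons_append, List.dropWhile_cons_of_pos (by simpa using Ne.symm h.1), ih h.2]

theorem exists_split_word {q : Passage} {w : List Passage} (h : q ∈ w) :
    ∃ X Y, w = X ++ q :: Y ∧ q ∉ X := List.eq_append_cons_of_mem h

theorem exists_split_code {q : Passage} {L : Code} (h : q ∈ L.flatten) :
    ∃ L₁ X Y L₂, L = L₁ ++ (X ++ q :: Y) :: L₂ ∧ q ∉ L₁.flatten ∧ q ∉ X := by
  induction L with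
  | nil => simp at h
  | cons w L ih =>
    by_cases hw : q ∈ w
    · obtain ⟨X, Y, rfl, hX⟩ := exists_split_word hw
      exact ⟨[], X, Y, L, by simp, by simp, hX⟩
    grind

theorem extract_append {q : Passage} {L₁ L₂ : Code} {X Y : List Passage} (h : q ∉ L₁.flatten)
    (hX : q ∉ X) : extract q (L₁ ++ (X ++ q :: Y) :: L₂) = (Y ++ X, L₁ ++ L₂) := by
  induction L₁ with
  | nil => simp [extract, beforeIn_append hX, afterIn_append hX]
  | cons w L₁ ih =>
    rw [List.flatten_cons, List.mem_append, not_or] at h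
    rw [List.cons_append, extract, if_neg h.1, ih h.2]
    rfl

theorem length_extract {q : Passage} {L : Code} (h : q ∈ L.flatten) :
    (extract q L).1.length + (extract q L).2.flatten.length + 1 = L.flatten.length ∧
      (extract q L).2.length + 1 = L.length := by
  obtain ⟨L₁, X, Y, L₂, rfl, h1, h2⟩ := exists_split_code h
  rw [extract_append h1 h2]
  simp
  omega

theorem length_before_after {q : Passage} {w : List Passage} (h : q ∈ w) :
    (afterIn q w).length + (beforeIn q w).length + 1 = w.length := by
  obtain ⟨X, Y, rfl, hX⟩ := exists_split_word h
  rw [afterIn_append hX, beforeIn_append hX]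
  simp
  omega

/-- The sign of a crossing. -/
def Passage.sign (p : Passage) : ℤ := if p.isPos then 1 else -1

/-- The coefficient of the switched diagram in the skein relation. -/
noncomputable def switchCoeff (p : Passage) : RingA := -LaurentPolynomial.T (-2 * p.sign)

/-- The coefficient of the smoothed diagram in the skein relation. -/
noncomputable def smoothCoeff (p : Passage) : RingA := LaurentPolynomial.T (-p.sign)

/-- The value of an additional circle. -/
noncomputable def circleValue : RingA := LaurentPolynomial.T 1 + LaurentPolynomial.T (-1)

open Polynomial in
/-- The skein polynomial, in the variable `z ^ 2`, of the diagram obtained from a system of words by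
travelling along them in the given order, computed by making the diagram descending. Passages
whose partner does not occur are ignored. -/
noncomputable def descend : Code → RingA[X]
  | [] => 0
  | [[]] => 1
  | [] :: w :: L => C circleValue * descend (w :: L)
  | (p :: W) :: L =>
      if p.isOver then descend (W :: L)
      else if h : p.partner ∈ W then
        C (switchCoeff p) * descend (W :: L) +
          C (smoothCoeff p) * descend (afterIn p.partner W :: beforeIn p.partner W :: L)
      else if h' : p.partner ∈ L.flatten then
        C (switchCoeff p) * descend (W :: L) + X * (C (smoothCoeff p) *
          descend (((extract p.partner L).1 ++ W) :: (extract p.partner L).2))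
      else descend (W :: L)
-- Smoothing a self-crossing adds a component but removes two passages, so the sum still drops.
termination_by D => D.flatten.length + D.length
decreasing_by
  · simp
  · simp
  · simp
  · have := length_before_after h
    simp at this ⊢
    omega
  · simp
  · have := length_extract h'
    simp at this ⊢
    omega
  · simp

section Rules

open Polynomial

variable {p : Passage} {W : List Passage} {L : Code}

theorem descend_nil_cons (hL : L ≠ []) : descend ([] :: L) = C circleValue * descend L := by
  obtain ⟨w, L, rfl⟩ := List.exists_cons_of_ne_nil hL
  rw [descend]

theorem descend_circle : descend [[]] = 1 := by rw [descend]

theorem descend_over (h : p.isOver = true) : descend ((p :: W) :: L) = descend (W :: L) := by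
  rw [descend, if_pos h]

theorem descend_unpaired (h : p.partner ∉ List.flatten (W :: L)) :
    descend ((p :: W) :: L) = descend (W :: L) := by
  rw [List.flatten_cons, List.mem_append, not_or] at h
  rw [descend, dif_neg h.1, dif_neg h.2, ite_self]

theorem descend_self {Y Z : List Passage} (h : p.isOver = false) (hY : p.partner ∉ Y) :
    descend ((p :: (Y ++ p.partner :: Z)) :: L) =
      C (switchCoeff p) * descend ((Y ++ p.partner :: Z) :: L) +
        C (smoothCoeff p) * descend (Z :: Y :: L) := by
  rw [descend, if_neg (by simp [h]), dif_pos (by simp), afterIn_append hY, beforeIn_append hY]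

theorem descend_mixed {Y Z : List Passage} {L₁ L₂ : Code} (h : p.isOver = false)
    (hW : p.partner ∉ W) (hL : p.partner ∉ L₁.flatten) (hY : p.partner ∉ Y) :
    descend ((p :: W) :: (L₁ ++ (Y ++ p.partner :: Z) :: L₂)) =
      C (switchCoeff p) * descend (W :: (L₁ ++ (Y ++ p.partner :: Z) :: L₂)) +
        X * (C (smoothCoeff p) * descend ((Z ++ Y ++ W) :: (L₁ ++ L₂))) := by
  rw [descend, if_neg (by simp [h]), dif_neg hW, dif_pos (by simp), extract_append hL hY]

end Rules

/-- The size of a code, for inductions. -/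
def Code.size (D : Code) : ℕ := D.flatten.length + D.length

theorem Code.size_cons (w : List Passage) (L : Code) :
    Code.size (w :: L) = w.length + 1 + Code.size L := by
  simp [Code.size]
  omega

theorem Code.size_append (L L' : Code) : Code.size (L ++ L') = Code.size L + Code.size L' := by
  simp [Code.size]
  omega

/-! ### Unpaired passages do not matter -/

section Filter

open Polynomial

/-- Delete the crossings outside a set. -/
def Code.restrict (P : ℕ → Bool) (D : Code) : Code := D.map (List.filter fun l => P l.label)

theorem Code.flatten_restrict (P : ℕ → Bool) (D : Code) :
    (D.restrict P).flatten = D.flatten.filter fun l => P l.label := by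
  simp [Code.restrict, List.filter_flatten]

/-- Deleting passages whose partner does not occur does not change the evaluation. -/
theorem descend_restrict (P : ℕ → Bool) (D : Code)
    (h : ∀ p ∈ D.flatten, P p.label = false → p.partner ∉ D.flatten) :
    descend (D.restrict P) = descend D := by
  induction hn : D.size using Nat.strong_induction_on generalizing D with
  | _ n ih =>
  subst hn
  match D, h, ih with
  | [], _, _ => rfl
  | [[]], _, _ => rfl
  | [] :: w :: L, h, ih =>
    have := ih _ (by simp [Code.size_cons]) (w :: L) (fun p hp => by simpa using h p (by simpa using hp)) rfl
    rw [descend_nil_cons (by simp), ← this]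
    exact descend_nil_cons (by simp)
  | (p :: W) :: L, h, ih =>
    have hW := ih _ (by simp [Code.size_cons]) (W :: L) (fun q hq hPq hq' =>
      h q (by simp only [List.flatten_cons, List.mem_append, List.mem_cons] at hq ⊢; tauto) hPq
        (by simp only [List.flatten_cons, List.mem_append, List.mem_cons] at hq' ⊢; tauto)) rfl
    have hcons : ∀ (w : List Passage) (L : Code), Code.restrict P (w :: L) =
      (w.filter fun l => P l.label) :: Code.restrict P L := fun _ _ => rfl
    cases hP : P p.label with
    | false =>
      rw [hcons, List.filter_cons_of_neg (by simp [hP]), ← hcons, hW, descend_unpaired]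
      grind
    | true =>
      rw [hcons, List.filter_cons_of_pos (by simp [hP])]
      cases ho : p.isOver with
      | true => rw [descend_over ho, descend_over ho, ← hcons, hW]
      | false =>
        by_cases h1 : p.partner ∈ W
        · obtain ⟨Y, Z, rfl, hY⟩ := exists_split_word h1
          have hYZ := ih _ (by simp [Code.size_cons]; omega) (Z :: Y :: L) (fun q hq hPq hq' =>
            h q (by simp only [List.flatten_cons, List.mem_append, List.mem_cons] at hq ⊢; tauto) hPq
              (by simp only [List.flatten_cons, List.mem_append, List.mem_cons] at hq' ⊢; tauto)) rfl
          rw [descend_self ho hY, ← hW, ← hYZ, hcons, hcons, hcons, List.filter_append,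
            List.filter_cons_of_pos (by simp [hP]),
            descend_self ho fun hm => hY (List.mem_of_mem_filter hm)]
        · by_cases h2 : p.partner ∈ L.flatten
          · obtain ⟨L₁, Y, Z, L₂, rfl, hL, hY⟩ := exists_split_code h2
            have hYZ := ih _ (by simp [Code.size_cons, Code.size_append]; omega)
              ((Z ++ Y ++ W) :: (L₁ ++ L₂)) (fun q hq hPq hq' =>
              h q (by simp only [List.flatten_cons, List.flatten_append, List.mem_append, List.mem_cons] at hq ⊢; tauto) hPq
                (by simp only [List.flatten_cons, List.flatten_append, List.mem_append, List.mem_cons] at hq' ⊢; tauto)) rfl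
            have happ : ∀ L L' : Code, Code.restrict P (L ++ L') = L.restrict P ++ L'.restrict P :=
              fun L L' => by simp [Code.restrict]
            rw [descend_mixed ho h1 hL hY, ← hW, ← hYZ, hcons, hcons, happ, happ, hcons,
              List.filter_append, List.filter_append, List.filter_append,
              List.filter_cons_of_pos (by simp [hP]),
              descend_mixed ho (fun hm => h1 (List.mem_of_mem_filter hm))
                (fun hm => hL (by rw [Code.flatten_restrict] at hm; exact List.mem_of_mem_filter hm))
                fun hm => hY (List.mem_of_mem_filter hm)]
          · rw [descend_unpaired, descend_unpaired, ← hcons, hW]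
            · grind
            · rw [← hcons, Code.flatten_restrict]
              grind

theorem Code.restrict_switch (Z : ℕ → Bool) (D : Code) :
    (D.switch Z).restrict (fun c => !Z c) = D.restrict fun c => !Z c := by
  simp only [Code.restrict, Code.switch, List.map_map]
  apply List.map_congr_left
  intro w hw
  clear hw
  simp only [Function.comp_apply]
  induction w with
  | nil => rfl
  | cons p w ih =>
    rw [List.map_cons]
    cases hZ : Z p.label with
    | true => rw [List.filter_cons_of_neg (by simp [hZ]), List.filter_cons_of_neg (by simp [hZ]), ih]
    | false =>
      rw [List.filter_cons_of_pos (by simp [hZ]), List.filter_cons_of_pos (by simp [hZ]), ih]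
      simp [Passage.switch, hZ]

/-- Switching passages whose partner does not occur does not change the evaluation. -/
theorem descend_switch (Z : ℕ → Bool) (D : Code)
    (h : ∀ p ∈ D.flatten, Z p.label = true → p.partner ∉ D.flatten) :
    descend (D.switch Z) = descend D := by
  -- After the crossings of `Z` are deleted, the code and the switched code coincide; and deleting
  -- them changes neither value, as their passages are unpaired.
  rw [← descend_restrict (fun c => !Z c) D fun p hp hZ => h p hp (by simpa using hZ),
    ← Code.restrict_switch, descend_restrict]
  intro p hp hZ hp'
  rw [Code.flatten_switch] at hp hp'
  obtain ⟨q, hq, rfl⟩ := List.mem_map.1 hp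
  obtain ⟨r, hr, hrq⟩ := List.mem_map.1 hp'
  rw [Passage.partner_switch] at hrq
  have := Passage.switch_injective Z hrq
  subst this
  exact h q hq (by simpa using hZ) hr

end Filter

/-! ### Stacked components -/

section Split

open Polynomial

/-- If the components in `E` lie over those in `L`, the evaluation factors. -/
theorem descend_append {E L : Code} (hE : E ≠ []) (hL : L ≠ [])
    (h : ∀ p ∈ E.flatten, p.partner ∈ L.flatten → p.isOver = true) :
    descend (E ++ L) = C circleValue * descend E * descend L := by
  induction hn : E.size using Nat.strong_induction_on generalizing E with
  | _ n ih =>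
  subst hn
  match E, hE, h, ih with
  | [[]], _, _, _ =>
    rw [List.singleton_append, descend_nil_cons hL, descend_circle, mul_one]
  | [] :: w :: E, _, h, ih =>
    have := ih _ (by simp [Code.size_cons]) (E := w :: E) (by simp)
      (fun p hp => h p (by simpa using hp)) rfl
    rw [List.cons_append, descend_nil_cons (by simp), descend_nil_cons (by simp), this]
    ring
  | (p :: W) :: E, _, h, ih =>
    have hW := ih _ (by simp [Code.size_cons]) (E := W :: E) (by simp) (fun q hq =>
      h q (by simp only [List.flatten_cons, List.mem_append, List.mem_cons] at hq ⊢; tauto)) rfl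
    rw [List.cons_append] at hW ⊢
    cases ho : p.isOver with
    | true => rw [descend_over ho, descend_over ho, hW]
    | false =>
      have hpL : p.partner ∉ L.flatten := fun hm => by
        grind
      by_cases h1 : p.partner ∈ W
      · obtain ⟨Y, Z, rfl, hY⟩ := exists_split_word h1
        have hYZ := ih _ (by simp [Code.size_cons]; omega) (E := Z :: Y :: E) (by simp) (fun q hq =>
          h q (by simp only [List.flatten_cons, List.mem_append, List.mem_cons] at hq ⊢; tauto)) rfl
        rw [List.cons_append, List.cons_append] at hYZ
        rw [descend_self ho hY, descend_self ho hY, hW, hYZ]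
        ring
      · by_cases h2 : p.partner ∈ E.flatten
        · obtain ⟨L₁, Y, Z, L₂, rfl, hL1, hY⟩ := exists_split_code h2
          have hYZ := ih _ (by simp [Code.size_cons, Code.size_append]; omega)
            (E := (Z ++ Y ++ W) :: (L₁ ++ L₂)) (by simp) (fun q hq =>
            h q (by simp only [List.flatten_cons, List.flatten_append, List.mem_append, List.mem_cons] at hq ⊢; tauto)) rfl
          rw [List.cons_append, List.append_assoc L₁] at hYZ
          rw [List.append_assoc, List.cons_append] at hW ⊢
          rw [descend_mixed ho h1 hL1 hY, descend_mixed ho h1 hL1 hY, hW, hYZ]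
          ring
        · rw [descend_unpaired, descend_unpaired, hW]
          all_goals grind

end Split

/-! ### Counting monomials -/

section Size

open Polynomial

/-- Sums of at most `w` elements of `M`. -/
def SumOf {A : Type} [Ring A] (M : Set A) (w : ℕ) (f : A) : Prop :=
  ∃ l : List A, l.length ≤ w ∧ (∀ m ∈ l, m ∈ M) ∧ l.sum = f

theorem SumOf.mono {A : Type} [Ring A] {M M' : Set A} {w w' : ℕ} {f : A} (h : SumOf M w f)
    (hM : M ⊆ M') (hw : w ≤ w') : SumOf M' w' f := by
  obtain ⟨l, h1, h2, h3⟩ := h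
  exact ⟨l, h1.trans hw, fun m hm => hM (h2 m hm), h3⟩

theorem SumOf.add {A : Type} [Ring A] {M : Set A} {w w' : ℕ} {f g : A} (hf : SumOf M w f)
    (hg : SumOf M w' g) : SumOf M (w + w') (f + g) := by
  obtain ⟨l, h1, h2, h3⟩ := hf
  obtain ⟨l', h1', h2', h3'⟩ := hg
  refine ⟨l ++ l', by simp; omega, ?_, by simp [h3, h3']⟩
  grind

theorem SumOf.of_mem {A : Type} [Ring A] {M : Set A} {f : A} (h : f ∈ M) : SumOf M 1 f :=
  ⟨[f], by simp, by simpa using h, by simp⟩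

theorem SumOf.zero {A : Type} [Ring A] (M : Set A) : SumOf M 0 (0 : A) :=
  ⟨[], by simp, by simp, by simp⟩

theorem SumOf.mul {A : Type} [Ring A] {M M' M'' : Set A} {w w' : ℕ} {f g : A}
    (hf : SumOf M w f) (hg : SumOf M' w' g) (hM : ∀ m ∈ M, ∀ m' ∈ M', m * m' ∈ M'') :
    SumOf M'' (w * w') (f * g) := by
  obtain ⟨l, h1, h2, h3⟩ := hf
  obtain ⟨l', h1', h2', h3'⟩ := hg
  refine ⟨(l ×ˢ l').map fun x => x.1 * x.2, ?_, ?_, ?_⟩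
  · simp only [List.length_map, List.length_product]
    exact Nat.mul_le_mul h1 h1'
  · intro m hm
    obtain ⟨x, hx, rfl⟩ := List.mem_map.1 hm
    obtain ⟨a, b⟩ := x
    rw [List.mem_product] at hx
    exact hM _ (h2 _ hx.1) _ (h2' _ hx.2)
  · rw [← h3, ← h3']
    clear h1 h2 h3 h1' h2' h3'
    induction l with
    | nil => simp
    | cons a l ih =>
      rw [List.product_cons, List.map_append, List.sum_append, ih, List.sum_cons, add_mul,
        List.map_map]
      have h : ∀ l' : List A, (l'.map fun x => a * x).sum = a * l'.sum := by
        intro l'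
        induction l' <;> simp_all [mul_add]
      simp [Function.comp_def, h]

theorem SumOf.map {A B : Type} [Ring A] [Ring B] {M : Set A} {M' : Set B} {w : ℕ} {f : A}
    (hf : SumOf M w f) (F : A →+ B) (hF : ∀ m ∈ M, F m ∈ M') : SumOf M' w (F f) := by
  obtain ⟨l, h1, h2, h3⟩ := hf
  refine ⟨l.map F, by simpa using h1, ?_, by rw [← h3, map_list_sum]⟩
  grind

/-- Signed powers of `a` with exponents of absolute value at most `s`, and zero. -/
def monoA (s : ℕ) : Set RingA :=
  {m | ∃ (c e : ℤ), |c| ≤ 1 ∧ |e| ≤ s ∧ m = LaurentPolynomial.C c * LaurentPolynomial.T e}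

theorem monoA_mono {s s' : ℕ} (h : s ≤ s') : monoA s ⊆ monoA s' := by
  rintro _ ⟨c, e, hc, he, rfl⟩
  exact ⟨c, e, hc, he.trans (by exact_mod_cast h), rfl⟩

theorem mul_mem_monoA {s s' : ℕ} {m m' : RingA} (h : m ∈ monoA s) (h' : m' ∈ monoA s') :
    m * m' ∈ monoA (s + s') := by
  obtain ⟨c, e, hc, he, rfl⟩ := h
  obtain ⟨c', e', hc', he', rfl⟩ := h'
  refine ⟨c * c', e + e', ?_, ?_, ?_⟩
  · rw [abs_mul]
    nlinarith [abs_nonneg c, abs_nonneg c']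
  · push_cast
    exact (abs_add_le e e').trans (add_le_add he he')
  · rw [map_mul, LaurentPolynomial.T_add]
    ring

theorem T_mem_monoA {e : ℤ} {s : ℕ} (h : |e| ≤ s) : LaurentPolynomial.T e ∈ monoA s :=
  ⟨1, e, by simp, h, by simp⟩

theorem neg_mem_monoA {m : RingA} {s : ℕ} (h : m ∈ monoA s) : -m ∈ monoA s := by
  obtain ⟨c, e, hc, he, rfl⟩ := h
  exact ⟨-c, e, by simpa using hc, he, by simp⟩

/-- Signed monomials in `a` and `z ^ 2`. -/
def monoAX (s : ℕ) : Set RingA[X] := {m | ∃ q ∈ monoA s, ∃ j : ℕ, m = C q * X ^ j}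

theorem monoAX_mono {s s' : ℕ} (h : s ≤ s') : monoAX s ⊆ monoAX s' := by
  rintro _ ⟨q, hq, j, rfl⟩
  exact ⟨q, monoA_mono h hq, j, rfl⟩

theorem mul_mem_monoAX {s s' : ℕ} {m m' : RingA[X]} (h : m ∈ monoAX s) (h' : m' ∈ monoAX s') :
    m * m' ∈ monoAX (s + s') := by
  obtain ⟨q, hq, j, rfl⟩ := h
  obtain ⟨q', hq', j', rfl⟩ := h'
  refine ⟨q * q', mul_mem_monoA hq hq', j + j', ?_⟩
  rw [map_mul, pow_add]
  ring

theorem C_mem_monoAX {s : ℕ} {q : RingA} (h : q ∈ monoA s) : C q ∈ monoAX s :=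
  ⟨q, h, 0, by simp⟩

theorem Passage.abs_sign (p : Passage) : |p.sign| = 1 := by
  unfold Passage.sign
  split <;> simp

theorem switchCoeff_mem (p : Passage) : switchCoeff p ∈ monoA 2 :=
  neg_mem_monoA (T_mem_monoA (by rw [abs_mul, p.abs_sign]; simp))

theorem smoothCoeff_mem (p : Passage) : smoothCoeff p ∈ monoA 1 :=
  T_mem_monoA (by rw [abs_neg, p.abs_sign]; simp)

theorem sumOf_circleValue : SumOf (monoA 1) 2 circleValue :=
  (SumOf.of_mem (T_mem_monoA (by simp))).add (SumOf.of_mem (T_mem_monoA (by simp)))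

theorem sumOf_C {s w : ℕ} {q : RingA} (h : SumOf (monoA s) w q) : SumOf (monoAX s) w (C q) :=
  h.map (C : RingA →+* RingA[X]).toAddMonoidHom fun _ hm => C_mem_monoAX hm

theorem SumOf.mulAX {s s' w w' : ℕ} {f g : RingA[X]} (hf : SumOf (monoAX s) w f)
    (hg : SumOf (monoAX s') w' g) : SumOf (monoAX (s + s')) (w * w') (f * g) :=
  hf.mul hg fun _ hm _ hm' => mul_mem_monoAX hm hm'

theorem SumOf.mulA {s s' w w' : ℕ} {f g : RingA} (hf : SumOf (monoA s) w f)
    (hg : SumOf (monoA s') w' g) : SumOf (monoA (s + s')) (w * w') (f * g) :=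
  hf.mul hg fun _ hm _ hm' => mul_mem_monoA hm hm'

theorem SumOf.X_mul {s w : ℕ} {f : RingA[X]} (hf : SumOf (monoAX s) w f) :
    SumOf (monoAX s) w (X * f) :=
  hf.map (AddMonoidHom.mulLeft X) fun m hm => by
    obtain ⟨q, hq, j, rfl⟩ := hm
    exact ⟨q, hq, j + 1, by simp [pow_succ]; ring⟩

theorem SumOf.coeff {s w : ℕ} {f : RingA[X]} (hf : SumOf (monoAX s) w f) (j : ℕ) :
    SumOf (monoA s) w (f.coeff j) :=
  hf.map (M' := monoA s) (lcoeff RingA j).toAddMonoidHom fun m hm => by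
    obtain ⟨q, hq, i, rfl⟩ := hm
    simp only [LinearMap.toAddMonoidHom_coe, lcoeff_apply, coeff_C_mul, coeff_X_pow]
    split
    · simpa using hq
    · exact ⟨0, 0, by simp, by simp, by simp⟩

/-- The evaluation of a code has bounded size. -/
theorem sumOf_descend (D : Code) :
    SumOf (monoAX (2 * D.size)) (2 ^ D.size) (descend D) := by
  induction hn : D.size using Nat.strong_induction_on generalizing D with
  | _ n ih =>
  subst hn
  match D, ih with
  | [], _ =>
    rw [descend]
    exact (SumOf.zero _).mono subset_rfl (Nat.zero_le _)
  | [[]], _ =>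
    rw [descend_circle]
    refine (SumOf.of_mem (M := monoAX 0) ?_).mono (monoAX_mono (Nat.zero_le _)) Nat.one_le_two_pow
    exact ⟨1, ⟨1, 0, by simp, by simp, by simp⟩, 0, by simp⟩
  | [] :: w :: L, ih =>
    have h := ih _ (by simp [Code.size_cons]) (w :: L) rfl
    rw [descend_nil_cons (by simp)]
    refine ((sumOf_C sumOf_circleValue).mulAX h).mono (monoAX_mono ?_) ?_
    · simp [Code.size_cons]; omega
    · rw [← pow_succ']
      exact Nat.pow_le_pow_right (by simp) (by simp [Code.size_cons])
  | (p :: W) :: L, ih =>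
    have hW := ih _ (by simp [Code.size_cons]) (W :: L) rfl
    have hmono : SumOf (monoAX (2 * Code.size ((p :: W) :: L))) (2 ^ Code.size ((p :: W) :: L))
        (descend (W :: L)) := hW.mono (monoAX_mono (by simp [Code.size_cons]))
        (Nat.pow_le_pow_right (by simp) (by simp [Code.size_cons]))
    have h1 := (sumOf_C (SumOf.of_mem (switchCoeff_mem p))).mulAX hW
    -- A skein step branches into two codes of smaller size, so `2 ^ size` bounds the number of
    -- monomials.
    have htwo : 2 ^ Code.size ((p :: W) :: L) = 1 * 2 ^ Code.size (W :: L) + 2 ^ Code.size (W :: L) := by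
      have : Code.size ((p :: W) :: L) = Code.size (W :: L) + 1 := by simp [Code.size_cons]; ring
      rw [this, pow_succ]
      ring
    cases ho : p.isOver with
    | true =>
      rw [descend_over ho]
      exact hmono
    | false =>
      by_cases hp : p.partner ∈ W
      · obtain ⟨Y, Z, rfl, hY⟩ := exists_split_word hp
        rw [descend_self ho hY]
        have h2 := (sumOf_C (SumOf.of_mem (smoothCoeff_mem p))).mulAX
          (ih _ (by simp [Code.size_cons]; omega) (Z :: Y :: L) rfl)
        rw [htwo]
        refine (h1.mono (monoAX_mono ?_) le_rfl).add (h2.mono (monoAX_mono ?_) ?_)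
        · simp [Code.size_cons]; omega
        · simp [Code.size_cons]; omega
        · rw [one_mul]
          exact Nat.pow_le_pow_right (by simp) (by simp [Code.size_cons]; omega)
      · by_cases h2 : p.partner ∈ L.flatten
        · obtain ⟨L₁, Y, Z, L₂, rfl, hL1, hY⟩ := exists_split_code h2
          rw [descend_mixed ho hp hL1 hY]
          have h2 := ((sumOf_C (SumOf.of_mem (smoothCoeff_mem p))).mulAX
            (ih _ (by simp [Code.size_cons, Code.size_append]; omega)
              ((Z ++ Y ++ W) :: (L₁ ++ L₂)) rfl)).X_mul
          rw [htwo]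
          refine (h1.mono (monoAX_mono ?_) le_rfl).add (h2.mono (monoAX_mono ?_) ?_)
          · simp [Code.size_cons]; omega
          · simp [Code.size_cons, Code.size_append]; omega
          · rw [one_mul]
            exact Nat.pow_le_pow_right (by simp) (by simp [Code.size_cons, Code.size_append]; omega)
        · rw [descend_unpaired]
          all_goals grind

end Size

end Skein

namespace Skein

/-! ### The skein polynomial of a descending diagram -/

open Polynomial in
/-- Substitution of `z ^ 2` for the variable. -/
noncomputable def zEval : RingA[X] →+* RingAZ :=
  Polynomial.toLaurent.comp (Polynomial.expand RingA 2).toRingHom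

open Polynomial in
theorem zEval_apply (f : RingA[X]) : zEval f = Polynomial.toLaurent (Polynomial.expand RingA 2 f) :=
  rfl

open Polynomial in
theorem zEval_C (q : RingA) : zEval (C q) = LaurentPolynomial.C q := by
  rw [zEval_apply, expand_C, toLaurent_C]

open Polynomial in
theorem zEval_X : zEval X = LaurentPolynomial.T 2 := by
  rw [zEval_apply, expand_X, toLaurent_X_pow]
  rfl

theorem zEval_injective : Function.Injective zEval := fun _ _ h =>
  Polynomial.expand_injective two_pos (Polynomial.toLaurent_injective h)

/-- The same crossing with over and under exchanged. -/
def Passage.flip (p : Passage) : Passage := ⟨p.label, !p.isOver, !p.isPos⟩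

@[simp] theorem Passage.label_flip (p : Passage) : p.flip.label = p.label := rfl

@[simp] theorem Passage.isOver_flip (p : Passage) : p.flip.isOver = !p.isOver := rfl

theorem Passage.switch_of_eq {p : Passage} {c : ℕ} (h : p.label = c) :
    p.switch (fun d => d = c) = p.flip := by
  simp [Passage.switch, h, Passage.flip]

theorem map_switch_of_ne {w : List Passage} {c : ℕ} (h : ∀ p ∈ w, p.label ≠ c) :
    w.map (Passage.switch fun d => d = c) = w := by
  conv_rhs => rw [← List.map_id w]
  exact List.map_congr_left fun p hp => by simp [Passage.switch, h p hp]

theorem Code.switch_of_ne {L : Code} {c : ℕ} (h : ∀ p ∈ L.flatten, p.label ≠ c) :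
    L.switch (fun d => d = c) = L := by
  unfold Code.switch
  conv_rhs => rw [← List.map_id L]
  exact List.map_congr_left fun w hw => map_switch_of_ne fun p hp => h p (List.mem_flatten.2 ⟨w, hw, hp⟩)

theorem Code.PW.labels_self {p : Passage} {X Y : List Passage} {L : Code}
    (h : Code.PW ((p :: (X ++ p.partner :: Y)) :: L)) :
    ∀ q ∈ X ++ Y ++ L.flatten, q.label ≠ p.label := by
  have hperm : (List.flatten ((p :: (X ++ p.partner :: Y)) :: L)).Perm
      (p :: p.partner :: (X ++ Y ++ L.flatten)) := by
    simp [List.perm_middle]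
  exact (WellFormedList.perm h.1 hperm).of_cons_cons.2

theorem Code.PW.labels_mixed {p : Passage} {X Y : List Passage} {L : Code}
    (h : Code.PW ((p :: X) :: (p.partner :: Y) :: L)) :
    ∀ q ∈ X ++ Y ++ L.flatten, q.label ≠ p.label := by
  have hperm : (List.flatten ((p :: X) :: (p.partner :: Y) :: L)).Perm
      (p :: p.partner :: (X ++ Y ++ L.flatten)) := by
    simp [List.perm_middle]
  exact (WellFormedList.perm h.1 hperm).of_cons_cons.2

theorem Code.PW.flip_self {p : Passage} {X Y : List Passage} {L : Code}
    (h : Code.PW ((p :: (X ++ p.partner :: Y)) :: L)) :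
    Code.PW ((p.flip :: (X ++ p.flip.partner :: Y)) :: L) := by
  have hl := h.labels_self
  have := h.switch fun d => d = p.label
  simp only [Code.switch, List.map_cons, List.map_append] at this
  rw [Passage.switch_of_eq (p := p) (c := p.label) rfl,
    Passage.switch_of_eq (p := p.partner) (c := p.label) rfl,
    map_switch_of_ne fun q hq => hl q (by simp [hq]),
    map_switch_of_ne fun q hq => hl q (by simp [hq])] at this
  rw [← Code.switch, Code.switch_of_ne fun q hq => hl q (List.mem_append_right _ hq)] at this
  exact this

theorem Code.PW.flip_mixed {p : Passage} {X Y : List Passage} {L : Code}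
    (h : Code.PW ((p :: X) :: (p.partner :: Y) :: L)) :
    Code.PW ((p.flip :: X) :: (p.flip.partner :: Y) :: L) := by
  have hl := h.labels_mixed
  have := h.switch fun d => d = p.label
  simp only [Code.switch, List.map_cons] at this
  rw [Passage.switch_of_eq (p := p) (c := p.label) rfl,
    Passage.switch_of_eq (p := p.partner) (c := p.label) rfl,
    map_switch_of_ne fun q hq => hl q (by simp [hq]),
    map_switch_of_ne fun q hq => hl q (by simp [hq])] at this
  rw [← Code.switch, Code.switch_of_ne fun q hq => hl q (List.mem_append_right _ hq)] at this
  exact this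

theorem Code.PW.nil_cons {L : Code} (h : L.PW) : Code.PW ([] :: L) :=
  h.of_chains (by simp) fun R => by simp

/-! ### Moves and skein relations for planar codes -/

section Value

variable (P : LinkDiagram → RingAZ)

open Classical in
/-- The normalised polynomial of a planar code. -/
noncomputable def Code.value (D : Code) : RingAZ :=
  if h : D ≠ [] ∧ D.PW then
    zPow ((D.length : ℤ) - 1) * P ⟨D, h.1, h.2.1, (Code.pw_iff.1 h.2).2⟩ else 0

theorem LinkDiagram.pw (D : LinkDiagram) : D.code.PW := Code.pw_iff.2 ⟨D.wellFormed, D.planar⟩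

theorem LinkDiagram.value_code (D : LinkDiagram) :
    D.code.value P = zPow ((D.com : ℤ) - 1) * P D := by
  rw [Code.value, dif_pos ⟨D.nonempty, D.pw⟩]
  rfl

variable {P}

theorem Code.value_move (hP : IsSkeinPolynomial P) {D D' : Code} (hne : D ≠ []) (hne' : D' ≠ [])
    (h : D.PW) (h' : D'.PW) (hl : D.length = D'.length) (hm : D.Move D') :
    D.value P = D'.value P := by
  rw [Code.value, Code.value, dif_pos ⟨hne, h⟩, dif_pos ⟨hne', h'⟩, hl]
  congr 1
  exact hP.isotopy _ _ hm

theorem Code.value_perm (hP : IsSkeinPolynomial P) {D D' : Code} (hne : D ≠ []) (h : D.PW)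
    (hp : D.Perm D') : D.value P = D'.value P :=
  Code.value_move hP hne (fun h0 => hne (by rw [h0] at hp; exact hp.eq_nil)) h (h.perm hp)
    hp.length_eq (.reorder hp)

theorem Code.value_rotate (hP : IsSkeinPolynomial P) {w w' : List Passage} {L : Code}
    (h : Code.PW (w :: L)) (hr : w.IsRotated w') :
    Code.value P (w :: L) = Code.value P (w' :: L) :=
  Code.value_move hP (by simp) (by simp) h (h.rotate hr) rfl (.rotate L hr)

theorem Code.value_circle (hP : IsSkeinPolynomial P) : Code.value P [[]] = 1 := by
  have := LinkDiagram.value_code P LinkDiagram.circle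
  rw [hP.unknot] at this
  have h1 : LinkDiagram.circle.code = [[]] := rfl
  rw [h1] at this
  rw [this]
  simp [LinkDiagram.com, h1, zPow]

/-- This is the overpass move with an empty new arc: an arc that runs over everything is lifted off
and shrunk, and all crossings on it disappear. -/
theorem Code.value_overpass (hP : IsSkeinPolynomial P) {A X : List Passage} {L : Code}
    (hA : ∀ l ∈ A, l.isOver = true) (h : Code.PW ((A ++ X) :: L))
    (h' : (Code.erase A (X :: L)).PW) :
    Code.value P ((A ++ X) :: L) = Code.value P (Code.erase A (X :: L)) := by
  refine Code.value_move hP (by simp) (by simp [Code.erase]) h h' (by simp [Code.erase]) ?_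
  exact Code.Move.overpass (A' := []) (X' := X.filter fun l => l.label ∉ A.map Passage.label) hA
    (by simp) (by simp [Code.erase])

/-- The exponent of `z` is what the normalisation leaves over: `0` when the smoothing splits a
component, `2` when it joins two. -/
theorem Code.value_skein (hP : IsSkeinPolynomial P) {Dp Dm D0 : Code} (hp : Dp.PW) (hm : Dm.PW)
    (h0 : D0.PW) (h : Code.SkeinTriple Dp Dm D0) :
    aPow 1 * Dp.value P + aPow (-1) * Dm.value P =
      zPow ((Dp.length : ℤ) - D0.length + 1) * D0.value P := by
  obtain ⟨hne1, hne2, hne3, hl⟩ : Dp ≠ [] ∧ Dm ≠ [] ∧ D0 ≠ [] ∧ zPow ((Dm.length : ℤ) - 1) =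
      zPow ((Dp.length : ℤ) - 1) := by cases h <;> simp
  have := hP.skein ⟨Dp, hne1, hp.1, (Code.pw_iff.1 hp).2⟩ ⟨Dm, hne2, hm.1, (Code.pw_iff.1 hm).2⟩
    ⟨D0, hne3, h0.1, (Code.pw_iff.1 h0).2⟩ h
  rw [Code.value, Code.value, Code.value, dif_pos ⟨hne1, hp⟩, dif_pos ⟨hne2, hm⟩,
    dif_pos ⟨hne3, h0⟩, hl]
  have hz : zPow ((Dp.length : ℤ) - D0.length + 1) * zPow ((D0.length : ℤ) - 1) =
      zPow ((Dp.length : ℤ) - 1) * zPow 1 := by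
    rw [zPow, zPow, zPow, zPow, ← LaurentPolynomial.T_add, ← LaurentPolynomial.T_add]
    congr 1
    ring
  grind

theorem aPow_mul (m n : ℤ) : aPow m * aPow n = aPow (m + n) := by
  rw [aPow, aPow, aPow, ← map_mul, ← LaurentPolynomial.T_add]

theorem aPow_zero : aPow 0 = 1 := by
  rw [aPow, LaurentPolynomial.T_zero, map_one]

theorem solve_positive {x y w : RingAZ} (h : aPow 1 * x + aPow (-1) * y = w) :
    x = -aPow (-2) * y + aPow (-1) * w := by
  rw [← h, mul_add, ← mul_assoc, ← mul_assoc, aPow_mul, aPow_mul]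
  norm_num [aPow_zero]
  ring

theorem solve_negative {x y w : RingAZ} (h : aPow 1 * x + aPow (-1) * y = w) :
    y = -aPow 2 * x + aPow 1 * w := by
  rw [← h, mul_add, ← mul_assoc, ← mul_assoc, aPow_mul, aPow_mul]
  norm_num [aPow_zero]
  ring

theorem zEval_switchCoeff (p : Passage) :
    zEval (Polynomial.C (switchCoeff p)) = -aPow (-2 * p.sign) := by
  rw [zEval_C, switchCoeff, map_neg, aPow]

theorem zEval_smoothCoeff (p : Passage) :
    zEval (Polynomial.C (smoothCoeff p)) = aPow (-p.sign) := by
  rw [zEval_C, smoothCoeff, aPow]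

theorem isRotated_cons_append {α : Type} (a : α) (X : List α) (b : α) (Y : List α) :
    (a :: (X ++ b :: Y)).IsRotated (b :: (Y ++ a :: X)) := by
  have := List.isRotated_append (l := a :: X) (l' := b :: Y)
  simpa using this

/-- The skein relation at a crossing of a component with itself. -/
theorem Code.value_self (hP : IsSkeinPolynomial P) {p : Passage} {X Y : List Passage} {L : Code}
    (h : Code.PW ((p :: (X ++ p.partner :: Y)) :: L)) (hp : p.isOver = false) :
    Code.value P ((p :: (X ++ p.partner :: Y)) :: L) =
      zEval (Polynomial.C (switchCoeff p)) *
        Code.value P ((p.flip :: (X ++ p.flip.partner :: Y)) :: L) +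
      zEval (Polynomial.C (smoothCoeff p)) * Code.value P (Y :: X :: L) := by
  rw [zEval_switchCoeff, zEval_smoothCoeff]
  have hf := h.flip_self
  have h0 : Code.PW (X :: Y :: L) := h.smooth_self
  have h0' : Code.PW (Y :: X :: L) := h0.perm (List.Perm.swap _ _ _)
  have hz : ∀ D0 : Code, zPow (((D0.length : ℕ) : ℤ) - (D0.length + 1 : ℕ) + 1) = 1 := fun D0 => by
    rw [zPow]
    simp
  rcases p with ⟨c, o, s⟩
  simp only at hp
  subst hp
  cases s with
  | true =>
    -- In a skein triple the positive diagram starts with the over passage and the negative one with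
    -- the under passage. Here `p` is the under passage of a positive crossing, so the words are
    -- rotated to start at the partner.
    have hr := isRotated_cons_append (⟨c, false, true⟩ : Passage) X ⟨c, true, true⟩ Y
    have hr' := isRotated_cons_append (⟨c, true, false⟩ : Passage) X ⟨c, false, false⟩ Y
    have := Code.value_skein hP (h.rotate hr) (hf.rotate hr') h0' (Code.SkeinTriple.self c Y X L)
    have hz' := hz (Y :: L)
    simp only [List.length_cons] at this hz'
    rw [hz', one_mul] at this
    have h1 := Code.value_rotate hP h hr
    have h2 := Code.value_rotate hP hf hr'
    refine h1.trans ?_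
    refine (solve_positive this).trans ?_
    rw [← h2]
    simp [Passage.sign]
  | false =>
    have := Code.value_skein hP hf h h0 (Code.SkeinTriple.self c X Y L)
    have hz' := hz (Y :: L)
    simp only [List.length_cons] at this hz'
    rw [hz', one_mul] at this
    refine (solve_negative this).trans ?_
    rw [Code.value_perm hP (by simp) h0 (List.Perm.swap _ _ _)]
    simp [Passage.sign]

/-- The skein relation at a crossing of two components. -/
theorem Code.value_mixed (hP : IsSkeinPolynomial P) {p : Passage} {X Y : List Passage} {L : Code}
    (h : Code.PW ((p :: X) :: (p.partner :: Y) :: L)) (hp : p.isOver = false) :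
    Code.value P ((p :: X) :: (p.partner :: Y) :: L) =
      zEval (Polynomial.C (switchCoeff p)) *
        Code.value P ((p.flip :: X) :: (p.flip.partner :: Y) :: L) +
      zEval (Polynomial.X * Polynomial.C (smoothCoeff p)) * Code.value P ((X ++ Y) :: L) := by
  rw [map_mul, zEval_switchCoeff, zEval_smoothCoeff, zEval_X]
  have hf := h.flip_mixed
  have h0 : Code.PW ((X ++ Y) :: L) := h.smooth_mixed
  have h0' : Code.PW ((Y ++ X) :: L) := h0.rotate List.isRotated_append
  have hz : ∀ n : ℕ, zPow (((n + 1 + 1 : ℕ) : ℤ) - ((n + 1 : ℕ) : ℤ) + 1) =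
      LaurentPolynomial.T 2 := fun n => by
    rw [zPow]
    congr 1
    push_cast
    ring
  rcases p with ⟨c, o, s⟩
  simp only at hp
  subst hp
  cases s with
  | true =>
    have hs : ∀ (v v' : List Passage), (v :: v' :: L).Perm (v' :: v :: L) := fun _ _ =>
      List.Perm.swap _ _ _
    have := Code.value_skein hP (h.perm (hs _ _)) (hf.perm (hs _ _)) h0'
      (Code.SkeinTriple.mixed c Y X L)
    simp only [List.length_cons] at this
    rw [hz] at this
    have h1 := Code.value_perm hP (by simp) h (hs _ _)
    have h2 := Code.value_perm hP (by simp) hf (hs _ _)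
    refine h1.trans ?_
    refine (solve_positive this).trans ?_
    rw [Code.value_rotate hP h0 List.isRotated_append, h2]
    simp [Passage.sign]
    ring_nf
  | false =>
    have := Code.value_skein hP hf h h0 (Code.SkeinTriple.mixed c X Y L)
    simp only [List.length_cons] at this
    rw [hz] at this
    refine (solve_negative this).trans ?_
    simp [Passage.sign]
    ring

/-- The effect of an additional circle. -/
theorem Code.value_nil_cons (hP : IsSkeinPolynomial P) {L : Code} (hL : L ≠ []) (h : L.PW) :
    Code.value P ([] :: L) = zEval (Polynomial.C circleValue) * Code.value P L := by
  obtain ⟨w, L, rfl⟩ := List.exists_cons_of_ne_nil hL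
  -- Put a kink with a fresh label `c` on the word `w`. For either sign the kink can be undone by an
  -- overpass move, and smoothing it splits off a circle; so the skein relation at the kink
  -- determines the value of the circle.
  obtain ⟨c, hc⟩ : ∃ c, ∀ q ∈ List.flatten (w :: L), q.label ≠ c := by
    obtain ⟨c, hc⟩ := Infinite.exists_notMem_finset ((List.flatten (w :: L)).map Passage.label).toFinset
    refine ⟨c, fun q hq hqc => hc ?_⟩
    rw [List.mem_toFinset, List.mem_map]
    exact ⟨q, hq, hqc⟩
  have herase : ∀ (A X : List Passage), (∀ l ∈ A, l.label = c) →
      Code.erase A ((w ++ X) :: L) = (w ++ X.filter fun l => l.label ∉ A.map Passage.label) :: L := by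
    intro A X hA
    have hnot : ∀ q ∈ List.flatten (w :: L), q.label ∉ A.map Passage.label := by
      grind
    unfold Code.erase
    rw [List.map_cons, List.filter_append, List.filter_eq_self.2 fun q hq => by
      simpa using hnot q (by simp [hq])]
    congr 1
    conv_rhs => rw [← List.map_id L]
    refine List.map_congr_left fun v hv => ?_
    rw [List.filter_eq_self.2 fun q hq => by
      simpa using hnot q (by rw [List.flatten_cons, List.mem_append]; exact Or.inr (List.mem_flatten.2 ⟨v, hv, hq⟩))]
    rfl
  have hk : Code.PW ((⟨c, false, false⟩ :: ([] ++ ⟨c, true, false⟩ :: w)) :: L) :=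
    h.add_kink (o := ⟨c, false, false⟩) hc
  have h1 : Code.value P ((⟨c, false, false⟩ :: ([] ++ ⟨c, true, false⟩ :: w)) :: L) =
      zEval (Polynomial.C (switchCoeff ⟨c, false, false⟩)) *
        Code.value P ((⟨c, true, true⟩ :: ([] ++ ⟨c, false, true⟩ :: w)) :: L) +
      zEval (Polynomial.C (smoothCoeff ⟨c, false, false⟩)) * Code.value P (w :: [] :: L) :=
    Code.value_self hP hk rfl
  have h2 : Code.value P ((⟨c, false, false⟩ :: ([] ++ ⟨c, true, false⟩ :: w)) :: L) =
      Code.value P (w :: L) := by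
    have hr : (⟨c, false, false⟩ :: ([] ++ ⟨c, true, false⟩ :: w) : List Passage).IsRotated
        ([⟨c, true, false⟩] ++ (w ++ [⟨c, false, false⟩])) := by
      simpa using isRotated_cons_append (⟨c, false, false⟩ : Passage) [] ⟨c, true, false⟩ w
    have he : Code.erase [⟨c, true, false⟩] ((w ++ [⟨c, false, false⟩]) :: L) = w :: L := by
      rw [herase _ _ (by simp)]
      simp
    rw [Code.value_rotate hP hk hr, Code.value_overpass hP (by simp) (hk.rotate hr) (by rwa [he]), he]
  have h3 : Code.value P ((⟨c, true, true⟩ :: ([] ++ ⟨c, false, true⟩ :: w)) :: L) =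
      Code.value P (w :: L) := by
    have he : Code.erase [⟨c, true, true⟩] ((⟨c, false, true⟩ :: w) :: L) = w :: L := by
      have := herase [⟨c, true, true⟩] [] (by simp)
      simp only [List.append_nil, List.filter_nil] at this
      rw [← this]
      simp [Code.erase]
    have hk' : Code.PW ((⟨c, true, true⟩ :: ([] ++ ⟨c, false, true⟩ :: w)) :: L) := hk.flip_self
    exact (Code.value_overpass hP (A := [⟨c, true, true⟩]) (by simp) hk' (by rwa [he])).trans
      (by rw [he])
  have h4 : Code.value P (w :: [] :: L) = Code.value P ([] :: w :: L) :=
    (Code.value_perm hP (by simp) h.nil_cons (List.Perm.swap _ _ _)).symm ▸ rfl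
  rw [h2] at h1
  rw [h3, h4, zEval_switchCoeff, zEval_smoothCoeff] at h1
  have hs : Passage.sign ⟨c, false, false⟩ = -1 := rfl
  rw [hs] at h1
  norm_num at h1
  have h5 : aPow 1 * Code.value P ([] :: w :: L) = (1 + aPow 2) * Code.value P (w :: L) := by
    linear_combination -h1
  have h6 : zEval (Polynomial.C circleValue) = aPow (-1) * (1 + aPow 2) := by
    rw [zEval_C, circleValue, map_add, mul_add, aPow_mul, mul_one, add_comm]
    rfl
  rw [h6, mul_assoc, ← h5, ← mul_assoc, aPow_mul]
  norm_num [aPow_zero]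

end Value

end Skein

/-! ### Descending diagrams are unlinks -/

namespace Skein

/-- The under passages of the word come after their partners, or have their partners in `s`. -/
def DescFrom : Set Passage → List Passage → Prop
  | _, [] => True
  | s, p :: l => (p.isOver = false → p.partner ∈ s) ∧ DescFrom (insert p s) l

theorem DescFrom.filter {P : ℕ → Bool} {l : List Passage} {s s' : Set Passage}
    (h : DescFrom s l) (hs : ∀ p ∈ s, P p.label = true → p ∈ s') :
    DescFrom s' (l.filter fun p => P p.label) := by
  induction l generalizing s s' with
  | nil => trivial
  | cons p l ih =>
    rw [List.filter_cons]
    split_ifs with hp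
    · refine ⟨fun ho => hs _ (h.1 ho) hp, ih h.2 ?_⟩
      grind
    · refine ih h.2 ?_
      grind

theorem descFrom_append {l l' : List Passage} {s : Set Passage} :
    DescFrom s (l ++ l') ↔ DescFrom s l ∧ DescFrom (s ∪ {p | p ∈ l}) l' := by
  induction l generalizing s with
  | nil => simp [DescFrom]
  | cons p l ih =>
    rw [List.cons_append, DescFrom, DescFrom, ih, and_assoc]
    have : insert p s ∪ {q | q ∈ l} = s ∪ {q | q ∈ p :: l} := by
      grind
    rw [this]

theorem DescFrom.concat {l : List Passage} {p : Passage} (h : DescFrom ∅ l)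
    (hp : p.isOver = false → p.partner ∈ l) : DescFrom ∅ (l ++ [p]) := by
  rw [descFrom_append]
  exact ⟨h, fun ho => Or.inr (hp ho), trivial⟩

/-- A descending word without under passages, or its first under passage. -/
theorem DescFrom.cases {T : List Passage} (h : DescFrom ∅ T) :
    (∀ p ∈ T, p.isOver = true) ∨ ∃ S B q T', T = S ++ q.partner :: (B ++ q :: T') ∧
      q.isOver = false ∧ ∀ p ∈ q.partner :: B, p.isOver = true := by
  induction T using List.reverseRecOn with
  | nil => exact Or.inl (by simp)
  | append_singleton T q ih =>
    rw [descFrom_append] at h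
    rcases ih h.1 with hT | ⟨S, B, r, T', rfl, hr⟩
    · cases hq : q.isOver with
      | true =>
        grind
      | false =>
        have hm : q.partner ∈ T := by simpa using h.2.1 hq
        obtain ⟨S, B, rfl⟩ := List.append_of_mem hm
        grind
    · exact Or.inr ⟨S, B, r, T' ++ [q], by simp, hr⟩

section Value

variable {P : LinkDiagram → RingAZ}

open Classical in
/-- The effect of adding a circle to a possibly empty code. -/
noncomputable def Code.circleAdd (P : LinkDiagram → RingAZ) (L : Code) : RingAZ :=
  if L = [] then 1 else zEval (Polynomial.C circleValue) * L.value P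

theorem Code.value_nil_cons' (hP : IsSkeinPolynomial P) {L : Code} (h : L.PW) :
    Code.value P ([] :: L) = L.circleAdd P := by
  unfold Code.circleAdd
  split_ifs with hL
  · rw [hL, Code.value_circle hP]
  · exact Code.value_nil_cons hP hL h

theorem Code.erase_cons (A w : List Passage) (L : Code) :
    Code.erase A (w :: L) = (w.filter fun l => l.label ∉ A.map Passage.label) :: Code.erase A L := rfl

theorem Code.erase_congr {A B : List Passage} {L : Code}
    (h : ∀ p ∈ L.flatten, p.label ∈ A.map Passage.label ↔ p.label ∈ B.map Passage.label) :
    Code.erase A L = Code.erase B L := by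
  refine List.map_congr_left fun w hw => List.filter_congr fun p hp => ?_
  simp only [h p (List.mem_flatten.2 ⟨w, hw, hp⟩)]

/-- A descending component is an unlinked circle. -/
theorem Code.value_descending (hP : IsSkeinPolynomial P) (n : ℕ) : ∀ {T : List Passage} {L : Code},
    T.length ≤ n → Code.PW (T :: L) → DescFrom ∅ T →
    Code.value P (T :: L) = (Code.erase T L).circleAdd P := by
  induction n with
  | zero =>
    intro T L hn h hT
    rw [Nat.le_zero, List.length_eq_zero_iff] at hn
    subst hn
    have he := h.erase_head
    have : Code.erase [] L = L := by
      unfold Code.erase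
      conv_rhs => rw [← List.map_id L]
      exact List.map_congr_left fun w _ => by simp
    rw [this] at he ⊢
    exact Code.value_nil_cons' hP he
  | succ n ih =>
    intro T L hn h hT
    rcases hT.cases with ho | ⟨S, B, q, T', rfl, hq, hB⟩
    · have h0 : Code.erase T ([] :: L) = [] :: Code.erase T L := rfl
      have := Code.value_overpass hP (A := T) (X := []) ho (by simpa using h)
        (by rw [h0]; exact h.erase_head.nil_cons)
      rw [List.append_nil, h0] at this
      rw [this]
      exact Code.value_nil_cons' hP h.erase_head
    -- `q` is the first under passage, so the strand from its partner up to `q` runs over everything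
    -- it meets. This strand is rotated to the front and lifted off; the remaining word is shorter
    -- and still descending.
    · have hr : (S ++ q.partner :: (B ++ q :: T')).IsRotated
          ((q.partner :: B) ++ (q :: (T' ++ S))) := by
        have := List.isRotated_append (l := S) (l' := q.partner :: (B ++ q :: T'))
        simpa using this
      have h1 : Code.PW (((q.partner :: B) ++ (q :: (T' ++ S))) :: L) := h.rotate hr
      have h1' : Code.PW ((q.partner :: (B ++ q.partner.partner :: (T' ++ S))) :: L) := by
        simpa using h1
      have hlab := h1'.labels_self
      simp only [Passage.partner] at hlab
      -- Erasing the crossing of `q` together with those of `B` is the same as smoothing at `q` and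
      -- deleting the loop `B`. Planarity of the result therefore follows from `smooth_self` and
      -- `erase_head`.
      have herase : Code.erase (q.partner :: B) ((q :: (T' ++ S)) :: L) =
          Code.erase B ((T' ++ S) :: L) := by
        have : Code.erase (q.partner :: B) ((T' ++ S) :: L) = Code.erase B ((T' ++ S) :: L) := by
          refine Code.erase_congr fun p hp => ?_
          have : p.label ≠ q.label := hlab p (by
            simp only [List.flatten_cons, List.mem_append] at hp ⊢
            tauto)
          simp [Passage.partner, this]
        rw [← this, Code.erase_cons, Code.erase_cons, List.filter_cons_of_neg (by
          simp [Passage.partner])]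
      have h2 : (Code.erase (q.partner :: B) ((q :: (T' ++ S)) :: L)).PW := by
        rw [herase]
        exact h1'.smooth_self.erase_head
      rw [Code.value_rotate hP h hr, Code.value_overpass hP hB h1 h2]
      rw [Code.erase_cons] at h2 ⊢
      set f : Passage → Bool := fun l => decide (l.label ∉ (q.partner :: B).map Passage.label) with hf
      have hfT : (S ++ q.partner :: (B ++ q :: T')).filter f = (S ++ T').filter f := by
        have hB' : B.filter f = [] := by
          rw [List.filter_eq_nil_iff]
          grind
        have e1 : f q.partner = false := by simp [hf]
        have e2 : f q = false := by simp [hf, Passage.partner]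
        simp [List.filter_append, e1, e2, hB']
      have hrot : ((q :: (T' ++ S)).filter f).IsRotated
          ((S ++ q.partner :: (B ++ q :: T')).filter f) := by
        rw [hfT, List.filter_cons_of_neg (by simp [hf, Passage.partner]), List.filter_append,
          List.filter_append]
        exact List.isRotated_append
      rw [Code.value_rotate hP h2 hrot]
      rw [ih ?_ (h2.rotate hrot)
        (hT.filter (P := fun c => decide (c ∉ (q.partner :: B).map Passage.label)) (by simp))]
      · congr 1
        unfold Code.erase
        rw [List.map_map]
        refine List.map_congr_left fun w hw => ?_
        rw [Function.comp_apply, List.filter_filter]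
        grind
      grind

/-- A descending diagram is a diagram of an unlink. -/
theorem Code.value_unlink (hP : IsSkeinPolynomial P) {T : List Passage} {L : Code}
    (h : Code.PW (T :: L)) (hT : DescFrom ∅ (List.flatten (T :: L))) :
    Code.value P (T :: L) = zEval (Polynomial.C circleValue ^ L.length) := by
  induction hn : L.length generalizing T L with
  | zero =>
    rw [List.length_eq_zero_iff] at hn
    subst hn
    rw [Code.value_descending hP _ le_rfl h (by simpa using hT)]
    simp [Code.erase, Code.circleAdd]
  | succ n ih =>
    rw [List.flatten_cons, descFrom_append] at hT
    obtain ⟨w, L, rfl⟩ := List.exists_cons_of_length_eq_add_one hn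
    rw [Code.value_descending hP _ le_rfl h hT.1, Code.circleAdd, if_neg (by simp [Code.erase]),
      pow_succ', map_mul, Code.erase_cons]
    congr 1
    refine ih h.erase_head ?_ (by simpa [Code.erase] using hn)
    rw [← Code.erase_cons, Code.flatten_erase]
    refine hT.2.filter (P := fun c => decide (c ∉ T.map Passage.label)) ?_
    grind

end Value

end Skein

/-! ### The polynomial as a descending evaluation -/

namespace Skein

variable {P : LinkDiagram → RingAZ} {Top L L₁ L₂ : Code} {A U V W Y Z : List Passage}

/-- The skein rules want the crossing at the start of the first word. So the untravelled rest `U` of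
the current component is brought to the front and the travelled part `A` is moved behind it. -/
theorem pw_front : Code.PW (Top ++ (A ++ U) :: L) ↔ Code.PW ((U ++ A) :: (Top ++ L)) :=
  ⟨fun h => (h.perm List.perm_middle).rotate List.isRotated_append,
    fun h => (h.rotate List.isRotated_append).perm List.perm_middle.symm⟩

theorem value_front (hP : IsSkeinPolynomial P) (h : Code.PW (Top ++ (A ++ U) :: L)) :
    Code.value P (Top ++ (A ++ U) :: L) = Code.value P ((U ++ A) :: (Top ++ L)) :=
  (Code.value_perm hP (by simp) h List.perm_middle).trans
    (Code.value_rotate hP (h.perm List.perm_middle) List.isRotated_append)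

theorem pw_front_two : Code.PW (Top ++ (A ++ U) :: (L₁ ++ (Y ++ V) :: L₂)) ↔
    Code.PW ((U ++ A) :: (V ++ Y) :: (Top ++ (L₁ ++ L₂))) := by
  rw [pw_front]
  have e : (U ++ A) :: (Top ++ (L₁ ++ (Y ++ V) :: L₂)) =
      ((U ++ A) :: (Top ++ L₁)) ++ (Y ++ V) :: L₂ := by simp
  rw [e, pw_front]
  have hp : ((V ++ Y) :: ((U ++ A) :: (Top ++ L₁) ++ L₂)).Perm
      ((U ++ A) :: (V ++ Y) :: (Top ++ (L₁ ++ L₂))) := by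
    simpa using List.Perm.swap (U ++ A) (V ++ Y) (Top ++ (L₁ ++ L₂))
  exact ⟨fun h => h.perm hp, fun h => h.perm hp.symm⟩

theorem value_front_two (hP : IsSkeinPolynomial P)
    (h : Code.PW (Top ++ (A ++ U) :: (L₁ ++ (Y ++ V) :: L₂))) :
    Code.value P (Top ++ (A ++ U) :: (L₁ ++ (Y ++ V) :: L₂)) =
      Code.value P ((U ++ A) :: (V ++ Y) :: (Top ++ (L₁ ++ L₂))) := by
  rw [value_front hP h]
  rw [pw_front] at h
  have e : (U ++ A) :: (Top ++ (L₁ ++ (Y ++ V) :: L₂)) =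
      ((U ++ A) :: (Top ++ L₁)) ++ (Y ++ V) :: L₂ := by simp
  rw [e] at h ⊢
  rw [value_front hP h]
  rw [pw_front] at h
  refine Code.value_perm hP (by simp) h ?_
  simpa using List.Perm.swap (U ++ A) (V ++ Y) (Top ++ (L₁ ++ L₂))

/-- Once `p` has been passed, the other passage of its crossing is unpaired in what remains, so it
makes no difference to `descend` whether it has been switched. -/
theorem descend_flip {p : Passage} {D D' : Code} (h : D.switch (fun c => c = p.label) = D')
    (hq : ∀ q ∈ D.flatten, q.label = p.label → q.partner ∉ D.flatten) :
    descend D' = descend D := by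
  rw [← h, descend_switch]
  intro q hq' hqp
  exact hq q hq' (by simpa using hqp)

theorem switch_word {p : Passage} (hY : ∀ q ∈ Y, q.label ≠ p.label) (hZ : ∀ q ∈ Z, q.label ≠ p.label) :
    (Y ++ p.partner :: Z).map (Passage.switch fun c => c = p.label) = Y ++ p.flip.partner :: Z := by
  rw [List.map_append, List.map_cons, map_switch_of_ne hY, map_switch_of_ne hZ,
    Passage.switch_of_eq (p := p.partner) (c := p.label) rfl]
  rfl

open Polynomial in
/-- The skein polynomial, computed by travelling along the components. -/
theorem value_eq_descend (hP : IsSkeinPolynomial P) (n : ℕ) : ∀ {Top L : Code} {A X : List Passage},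
    Code.size (X :: L) ≤ n → Code.PW (Top ++ (A ++ X) :: L) → DescFrom ∅ (Top.flatten ++ A) →
    Code.value P (Top ++ (A ++ X) :: L) = zEval (C circleValue ^ Top.length * descend (X :: L)) := by
  induction n with
  | zero =>
    intro Top L A X hn
    simp [Code.size_cons] at hn
  | succ n ih =>
    intro Top L A X hn h hT
    match X, hn, h with
    | [], hn, h =>
      rw [List.append_nil] at h ⊢
      -- The current component is finished. If it was the last, the whole diagram is descending and
      -- hence an unlink; otherwise it joins `Top` and accounts for one factor `circleValue`.
      rcases L with _ | ⟨w, L⟩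
      · rw [descend_circle, mul_one]
        have hl : (Top ++ [A]).length = Top.length + 1 := by simp
        have hf : (Top ++ [A]).flatten = Top.flatten ++ A := by simp
        rw [← hf] at hT
        obtain ⟨T, L, hTL⟩ := List.exists_cons_of_ne_nil (l := Top ++ [A]) (by simp)
        rw [hTL] at h hT hl ⊢
        rw [Code.value_unlink hP h hT, map_pow]
        simp at hl
        rw [hl, map_pow]
      · have e : Top ++ A :: w :: L = (Top ++ [A]) ++ ([] ++ w) :: L := by simp
        rw [e] at h ⊢
        rw [ih (by simp [Code.size_cons] at hn ⊢; omega) h (by simpa using hT),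
          descend_nil_cons (by simp)]
        simp [pow_succ, mul_assoc]
    | p :: W, hn, h =>
      -- No skein step is needed if `p` goes over, or if its partner is not ahead. In the second
      -- case the partner was passed before, as the whole diagram is well formed, and the travelled
      -- part stays descending.
      have hmove : (p.isOver = true ∨ p.partner ∉ List.flatten (W :: L)) →
          Code.value P (Top ++ (A ++ p :: W) :: L) =
            zEval (C circleValue ^ Top.length * descend ((p :: W) :: L)) := by
        intro hor
        have e : descend ((p :: W) :: L) = descend (W :: L) := by
          rcases hor with ho | ho
          · exact descend_over ho
          · exact descend_unpaired ho
        have e' : A ++ p :: W = (A ++ [p]) ++ W := by simp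
        rw [e]
        rw [e'] at h ⊢
        refine ih (by simp [Code.size_cons] at hn ⊢; omega) h ?_
        rw [← List.append_assoc]
        refine hT.concat fun ho => ?_
        have hm := h.1.2.1 p (by simp)
        have hp := p.partner_ne
        grind
      cases ho : p.isOver with
      | true => exact hmove (Or.inl ho)
      | false =>
      -- After the switch the passage is over, so it can be appended to the descending part without
      -- condition.
      have hfo : p.flip.isOver = false → p.flip.partner ∈ Top.flatten ++ A := by simp [ho]
      by_cases h1 : p.partner ∈ W
      · obtain ⟨Y, Z, rfl, hY⟩ := exists_split_word h1
        have h2 : Code.PW ((p :: (Y ++ p.partner :: (Z ++ A))) :: (Top ++ L)) := by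
          have := pw_front.1 h
          simpa using this
        have hlab := h2.labels_self
        have v1 := value_front hP h
        rw [List.cons_append, List.append_assoc, List.cons_append, Code.value_self hP h2 ho] at v1
        have f2 : Code.PW (Top ++ ((A ++ [p.flip]) ++ (Y ++ p.flip.partner :: Z)) :: L) := by
          have : Code.PW (Top ++ (A ++ (p.flip :: (Y ++ p.flip.partner :: Z))) :: L) := by
            rw [pw_front]
            simpa using h2.flip_self
          simpa using this
        have v2 := ih (by simp [Code.size_cons] at hn ⊢; omega) f2
          (by rw [← List.append_assoc]; exact hT.concat hfo)
        have g2 : Code.value P (Top ++ ((A ++ [p.flip]) ++ (Y ++ p.flip.partner :: Z)) :: L) =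
            Code.value P ((p.flip :: (Y ++ p.flip.partner :: (Z ++ A))) :: (Top ++ L)) := by
          have e : (A ++ [p.flip]) ++ (Y ++ p.flip.partner :: Z) =
            A ++ (p.flip :: (Y ++ p.flip.partner :: Z)) := by simp
          rw [e] at f2 ⊢
          rw [value_front hP f2]
          simp
        have d2 : descend ((Y ++ p.flip.partner :: Z) :: L) = descend ((Y ++ p.partner :: Z) :: L) := by
          refine descend_flip (p := p) ?_ ?_
          · rw [Code.switch, List.map_cons, switch_word (fun q hq => hlab q (by simp [hq]))
              (fun q hq => hlab q (by simp [hq])), ← Code.switch,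
              Code.switch_of_ne fun q hq => hlab q (by simp at hq ⊢; tauto)]
          · intro q hq hql hm
            have : ∀ r ∈ List.flatten ((Y ++ p.partner :: Z) :: L), r.label = p.label →
                r = p.partner := by
              grind
            exact Passage.partner_ne q ((this _ hm hql).trans (this _ hq hql).symm)
        have f3 : Code.PW (Top ++ (A ++ Z) :: (Y :: L)) := by
          rw [pw_front]
          have := h2.smooth_self.perm (List.Perm.swap _ _ _)
          exact this.perm (List.Perm.cons _ List.perm_middle.symm)
        have v3 := ih (by simp [Code.size_cons] at hn ⊢; omega) f3 hT
        have g3 : Code.value P (Top ++ (A ++ Z) :: (Y :: L)) =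
            Code.value P ((Z ++ A) :: Y :: (Top ++ L)) := by
          rw [value_front hP f3]
          exact Code.value_perm hP (by simp) (pw_front.1 f3) (List.Perm.cons _ List.perm_middle)
        rw [v1, ← g2, ← g3, v2, v3, d2, descend_self ho hY]
        simp only [map_mul, map_add]
        ring
      · by_cases h2 : p.partner ∈ L.flatten
        · obtain ⟨L₁, Y, Z, L₂, rfl, hL, hY⟩ := exists_split_code h2
          have h2 : Code.PW ((p :: (W ++ A)) :: (p.partner :: (Z ++ Y)) :: (Top ++ (L₁ ++ L₂))) := by
            have := pw_front_two.1 h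
            simpa using this
          have hlab := h2.labels_mixed
          have v1 := value_front_two hP h
          rw [List.cons_append, List.cons_append, Code.value_mixed hP h2 ho] at v1
          have f2 : Code.PW (Top ++ ((A ++ [p.flip]) ++ W) :: (L₁ ++ (Y ++ p.flip.partner :: Z) :: L₂)) := by
            have : Code.PW (Top ++ (A ++ (p.flip :: W)) :: (L₁ ++ (Y ++ p.flip.partner :: Z) :: L₂)) := by
              rw [pw_front_two]
              simpa using h2.flip_mixed
            simpa using this
          have v2 := ih (by simp [Code.size_cons, Code.size_append] at hn ⊢; omega) f2
            (by rw [← List.append_assoc]; exact hT.concat hfo)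
          have g2 : Code.value P
              (Top ++ ((A ++ [p.flip]) ++ W) :: (L₁ ++ (Y ++ p.flip.partner :: Z) :: L₂)) =
              Code.value P ((p.flip :: (W ++ A)) :: (p.flip.partner :: (Z ++ Y)) ::
                (Top ++ (L₁ ++ L₂))) := by
            have e : (A ++ [p.flip]) ++ W = A ++ (p.flip :: W) := by simp
            rw [e] at f2 ⊢
            rw [value_front_two hP f2]
            simp
          have d2 : descend (W :: (L₁ ++ (Y ++ p.flip.partner :: Z) :: L₂)) =
              descend (W :: (L₁ ++ (Y ++ p.partner :: Z) :: L₂)) := by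
            refine descend_flip (p := p) ?_ ?_
            · have a1 := Code.switch_of_ne (L := L₁) (c := p.label) fun q hq => hlab q (by
                simp only [List.flatten_append, List.mem_append]; tauto)
              have a2 := Code.switch_of_ne (L := L₂) (c := p.label) fun q hq => hlab q (by
                simp only [List.flatten_append, List.mem_append]; tauto)
              unfold Code.switch at a1 a2 ⊢
              rw [List.map_cons, List.map_append, List.map_cons,
                switch_word (fun q hq => hlab q (by simp [hq])) (fun q hq => hlab q (by simp [hq])),
                a1, a2, map_switch_of_ne fun q hq => hlab q (by simp [hq])]
            · intro q hq hql hm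
              have : ∀ r ∈ List.flatten (W :: (L₁ ++ (Y ++ p.partner :: Z) :: L₂)), r.label = p.label →
                  r = p.partner := by
                grind
              exact Passage.partner_ne q ((this _ hm hql).trans (this _ hq hql).symm)
          have e3 : W ++ A ++ (Z ++ Y) = W ++ (A ++ (Z ++ Y)) := by simp
          have hr : (W ++ A ++ (Z ++ Y)).IsRotated ((Z ++ Y ++ W) ++ A) := by
            have := List.isRotated_append (l := W ++ A) (l' := Z ++ Y)
            simpa using this
          have f3' := h2.smooth_mixed
          have f3 : Code.PW (Top ++ (A ++ (Z ++ Y ++ W)) :: (L₁ ++ L₂)) := by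
            rw [pw_front]
            exact f3'.rotate hr
          have v3 := ih (by simp [Code.size_cons, Code.size_append] at hn ⊢; omega) f3 hT
          have g3 : Code.value P (Top ++ (A ++ (Z ++ Y ++ W)) :: (L₁ ++ L₂)) =
              Code.value P ((W ++ A ++ (Z ++ Y)) :: (Top ++ (L₁ ++ L₂))) := by
            rw [value_front hP f3]
            exact (Code.value_rotate hP f3' hr).symm
          rw [v1, ← g2, ← g3, v2, v3, d2, descend_mixed ho h1 hL hY]
          simp only [map_mul, map_add]
          ring
        grind

end Skein

namespace Skein

open Polynomial

/-! ### Expansion at an arbitrary crossing of two components -/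

/-- Lengthen the first word of a code at its beginning. -/
def addFirst (A : List Passage) : Code → Code
  | [] => []
  | X :: L => (A ++ X) :: L

/-- A code that is cut out of a planar diagram: what remains to be travelled along in `descend`. -/
def Code.Good (D : Code) : Prop := ∃ (Top : Code) (A : List Passage), Code.PW (Top ++ addFirst A D)

theorem addFirst_switch (Z : ℕ → Bool) (A : List Passage) (D : Code) :
    (addFirst A D).switch Z = addFirst (A.map (Passage.switch Z)) (D.switch Z) := by
  cases D <;> simp [addFirst, Code.switch]

theorem Code.switch_append (Z : ℕ → Bool) (D D' : Code) :
    (D ++ D').switch Z = D.switch Z ++ D'.switch Z := by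
  simp [Code.switch]

theorem Code.Good.switch {D : Code} (h : D.Good) (Z : ℕ → Bool) : (D.switch Z).Good := by
  obtain ⟨Top, A, h⟩ := h
  refine ⟨Top.switch Z, A.map (Passage.switch Z), ?_⟩
  rw [← addFirst_switch, ← Code.switch_append]
  exact h.switch Z

theorem Code.PW.good {D : Code} (h : D.PW) : D.Good := by
  refine ⟨[], [], ?_⟩
  cases D <;> simpa [addFirst] using h

theorem flatten_addFirst_perm (Top : Code) (A : List Passage) {D : Code} (hD : D ≠ []) :
    (Top ++ addFirst A D).flatten.Perm ((Top.flatten ++ A) ++ D.flatten) := by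
  obtain ⟨X, L, rfl⟩ := List.exists_cons_of_ne_nil hD
  simp [addFirst]

/-- The surroundings change only what stands before `U`, and in the same way for all `U` and `R`; so
the three terms of a skein relation are treated alike. -/
theorem exists_shape (Top : Code) (A : List Passage) (L₁ : Code) (Y₁ : List Passage) :
    ∃ (L₁' : Code) (Y₁' : List Passage), ∀ (U : List Passage) (R : Code),
      Top ++ addFirst A (L₁ ++ (Y₁ ++ U) :: R) = L₁' ++ (Y₁' ++ U) :: R := by
  rcases L₁ with _ | ⟨X, L₁⟩
  · exact ⟨Top, A ++ Y₁, fun U R => by simp [addFirst]⟩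
  · exact ⟨Top ++ (A ++ X) :: L₁, Y₁, fun U R => by simp [addFirst]⟩

/-- The passages of a part of a diagram. -/
def SubWF (l : List Passage) : Prop :=
  l.Nodup ∧ ∀ p ∈ l, ∀ q ∈ l, p.label = q.label → q = p ∨ q = p.partner

theorem SubWF.sublist {l l' : List Passage} (h : SubWF l) (hl : l'.Sublist l) : SubWF l' :=
  ⟨h.1.sublist hl, fun p hp q hq => h.2 p (hl.subset hp) q (hl.subset hq)⟩

theorem SubWF.perm {l l' : List Passage} (h : SubWF l) (hl : l.Perm l') : SubWF l' :=
  ⟨(hl.nodup_iff).1 h.1, fun p hp q hq => h.2 p (hl.mem_iff.2 hp) q (hl.mem_iff.2 hq)⟩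

theorem Code.Good.subWF {D : Code} (h : D.Good) : SubWF D.flatten := by
  by_cases hD : D = []
  · subst hD
    exact ⟨by simp, by simp⟩
  obtain ⟨Top, A, h⟩ := h
  have hw : SubWF (Top ++ addFirst A D).flatten := ⟨h.1.1, h.1.2.2⟩
  exact (hw.perm (flatten_addFirst_perm Top A hD)).sublist (List.sublist_append_right _ _)

theorem smooth_mixed_middle {L₁ L₂ L₃ : Code} {Y₁ Y₂ X₁ X₂ : List Passage} {v : Passage}
    (h : Code.PW (L₁ ++ (Y₁ ++ v :: Y₂) :: (L₂ ++ (X₁ ++ v.partner :: X₂) :: L₃))) :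
    Code.PW (L₁ ++ (Y₁ ++ (X₂ ++ X₁ ++ Y₂)) :: (L₂ ++ L₃)) := by
  rw [pw_front_two, List.cons_append, List.cons_append] at h
  rw [pw_front]
  refine h.smooth_mixed.rotate ?_
  have := List.isRotated_append (l := Y₂ ++ Y₁) (l' := X₂ ++ X₁)
  simpa using this

variable {P : LinkDiagram → RingAZ}

theorem value_mixed_middle (hP : IsSkeinPolynomial P) {L₁ L₂ L₃ : Code}
    {Y₁ Y₂ X₁ X₂ : List Passage} {v : Passage} (hv : v.isOver = false)
    (h : Code.PW (L₁ ++ (Y₁ ++ v :: Y₂) :: (L₂ ++ (X₁ ++ v.partner :: X₂) :: L₃))) :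
    Code.PW (L₁ ++ (Y₁ ++ v.flip :: Y₂) :: (L₂ ++ (X₁ ++ v.flip.partner :: X₂) :: L₃)) ∧
    Code.value P (L₁ ++ (Y₁ ++ v :: Y₂) :: (L₂ ++ (X₁ ++ v.partner :: X₂) :: L₃)) =
      zEval (C (switchCoeff v)) *
        Code.value P (L₁ ++ (Y₁ ++ v.flip :: Y₂) :: (L₂ ++ (X₁ ++ v.flip.partner :: X₂) :: L₃)) +
      zEval (X * C (smoothCoeff v)) *
        Code.value P (L₁ ++ (Y₁ ++ (X₂ ++ X₁ ++ Y₂)) :: (L₂ ++ L₃)) := by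
  have h0 := smooth_mixed_middle h
  rw [value_front_two hP h]
  rw [pw_front_two, List.cons_append, List.cons_append] at h
  have hf : Code.PW (L₁ ++ (Y₁ ++ v.flip :: Y₂) :: (L₂ ++ (X₁ ++ v.flip.partner :: X₂) :: L₃)) := by
    rw [pw_front_two]
    exact h.flip_mixed
  refine ⟨hf, ?_⟩
  rw [List.cons_append, List.cons_append, Code.value_mixed hP h hv, value_front_two hP hf,
    value_front hP h0]
  congr 2
  refine Code.value_rotate hP h.smooth_mixed ?_
  have := List.isRotated_append (l := Y₂ ++ Y₁) (l' := X₂ ++ X₁)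
  simpa using this

theorem value_eq_descend_addFirst (hP : IsSkeinPolynomial P) {Top D : Code} {A : List Passage}
    (hD : D ≠ []) (h : Code.PW (Top ++ addFirst A D)) (hT : DescFrom ∅ (Top.flatten ++ A)) :
    Code.value P (Top ++ addFirst A D) = zEval (C circleValue ^ Top.length * descend D) := by
  obtain ⟨X, L, rfl⟩ := List.exists_cons_of_ne_nil hD
  exact value_eq_descend hP _ le_rfl h hT

theorem circleValue_ne_zero : circleValue ≠ 0 := by
  intro h
  have := congrArg (fun f : RingA => f.coeff 1) h
  simp only [circleValue, AddMonoidAlgebra.coeff_add, Finsupp.add_apply, LaurentPolynomial.T_apply] at this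
  simp at this

/-- The components that were split off contribute a power of `circleValue`, which is not zero, and
`RingA[X]` has no zero divisors; so this power cancels. -/
theorem eq_of_zEval_mul {f g : RingA[X]} {n : ℕ}
    (h : zEval (C circleValue ^ n * f) = zEval (C circleValue ^ n * g)) : f = g := by
  have h0 : (C circleValue : RingA[X]) ^ n ≠ 0 := pow_ne_zero _ (by simpa using circleValue_ne_zero)
  exact mul_left_cancel₀ h0 (zEval_injective h)

open Classical in
/-- Any word of a diagram becomes descending after some switches. -/
theorem exists_switch_descending {T : List Passage} (hT : SubWF T) :
    ∃ Z : ℕ → Bool, DescFrom ∅ (T.map (Passage.switch Z)) ∧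
      ∀ c, Z c = true → ∃ p ∈ T, p.label = c := by
  induction T using List.reverseRecOn with
  | nil => exact ⟨fun _ => false, trivial, by simp⟩
  | append_singleton T p ih =>
    obtain ⟨Z, hZ, hZT⟩ := ih (hT.sublist (List.sublist_append_left _ _))
    by_cases hp : ∃ q ∈ T, q.label = p.label
    · refine ⟨Z, ?_, fun c hc => ?_⟩
      · rw [List.map_append, List.map_singleton]
        refine hZ.concat fun _ => ?_
        obtain ⟨q, hq, hqp⟩ := hp
        rw [Passage.partner_switch]
        refine List.mem_map_of_mem ?_
        rcases hT.2 p (by simp) q (by simp [hq]) hqp.symm with rfl | rfl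
        · exact absurd hT.1 (by
            rw [List.nodup_append]
            exact fun h => h.2.2 q hq q (by simp) rfl)
        · exact hq
      grind
    -- The crossing of `p` is new, so it is switched exactly if `p` goes under. Had it occurred
    -- before, the partner would precede `p` and nothing would have to be done.
    · refine ⟨fun c => if c = p.label then !p.isOver else Z c, ?_, fun c hc => ?_⟩
      · have e : T.map (Passage.switch fun c => if c = p.label then !p.isOver else Z c) =
            T.map (Passage.switch Z) := by
          refine List.map_congr_left fun q hq => ?_
          have : q.label ≠ p.label := fun h => hp ⟨q, hq, h⟩
          simp [Passage.switch, this]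
        rw [List.map_append, List.map_singleton, e]
        refine hZ.concat fun ho => ?_
        exfalso
        revert ho
        cases h : p.isOver <;> simp [Passage.switch, h]
      grind

theorem Code.Good.smooth_mixed {L₁ L₂ L₃ : Code} {Y₁ Y₂ X₁ X₂ : List Passage} {v : Passage}
    (h : Code.Good (L₁ ++ (Y₁ ++ v :: Y₂) :: (L₂ ++ (X₁ ++ v.partner :: X₂) :: L₃))) :
    Code.Good (L₁ ++ (Y₁ ++ (X₂ ++ X₁ ++ Y₂)) :: (L₂ ++ L₃)) := by
  obtain ⟨Top, A, h⟩ := h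
  refine ⟨Top, A, ?_⟩
  obtain ⟨L₁', Y₁', hs⟩ := exists_shape Top A L₁ Y₁
  rw [hs] at h ⊢
  exact smooth_mixed_middle h

/-- Everything except the two arcs is moved into the travelled part. `Good` permits any
surroundings, as long as the whole is planar. -/
theorem Code.Good.smooth_self {L₁ L₂ : Code} {U V Y Z : List Passage} {p : Passage}
    (h : Code.Good (L₁ ++ (U ++ (p :: (Y ++ p.partner :: (Z ++ V)))) :: L₂)) :
    Code.Good [Z, Y] := by
  obtain ⟨Top, A, h⟩ := h
  obtain ⟨L₁', Y₁', hs⟩ := exists_shape Top A L₁ U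
  rw [hs, pw_front, List.cons_append, List.append_assoc, List.cons_append] at h
  refine ⟨L₁' ++ L₂, V ++ Y₁', ?_⟩
  rw [addFirst, pw_front]
  have := h.smooth_self.perm (List.Perm.swap _ _ _)
  refine Code.PW.perm (D := (Z ++ (V ++ Y₁')) :: Y :: (L₁' ++ L₂)) (by simpa using this) ?_
  grind

/-- When the travelled part is descending, each of the three terms, up to the same power of
`circleValue`, is the value of a planar diagram. The skein relation holds there at any crossing, not
only at the first one met. -/
theorem Code.Good.expand_descending (hP : IsSkeinPolynomial P) {Top : Code} {A : List Passage}
    {L₁ L₂ L₃ : Code}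
    {Y₁ Y₂ X₁ X₂ : List Passage} {v : Passage} (hv : v.isOver = false)
    (h : Code.PW (Top ++ addFirst A (L₁ ++ (Y₁ ++ v :: Y₂) :: (L₂ ++ (X₁ ++ v.partner :: X₂) :: L₃))))
    (hT : DescFrom ∅ (Top.flatten ++ A)) :
    descend (L₁ ++ (Y₁ ++ v :: Y₂) :: (L₂ ++ (X₁ ++ v.partner :: X₂) :: L₃)) =
      C (switchCoeff v) *
        descend (L₁ ++ (Y₁ ++ v.flip :: Y₂) :: (L₂ ++ (X₁ ++ v.flip.partner :: X₂) :: L₃)) +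
      X * C (smoothCoeff v) * descend (L₁ ++ (Y₁ ++ (X₂ ++ X₁ ++ Y₂)) :: (L₂ ++ L₃)) := by
  obtain ⟨L₁', Y₁', hs⟩ := exists_shape Top A L₁ Y₁
  have v1 := value_eq_descend_addFirst hP (by simp) h hT
  have h' := h
  rw [hs] at h' v1
  obtain ⟨hf, hv⟩ := value_mixed_middle hP hv h'
  have h0 := smooth_mixed_middle h'
  rw [hv] at v1
  rw [← hs] at hf h0
  have v2 := value_eq_descend_addFirst hP (by simp) hf hT
  have v3 := value_eq_descend_addFirst hP (by simp) h0 hT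
  rw [hs] at v2 v3
  rw [v2, v3, ← map_mul, ← map_mul, ← map_add] at v1
  refine eq_of_zEval_mul (n := Top.length) (v1.symm.trans ?_)
  congr 1
  ring

theorem Passage.switch_of_false {Z : ℕ → Bool} {p : Passage} (h : Z p.label = false) :
    p.switch Z = p := by
  simp [Passage.switch, h]

/-- The travelled part can be made descending by switching crossings that have a passage in it. At
most one passage of such a crossing lies in the untravelled part, so `descend` does not notice the
switches and `expand_descending` applies. -/
theorem Code.Good.expand (hP : IsSkeinPolynomial P) {L₁ L₂ L₃ : Code}
    {Y₁ Y₂ X₁ X₂ : List Passage} {v : Passage} (hv : v.isOver = false)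
    (h : Code.Good (L₁ ++ (Y₁ ++ v :: Y₂) :: (L₂ ++ (X₁ ++ v.partner :: X₂) :: L₃))) :
    descend (L₁ ++ (Y₁ ++ v :: Y₂) :: (L₂ ++ (X₁ ++ v.partner :: X₂) :: L₃)) =
      C (switchCoeff v) *
        descend (L₁ ++ (Y₁ ++ v.flip :: Y₂) :: (L₂ ++ (X₁ ++ v.flip.partner :: X₂) :: L₃)) +
      X * C (smoothCoeff v) * descend (L₁ ++ (Y₁ ++ (X₂ ++ X₁ ++ Y₂)) :: (L₂ ++ L₃)) := by
  obtain ⟨Top, A, h⟩ := h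
  set D := L₁ ++ (Y₁ ++ v :: Y₂) :: (L₂ ++ (X₁ ++ v.partner :: X₂) :: L₃) with hD
  have hperm := flatten_addFirst_perm Top A (D := D) (by simp [hD])
  have hw : SubWF ((Top.flatten ++ A) ++ D.flatten) :=
    SubWF.perm ⟨h.1.1, h.1.2.2⟩ hperm
  obtain ⟨Z, hZ, hZT⟩ := exists_switch_descending (hw.sublist (List.sublist_append_left _ _))
  have hun : ∀ p ∈ D.flatten, Z p.label = true → p.partner ∉ D.flatten := by
    intro p hp hZp hpp
    obtain ⟨q, hq, hqp⟩ := hZT _ hZp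
    have hd := (List.nodup_append.1 hw.1).2.2
    rcases hw.2 p (List.mem_append_right _ hp) q (List.mem_append_left _ hq) hqp.symm with rfl | rfl
    · exact hd _ hq _ hp rfl
    · exact hd _ hq _ hpp rfl
  have hvZ : Z v.label = false := by
    grind
  have hvp : v.partner.switch Z = v.partner := Passage.switch_of_false hvZ
  have hvf : v.flip.switch Z = v.flip := Passage.switch_of_false hvZ
  have hvfp : v.flip.partner.switch Z = v.flip.partner := Passage.switch_of_false hvZ
  have hv' : v.switch Z = v := Passage.switch_of_false hvZ
  have hs := h.switch Z
  rw [Code.switch_append, addFirst_switch] at hs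
  have hZ' : DescFrom ∅ ((Top.switch Z).flatten ++ A.map (Passage.switch Z)) := by
    rwa [Code.flatten_switch, ← List.map_append]
  have e1 : D.switch Z = L₁.switch Z ++ (Y₁.map (Passage.switch Z) ++ v :: Y₂.map (Passage.switch Z)) ::
      (L₂.switch Z ++ (X₁.map (Passage.switch Z) ++ v.partner :: X₂.map (Passage.switch Z)) ::
        L₃.switch Z) := by
    simp [hD, Code.switch, hv', hvp]
  rw [e1] at hs
  have key := Code.Good.expand_descending hP hv hs hZ'
  rw [← e1, descend_switch Z D hun] at key
  rw [key, ← descend_switch Z (L₁ ++ (Y₁ ++ v.flip :: Y₂) ::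
      (L₂ ++ (X₁ ++ v.flip.partner :: X₂) :: L₃)), ← descend_switch Z
      (L₁ ++ (Y₁ ++ (X₂ ++ X₁ ++ Y₂)) :: (L₂ ++ L₃))]
  · simp [Code.switch, hvf, hvfp]
  · intro p hp hpZ hpp
    refine hun p ?_ hpZ ?_
    · simp only [hD, List.flatten_append, List.flatten_cons, List.mem_append, List.mem_cons] at hp ⊢
      tauto
    · simp only [hD, List.flatten_append, List.flatten_cons, List.mem_append, List.mem_cons] at hpp ⊢
      tauto
  · intro p hp hpZ hpp
    have a1 : p ≠ v.flip := fun h => by rw [h] at hpZ; simp [hvZ] at hpZ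
    have a2 : p ≠ v.flip.partner := fun h => by rw [h] at hpZ; simp [Passage.partner, hvZ] at hpZ
    have a3 : p.partner ≠ v.flip := fun h => a2 (by rw [← h, Passage.partner_partner])
    have a4 : p.partner ≠ v.flip.partner := fun h => a1 (by
      rw [← Passage.partner_partner p, h, Passage.partner_partner])
    refine hun p ?_ hpZ ?_
    · simp only [hD, List.flatten_append, List.flatten_cons, List.mem_append, List.mem_cons] at hp ⊢
      tauto
    · simp only [hD, List.flatten_append, List.flatten_cons, List.mem_append, List.mem_cons] at hpp ⊢
      tauto

/-! ### The coefficients of the skein polynomial -/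

theorem normalizedHomflypt_eq (h : ∃ P, IsSkeinPolynomial P) (D : LinkDiagram) :
    normalizedHomflypt D = zEval (descend D.code) := by
  have hP : IsSkeinPolynomial homflypt := by
    rw [homflypt, dif_pos h]
    exact h.choose_spec
  rw [normalizedHomflypt, ← LinkDiagram.value_code]
  obtain ⟨X, L, hXL⟩ := List.exists_cons_of_ne_nil D.nonempty
  have hpw := D.pw
  rw [hXL] at hpw ⊢
  have := value_eq_descend (Top := []) (A := []) hP _ le_rfl hpw trivial
  simpa using this

theorem homflyptCoeff_eq (h : ∃ P, IsSkeinPolynomial P) (i : ℕ) (D : LinkDiagram) :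
    homflyptCoeff i D = (descend D.code).coeff i := by
  rw [homflyptCoeff, normalizedHomflypt_eq h, zEval_apply]
  have : (2 * (i : ℤ)) = ((i * 2 : ℕ) : ℤ) := by push_cast; ring
  rw [this, LaurentPolynomial.coeff_toLaurent]
  exact (Finsupp.mapDomain_apply Nat.castEmbedding.injective _ (i * 2)).trans
    (coeff_expand_mul two_pos _ _)

/-- The expansion in even powers of `z`. -/
theorem normalizedHomflypt_expansion (D : LinkDiagram) : ∃ M : ℕ, normalizedHomflypt D =
    ∑ i ∈ Finset.range (M + 1), LaurentPolynomial.C (homflyptCoeff i D) * zPow (2 * (i : ℤ)) := by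
  by_cases h : ∃ P, IsSkeinPolynomial P
  · refine ⟨(descend D.code).natDegree, ?_⟩
    conv_lhs => rw [normalizedHomflypt_eq h, (descend D.code).as_sum_range_C_mul_X_pow, map_sum]
    refine Finset.sum_congr rfl fun i _ => ?_
    rw [map_mul, map_pow, zEval_C, zEval_X, homflyptCoeff_eq h, LaurentPolynomial.T_pow, zPow, mul_comm (i : ℤ)]
  -- If no skein polynomial exists, `homflypt` is zero by definition and so are all coefficients.
  · refine ⟨0, ?_⟩
    have h0 : normalizedHomflypt D = 0 := by
      rw [normalizedHomflypt, homflypt, dif_neg h]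
      simp
    simp [homflyptCoeff, h0]

end Skein

namespace Skein

open Polynomial Function

/-! ### Truncated polynomials -/

/-- The part of degree at most `k`. -/
noncomputable def tr (k : ℕ) (f : RingA[X]) : RingA[X] :=
  ∑ j ∈ Finset.range (k + 1), monomial j (f.coeff j)

theorem coeff_tr (k : ℕ) (f : RingA[X]) (j : ℕ) : (tr k f).coeff j = if j ≤ k then f.coeff j else 0 := by
  simp [tr, coeff_monomial]

theorem tr_eq_tr_iff {k : ℕ} {f g : RingA[X]} : tr k f = tr k g ↔ ∀ j ≤ k, f.coeff j = g.coeff j := by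
  constructor
  · intro h j hj
    have := congrArg (fun f => f.coeff j) h
    simpa [coeff_tr, hj] using this
  · intro h
    ext1 j
    rw [coeff_tr, coeff_tr]
    split_ifs with hj
    · exact h j hj
    · rfl

theorem tr_tr (k : ℕ) (f : RingA[X]) : tr k (tr k f) = tr k f := by
  rw [tr_eq_tr_iff]
  intro j hj
  rw [coeff_tr, if_pos hj]

theorem tr_add (k : ℕ) (f g : RingA[X]) : tr k (f + g) = tr k f + tr k g := by
  ext1 j
  rw [coeff_add, coeff_tr, coeff_tr, coeff_tr]
  split_ifs <;> simp

theorem tr_zero (k : ℕ) : tr k 0 = 0 := by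
  ext1 j
  simp [coeff_tr]

theorem tr_C (k : ℕ) (q : RingA) : tr k (C q) = C q := by
  ext1 j
  rw [coeff_tr, coeff_C]
  split_ifs with h1 h2
  · rfl
  · rfl
  · omega
  · rfl

theorem tr_congr_mul {k : ℕ} {f f' g g' : RingA[X]} (hf : tr k f = tr k f') (hg : tr k g = tr k g') :
    tr k (f * g) = tr k (f' * g') := by
  rw [tr_eq_tr_iff] at *
  intro j hj
  rw [coeff_mul, coeff_mul]
  refine Finset.sum_congr rfl fun x hx => ?_
  rw [Finset.HasAntidiagonal.mem_antidiagonal] at hx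
  rw [hf _ (by omega), hg _ (by omega)]

theorem tr_congr_add {k : ℕ} {f f' g g' : RingA[X]} (hf : tr k f = tr k f') (hg : tr k g = tr k g') :
    tr k (f + g) = tr k (f' + g') := by
  rw [tr_add, tr_add, hf, hg]

/-- The factor `X` of a smoothing that joins two components shifts degrees by one. This is why a
smoothed code is needed only at the previous level. -/
theorem tr_succ_X_mul {k : ℕ} {f g : RingA[X]} (h : tr k f = tr k g) :
    tr (k + 1) (X * f) = tr (k + 1) (X * g) := by
  rw [tr_eq_tr_iff] at *
  intro j hj
  cases j with
  | zero => simp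
  | succ j => rw [coeff_X_mul, coeff_X_mul, h j (by omega)]

theorem tr_zero_X_mul (f : RingA[X]) : tr 0 (X * f) = 0 := by
  rw [← tr_zero 0, tr_eq_tr_iff]
  intro j hj
  rw [Nat.le_zero.1 hj]
  simp

/-- A bound for the exponents and the coefficients. -/
def Bd (b : ℕ) (f : RingA[X]) : Prop := SumOf (monoAX b) (2 ^ b) f

theorem Bd.mono {b b' : ℕ} {f : RingA[X]} (h : Bd b f) (hb : b ≤ b') : Bd b' f :=
  SumOf.mono h (monoAX_mono hb) (Nat.pow_le_pow_right (by simp) hb)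

/-- One number bounds both the exponents and the binary logarithm of the number of monomials; for
products both add. -/
theorem Bd.mul {b b' : ℕ} {f g : RingA[X]} (hf : Bd b f) (hg : Bd b' g) : Bd (b + b') (f * g) := by
  unfold Bd
  rw [pow_add]
  exact SumOf.mulAX hf hg

theorem Bd.add {b : ℕ} {f g : RingA[X]} (hf : Bd b f) (hg : Bd b g) : Bd (b + 1) (f + g) := by
  unfold Bd
  rw [pow_succ, mul_two]
  exact (SumOf.add hf hg).mono (monoAX_mono (Nat.le_succ b)) le_rfl

theorem Bd.tr {b : ℕ} {f : RingA[X]} (hf : Bd b f) (k : ℕ) : Bd b (tr k f) := by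
  have : ∀ f g : RingA[X], Skein.tr k (f + g) = Skein.tr k f + Skein.tr k g := tr_add k
  refine SumOf.map hf ⟨⟨Skein.tr k, tr_zero k⟩, this⟩ fun m hm => ?_
  obtain ⟨q, hq, j, rfl⟩ := hm
  by_cases hj : j ≤ k
  · refine ⟨q, hq, j, ?_⟩
    change Skein.tr k _ = _
    ext1 l
    rw [coeff_tr, coeff_C_mul_X_pow]
    split_ifs <;> first | rfl | omega
  · refine ⟨0, ⟨0, 0, by simp, by simp, by simp⟩, 0, ?_⟩
    change Skein.tr k _ = _
    ext1 l
    rw [coeff_tr, coeff_C_mul_X_pow]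
    split_ifs
    · omega
    · simp
    · simp

theorem Bd.C_of_mem {b : ℕ} {q : RingA} (h : q ∈ monoA b) : Bd b (C q) :=
  (sumOf_C (SumOf.of_mem h)).mono subset_rfl Nat.one_le_two_pow

theorem Bd.one : Bd 0 1 := by
  rw [← C_1]
  exact Bd.C_of_mem ⟨1, 0, by simp, by simp, by simp⟩

theorem Bd.zero : Bd 0 0 := (SumOf.zero _).mono subset_rfl (Nat.zero_le _)

theorem Bd.circle : Bd 1 (C circleValue) := sumOf_C sumOf_circleValue

theorem Bd.switch (p : Passage) : Bd 2 (C (switchCoeff p)) := Bd.C_of_mem (switchCoeff_mem p)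

theorem Bd.smooth (p : Passage) : Bd 1 (C (smoothCoeff p)) := Bd.C_of_mem (smoothCoeff_mem p)

theorem Bd.X_mul {b : ℕ} {f : RingA[X]} (hf : Bd b f) : Bd b (X * f) := SumOf.X_mul hf

theorem Bd.X : Bd 0 (X : RingA[X]) := by
  simpa using Bd.one.X_mul

theorem Bd.descend (D : Code) : Bd (2 * D.size) (descend D) :=
  (sumOf_descend D).mono subset_rfl (Nat.pow_le_pow_right (by simp) (by omega))

/-! ### A programming language with arrays -/

/-- Names of variables and arrays. The first component is the recursion level. -/
abbrev Name := ℕ × ℕ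

/-- The values of integer variables, integer arrays, polynomial variables, and polynomial arrays
with two indices. -/
structure Store where
  v : Name → ℤ
  a : Name → ℕ → ℤ
  pv : Name → RingA[X]
  pa : Name → ℕ → ℕ → RingA[X]

/-- Assignments. -/
inductive Op where
  | const (x : Name) (c : ℤ)
  | add (x y z : Name)
  | sub (x y z : Name)
  | addc (x y : Name) (c : ℤ)
  | load (x α y : Name)
  | store (α y x : Name)
  | input (x y : Name)
  | pconst (x : Name) (f : RingA[X])
  | padd (x y z : Name)
  | pmul (k : ℕ) (x y z : Name)
  | pload (x α y z : Name)
  | pstore (α y z x : Name)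

/-- Commands. The condition of `ifLt x y` is that `x` is less than `y`, and `rep x c` repeats `c`
as often as the initial value of `x` says. -/
inductive Cmd where
  | op (o : Op)
  | seq (c d : Cmd)
  | ifLt (x y : Name) (c d : Cmd)
  | rep (x : Name) (c : Cmd)

/-- The effect of an assignment. -/
@[simp] noncomputable def Op.run (inp : ℕ → ℤ) : Op → Store → Store
  | const x c, S => { S with v := update S.v x c }
  | add x y z, S => { S with v := update S.v x (S.v y + S.v z) }
  | sub x y z, S => { S with v := update S.v x (S.v y - S.v z) }
  | addc x y c, S => { S with v := update S.v x (S.v y + c) }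
  | load x α y, S => { S with v := update S.v x (S.a α (S.v y).toNat) }
  | store α y x, S => { S with a := update S.a α (update (S.a α) (S.v y).toNat (S.v x)) }
  | input x y, S => { S with v := update S.v x (inp (S.v y).toNat) }
  | pconst x f, S => { S with pv := update S.pv x f }
  | padd x y z, S => { S with pv := update S.pv x (S.pv y + S.pv z) }
  | pmul k x y z, S => { S with pv := update S.pv x (tr k (S.pv y * S.pv z)) }
  | pload x α y z, S => { S with pv := update S.pv x (S.pa α (S.v y).toNat (S.v z).toNat) }
  | pstore α y z x, S => { S with pa := update S.pa α (update (S.pa α) (S.v y).toNat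
      (update (S.pa α (S.v y).toNat) (S.v z).toNat (S.pv x))) }

/-- The size and index conditions of an assignment. -/
@[simp] def Op.Ok (N Y : ℕ) : Op → Store → Prop
  | const _ c, _ => |c| ≤ N
  | add _ y z, S => |S.v y + S.v z| ≤ N
  | sub _ y z, S => |S.v y - S.v z| ≤ N
  | addc _ y c, S => |c| ≤ N ∧ |S.v y + c| ≤ N
  | load _ _ y, S => 0 ≤ S.v y
  | store _ y _, S => 0 ≤ S.v y
  | input _ y, S => 0 ≤ S.v y
  | pconst _ f, _ => Bd Y f
  | padd _ y z, S => Bd Y (S.pv y + S.pv z)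
  | pmul k _ y z, S => Bd Y (tr k (S.pv y * S.pv z))
  | pload _ _ y z, S => 0 ≤ S.v y ∧ 0 ≤ S.v z
  | pstore _ y z _, S => 0 ≤ S.v y ∧ 0 ≤ S.v z

/-- Iterate a predicate transformer. -/
def iterT (F : (Store → Prop) → Store → Prop) : ℕ → (Store → Prop) → Store → Prop
  | 0, Q => Q
  | n + 1, Q => F (iterT F n Q)

/-- The weakest condition under which a command runs without violation of size and index conditions
and ends in a store that satisfies `Q`. -/
def WP (inp : ℕ → ℤ) (N Y : ℕ) : Cmd → (Store → Prop) → Store → Prop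
  | .op o, Q, S => o.Ok N Y S ∧ Q (o.run inp S)
  | .seq c d, Q, S => WP inp N Y c (WP inp N Y d Q) S
  | .ifLt x y c d, Q, S => (S.v x < S.v y → WP inp N Y c Q S) ∧ (S.v y ≤ S.v x → WP inp N Y d Q S)
  | .rep x c, Q, S => iterT (WP inp N Y c) (S.v x).toNat Q S

variable {inp : ℕ → ℤ} {N Y : ℕ}

theorem iterT_mono {F : (Store → Prop) → Store → Prop}
    (hF : ∀ Q Q' : Store → Prop, (∀ S, Q S → Q' S) → ∀ S, F Q S → F Q' S) (n : ℕ)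
    {Q Q' : Store → Prop} (h : ∀ S, Q S → Q' S) : ∀ S, iterT F n Q S → iterT F n Q' S := by
  induction n with
  | zero => exact h
  | succ n ih => exact hF _ _ ih

theorem WP.mono' (c : Cmd) : ∀ Q Q' : Store → Prop, (∀ S, Q S → Q' S) →
    ∀ S, WP inp N Y c Q S → WP inp N Y c Q' S := by
  induction c with
  | op o => exact fun Q Q' h S hS => ⟨hS.1, h _ hS.2⟩
  | seq c d ihc ihd => exact fun Q Q' h S hS => ihc _ _ (ihd _ _ h) S hS
  | ifLt x y c d ihc ihd =>
    exact fun Q Q' h S hS => ⟨fun hx => ihc _ _ h S (hS.1 hx), fun hx => ihd _ _ h S (hS.2 hx)⟩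
  | rep x c ihc => exact fun Q Q' h S hS => iterT_mono ihc _ h S hS

theorem WP.mono {c : Cmd} {Q Q' : Store → Prop} {S : Store} (hS : WP inp N Y c Q S)
    (h : ∀ S, Q S → Q' S) : WP inp N Y c Q' S := WP.mono' c Q Q' h S hS

/-- The induction is on the number `m` of rounds still to be run, while the invariant counts those
already done. -/
theorem iterT_of_invariant {F : (Store → Prop) → Store → Prop}
    (hF : ∀ Q Q' : Store → Prop, (∀ S, Q S → Q' S) → ∀ S, F Q S → F Q' S) (I : ℕ → Store → Prop)
    {n : ℕ} {Q : Store → Prop} (hs : ∀ j < n, ∀ S, I j S → F (I (j + 1)) S) (hQ : ∀ S, I n S → Q S)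
    (m : ℕ) (hm : m ≤ n) : ∀ S, I (n - m) S → iterT F m Q S := by
  induction m with
  | zero => exact fun S hS => hQ S (by simpa using hS)
  | succ m ih =>
    intro S hS
    refine hF _ _ (ih (by omega)) S ?_
    grind

/-- The rule for loops. -/
theorem WP.rep {x : Name} {c : Cmd} {Q : Store → Prop} {S : Store} (n : ℕ) (I : ℕ → Store → Prop)
    (hn : S.v x = n) (h0 : I 0 S) (hs : ∀ j < n, ∀ S, I j S → WP inp N Y c (I (j + 1)) S)
    (hQ : ∀ S, I n S → Q S) : WP inp N Y (.rep x c) Q S := by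
  rw [WP, hn, Int.toNat_natCast]
  exact iterT_of_invariant (WP.mono' c) I hs hQ n le_rfl S (by simpa using h0)

/-! ### What a command leaves alone -/

/-- What an assignment changes: kind `0` are integer variables, `1` integer arrays, `2` polynomial
variables, `3` polynomial arrays. -/
def Op.Changes : Op → ℕ → Name → Prop
  | const x _, i, y => i = 0 ∧ y = x
  | add x _ _, i, y => i = 0 ∧ y = x
  | sub x _ _, i, y => i = 0 ∧ y = x
  | addc x _ _, i, y => i = 0 ∧ y = x
  | load x _ _, i, y => i = 0 ∧ y = x
  | store α _ _, i, y => i = 1 ∧ y = α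
  | input x _, i, y => i = 0 ∧ y = x
  | pconst x _, i, y => i = 2 ∧ y = x
  | padd x _ _, i, y => i = 2 ∧ y = x
  | pmul _ x _ _, i, y => i = 2 ∧ y = x
  | pload x _ _ _, i, y => i = 2 ∧ y = x
  | pstore α _ _ _, i, y => i = 3 ∧ y = α

/-- What a command may change. -/
def Cmd.Changes : Cmd → ℕ → Name → Prop
  | op o, i, y => o.Changes i y
  | seq c d, i, y => c.Changes i y ∨ d.Changes i y
  | ifLt _ _ c d, i, y => c.Changes i y ∨ d.Changes i y
  | rep _ c, i, y => c.Changes i y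

/-- Two stores agree outside `W`. -/
structure Agree (W : ℕ → Name → Prop) (S S' : Store) : Prop where
  v : ∀ y, (_ : ¬ W 0 y := by simp) → S'.v y = S.v y
  a : ∀ y, (_ : ¬ W 1 y := by simp) → S'.a y = S.a y
  pv : ∀ y, (_ : ¬ W 2 y := by simp) → S'.pv y = S.pv y
  pa : ∀ y, (_ : ¬ W 3 y := by simp) → S'.pa y = S.pa y

theorem Agree.refl (W : ℕ → Name → Prop) (S : Store) : Agree W S S :=
  ⟨fun _ _ => rfl, fun _ _ => rfl, fun _ _ => rfl, fun _ _ => rfl⟩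

theorem Agree.trans {W : ℕ → Name → Prop} {S S' S'' : Store} (h : Agree W S S')
    (h' : Agree W S' S'') : Agree W S S'' :=
  ⟨fun y hy => (h'.v y hy).trans (h.v y hy), fun y hy => (h'.a y hy).trans (h.a y hy),
    fun y hy => (h'.pv y hy).trans (h.pv y hy), fun y hy => (h'.pa y hy).trans (h.pa y hy)⟩

theorem Agree.mono {W W' : ℕ → Name → Prop} {S S' : Store} (h : Agree W S S')
    (hW : ∀ i y, W i y → W' i y) : Agree W' S S' :=
  ⟨fun y hy => h.v y fun h' => hy (hW _ _ h'), fun y hy => h.a y fun h' => hy (hW _ _ h'),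
    fun y hy => h.pv y fun h' => hy (hW _ _ h'), fun y hy => h.pa y fun h' => hy (hW _ _ h')⟩

theorem Op.agree (o : Op) (S : Store) : Agree o.Changes S (o.run inp S) := by
  cases o <;> constructor <;> intro y hy <;> simp [Op.Changes] at hy <;> simp [Op.run, hy]

/-- The reference store `S₀` is kept apart from the current store `S`, so that the induction over
the rounds of a loop can carry the comparison with the beginning. -/
theorem WP.agree' (c : Cmd) : ∀ (Q : Store → Prop) (S₀ S : Store) (W : ℕ → Name → Prop),
    (∀ i y, c.Changes i y → W i y) → Agree W S₀ S → WP inp N Y c Q S →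
    WP inp N Y c (fun S' => Q S' ∧ Agree W S₀ S') S := by
  induction c with
  | op o => exact fun Q S₀ S W hW hS h => ⟨h.1, h.2, hS.trans ((o.agree S).mono hW)⟩
  | seq c d ihc ihd =>
    intro Q S₀ S W hW hS h
    have := ihc _ S₀ S W (fun i y hi => hW i y (Or.inl hi)) hS h
    exact this.mono fun S' hS' => ihd _ S₀ S' W (fun i y hi => hW i y (Or.inr hi)) hS'.2 hS'.1
  | ifLt x y c d ihc ihd =>
    intro Q S₀ S W hW hS h
    exact ⟨fun hx => ihc _ S₀ S W (fun i y hi => hW i y (Or.inl hi)) hS (h.1 hx),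
      fun hx => ihd _ S₀ S W (fun i y hi => hW i y (Or.inr hi)) hS (h.2 hx)⟩
  | rep x c ihc =>
    intro Q S₀ S W hW hS h
    have key : ∀ n S, Agree W S₀ S → iterT (WP inp N Y c) n Q S →
        iterT (WP inp N Y c) n (fun S' => Q S' ∧ Agree W S₀ S') S := by
      intro n
      induction n with
      | zero => exact fun S hS h => ⟨h, hS⟩
      | succ n ih =>
        intro S hS h
        exact (ihc _ S₀ S W hW hS h).mono fun S' hS' => ih S' hS'.2 hS'.1
    exact key _ S hS h

/-- A command leaves alone what it does not mention as a target. -/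
theorem WP.agree {c : Cmd} {Q : Store → Prop} {S : Store} (h : WP inp N Y c Q S) :
    WP inp N Y c (fun S' => Q S' ∧ Agree c.Changes S S') S :=
  WP.agree' c Q S S _ (fun _ _ h => h) (Agree.refl _ S) h

/-! ### The number of steps -/

/-- The exponent of the time bound. -/
def Cmd.deg : Cmd → ℕ
  | op _ => 0
  | seq c d => max c.deg d.deg
  | ifLt _ _ c d => max c.deg d.deg
  | rep _ c => c.deg + 1

end Skein

namespace Skein

open Polynomial Function

/-! ### Running straight-line programs -/

/-- A straight-line program. -/
def Program.ofList : List Instr → Program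
  | [] => .instr (.const 0 0)
  | [o] => .instr o
  | o :: l => .seq (.instr o) (ofList l)

/-- Every state that a straight-line program produces has property `ok`. -/
def RunOk (ok : State → Prop) : List Instr → State → Prop
  | [], _ => True
  | o :: l, σ => ok (o.run σ) ∧ RunOk ok l (o.run σ)

/-- The effect of a straight-line program. -/
noncomputable def runList (l : List Instr) (σ : State) : State := l.foldl (fun σ o => o.run σ) σ

theorem runList_append (l l' : List Instr) (σ : State) :
    runList (l ++ l') σ = runList l' (runList l σ) := List.foldl_append

theorem RunOk.append {ok : State → Prop} {l l' : List Instr} {σ : State} (h : RunOk ok l σ)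
    (h' : RunOk ok l' (runList l σ)) : RunOk ok (l ++ l') σ := by
  induction l generalizing σ with
  | nil => exact h'
  | cons o l ih => exact ⟨h.1, ih h.2 h'⟩

theorem exec_ofList {ok : State → Prop} {l : List Instr} (hl : l ≠ []) {σ : State}
    (h : RunOk ok l σ) : Exec ok (Program.ofList l) σ l.length (runList l σ) := by
  induction l generalizing σ with
  | nil => exact absurd rfl hl
  | cons o l ih =>
    rcases l with _ | ⟨o', l⟩
    · exact Exec.instr h.1
    · have := Exec.seq (Exec.instr h.1) (ih (by simp) h.2)
      rw [add_comm] at this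
      exact this

/-- The polynomial has exponents and coefficients of bounded size. -/
def CoeffLE (B : ℕ) (q : RingA) : Prop := ∀ e, q.coeff e ≠ 0 → |e| ≤ B ∧ |q.coeff e| ≤ 2 ^ B

/-- A signed monomial changes one coefficient by at most one, so the number of monomials bounds
every coefficient. -/
theorem coeffLE_of_sumOf {b B : ℕ} {q : RingA} (h : SumOf (monoA b) (2 ^ b) q) (hb : b ≤ B) :
    CoeffLE B q := by
  obtain ⟨l, h1, h2, rfl⟩ := h
  have key : ∀ l : List RingA, (∀ m ∈ l, m ∈ monoA b) → ∀ e, (l.sum.coeff e ≠ 0 → |e| ≤ b) ∧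
      |l.sum.coeff e| ≤ l.length := by
    intro l
    induction l with
    | nil => intro _ e; simp
    | cons m l ih =>
      intro hl e
      have ih := ih (fun m hm => hl m (by simp [hm])) e
      obtain ⟨c, d, hc, hd, hm⟩ := hl m (by simp)
      have hme : m.coeff e = if d = e then c else 0 := by
        rw [hm, ← LaurentPolynomial.single_eq_C_mul_T, AddMonoidAlgebra.coeff_single,
          Finsupp.single_apply]
      rw [List.sum_cons, AddMonoidAlgebra.coeff_add, Finsupp.add_apply, hme]
      grind
  intro e he
  have := key l h2 e
  refine ⟨(this.1 he).trans (by exact_mod_cast hb), this.2.trans ?_⟩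
  have h3 : l.length ≤ 2 ^ B := h1.trans (Nat.pow_le_pow_right (by simp) hb)
  exact_mod_cast h3

section SizeLE

variable {B : ℕ} {σ : State}

theorem State.SizeLE.setReg (h : σ.SizeLE B) {r : ℕ} {x : ℤ} (hx : |x| ≤ B) :
    State.SizeLE B { σ with reg := update σ.reg r x } := by
  refine ⟨fun s => ?_, h.2⟩
  by_cases hs : s = r
  · subst hs; simpa using hx
  · simpa [hs] using h.1 s

theorem State.SizeLE.setMem (h : σ.SizeLE B) {r : ℤ} {x : ℤ} (hx : |x| ≤ B) :
    State.SizeLE B { σ with mem := update σ.mem r x } := by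
  refine ⟨h.1, fun s => ?_, h.2.2⟩
  by_cases hs : s = r
  · subst hs; simpa using hx
  · simpa [hs] using h.2.1 s

theorem State.SizeLE.setPolyReg (h : σ.SizeLE B) {r : ℕ} {q : RingA} (hx : CoeffLE B q) :
    State.SizeLE B { σ with polyReg := update σ.polyReg r q } := by
  refine ⟨h.1, h.2.1, fun s => ?_, h.2.2.2⟩
  by_cases hs : s = r
  · subst hs; simpa [CoeffLE] using hx
  · simpa [hs] using h.2.2.1 s

theorem State.SizeLE.setPolyMem (h : σ.SizeLE B) {r : ℤ} {q : RingA} (hx : CoeffLE B q) :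
    State.SizeLE B { σ with polyMem := update σ.polyMem r q } := by
  refine ⟨h.1, h.2.1, h.2.2.1, fun s => ?_⟩
  by_cases hs : s = r
  · subst hs; simpa [CoeffLE] using hx
  · simpa [hs] using h.2.2.2 s

end SizeLE

/-! ### Compilation -/

/-- The register of a variable. -/
def varReg (x : Name) : ℕ := 4 + 2 * Nat.pair x.1 x.2

/-- The register of the counter of a loop of a given depth. -/
def counterReg (d : ℕ) : ℕ := 5 + 2 * d

/-- The register of a coefficient of a polynomial variable. -/
def polyVarReg (i : ℕ) (x : Name) (t : ℕ) : ℕ := 4 + ((i + 1) * Nat.pair x.1 x.2 + t)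

/-- The offset of an array. -/
def offset (i : ℕ) (α : Name) (t : ℕ) : ℕ := (i + 1) * Nat.pair α.1 α.2 + t

/-- The address of an array cell. -/
def cell (i K : ℕ) (α : Name) (y : ℕ) : ℤ := 0 - ((K * y + (offset i α 0 + 1) : ℕ) : ℤ)

/-- The address of a coefficient of a cell of a polynomial array. -/
def polyCell (i K : ℕ) (α : Name) (y z t : ℕ) : ℤ :=
  ((K * ((y + z) * (y + z) + z) + offset i α t : ℕ) : ℤ)

/-- Compute the address of an array cell. -/
def cellCode (i K : ℕ) (α y : Name) : List Instr :=
  [.const 0 K, .mul 0 0 (varReg y), .const 1 (offset i α 0 + 1 : ℕ), .add 0 0 1, .const 1 0, .sub 0 1 0]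

/-- Compute the address of the constant coefficient of a cell of a polynomial array. -/
def polyCellCode (i K : ℕ) (α y z : Name) : List Instr :=
  [.add 0 (varReg y) (varReg z), .mul 0 0 0, .add 0 0 (varReg z), .const 1 K, .mul 0 1 0,
    .const 1 (offset i α 0 : ℕ), .add 0 0 1, .const 1 1]

/-- Compute a coefficient of a product. -/
noncomputable def convolve (i : ℕ) (y z : Name) (t : ℕ) : List Instr :=
  .polyConst 0 0 :: (List.range (t + 1)).flatMap fun u =>
    [.polyMul 1 (polyVarReg i y u) (polyVarReg i z (t - u)), .polyAdd 0 0 1]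

open Classical in
/-- The instructions for an assignment. -/
noncomputable def Op.compile (i K : ℕ) : Op → List Instr
  | const x c => [.const (varReg x) c]
  | add x y z => [.add (varReg x) (varReg y) (varReg z)]
  | sub x y z => [.sub (varReg x) (varReg y) (varReg z)]
  | addc x y c => [.const 0 c, .add (varReg x) (varReg y) 0]
  | load x α y => cellCode i K α y ++ [.load (varReg x) 0]
  | store α y x => cellCode i K α y ++ [.store 0 (varReg x)]
  | input x y => [.load (varReg x) (varReg y)]
  | pconst x f => (List.range (i + 1)).flatMap fun t => [.polyConst (polyVarReg i x t) (f.coeff t)]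
  | padd x y z => (List.range (i + 1)).flatMap fun t =>
      [.polyAdd (polyVarReg i x t) (polyVarReg i y t) (polyVarReg i z t)]
  | pmul k x y z => .polyConst 2 0 :: (List.range (i + 1)).reverse.flatMap fun t =>
      if t ≤ k then convolve i y z t ++ [.polyAdd (polyVarReg i x t) 0 2]
      else [.polyConst (polyVarReg i x t) 0]
  | pload x α y z => polyCellCode i K α y z ++ (List.range (i + 1)).flatMap fun t =>
      [.polyLoad (polyVarReg i x t) 0, .add 0 0 1]
  | pstore α y z x => polyCellCode i K α y z ++ (List.range (i + 1)).flatMap fun t =>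
      [.polyStore 0 (polyVarReg i x t), .add 0 0 1]

/-- The program for a command inside `d` loops. -/
noncomputable def Cmd.compile (i K : ℕ) : ℕ → Cmd → Program
  | _, op o => Program.ofList (o.compile i K)
  | d, seq c c' => .seq (c.compile i K d) (c'.compile i K d)
  | d, ifLt x y c c' => .seq (.instr (.sub 0 (varReg y) (varReg x)))
      (.ite 0 (c.compile i K d) (c'.compile i K d))
  | d, rep x c => .seq (Program.ofList [.const 0 0, .add (counterReg d) 0 (varReg x)])
      (.loop (counterReg d) (.seq (c.compile i K (d + 1))
        (Program.ofList [.const 0 1, .sub (counterReg d) (counterReg d) 0])))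

/-- A bound for the number of steps, when no loop is repeated more than `N` times. -/
noncomputable def Cmd.cost (i K N : ℕ) : Cmd → ℕ
  | op o => (o.compile i K).length
  | seq c c' => c.cost i K N + c'.cost i K N
  | ifLt _ _ c c' => c.cost i K N + c'.cost i K N + 2
  | rep _ c => N * (c.cost i K N + 3) + 3

/-- Only loops contribute factors `N`, so the degree is the depth of nesting. The constant depends
on the command, not on `N`. -/
theorem Cmd.cost_le (i K : ℕ) (c : Cmd) : ∃ C, ∀ N, 1 ≤ N → c.cost i K N ≤ C * N ^ c.deg := by
  induction c with
  | op o => exact ⟨(o.compile i K).length, fun N _ => by simp [Cmd.cost, Cmd.deg]⟩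
  | seq c c' ih ih' =>
    obtain ⟨C, hC⟩ := ih
    obtain ⟨C', hC'⟩ := ih'
    refine ⟨C + C', fun N hN => ?_⟩
    have h1 := Nat.mul_le_mul_left C (Nat.pow_le_pow_right hN (le_max_left c.deg c'.deg))
    have h2 := Nat.mul_le_mul_left C' (Nat.pow_le_pow_right hN (le_max_right c.deg c'.deg))
    rw [Cmd.cost, Cmd.deg, add_mul]
    linarith [hC N hN, hC' N hN]
  | ifLt x y c c' ih ih' =>
    obtain ⟨C, hC⟩ := ih
    obtain ⟨C', hC'⟩ := ih'
    refine ⟨C + C' + 2, fun N hN => ?_⟩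
    have h1 := Nat.mul_le_mul_left C (Nat.pow_le_pow_right hN (le_max_left c.deg c'.deg))
    have h2 := Nat.mul_le_mul_left C' (Nat.pow_le_pow_right hN (le_max_right c.deg c'.deg))
    have h3 : 1 ≤ N ^ max c.deg c'.deg := Nat.one_le_pow _ _ hN
    rw [Cmd.cost, Cmd.deg, add_mul, add_mul]
    linarith [hC N hN, hC' N hN]
  | rep x c ih =>
    obtain ⟨C, hC⟩ := ih
    -- Three from the overhead of each round, and three from the steps outside the rounds.
    refine ⟨C + 6, fun N hN => ?_⟩
    have h3 : 1 ≤ N ^ c.deg := Nat.one_le_pow _ _ hN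
    rw [Cmd.cost, Cmd.deg, pow_succ]
    have h1 : N * (c.cost i K N + 3) ≤ N * ((C + 3) * N ^ c.deg) := by
      refine Nat.mul_le_mul_left N ?_
      rw [add_mul]
      linarith [hC N hN]
    have h4 : 1 ≤ N ^ c.deg * N := Nat.one_le_iff_ne_zero.2 (by positivity)
    grind

/-- All arrays of a command have offsets less than `K`. -/
def Op.Fits (i K : ℕ) : Op → Prop
  | load _ α _ => offset i α 0 + i < K
  | store α _ _ => offset i α 0 + i < K
  | pload _ α _ _ => offset i α 0 + i < K
  | pstore α _ _ _ => offset i α 0 + i < K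
  | _ => True

/-- All arrays of a command have offsets less than `K`. -/
def Cmd.Fits (i K : ℕ) : Cmd → Prop
  | op o => o.Fits i K
  | seq c d => c.Fits i K ∧ d.Fits i K
  | ifLt _ _ c d => c.Fits i K ∧ d.Fits i K
  | rep _ c => c.Fits i K

theorem Cmd.Fits.mono {i K K' : ℕ} (hK : K ≤ K') {c : Cmd} (h : c.Fits i K) : c.Fits i K' := by
  induction c with
  | op o => cases o <;> simp only [Cmd.Fits, Op.Fits] at h ⊢ <;> omega
  | seq c d ihc ihd => exact ⟨ihc h.1, ihd h.2⟩
  | ifLt x y c d ihc ihd => exact ⟨ihc h.1, ihd h.2⟩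
  | rep x c ih => exact ih h

theorem Cmd.exists_fits (i : ℕ) (c : Cmd) : ∃ K, c.Fits i K := by
  induction c with
  | op o =>
    cases o
    case load x α y => exact ⟨_, Nat.lt_succ_self _⟩
    case store α y x => exact ⟨_, Nat.lt_succ_self _⟩
    case pload x α y z => exact ⟨_, Nat.lt_succ_self _⟩
    case pstore α y z x => exact ⟨_, Nat.lt_succ_self _⟩
    all_goals exact ⟨0, trivial⟩
  | seq c d ihc ihd =>
    obtain ⟨K, hK⟩ := ihc
    obtain ⟨K', hK'⟩ := ihd
    exact ⟨max K K', hK.mono (le_max_left _ _), hK'.mono (le_max_right _ _)⟩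
  | ifLt x y c d ihc ihd =>
    obtain ⟨K, hK⟩ := ihc
    obtain ⟨K', hK'⟩ := ihd
    exact ⟨max K K', hK.mono (le_max_left _ _), hK'.mono (le_max_right _ _)⟩
  | rep x c ih => exact ih

/-! ### Injectivity of the layout -/

theorem varReg_inj {x y : Name} : varReg x = varReg y ↔ x = y := by
  refine ⟨fun h => ?_, fun h => h ▸ rfl⟩
  have h : Nat.pair x.1 x.2 = Nat.pair y.1 y.2 := by unfold varReg at h; omega
  exact Prod.ext_iff.2 (Nat.pair_eq_pair.1 h)

/-- Variables have even registers and loop counters odd ones, all from `4` on; the registers below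
`4` are scratch space. -/
theorem varReg_ne_counterReg (x : Name) (d : ℕ) : varReg x ≠ counterReg d := by
  unfold varReg counterReg
  omega

theorem offset_inj {i : ℕ} {x y : Name} {t u : ℕ} (ht : t ≤ i) (hu : u ≤ i) :
    offset i x t = offset i y u ↔ x = y ∧ t = u := by
  refine ⟨fun h => ?_, by rintro ⟨rfl, rfl⟩; rfl⟩
  unfold offset at h
  have h1 : ∀ (a t : ℕ), t ≤ i → ((i + 1) * a + t) / (i + 1) = a := fun a t ht => by
    rw [Nat.mul_add_div (by omega), Nat.div_eq_of_lt (by omega), add_zero]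
  have h2 : Nat.pair x.1 x.2 = Nat.pair y.1 y.2 := by
    rw [← h1 (Nat.pair x.1 x.2) t ht, h, h1 _ u hu]
  rw [h2] at h
  exact ⟨Prod.ext_iff.2 (Nat.pair_eq_pair.1 h2), by omega⟩

theorem polyVarReg_inj {i : ℕ} {x y : Name} {t u : ℕ} (ht : t ≤ i) (hu : u ≤ i) :
    polyVarReg i x t = polyVarReg i y u ↔ x = y ∧ t = u := by
  rw [← offset_inj ht hu]
  unfold polyVarReg offset
  omega

theorem digits_inj {K a b c d : ℕ} (hb : b < K) (hd : d < K) (h : K * a + b = K * c + d) :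
    a = c ∧ b = d := by
  have h1 : ∀ (a t : ℕ), t < K → (K * a + t) / K = a := fun a t ht => by
    rw [Nat.mul_add_div (by omega), Nat.div_eq_of_lt (by omega), add_zero]
  grind

theorem cell_inj {i K : ℕ} {α β : Name} {y z : ℕ} (hα : offset i α 0 + i < K)
    (hβ : offset i β 0 + i < K) : cell i K α y = cell i K β z ↔ α = β ∧ y = z := by
  refine ⟨fun h => ?_, by rintro ⟨rfl, rfl⟩; rfl⟩
  unfold cell at h
  have h : K * y + offset i α 0 = K * z + offset i β 0 := by omega
  have := digits_inj (by omega) (by omega) h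
  exact ⟨((offset_inj (Nat.zero_le _) (Nat.zero_le _)).1 this.2).1, this.1⟩

/-- Integer arrays live at negative addresses, so that writing to them never destroys the input,
which occupies the nonnegative ones. -/
theorem cell_neg (i K : ℕ) (α : Name) (y : ℕ) : cell i K α y < 0 := by
  unfold cell
  omega

/-- The number `(y + z) ^ 2 + z` lies between the squares of `y + z` and `y + z + 1`, so it
determines the sum and then `z`. This pairing of indices takes only a few machine operations. -/
theorem triangle_inj {y z y' z' : ℕ} (h : (y + z) * (y + z) + z = (y' + z') * (y' + z') + z') :
    y = y' ∧ z = z' := by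
  have h1 : y + z = y' + z' := by
    by_contra hne
    rcases lt_or_gt_of_ne hne with hlt | hlt
    · have : (y + z + 1) * (y + z + 1) ≤ (y' + z') * (y' + z') := Nat.mul_le_mul hlt hlt
      nlinarith
    · have : (y' + z' + 1) * (y' + z' + 1) ≤ (y + z) * (y + z) := Nat.mul_le_mul hlt hlt
      nlinarith
  rw [h1] at h
  omega

theorem polyCell_inj {i K : ℕ} {α β : Name} {y z y' z' t t' : ℕ} (hα : offset i α 0 + i < K)
    (hβ : offset i β 0 + i < K) (ht : t ≤ i) (ht' : t' ≤ i) :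
    polyCell i K α y z t = polyCell i K β y' z' t' ↔ (α = β ∧ t = t') ∧ y = y' ∧ z = z' := by
  refine ⟨fun h => ?_, by rintro ⟨⟨rfl, rfl⟩, rfl, rfl⟩; rfl⟩
  unfold polyCell at h
  have hs : ∀ (γ : Name) (u : ℕ), offset i γ u = offset i γ 0 + u := fun γ u => by simp [offset]
  have := digits_inj (by rw [hs]; omega) (by rw [hs]; omega) (Nat.cast_injective h)
  exact ⟨(offset_inj ht ht').1 this.2, triangle_inj this.1⟩

end Skein

namespace Skein

open Polynomial Function

/-! ### Correctness of the compiler -/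

theorem run_range {ok : State → Prop} {f : ℕ → List Instr} (I : ℕ → State → Prop) {n : ℕ} {σ : State}
    (h0 : I 0 σ) (hs : ∀ t < n, ∀ σ, I t σ → RunOk ok (f t) σ ∧ I (t + 1) (runList (f t) σ)) :
    RunOk ok ((List.range n).flatMap f) σ ∧ I n (runList ((List.range n).flatMap f) σ) := by
  induction n with
  | zero => exact ⟨trivial, h0⟩
  | succ n ih =>
    obtain ⟨h1, h2⟩ := ih fun t ht => hs t (by omega)
    obtain ⟨h3, h4⟩ := hs n (by omega) _ h2
    rw [List.range_succ, List.flatMap_append, List.flatMap_singleton, runList_append]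
    exact ⟨h1.append h3, h4⟩

theorem run_range_reverse {ok : State → Prop} {f : ℕ → List Instr} (I : ℕ → State → Prop) {n : ℕ}
    {σ : State} (h0 : I n σ)
    (hs : ∀ t < n, ∀ σ, I (t + 1) σ → RunOk ok (f t) σ ∧ I t (runList (f t) σ)) :
    RunOk ok ((List.range n).reverse.flatMap f) σ ∧
      I 0 (runList ((List.range n).reverse.flatMap f) σ) := by
  induction n generalizing σ with
  | zero => exact ⟨trivial, h0⟩
  | succ n ih =>
    obtain ⟨h3, h4⟩ := hs n (by omega) _ h0
    obtain ⟨h1, h2⟩ := ih h4 fun t ht => hs t (by omega)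
    rw [List.range_succ, List.reverse_append, List.reverse_singleton, List.singleton_append,
      List.flatMap_cons, runList_append]
    exact ⟨h3.append h1, h2⟩

theorem runList_singleton (o : Instr) (σ : State) : runList [o] σ = o.run σ := rfl

/-- The machine state `σ` represents the given values. -/
structure Repr (i K B : ℕ) (inp : ℕ → ℤ) (cnt : ℕ → ℤ) (v : Name → ℤ) (a : Name → ℕ → ℤ)
    (c : Name → ℕ → RingA) (d : Name → ℕ → ℕ → ℕ → RingA) (σ : State) : Prop where
  counter : ∀ k, σ.reg (counterReg k) = cnt k
  reg : ∀ x, σ.reg (varReg x) = v x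
  mem : ∀ α, offset i α 0 + i < K → ∀ y, σ.mem (cell i K α y) = a α y
  input : ∀ y : ℕ, σ.mem y = inp y
  preg : ∀ x, ∀ t ≤ i, σ.polyReg (polyVarReg i x t) = c x t
  pmem : ∀ α, offset i α 0 + i < K → ∀ y z, ∀ t ≤ i, σ.polyMem (polyCell i K α y z t) = d α y z t
  size : σ.SizeLE B

section Repr

variable {i K B : ℕ} {inp cnt : ℕ → ℤ} {v : Name → ℤ} {a : Name → ℕ → ℤ} {c : Name → ℕ → RingA}
  {d : Name → ℕ → ℕ → ℕ → RingA} {σ : State}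

theorem varReg_ge (x : Name) : 4 ≤ varReg x := by unfold varReg; omega

theorem counterReg_ge (d : ℕ) : 4 ≤ counterReg d := by unfold counterReg; omega

theorem polyVarReg_ge (i : ℕ) (x : Name) (t : ℕ) : 4 ≤ polyVarReg i x t := by
  unfold polyVarReg; omega

theorem Repr.setScratch (h : Repr i K B inp cnt v a c d σ) {r : ℕ} (hr : r < 4) {x : ℤ}
    (hx : |x| ≤ B) : Repr i K B inp cnt v a c d { σ with reg := update σ.reg r x } := by
  refine ⟨fun k => ?_, fun y => ?_, h.mem, h.input, h.preg, h.pmem, h.size.setReg hx⟩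
  · have := counterReg_ge k
    simp [update_of_ne (show counterReg k ≠ r by omega), h.counter]
  · have := varReg_ge y
    simp [update_of_ne (show varReg y ≠ r by omega), h.reg]

theorem Repr.setScratchNat (h : Repr i K B inp cnt v a c d σ) {r : ℕ} (hr : r < 4) {x : ℕ}
    (hx : x ≤ B) : Repr i K B inp cnt v a c d { σ with reg := update σ.reg r (x : ℤ) } :=
  h.setScratch hr (by rw [Nat.abs_cast]; exact_mod_cast hx)

theorem Repr.setPolyScratch (h : Repr i K B inp cnt v a c d σ) {r : ℕ} (hr : r < 4) {q : RingA}
    (hq : CoeffLE B q) :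
    Repr i K B inp cnt v a c d { σ with polyReg := update σ.polyReg r q } := by
  refine ⟨h.counter, h.reg, h.mem, h.input, fun y t ht => ?_, h.pmem, h.size.setPolyReg hq⟩
  have := polyVarReg_ge i y t
  simp [update_of_ne (show polyVarReg i y t ≠ r by omega), h.preg y t ht]

theorem Repr.setVar (h : Repr i K B inp cnt v a c d σ) (y : Name) {x : ℤ} (hx : |x| ≤ B) :
    Repr i K B inp cnt (update v y x) a c d
      { σ with reg := update σ.reg (varReg y) x } := by
  refine ⟨fun k => ?_, fun z => ?_, h.mem, h.input, h.preg, h.pmem, h.size.setReg hx⟩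
  · simp [update_of_ne (varReg_ne_counterReg y k).symm, h.counter]
  · by_cases hz : z = y
    · subst hz; simp
    · simp [update_of_ne hz, update_of_ne fun hn => hz (varReg_inj.1 hn), h.reg]

theorem Repr.setCounter (h : Repr i K B inp cnt v a c d σ) (k : ℕ) {x : ℤ} (hx : |x| ≤ B) :
    Repr i K B inp (update cnt k x) v a c d
      { σ with reg := update σ.reg (counterReg k) x } := by
  refine ⟨fun l => ?_, fun z => ?_, h.mem, h.input, h.preg, h.pmem, h.size.setReg hx⟩
  · by_cases hl : l = k
    · subst hl; simp
    · have : counterReg l ≠ counterReg k := by unfold counterReg; omega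
      simp [update_of_ne hl, update_of_ne this, h.counter]
  · simp [update_of_ne (varReg_ne_counterReg z k), h.reg]

theorem Repr.setArr (h : Repr i K B inp cnt v a c d σ) {α : Name} (hα : offset i α 0 + i < K)
    (y : ℕ) {x : ℤ} (hx : |x| ≤ B) :
    Repr i K B inp cnt v (update a α (update (a α) y x)) c d
      { σ with mem := update σ.mem (cell i K α y) x } := by
  refine ⟨h.counter, h.reg, fun β hβ z => ?_, fun z => ?_, h.preg, h.pmem, h.size.setMem hx⟩
  · by_cases hb : β = α
    · subst hb
      by_cases hz : z = y
      · subst hz; simp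
      · simp [update_of_ne hz, update_of_ne fun hn => hz ((cell_inj hβ hβ).1 hn).2,
          h.mem β hβ]
    · simp [update_of_ne hb, update_of_ne fun hn => hb ((cell_inj hβ hα).1 hn).1,
        h.mem β hβ]
  · have : (z : ℤ) ≠ cell i K α y := by
      have := cell_neg i K α y
      omega
    simp [update_of_ne this, h.input]

theorem Repr.setPolyVar (h : Repr i K B inp cnt v a c d σ) (x : Name) {t : ℕ} (ht : t ≤ i) {q : RingA}
    (hq : CoeffLE B q) :
    Repr i K B inp cnt v a (update c x (update (c x) t q)) d
      { σ with polyReg := update σ.polyReg (polyVarReg i x t) q } := by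
  refine ⟨h.counter, h.reg, h.mem, h.input, fun y u hu => ?_, h.pmem, h.size.setPolyReg hq⟩
  by_cases hy : y = x
  · subst hy
    by_cases hut : u = t
    · subst hut; simp
    · simp [update_of_ne hut,
        update_of_ne fun hn => hut ((polyVarReg_inj hu ht).1 hn).2, h.preg y u hu]
  · simp [update_of_ne hy,
      update_of_ne fun hn => hy ((polyVarReg_inj hu ht).1 hn).1, h.preg y u hu]

theorem Repr.setPolyArr (h : Repr i K B inp cnt v a c d σ) {α : Name} (hα : offset i α 0 + i < K)
    (y z : ℕ) {t : ℕ} (ht : t ≤ i) {q : RingA} (hq : CoeffLE B q) :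
    Repr i K B inp cnt v a c (update d α (update (d α) y
      (update (d α y) z (update (d α y z) t q))))
      { σ with polyMem := update σ.polyMem (polyCell i K α y z t) q } := by
  refine ⟨h.counter, h.reg, h.mem, h.input, h.preg, fun β hβ y' z' u hu => ?_, h.size.setPolyMem hq⟩
  simp only [update_apply]
  rw [h.pmem β hβ y' z' u hu]
  simp only [polyCell_inj hβ hα hu ht]
  by_cases h1 : β = α
  · subst h1
    by_cases h2 : y' = y
    · subst h2
      by_cases h3 : z' = z
      · subst h3
        simp [update_apply]
      · simp [h3]
    · simp [h2]
  · simp [h1]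

theorem Repr.congr {c' : Name → ℕ → RingA} {d' : Name → ℕ → ℕ → ℕ → RingA}
    (h : Repr i K B inp cnt v a c d σ) (hc : ∀ x, ∀ t ≤ i, c x t = c' x t)
    (hd : ∀ α y z, ∀ t ≤ i, d α y z t = d' α y z t) : Repr i K B inp cnt v a c' d' σ :=
  ⟨h.counter, h.reg, h.mem, h.input, fun x t ht => (h.preg x t ht).trans (hc x t ht),
    fun α hα y z t ht => (h.pmem α hα y z t ht).trans (hd α y z t ht), h.size⟩

theorem Repr.cellCode (h : Repr i K B inp cnt v a c d σ) {α : Name} (hα : offset i α 0 + i < K)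
    {N : ℕ} {y : Name} (hy : 0 ≤ v y) (hyN : v y ≤ N) (hB : K * (N + 1) ≤ B) :
    RunOk (State.SizeLE B) (cellCode i K α y) σ ∧
      Repr i K B inp cnt v a c d (runList (cellCode i K α y) σ) ∧
      (runList (cellCode i K α y) σ).reg 0 = cell i K α (v y).toNat := by
  have hvr := varReg_ge y
  obtain ⟨z, hz⟩ := Int.eq_ofNat_of_zero_le hy
  rw [hz] at hyN
  have hzN : z ≤ N := by exact_mod_cast hyN
  have hKz : K * z + K ≤ B := by
    have := Nat.mul_le_mul_left K hzN
    linarith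
  have h1 := h.setScratchNat (r := 0) (x := K) (by omega) (by omega)
  have h2 := h1.setScratchNat (r := 0) (x := K * z) (by omega) (by omega)
  have h3 := h2.setScratchNat (r := 1) (x := offset i α 0 + 1) (by omega) (by omega)
  have h4 := h3.setScratchNat (r := 0) (x := K * z + (offset i α 0 + 1)) (by omega) (by omega)
  have h5 := h4.setScratch (r := 1) (x := 0) (by omega) (by simp)
  have h6 := h5.setScratch (r := 0) (x := cell i K α z) (by omega) (by
    rw [cell, zero_sub, abs_neg, Nat.abs_cast]
    exact_mod_cast (by omega : K * z + (offset i α 0 + 1) ≤ B))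
  have e2 : update σ.reg 0 (K : ℤ) 0 * update σ.reg 0 (K : ℤ) (varReg y) =
      ((K * z : ℕ) : ℤ) := by
    rw [update_self, update_of_ne (by omega), h.reg, hz]
    push_cast
    rfl
  simp only [Skein.cellCode, RunOk, Instr.run, runList, List.foldl]
  rw [e2]
  simp only [update_self, update_of_ne (show (0 : ℕ) ≠ 1 by omega)]
  rw [← Nat.cast_add]
  have e6 : 0 - ((K * z + (offset i α 0 + 1) : ℕ) : ℤ) = cell i K α z := rfl
  rw [e6, hz]
  exact ⟨⟨h1.size, h2.size, h3.size, h4.size, h5.size, h6.size, trivial⟩, h6, rfl⟩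

theorem Repr.polyCellCode (h : Repr i K B inp cnt v a c d σ) {α : Name} (hα : offset i α 0 + i < K)
    {N : ℕ} {y z : Name} (hy : 0 ≤ v y) (hyN : v y ≤ N) (hz : 0 ≤ v z) (hzN : v z ≤ N)
    (hB : K * ((N + N) * (N + N) + N + 1) ≤ B) :
    RunOk (State.SizeLE B) (polyCellCode i K α y z) σ ∧
      Repr i K B inp cnt v a c d (runList (polyCellCode i K α y z) σ) ∧
      (runList (polyCellCode i K α y z) σ).reg 0 = polyCell i K α (v y).toNat (v z).toNat 0 ∧
      (runList (polyCellCode i K α y z) σ).reg 1 = 1 := by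
  have hvr := varReg_ge y
  have hvr' := varReg_ge z
  obtain ⟨p, hp⟩ := Int.eq_ofNat_of_zero_le hy
  obtain ⟨q, hq⟩ := Int.eq_ofNat_of_zero_le hz
  rw [hp] at hyN
  rw [hq] at hzN
  have hpN : p ≤ N := by exact_mod_cast hyN
  have hqN : q ≤ N := by exact_mod_cast hzN
  have hsq : (p + q) * (p + q) ≤ (N + N) * (N + N) := Nat.mul_le_mul (by omega) (by omega)
  have hK : K * ((p + q) * (p + q) + q) + K ≤ B := by
    have := Nat.mul_le_mul_left K (show (p + q) * (p + q) + q ≤ (N + N) * (N + N) + N by omega)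
    linarith
  have hK1 : 1 ≤ K := by omega
  have hself : (p + q) ≤ (p + q) * (p + q) := Nat.le_mul_self _
  have hB' : (p + q) * (p + q) + q ≤ B := by
    have := Nat.le_mul_of_pos_left ((p + q) * (p + q) + q) hK1
    omega
  have h1 := h.setScratchNat (r := 0) (x := p + q) (by omega) (by omega)
  have h2 := h1.setScratchNat (r := 0) (x := (p + q) * (p + q)) (by omega) (by omega)
  have h3 := h2.setScratchNat (r := 0) (x := (p + q) * (p + q) + q) (by omega) (by omega)
  have h4 := h3.setScratchNat (r := 1) (x := K) (by omega) (by omega)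
  have h5 := h4.setScratchNat (r := 0) (x := K * ((p + q) * (p + q) + q)) (by omega) (by omega)
  have h6 := h5.setScratchNat (r := 1) (x := offset i α 0) (by omega) (by omega)
  have h7 := h6.setScratchNat (r := 0) (x := K * ((p + q) * (p + q) + q) + offset i α 0) (by omega) (by omega)
  have h8 := h7.setScratch (r := 1) (x := 1) (by omega) (by
    have : 1 ≤ B := by omega
    simpa using this)
  have e1 : σ.reg (varReg y) + σ.reg (varReg z) = ((p + q : ℕ) : ℤ) := by
    rw [h.reg, h.reg, hp, hq]; push_cast; rfl
  simp only [Skein.polyCellCode, RunOk, Instr.run, runList, List.foldl]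
  rw [e1]
  simp only [update_self, update_of_ne (show (0 : ℕ) ≠ 1 by omega)]
  rw [← Nat.cast_mul]
  rw [update_of_ne (show varReg z ≠ 0 by omega),
    update_of_ne (show varReg z ≠ 0 by omega), h.reg, hq, hp]
  rw [← Nat.cast_add, ← Nat.cast_mul, ← Nat.cast_add]
  exact ⟨⟨h1.size, h2.size, h3.size, h4.size, h5.size, h6.size, h7.size, h8.size, trivial⟩, h8, rfl,
    trivial⟩

theorem Repr.convolve (h : Repr i K B inp cnt v a c d σ) {y z : Name} {t b : ℕ} (ht : t ≤ i)
    (hy : ∀ u ≤ t, SumOf (monoA b) (2 ^ b) (c y u)) (hz : ∀ u ≤ t, SumOf (monoA b) (2 ^ b) (c z u))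
    (hB : 2 * b + i + 1 ≤ B) (h2 : σ.polyReg 2 = 0) :
    RunOk (State.SizeLE B) (convolve i y z t) σ ∧
      Repr i K B inp cnt v a c d (runList (convolve i y z t) σ) ∧
      (runList (convolve i y z t) σ).polyReg 2 = 0 ∧
      (runList (convolve i y z t) σ).polyReg 0 =
        ∑ u ∈ Finset.range (t + 1), c y u * c z (t - u) := by
  have hprod : ∀ u ≤ t, SumOf (monoA (2 * b)) (2 ^ (2 * b)) (c y u * c z (t - u)) := by
    intro u hu
    rw [two_mul, pow_add]
    exact (hy u hu).mulA (hz (t - u) (by omega))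
  have hsum : ∀ n ≤ t + 1, SumOf (monoA (2 * b)) (n * 2 ^ (2 * b))
      (∑ u ∈ Finset.range n, c y u * c z (t - u)) := by
    intro n
    induction n with
    | zero =>
      intro _
      rw [Finset.range_zero, Finset.sum_empty, zero_mul]
      exact SumOf.zero _
    | succ n ih =>
      intro hn
      rw [Finset.sum_range_succ, add_mul, one_mul]
      exact (ih (by omega)).add (hprod n (by omega))
  have hle : ∀ n ≤ t + 1, CoeffLE B (∑ u ∈ Finset.range n, c y u * c z (t - u)) := by
    intro n hn
    -- At most `i + 1` products are added, each with at most `2 ^ (2 * b)` monomials, and `i + 1 < 2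
    -- ^ (i + 1)`; hence the exponent `2 * b + i + 1`.
    refine coeffLE_of_sumOf ((hsum n hn).mono (monoA_mono (show 2 * b ≤ 2 * b + i + 1 by omega)) ?_) hB
    rw [show 2 * b + i + 1 = (i + 1) + 2 * b by ring, pow_add]
    refine Nat.mul_le_mul_right _ ?_
    have : i + 1 < 2 ^ (i + 1) := Nat.lt_two_pow_self
    omega
  have h0 : RunOk (State.SizeLE B) [.polyConst 0 0] σ ∧
      Repr i K B inp cnt v a c d (runList [.polyConst 0 0] σ) := by
    have := h.setPolyScratch (r := 0) (q := 0) (by omega) (by intro e he; simp at he)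
    exact ⟨⟨this.size, trivial⟩, this⟩
  have key := run_range (ok := State.SizeLE B) (f := fun u =>
    [.polyMul 1 (polyVarReg i y u) (polyVarReg i z (t - u)), .polyAdd 0 0 1])
    (fun n τ => Repr i K B inp cnt v a c d τ ∧ τ.polyReg 2 = 0 ∧
      τ.polyReg 0 = ∑ u ∈ Finset.range n, c y u * c z (t - u)) (n := t + 1)
    (σ := runList [.polyConst 0 0] σ) ⟨h0.2, by simp [runList, Instr.run, h2], by simp [runList, Instr.run]⟩ ?_
  · have e : Skein.convolve i y z t = [.polyConst 0 0] ++ (List.range (t + 1)).flatMap fun u =>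
      [.polyMul 1 (polyVarReg i y u) (polyVarReg i z (t - u)), .polyAdd 0 0 1] := rfl
    rw [e, runList_append]
    exact ⟨h0.1.append key.1, key.2⟩
  · rintro u hu τ ⟨g1, g2, g3⟩
    have k1 := g1.setPolyScratch (r := 1) (q := c y u * c z (t - u)) (by omega)
      (coeffLE_of_sumOf (hprod u (by omega)) (by omega))
    have k2 := k1.setPolyScratch (r := 0) (q := ∑ u ∈ Finset.range (u + 1), c y u * c z (t - u))
      (by omega) (hle _ (by omega))
    simp only [RunOk, runList, List.foldl, Instr.run, update_self,
      update_of_ne (show (0 : ℕ) ≠ 1 by omega),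
      update_of_ne (show (2 : ℕ) ≠ 1 by omega),
      update_of_ne (show (2 : ℕ) ≠ 0 by omega)]
    rw [g1.preg y u (by omega), g1.preg z (t - u) (by omega), g3, ← Finset.sum_range_succ
      (fun u => c y u * c z (t - u)) u]
    exact ⟨⟨k1.size, k2.size, trivial⟩, k2, g2, rfl⟩

end Repr

/-- The values in a store are bounded. -/
structure Store.Bounded (N Y : ℕ) (S : Store) : Prop where
  v : ∀ x, |S.v x| ≤ N
  a : ∀ α y, |S.a α y| ≤ N
  pv : ∀ x, Bd Y (S.pv x)
  pa : ∀ α y z, Bd Y (S.pa α y z)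

/-- The machine state represents the store. -/
def Store.Repr (i K B : ℕ) (inp cnt : ℕ → ℤ) (S : Store) (σ : State) : Prop :=
  Skein.Repr i K B inp cnt S.v S.a (fun x t => (S.pv x).coeff t) (fun α y z t => (S.pa α y z).coeff t) σ

theorem coeffLE_of_bd {b B : ℕ} {f : RingA[X]} (h : Bd b f) (hb : b ≤ B) (t : ℕ) :
    CoeffLE B (f.coeff t) :=
  coeffLE_of_sumOf (SumOf.coeff h t) hb

/-! ### Simulation of assignments and commands -/

section Simulation

variable {i K B N Y : ℕ} {inp cnt : ℕ → ℤ} {S : Store} {σ : State}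

theorem update_le {α : Type} [DecidableEq α] {f : α → ℤ} {N : ℕ} (h : ∀ x, |f x| ≤ N) (y : α) {z : ℤ}
    (hz : |z| ≤ N) (x : α) : |update f y z x| ≤ N := by
  grind

theorem update_bd {α : Type} [DecidableEq α] {f : α → RingA[X]} (h : ∀ x, Bd Y (f x)) (y : α)
    {z : RingA[X]} (hz : Bd Y z) (x : α) : Bd Y (update f y z x) := by
  grind

theorem abs_polyCell_le {α : Name} (hα : offset i α 0 + i < K) {y z : ℕ} (hy : y ≤ N) (hz : z ≤ N)
    (hB : K * ((N + N) * (N + N) + N + 1) ≤ B) (t : ℕ) (ht : t ≤ i + 1) :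
    |polyCell i K α y z t| ≤ B := by
  have hsq : (y + z) * (y + z) ≤ (N + N) * (N + N) := Nat.mul_le_mul (by omega) (by omega)
  have := Nat.mul_le_mul_left K (show (y + z) * (y + z) + z ≤ (N + N) * (N + N) + N by omega)
  have ht' : offset i α t = offset i α 0 + t := by simp [offset]
  rw [polyCell, Nat.abs_cast]
  grind

theorem Op.bounded {o : Op} (hS : S.Bounded N Y) (ho : o.Ok N Y S) (hin : ∀ y, |inp y| ≤ N) :
    (o.run inp S).Bounded N Y := by
  cases o with
  | const x c => exact ⟨update_le hS.v x ho, hS.a, hS.pv, hS.pa⟩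
  | add x y z => exact ⟨update_le hS.v x ho, hS.a, hS.pv, hS.pa⟩
  | sub x y z => exact ⟨update_le hS.v x ho, hS.a, hS.pv, hS.pa⟩
  | addc x y c => exact ⟨update_le hS.v x ho.2, hS.a, hS.pv, hS.pa⟩
  | load x α y => exact ⟨update_le hS.v x (hS.a _ _), hS.a, hS.pv, hS.pa⟩
  | store α y x =>
    refine ⟨hS.v, fun β z => ?_, hS.pv, hS.pa⟩
    by_cases hb : β = α
    · subst hb
      simpa [Op.run] using update_le (hS.a β) (S.v y).toNat (hS.v x) z
    · simpa [Op.run, hb] using hS.a β z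
  | input x y => exact ⟨update_le hS.v x (hin _), hS.a, hS.pv, hS.pa⟩
  | pconst x f => exact ⟨hS.v, hS.a, update_bd hS.pv x ho, hS.pa⟩
  | padd x y z => exact ⟨hS.v, hS.a, update_bd hS.pv x ho, hS.pa⟩
  | pmul k x y z => exact ⟨hS.v, hS.a, update_bd hS.pv x ho, hS.pa⟩
  | pload x α y z => exact ⟨hS.v, hS.a, update_bd hS.pv x (hS.pa _ _ _), hS.pa⟩
  | pstore α y z x =>
    refine ⟨hS.v, hS.a, hS.pv, fun β p q => ?_⟩
    by_cases hb : β = α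
    · subst hb
      by_cases hp : p = (S.v y).toNat
      · subst hp
        simpa [Op.run] using update_bd (hS.pa β _) (S.v z).toNat (hS.pv x) q
      · simpa [Op.run, hp] using hS.pa β p q
    · simpa [Op.run, hb] using hS.pa β p q

/-- The relation between the bounds for a command and the bound for the machine. -/
structure Large (i K N Y B : ℕ) : Prop where
  address : K * ((N + N) * (N + N) + N + 1) ≤ B
  poly : 2 * Y + i + 1 ≤ B
  one_le : 1 ≤ N
  two_le : 2 * N ≤ B

theorem Large.le (h : Large i K N Y B) : N ≤ B := by
  have := h.two_le
  omega

open Classical in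
/-- As `Store.Repr`, but `x` already has those coefficients of `f` for which `p` holds. -/
def Store.Partial (i K B : ℕ) (inp cnt : ℕ → ℤ) (S : Store) (x : Name) (f : RingA[X]) (p : ℕ → Prop) (σ : State) : Prop :=
  Skein.Repr i K B inp cnt S.v S.a (update (fun x t => (S.pv x).coeff t) x fun t =>
    if p t then f.coeff t else (S.pv x).coeff t) (fun α y z t => (S.pa α y z).coeff t) σ

theorem Store.Repr.start (h : S.Repr i K B inp cnt σ) (x : Name) (f : RingA[X]) {p : ℕ → Prop} (hp : ∀ t ≤ i, ¬ p t) :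
    S.Partial i K B inp cnt x f p σ :=
  Skein.Repr.congr h (fun y t ht => by
    by_cases hy : y = x
    · subst hy; simp [hp t ht]
    · simp [hy]) fun _ _ _ _ _ => rfl

theorem Store.Partial.finish {x : Name} {f : RingA[X]} {p : ℕ → Prop} (h : S.Partial i K B inp cnt x f p σ)
    (hp : ∀ t ≤ i, p t) : Store.Repr i K B inp cnt { S with pv := update S.pv x f } σ :=
  Skein.Repr.congr h (fun y t ht => by
    by_cases hy : y = x
    · subst hy; simp [hp t ht]
    · simp [hy]) fun _ _ _ _ _ => rfl

theorem Store.Partial.step {x : Name} {f : RingA[X]} {p p' : ℕ → Prop} {t : ℕ} (h : S.Partial i K B inp cnt x f p σ)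
    (ht : t ≤ i) (hf : Bd Y f) (hY : Y ≤ B) (hp : ∀ u, p' u ↔ u = t ∨ p u) :
    S.Partial i K B inp cnt x f p' { σ with polyReg := update σ.polyReg (polyVarReg i x t) (f.coeff t) } :=
  (h.setPolyVar x ht (coeffLE_of_bd hf hY t)).congr (fun y u _ => by
    by_cases hy : y = x
    · subst hy
      by_cases hut : u = t
      · subst hut; simp [hp]
      · by_cases hpu : p u <;> simp [hut, hp, hpu]
    · simp [hy]) fun _ _ _ _ _ => rfl

open Classical in
theorem Store.Partial.coeff {x : Name} {f : RingA[X]} {p : ℕ → Prop} {t : ℕ} (ht : ¬ p t) (y : Name) :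
    update (fun x t => (S.pv x).coeff t) x (fun t => if p t then f.coeff t else (S.pv x).coeff t) y t =
      (S.pv y).coeff t := by
  by_cases hy : y = x
  · subst hy; simp [ht]
  · simp [hy]

/-- A polynomial assignment is a run over the coefficients `0, …, i`. In between, the state
represents a target that is only partly written: `Store.Partial`, or `D n` for arrays. -/
theorem Op.simulate {o : Op} (hL : Large i K N Y B) (h : S.Repr i K B inp cnt σ)
    (hS : S.Bounded N Y) (ho : o.Ok N Y S) (hf : o.Fits i K) (hin : ∀ y, |inp y| ≤ N) :
    RunOk (State.SizeLE B) (o.compile i K) σ ∧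
      (o.run inp S).Repr i K B inp cnt (runList (o.compile i K) σ) := by
  have hNB : ∀ {x : ℤ}, |x| ≤ N → |x| ≤ B := fun hx => hx.trans (by exact_mod_cast hL.le)
  have hYB : Y ≤ B := by have := hL.poly; omega
  have hKB : K * (N + 1) ≤ B := (Nat.mul_le_mul_left K (by
    have : 0 ≤ (N + N) * (N + N) := Nat.zero_le _
    omega)).trans hL.address
  have hle : ∀ {x : ℤ}, |x| ≤ N → x ≤ N := fun hx => (le_abs_self _).trans hx
  have hnext (α : Name) (y z t : ℕ) : polyCell i K α y z t + 1 = polyCell i K α y z (t + 1) := by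
    unfold polyCell offset
    push_cast
    ring
  cases o with
  | const x c =>
    have := Skein.Repr.setVar h x (hNB ho)
    exact ⟨⟨this.size, trivial⟩, this⟩
  | add x y z =>
    have := Skein.Repr.setVar h x (hNB ho)
    simp only [Op.compile, RunOk, runList, List.foldl, Instr.run]
    rw [h.reg, h.reg]
    exact ⟨⟨this.size, trivial⟩, this⟩
  | sub x y z =>
    have := Skein.Repr.setVar h x (hNB ho)
    simp only [Op.compile, RunOk, runList, List.foldl, Instr.run]
    rw [h.reg, h.reg]
    exact ⟨⟨this.size, trivial⟩, this⟩
  | addc x y c =>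
    have h1 := Skein.Repr.setScratch h (r := 0) (by omega) (hNB ho.1)
    have h2 := h1.setVar x (hNB ho.2)
    have := varReg_ge y
    simp only [Op.compile, RunOk, runList, List.foldl, Instr.run, update_self,
      update_of_ne (show varReg y ≠ 0 by omega)]
    rw [h.reg]
    exact ⟨⟨h1.size, h2.size, trivial⟩, h2⟩
  | load x α y =>
    obtain ⟨h1, h2, h3⟩ := Skein.Repr.cellCode h hf ho (hle (hS.v y)) hKB
    have h4 := h2.setVar x (hNB (hS.a α (S.v y).toNat))
    have e : (Instr.load (varReg x) 0).run (runList (cellCode i K α y) σ) =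
        { runList (cellCode i K α y) σ with
          reg := update (runList (cellCode i K α y) σ).reg (varReg x) (S.a α (S.v y).toNat) } := by
      rw [Instr.run, h3, h2.mem α hf]
    rw [Op.compile, runList_append, runList_singleton, e]
    exact ⟨h1.append ⟨by rw [e]; exact h4.size, trivial⟩, h4⟩
  | store α y x =>
    obtain ⟨h1, h2, h3⟩ := Skein.Repr.cellCode h hf ho (hle (hS.v y)) hKB
    have h4 := h2.setArr hf (S.v y).toNat (hNB (hS.v x))
    have e : (Instr.store 0 (varReg x)).run (runList (cellCode i K α y) σ) =
        { runList (cellCode i K α y) σ with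
          mem := update (runList (cellCode i K α y) σ).mem (cell i K α (S.v y).toNat)
            (S.v x) } := by
      rw [Instr.run, h3, h2.reg]
    rw [Op.compile, runList_append, runList_singleton, e]
    exact ⟨h1.append ⟨by rw [e]; exact h4.size, trivial⟩, h4⟩
  | input x y =>
    have := Skein.Repr.setVar h x (hNB (hin (S.v y).toNat))
    have e : σ.mem (σ.reg (varReg y)) = inp (S.v y).toNat := by
      rw [h.reg, ← h.input, Int.toNat_of_nonneg ho]
    simp only [Op.compile, RunOk, runList, List.foldl, Instr.run]
    rw [e]
    exact ⟨⟨this.size, trivial⟩, this⟩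
  | pconst x f =>
    have key := run_range (ok := State.SizeLE B) (f := fun t => [.polyConst (polyVarReg i x t) (f.coeff t)])
      (fun n => S.Partial i K B inp cnt x f (· < n)) (n := i + 1) (h.start x f (by simp)) fun t ht τ hτ => by
        have := hτ.step (p' := (· < t + 1)) (t := t) (by omega) ho hYB (by omega)
        exact ⟨⟨this.size, trivial⟩, this⟩
    exact ⟨key.1, key.2.finish (by omega)⟩
  | padd x y z =>
    have key := run_range (ok := State.SizeLE B)
      (f := fun t => [.polyAdd (polyVarReg i x t) (polyVarReg i y t) (polyVarReg i z t)])
      (fun n => S.Partial i K B inp cnt x (S.pv y + S.pv z) (· < n)) (n := i + 1) (h.start x _ (by simp))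
      fun t ht τ hτ => by
        have := hτ.step (p' := (· < t + 1)) (t := t) (by omega) ho hYB (by omega)
        have e : ∀ w, τ.polyReg (polyVarReg i w t) = (S.pv w).coeff t := fun w =>
          (hτ.preg w t (by omega)).trans (Store.Partial.coeff (p := (· < t)) (lt_irrefl t) w)
        simp only [RunOk, runList, List.foldl, Instr.run]
        rw [e, e, ← coeff_add]
        exact ⟨⟨this.size, trivial⟩, this⟩
    exact ⟨key.1, key.2.finish (by omega)⟩
  | pmul k x y z =>
    -- Scratch register `2` holds zero throughout, because a register is copied by adding zero.
    have h0 : S.Repr i K B inp cnt (runList [.polyConst 2 0] σ) :=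
      Skein.Repr.setPolyScratch h (r := 2) (q := 0) (by omega) (by intro e he; simp at he)
    -- Coefficients of the product are computed from the highest down. Coefficient `t` uses only
    -- coefficients up to `t` of the factors, and these are not yet overwritten even if the target
    -- is one of the factors.
    have key := run_range_reverse (ok := State.SizeLE B)
      (f := fun t => if t ≤ k then convolve i y z t ++ [.polyAdd (polyVarReg i x t) 0 2]
        else [.polyConst (polyVarReg i x t) 0])
      (fun n τ => S.Partial i K B inp cnt x (tr k (S.pv y * S.pv z)) (n ≤ ·) τ ∧ τ.polyReg 2 = 0) (n := i + 1)
      (σ := runList [.polyConst 2 0] σ) ⟨h0.start x _ (by omega), by simp [runList, Instr.run]⟩ ?_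
    · exact ⟨RunOk.append (l := [.polyConst 2 0]) ⟨h0.size, trivial⟩ key.1, key.2.1.finish (by simp)⟩
    rintro t ht τ ⟨hτ, hτ2⟩
    have := polyVarReg_ge i x t
    by_cases htk : t ≤ k
    · have e (w : Name) (u : ℕ) (hu : u ≤ t) := Store.Partial.coeff (S := S) (x := x) (f := tr k (S.pv y * S.pv z))
        (p := (t + 1 ≤ ·)) (t := u) (by omega) w
      obtain ⟨g1, g2, g3, g4⟩ := hτ.convolve (y := y) (z := z) (t := t) (b := Y) (by omega)
        (fun u hu => by rw [e y u hu]; exact SumOf.coeff (hS.pv y) u)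
        (fun u hu => by rw [e z u hu]; exact SumOf.coeff (hS.pv z) u) hL.poly hτ2
      have g6 := Store.Partial.step (p' := (t ≤ ·)) (t := t) g2 (by omega) ho hYB (by omega)
      have g5 : (runList (convolve i y z t) τ).polyReg 0 + (runList (convolve i y z t) τ).polyReg 2 =
          (tr k (S.pv y * S.pv z)).coeff t := by
        rw [g3, g4, add_zero, coeff_tr, if_pos htk, coeff_mul, Finset.Nat.sum_antidiagonal_eq_sum_range_succ_mk]
        refine Finset.sum_congr rfl fun u hu => ?_
        rw [Finset.mem_range] at hu
        rw [e y u (by omega), e z (t - u) (by omega)]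
      have e' : (Instr.polyAdd (polyVarReg i x t) 0 2).run (runList (convolve i y z t) τ) =
          { runList (convolve i y z t) τ with
            polyReg := update (runList (convolve i y z t) τ).polyReg (polyVarReg i x t)
              ((tr k (S.pv y * S.pv z)).coeff t) } := by
        rw [Instr.run, g5]
      rw [if_pos htk, runList_append, runList_singleton, e']
      exact ⟨g1.append ⟨by rw [e']; exact g6.size, trivial⟩, g6,
        by simp [update_of_ne (show 2 ≠ polyVarReg i x t by omega), g3]⟩
    · rw [if_neg htk]
      have g6 := hτ.step (p' := (t ≤ ·)) (t := t) (by omega) ho hYB (by omega)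
      rw [coeff_tr, if_neg htk] at g6
      exact ⟨⟨g6.size, trivial⟩, g6, by
        simp [runList, Instr.run, update_of_ne (show 2 ≠ polyVarReg i x t by omega), hτ2]⟩
  | pload x α y z =>
    obtain ⟨h1, h2, h3, h3'⟩ := Skein.Repr.polyCellCode h hf ho.1 (hle (hS.v y)) ho.2 (hle (hS.v z))
      hL.address
    have hcell := abs_polyCell_le (i := i) (K := K) (N := N) (B := B) (α := α) hf
      (y := (S.v y).toNat) (z := (S.v z).toNat) (by have := hle (hS.v y); omega)
      (by have := hle (hS.v z); omega) hL.address
    have key := run_range (ok := State.SizeLE B)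
      (f := fun t => [.polyLoad (polyVarReg i x t) 0, .add 0 0 1])
      (fun n τ => S.Partial i K B inp cnt x (S.pa α (S.v y).toNat (S.v z).toNat) (· < n) τ ∧
        τ.reg 0 = polyCell i K α (S.v y).toNat (S.v z).toNat n ∧ τ.reg 1 = 1) (n := i + 1)
      (σ := runList (polyCellCode i K α y z) σ) ⟨Store.Repr.start h2 x _ (by simp), h3, h3'⟩ ?_
    · rw [Op.compile, runList_append]
      exact ⟨h1.append key.1, key.2.1.finish (by omega)⟩
    · rintro t ht τ ⟨hτ, hτ0, hτ1⟩
      have g1 := hτ.step (p' := (· < t + 1)) (t := t) (by omega) (hS.pa _ _ _) hYB (by omega)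
      have g2 := g1.setScratch (r := 0) (by omega) (hcell (t + 1) (by omega))
      simp only [RunOk, runList, List.foldl, Instr.run]
      rw [hτ0, hτ.pmem α hf _ _ t (by omega), hτ1, hnext]
      exact ⟨⟨g1.size, g2.size, trivial⟩, g2, by simp, by simp [hτ1]⟩
  | pstore α y z x =>
    obtain ⟨h1, h2, h3, h3'⟩ := Skein.Repr.polyCellCode h hf ho.1 (hle (hS.v y)) ho.2 (hle (hS.v z))
      hL.address
    have hcell := abs_polyCell_le (i := i) (K := K) (N := N) (B := B) (α := α) hf
      (y := (S.v y).toNat) (z := (S.v z).toNat) (by have := hle (hS.v y); omega)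
      (by have := hle (hS.v z); omega) hL.address
    set D : ℕ → Name → ℕ → ℕ → ℕ → RingA := fun n =>
      update (fun α y z t => (S.pa α y z).coeff t) α
        (update (fun y z t => (S.pa α y z).coeff t) (S.v y).toNat
          (update (fun z t => (S.pa α (S.v y).toNat z).coeff t) (S.v z).toNat
            fun t => if t < n then (S.pv x).coeff t else
              (S.pa α (S.v y).toNat (S.v z).toNat).coeff t)) with hD
    have key := run_range (ok := State.SizeLE B)
      (f := fun t => [.polyStore 0 (polyVarReg i x t), .add 0 0 1])
      (fun n τ => Skein.Repr i K B inp cnt S.v S.a (fun x t => (S.pv x).coeff t) (D n) τ ∧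
        τ.reg 0 = polyCell i K α (S.v y).toNat (S.v z).toNat n ∧ τ.reg 1 = 1) (n := i + 1)
      (σ := runList (polyCellCode i K α y z) σ) ⟨by simpa [hD] using h2, h3, h3'⟩ ?_
    · rw [Op.compile, runList_append]
      refine ⟨h1.append key.1, key.2.1.congr (fun _ _ _ => rfl) fun β p q t ht => ?_⟩
      by_cases hb : β = α
      · subst hb
        by_cases hp : p = (S.v y).toNat
        · subst hp
          by_cases hq : q = (S.v z).toNat
          · subst hq
            simp only [hD, Op.run, update_self, if_pos (Nat.lt_succ_of_le ht)]
          · simp [hD, Op.run, hq]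
        · simp [hD, Op.run, hp]
      · simp [hD, Op.run, hb]
    · rintro t ht τ ⟨hτ, hτ0, hτ1⟩
      have g1 := (hτ.setPolyArr hf (S.v y).toNat (S.v z).toNat (t := t) (by omega)
        (coeffLE_of_bd (hS.pv x) hYB t)).congr (d' := D (t + 1)) (fun _ _ _ => rfl)
        fun β p q u hu => by
          by_cases hb : β = α
          · subst hb
            by_cases hp : p = (S.v y).toNat
            · subst hp
              by_cases hq : q = (S.v z).toNat
              · subst hq
                simp only [hD, update_self]
                grind
              · simp [hD, hq]
            · simp [hD, hp]
          · simp [hD, hb]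
      have g2 := g1.setScratch (r := 0) (by omega) (hcell (t + 1) (by omega))
      simp only [RunOk, runList, List.foldl, Instr.run]
      rw [hτ0, hτ.preg x t (by omega), hτ1, hnext]
      exact ⟨⟨g1.size, g2.size, trivial⟩, g2, by simp, by simp [hτ1]⟩

/-- Inside `d` loops only the counters below `d` are in use. The compiled command preserves these
and may spoil the others. -/
theorem Cmd.simulate (hL : Large i K N Y B) (hin : ∀ y, |inp y| ≤ N) (c : Cmd) :
    ∀ (Q : Store → Prop) (S : Store) (σ : State) (cnt : ℕ → ℤ) (d : ℕ), c.Fits i K →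
      S.Repr i K B inp cnt σ → S.Bounded N Y → WP inp N Y c Q S →
      ∃ (S' : Store) (σ' : State) (cnt' : ℕ → ℤ) (t : ℕ),
        Exec (State.SizeLE B) (c.compile i K d) σ t σ' ∧ Q S' ∧ S'.Repr i K B inp cnt' σ' ∧
          S'.Bounded N Y ∧ t ≤ c.cost i K N ∧ ∀ k < d, cnt' k = cnt k := by
  have hNB : ∀ {x : ℤ}, |x| ≤ N → |x| ≤ B := fun hx => hx.trans (by exact_mod_cast hL.le)
  have h2B := hL.two_le
  induction c with
  | op o =>
    intro Q S σ cnt d hf h hS hQ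
    obtain ⟨h1, h2⟩ := Op.simulate hL h hS hQ.1 hf hin
    have hne : o.compile i K ≠ [] := by
      cases o <;> simp [Op.compile, cellCode, polyCellCode, List.range_succ]
    exact ⟨_, _, cnt, _, exec_ofList hne h1, hQ.2, h2, Op.bounded hS hQ.1 hin, le_rfl, fun _ _ => rfl⟩
  | seq c c' ih ih' =>
    intro Q S σ cnt d hf h hS hQ
    obtain ⟨S1, σ1, cnt1, t1, e1, q1, r1, b1, l1, k1⟩ := ih _ S σ cnt d hf.1 h hS hQ
    obtain ⟨S2, σ2, cnt2, t2, e2, q2, r2, b2, l2, k2⟩ := ih' _ S1 σ1 cnt1 d hf.2 r1 b1 q1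
    exact ⟨S2, σ2, cnt2, _, e1.seq e2, q2, r2, b2, Nat.add_le_add l1 l2,
      fun k hk => (k2 k hk).trans (k1 k hk)⟩
  | ifLt x y c c' ih ih' =>
    intro Q S σ cnt d hf h hS hQ
    have hx := hS.v x
    have hy := hS.v y
    have hxy : |S.v y - S.v x| ≤ B := by
      grind
    have h1 : S.Repr i K B inp cnt ((Instr.sub 0 (varReg y) (varReg x)).run σ) := by
      have := Skein.Repr.setScratch h (r := 0) (by omega) hxy
      simp only [Instr.run]
      rw [h.reg, h.reg]
      exact this
    have h0 : ((Instr.sub 0 (varReg y) (varReg x)).run σ).reg 0 = S.v y - S.v x := by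
      simp [Instr.run, h.reg]
    by_cases hlt : S.v x < S.v y
    · obtain ⟨S1, σ1, cnt1, t1, e1, q1, r1, b1, l1, k1⟩ := ih _ S _ cnt d hf.1 h1 hS (hQ.1 hlt)
      refine ⟨S1, σ1, cnt1, _, (Exec.instr h1.size).seq (Exec.ite_pos (by rw [h0]; omega) e1), q1, r1,
        b1, ?_, k1⟩
      rw [Cmd.cost]
      omega
    · obtain ⟨S1, σ1, cnt1, t1, e1, q1, r1, b1, l1, k1⟩ :=
        ih' _ S _ cnt d hf.2 h1 hS (hQ.2 (not_lt.1 hlt))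
      refine ⟨S1, σ1, cnt1, _, (Exec.instr h1.size).seq (Exec.ite_neg (by rw [h0]; omega) e1), q1, r1,
        b1, ?_, k1⟩
      rw [Cmd.cost]
      omega
  | rep x c ih =>
    intro Q S σ cnt d hf h hS hQ
    have hx := hS.v x
    have hcr := counterReg_ge d
    have hvr := varReg_ge x
    have h1 := Skein.Repr.setScratch h (r := 0) (x := 0) (by omega) (by simp)
    have h2 := h1.setCounter d (hNB hx)
    have e0 : Exec (State.SizeLE B) (Program.ofList [.const 0 0, .add (counterReg d) 0 (varReg x)]) σ 2
        (runList [.const 0 0, .add (counterReg d) 0 (varReg x)] σ) ∧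
        S.Repr i K B inp (update cnt d (S.v x))
          (runList [.const 0 0, .add (counterReg d) 0 (varReg x)] σ) := by
      have e : update σ.reg 0 0 0 + update σ.reg 0 0 (varReg x) = S.v x := by
        rw [update_self, update_of_ne (by omega), h.reg, zero_add]
      constructor
      · refine exec_ofList (by simp) ?_
        simp only [RunOk, Instr.run]
        rw [e]
        exact ⟨h1.size, h2.size, trivial⟩
      · simp only [runList, List.foldl, Instr.run]
        rw [e]
        exact h2
    -- Here `n` is the number of remaining rounds. The counter equals `n` while `n` is positive;
    -- when `n` is zero it may be negative, since the loop variable may be.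
    have loop : ∀ n : ℕ, ∀ (S : Store) (σ : State) (cnt : ℕ → ℤ), n ≤ N →
        S.Repr i K B inp cnt σ → S.Bounded N Y → iterT (WP inp N Y c) n Q S → cnt d ≤ n →
        (0 < n → cnt d = n) →
        ∃ (S' : Store) (σ' : State) (cnt' : ℕ → ℤ) (t : ℕ),
          Exec (State.SizeLE B) (.loop (counterReg d) (.seq (c.compile i K (d + 1))
            (Program.ofList [.const 0 1, .sub (counterReg d) (counterReg d) 0]))) σ t σ' ∧
          Q S' ∧ S'.Repr i K B inp cnt' σ' ∧
          S'.Bounded N Y ∧ t ≤ n * (c.cost i K N + 3) + 1 ∧ ∀ k < d, cnt' k = cnt k := by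
      intro n
      induction n with
      | zero =>
        intro S σ cnt hn h hS hQ hc _
        exact ⟨S, σ, cnt, 1, Exec.loop_neg (by rw [h.counter]; push_cast at hc; omega), hQ, h, hS,
          by omega, fun _ _ => rfl⟩
      | succ n ihn =>
        intro S σ cnt hn h hS hQ _ hc
        have hc := hc (by omega)
        obtain ⟨S1, σ1, cnt1, t1, e1, q1, r1, b1, l1, k1⟩ := ih _ S σ cnt (d + 1) hf h hS hQ
        have hc1 : cnt1 d = ((n + 1 : ℕ) : ℤ) := (k1 d (by omega)).trans hc
        have g1 := Skein.Repr.setScratch r1 (r := 0) (x := 1) (by omega) (by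
          have : 1 ≤ B := hL.one_le.trans hL.le
          simpa using this)
        have g2 := g1.setCounter d (x := n) (by
          rw [Nat.abs_cast]
          have := hL.le
          exact_mod_cast (by omega : n ≤ B))
        have e : update σ1.reg 0 1 (counterReg d) - update σ1.reg 0 1 0 = n := by
          rw [update_self, update_of_ne (by omega), r1.counter, hc1]
          push_cast
          ring
        have e2 : Exec (State.SizeLE B) (Program.ofList [.const 0 1, .sub (counterReg d) (counterReg d) 0])
            σ1 2 (runList [.const 0 1, .sub (counterReg d) (counterReg d) 0] σ1) := by
          refine exec_ofList (by simp) ?_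
          simp only [RunOk, Instr.run]
          rw [e]
          exact ⟨g1.size, g2.size, trivial⟩
        have g3 : S1.Repr i K B inp (update cnt1 d n)
            (runList [.const 0 1, .sub (counterReg d) (counterReg d) 0] σ1) := by
          simp only [runList, List.foldl, Instr.run]
          rw [e]
          exact g2
        obtain ⟨S2, σ2, cnt2, t2, e3, q2, r2, b2, l2, k2⟩ := ihn S1 _ _ (by omega) g3 b1 q1
          (by simp) (by simp)
        refine ⟨S2, σ2, cnt2, _, Exec.loop_pos (by rw [h.counter, hc]; push_cast; omega)
          (e1.seq e2) e3, q2, r2, b2, ?_, fun k hk => ?_⟩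
        all_goals grind
    obtain ⟨S1, σ1, cnt1, t1, e1, q1, r1, b1, l1, k1⟩ := loop (S.v x).toNat S _ _ (by
      have := (le_abs_self _).trans hx
      omega) e0.2 hS hQ (by simp) (by simp; omega)
    refine ⟨S1, σ1, cnt1, _, e0.1.seq e1, q1, r1, b1, ?_, fun k hk => ?_⟩
    · rw [Cmd.cost]
      have hxN : (S.v x).toNat ≤ N := by
        have := (le_abs_self _).trans hx
        omega
      have := Nat.mul_le_mul_right (c.cost i K N + 3) hxN
      omega
    · rw [k1 k hk, update_of_ne (by omega)]

end Simulation

end Skein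

namespace Skein

open Polynomial Function

/-! ### Codes given by positions -/

/-- The word of the passages at the positions from `a` to `b`. -/
def seg (f : ℕ → Passage) (a b : ℕ) : List Passage := (List.Ico a b).map f

/-- The code whose components are given by intervals of positions. -/
def codeOf (f : ℕ → Passage) (a b : ℕ → ℕ) (m : ℕ) : Code :=
  (List.range m).map fun c => seg f (a c) (b c)

theorem mem_seg {f : ℕ → Passage} {a b : ℕ} {p : Passage} :
    p ∈ seg f a b ↔ ∃ x, a ≤ x ∧ x < b ∧ f x = p := by
  simp [seg, and_assoc]

theorem seg_self (f : ℕ → Passage) (a : ℕ) : seg f a a = [] := by simp [seg]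

theorem seg_append {f : ℕ → Passage} {a b c : ℕ} (hab : a ≤ b) (hbc : b ≤ c) :
    seg f a b ++ seg f b c = seg f a c := by
  rw [seg, seg, seg, ← List.map_append, List.Ico.append_consecutive hab hbc]

theorem seg_cons {f : ℕ → Passage} {a b : ℕ} (h : a < b) : seg f a b = f a :: seg f (a + 1) b := by
  rw [seg, List.Ico.eq_cons h]
  rfl

theorem seg_split {f : ℕ → Passage} {a x b : ℕ} (hax : a ≤ x) (hxb : x < b) :
    seg f a b = seg f a x ++ f x :: seg f (x + 1) b := by
  rw [← seg_cons hxb, seg_append hax hxb.le]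

theorem length_seg (f : ℕ → Passage) (a b : ℕ) : (seg f a b).length = b - a := by simp [seg]

theorem mem_codeOf {f : ℕ → Passage} {a b : ℕ → ℕ} {m : ℕ} {p : Passage} :
    p ∈ (codeOf f a b m).flatten ↔ ∃ c < m, ∃ x, a c ≤ x ∧ x < b c ∧ f x = p := by
  simp [codeOf, mem_seg]

theorem length_codeOf (f : ℕ → Passage) (a b : ℕ → ℕ) (m : ℕ) : (codeOf f a b m).length = m := by
  simp [codeOf]

theorem codeOf_succ (f : ℕ → Passage) (a b : ℕ → ℕ) (m : ℕ) :
    codeOf f a b (m + 1) = codeOf f a b m ++ [seg f (a m) (b m)] := by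
  simp [codeOf, List.range_succ]

theorem seg_switch (f : ℕ → Passage) (Z : ℕ → Bool) (a b : ℕ) :
    seg (fun x => (f x).switch Z) a b = (seg f a b).map (Passage.switch Z) := by
  simp [seg]

theorem codeOf_switch (f : ℕ → Passage) (Z : ℕ → Bool) (a b : ℕ → ℕ) (m : ℕ) :
    codeOf (fun x => (f x).switch Z) a b m = (codeOf f a b m).switch Z := by
  simp [codeOf, Code.switch, seg_switch]

/-- The passages at the positions below `N` are pairwise different, and passages with the same label
are partners. -/
def Sound (f : ℕ → Passage) (N : ℕ) : Prop := SubWF ((List.range N).map f)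

theorem Sound.eq {f : ℕ → Passage} {N x y : ℕ} (h : Sound f N) (hx : x < N) (hy : y < N)
    (hxy : f x = f y) : x = y :=
  List.inj_on_of_nodup_map h.1 (List.mem_range.2 hx) (List.mem_range.2 hy) hxy

theorem Sound.partner {f : ℕ → Passage} {N x y : ℕ} (h : Sound f N) (hx : x < N) (hy : y < N)
    (hne : x ≠ y) (hxy : (f x).label = (f y).label) : f y = (f x).partner := by
  rcases h.2 (f x) (List.mem_map_of_mem (List.mem_range.2 hx)) (f y)
    (List.mem_map_of_mem (List.mem_range.2 hy)) hxy with h1 | h1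
  · exact absurd (h.eq hx hy h1.symm) hne
  · exact h1

/-- The position of the passage with the same label; passages without partner are their own
partners. -/
structure IsPar (f : ℕ → Passage) (N : ℕ) (par : ℕ → ℕ) : Prop where
  lt : ∀ x < N, par x < N
  label : ∀ x < N, (f (par x)).label = (f x).label
  eq : ∀ x < N, ∀ y < N, y ≠ x → (f y).label = (f x).label → par x = y

theorem IsPar.par_par {f : ℕ → Passage} {N : ℕ} {par : ℕ → ℕ} (h : IsPar f N par) {x : ℕ}
    (hx : x < N) : par (par x) = x := by
  by_cases hp : par x = x
  · rw [hp, hp]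
  · exact h.eq _ (h.lt x hx) _ hx (Ne.symm hp) (h.label x hx).symm

theorem IsPar.partner {f : ℕ → Passage} {N : ℕ} {par : ℕ → ℕ} (h : IsPar f N par) (hs : Sound f N)
    {x : ℕ} (hx : x < N) (hne : par x ≠ x) : f (par x) = (f x).partner :=
  hs.partner hx (h.lt x hx) (Ne.symm hne) (h.label x hx).symm

theorem IsPar.eq_of_partner {f : ℕ → Passage} {N : ℕ} {par : ℕ → ℕ} (h : IsPar f N par)
    {x y : ℕ} (hx : x < N) (hy : y < N) (hxy : f y = (f x).partner) : par x = y := by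
  refine h.eq x hx y hy ?_ (by rw [hxy, Passage.label_partner])
  rintro rfl
  exact (f y).partner_ne hxy.symm

theorem IsPar.switch {f : ℕ → Passage} {N : ℕ} {par : ℕ → ℕ} (h : IsPar f N par) (Z : ℕ → Bool) :
    IsPar (fun x => (f x).switch Z) N par :=
  ⟨h.lt, by simpa using h.label, by simpa using h.eq⟩

theorem SubWF.switch {l : List Passage} (h : SubWF l) (Z : ℕ → Bool) :
    SubWF (l.map (Passage.switch Z)) := by
  refine ⟨h.1.map (Passage.switch_injective Z), ?_⟩
  simp only [List.mem_map]
  rintro _ ⟨p, hp, rfl⟩ _ ⟨q, hq, rfl⟩ hpq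
  rw [Passage.label_switch, Passage.label_switch] at hpq
  rcases h.2 p hp q hq hpq with rfl | rfl
  · exact Or.inl rfl
  · exact Or.inr (Passage.partner_switch Z p).symm

theorem Sound.switch {f : ℕ → Passage} {N : ℕ} (h : Sound f N) (Z : ℕ → Bool) :
    Sound (fun x => (f x).switch Z) N := by
  have := SubWF.switch h Z
  rwa [List.map_map] at this

/-- The index of the component of a position. -/
structure IsIndex (a b : ℕ → ℕ) (m : ℕ) (cx : ℕ → ℤ) : Prop where
  mem : ∀ c < m, ∀ x, a c ≤ x → x < b c → cx x = c
  exists_of_nonneg : ∀ x, 0 ≤ cx x → ∃ c < m, a c ≤ x ∧ x < b c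

/-- An under passage whose partner lies on a later component. -/
def Bad (f : ℕ → Passage) (par : ℕ → ℕ) (cx : ℕ → ℤ) (x : ℕ) : Prop :=
  (f x).isOver = false ∧ 0 ≤ cx x ∧ cx x < cx (par x)

/-- The positions on the components after smoothing a crossing of the components `c` and `d`. -/
def smoothPos (a b : ℕ → ℕ) (c d v w e : ℕ) : List ℕ :=
  if e = c then List.Ico (a c) v ++ (List.Ico (w + 1) (b d) ++ (List.Ico (a d) w ++ List.Ico (v + 1) (b c)))
  else List.Ico (a e) (b e)

/-- The code after smoothing a crossing of the components `c` and `d`. -/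
def smoothCode (f : ℕ → Passage) (a b : ℕ → ℕ) (m c d v w : ℕ) : Code :=
  ((List.range m).filter fun e => e ≠ d).map fun e => (smoothPos a b c d v w e).map f

theorem range_split {c m : ℕ} (h : c < m) :
    List.range m = List.range c ++ c :: List.Ico (c + 1) m := by
  rw [← List.Ico.zero_bot, ← List.Ico.zero_bot, ← List.Ico.eq_cons h,
    List.Ico.append_consecutive (Nat.zero_le c) h.le]

theorem range_split_two {c d m : ℕ} (h : c < d) (hd : d < m) :
    List.range m = List.range c ++ c :: (List.Ico (c + 1) d ++ d :: List.Ico (d + 1) m) := by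
  rw [range_split (h.trans hd), ← List.Ico.eq_cons hd, List.Ico.append_consecutive h hd.le]

/-! ### Skein expansion in terms of positions -/

section Expand

variable {f : ℕ → Passage} {a b : ℕ → ℕ} {m c d v w : ℕ}

theorem codeOf_split (h : c < d) (hd : d < m) (hv : a c ≤ v) (hv' : v < b c) (hw : a d ≤ w)
    (hw' : w < b d) : codeOf f a b m = ((List.range c).map fun e => seg f (a e) (b e)) ++
      (seg f (a c) v ++ f v :: seg f (v + 1) (b c)) ::
      (((List.Ico (c + 1) d).map fun e => seg f (a e) (b e)) ++
        (seg f (a d) w ++ f w :: seg f (w + 1) (b d)) ::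
        ((List.Ico (d + 1) m).map fun e => seg f (a e) (b e))) := by
  rw [codeOf, range_split_two h hd, ← seg_split hv hv', ← seg_split hw hw']
  simp

theorem smoothCode_split (h : c < d) (hd : d < m) :
    smoothCode f a b m c d v w = ((List.range c).map fun e => seg f (a e) (b e)) ++
      (seg f (a c) v ++ (seg f (w + 1) (b d) ++ seg f (a d) w ++ seg f (v + 1) (b c))) ::
      (((List.Ico (c + 1) d).map fun e => seg f (a e) (b e)) ++
        ((List.Ico (d + 1) m).map fun e => seg f (a e) (b e))) := by
  have hmap : ∀ l : List ℕ, c ∉ l → d ∉ l →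
      ((l.filter fun e => e ≠ d).map fun e => (smoothPos a b c d v w e).map f) =
        l.map fun e => seg f (a e) (b e) := by
    intro l hc hd
    rw [List.filter_eq_self.2 fun e he => by
      have : e ≠ d := by
        rintro rfl
        exact hd he
      simpa using this]
    refine List.map_congr_left fun e he => ?_
    have : e ≠ c := by
      rintro rfl
      exact hc he
    rw [smoothPos, if_neg this]
    rfl
  rw [smoothCode, range_split_two h hd, List.filter_append, List.map_append, hmap _ (by simp)
    (by simp; omega), List.filter_cons_of_pos (by simp; omega), List.filter_append, List.map_cons,
    List.map_append, hmap _ (by simp) (by simp), List.filter_cons_of_neg (by simp),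
    hmap _ (by simp; omega) (by simp)]
  simp [smoothPos, seg]


theorem map_switch_single {v : Passage} {l : List Passage} (h : ∀ p ∈ l, p.label ≠ v.label) :
    l.map (Passage.switch fun c => c == v.label) = l := by
  conv_rhs => rw [← List.map_id l]
  exact List.map_congr_left fun p hp => Passage.switch_of_false (by simpa using h p hp)

theorem Code.switch_single {v : Passage} {L : Code} (h : ∀ p ∈ L.flatten, p.label ≠ v.label) :
    L.switch (fun c => c == v.label) = L := by
  conv_rhs => rw [← List.map_id L]
  exact List.map_congr_left fun w hw =>
    map_switch_single fun p hp => h p (List.mem_flatten_of_mem hw hp)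

/-- The flipped crossing is written as a switch of the whole code, so that positions and components
stay the same and only the function of passages changes. -/
theorem Code.Good.expand_switch {P : LinkDiagram → RingAZ} (hP : IsSkeinPolynomial P)
    {L₁ L₂ L₃ : Code} {Y₁ Y₂ X₁ X₂ : List Passage} {v : Passage} (hv : v.isOver = false)
    (h : Code.Good (L₁ ++ (Y₁ ++ v :: Y₂) :: (L₂ ++ (X₁ ++ v.partner :: X₂) :: L₃))) :
    descend (L₁ ++ (Y₁ ++ v :: Y₂) :: (L₂ ++ (X₁ ++ v.partner :: X₂) :: L₃)) =
      C (switchCoeff v) * descend (Code.switch (fun c => c == v.label)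
        (L₁ ++ (Y₁ ++ v :: Y₂) :: (L₂ ++ (X₁ ++ v.partner :: X₂) :: L₃))) +
      X * C (smoothCoeff v) * descend (L₁ ++ (Y₁ ++ (X₂ ++ X₁ ++ Y₂)) :: (L₂ ++ L₃)) := by
  rw [Code.Good.expand hP hv h]
  have hw := h.subWF
  have hperm : List.Perm (L₁ ++ (Y₁ ++ v :: Y₂) :: (L₂ ++ (X₁ ++ v.partner :: X₂) :: L₃)).flatten
      (v :: v.partner :: (L₁.flatten ++ (Y₁ ++ (Y₂ ++ (L₂.flatten ++ (X₁ ++ (X₂ ++ L₃.flatten))))))) := by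
    grind
  have hw := hw.perm hperm
  have hlab : ∀ p ∈ L₁.flatten ++ (Y₁ ++ (Y₂ ++ (L₂.flatten ++ (X₁ ++ (X₂ ++ L₃.flatten))))),
      p.label ≠ v.label := by
    intro p hp hpv
    have hn := hw.1
    rw [List.nodup_cons, List.nodup_cons] at hn
    rcases hw.2 v (by simp) p (List.mem_cons_of_mem _ (List.mem_cons_of_mem _ hp)) hpv.symm with rfl | rfl
    · exact hn.1 (List.mem_cons_of_mem _ hp)
    · exact hn.2.1 hp
  simp only [List.mem_append, or_imp, forall_and] at hlab
  have hv1 : v.switch (fun c => c == v.label) = v.flip := by simp [Passage.switch, Passage.flip]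
  have hv2 : v.partner.switch (fun c => c == v.label) = v.flip.partner := by
    simp [Passage.switch, Passage.flip, Passage.partner]
  congr 3
  rw [Code.switch_append, Code.switch_single hlab.1]
  congr 1
  simp only [Code.switch, List.map_cons, List.map_append, hv1, hv2, map_switch_single hlab.2.1,
    map_switch_single hlab.2.2.1, map_switch_single hlab.2.2.2.2.1,
    map_switch_single hlab.2.2.2.2.2.1]
  congr 2
  · exact (Code.switch_single hlab.2.2.2.1).symm
  · congr 1
    exact (Code.switch_single hlab.2.2.2.2.2.2).symm

theorem codeOf_expand {P : LinkDiagram → RingAZ} (hP : IsSkeinPolynomial P) (h : c < d) (hd : d < m)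
    (hv : a c ≤ v) (hv' : v < b c) (hw : a d ≤ w) (hw' : w < b d) (hvw : f w = (f v).partner)
    (ho : (f v).isOver = false) (hg : (codeOf f a b m).Good) :
    descend (codeOf f a b m) = C (switchCoeff (f v)) *
        descend ((codeOf f a b m).switch fun c => c == (f v).label) +
      X * C (smoothCoeff (f v)) * descend (smoothCode f a b m c d v w) := by
  rw [smoothCode_split h hd]
  rw [codeOf_split h hd hv hv' hw hw', hvw] at hg ⊢
  exact hg.expand_switch hP ho

theorem good_smoothCode (h : c < d) (hd : d < m) (hv : a c ≤ v) (hv' : v < b c) (hw : a d ≤ w)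
    (hw' : w < b d) (hvw : f w = (f v).partner) (hg : (codeOf f a b m).Good) :
    (smoothCode f a b m c d v w).Good := by
  rw [smoothCode_split h hd]
  rw [codeOf_split h hd hv hv' hw hw', hvw] at hg
  exact hg.smooth_mixed

/-- Two passages and one component are lost. So the size bound of the first code serves for the
codes of all lower levels. -/
theorem size_smoothCode (h : c < d) (hd : d < m) (hv : a c ≤ v) (hv' : v < b c) (hw : a d ≤ w)
    (hw' : w < b d) : (smoothCode f a b m c d v w).size + 3 = (codeOf f a b m).size := by
  rw [smoothCode_split h hd, codeOf_split h hd hv hv' hw hw']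
  simp only [Code.size_append, Code.size_cons, List.length_append, List.length_cons]
  omega

end Expand

/-! ### Sorting the components -/

/-- A code given by positions, with its combinatorial data. -/
structure Layout (f : ℕ → Passage) (N : ℕ) (par : ℕ → ℕ) (a b : ℕ → ℕ) (m : ℕ) (cx : ℕ → ℤ) :
    Prop where
  sound : Sound f N
  par : IsPar f N par
  le : ∀ c < m, b c ≤ N
  index : IsIndex a b m cx
  good : (codeOf f a b m).Good

theorem Layout.switch {f : ℕ → Passage} {N : ℕ} {par : ℕ → ℕ} {a b : ℕ → ℕ} {m : ℕ} {cx : ℕ → ℤ}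
    (h : Layout f N par a b m cx) (Z : ℕ → Bool) :
    Layout (fun x => (f x).switch Z) N par a b m cx :=
  ⟨h.sound.switch Z, h.par.switch Z, h.le, h.index, by
    rw [codeOf_switch]
    exact h.good.switch Z⟩

/-- The components are being sorted: crossings at positions before `j` go over from the earlier
component, after switching the set `Z` of crossings. -/
structure Sorting (k : ℕ) (f : ℕ → Passage) (N : ℕ) (par : ℕ → ℕ) (a b : ℕ → ℕ) (m : ℕ)
    (cx : ℕ → ℤ) (Z : ℕ → Bool) (j : ℕ) (M R : RingA[X]) : Prop where
  eq : tr k (descend (codeOf f a b m)) =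
    tr k (M * descend (codeOf (fun x => (f x).switch Z) a b m) + X * R)
  sorted : ∀ x < j, ¬ Bad (fun x => (f x).switch Z) par cx x
  mixed : ∀ x < N, Z (f x).label = true → cx x ≠ cx (par x)
  unseen : ∀ x < N, j ≤ x → Z (f x).label = true → cx (par x) < cx x

/-! ### Making each component lie over the later ones -/

section Sorting

variable {k : ℕ} {f : ℕ → Passage} {N : ℕ} {par : ℕ → ℕ} {a b : ℕ → ℕ} {m : ℕ} {cx : ℕ → ℤ}
  {Z : ℕ → Bool} {j : ℕ} {M R : RingA[X]}

theorem Sorting.init : Sorting k f N par a b m cx (fun _ => false) 0 1 0 :=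
  ⟨by simp [Passage.switch], by simp, by simp, by simp⟩

/-- If the crossing at a position not yet treated has been switched already, its other passage lies
on an earlier component, so the position is bad neither before nor after the switch. Badness can
therefore be read off the original passages. -/
theorem Sorting.bad_iff (h : Sorting k f N par a b m cx Z j M R) {x : ℕ} (hx : x < N) (hj : j ≤ x) :
    Bad (fun x => (f x).switch Z) par cx x ↔ Bad f par cx x := by
  by_cases hZ : Z (f x).label = true
  · have := h.unseen x hx hj hZ
    constructor <;> rintro ⟨_, _, h3⟩ <;> omega
  · simp [Bad, Passage.switch_of_false (by simpa using hZ : Z (f x).label = false)]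

theorem Sorting.skip (h : Sorting k f N par a b m cx Z j M R)
    (hb : ¬ Bad (fun x => (f x).switch Z) par cx j) : Sorting k f N par a b m cx Z (j + 1) M R := by
  refine ⟨h.eq, fun x hx => ?_, h.mixed, fun x hx hj => h.unseen x hx (by omega)⟩
  rcases Nat.lt_succ_iff_lt_or_eq.1 hx with hx | rfl
  · exact h.sorted x hx
  · exact hb

theorem Bad.exists (hl : Layout f N par a b m cx) (hb : Bad f par cx j) (hj : j < N) :
    ∃ c d : ℕ, cx j = (c : ℤ) ∧ cx (par j) = (d : ℤ) ∧ c < d ∧ d < m ∧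
      a c ≤ j ∧ j < b c ∧ a d ≤ par j ∧ par j < b d ∧
      f (par j) = (f j).partner ∧ par j ≠ j := by
  obtain ⟨ho, h0, h1⟩ := hb
  obtain ⟨c, hc, hc1, hc2⟩ := hl.index.exists_of_nonneg j h0
  obtain ⟨d, hd, hd1, hd2⟩ := hl.index.exists_of_nonneg (par j) (h0.trans h1.le)
  have e1 := hl.index.mem c hc j hc1 hc2
  have e2 := hl.index.mem d hd _ hd1 hd2
  have hne : par j ≠ j := fun h => by rw [h] at h1; omega
  exact ⟨c, d, e1, e2, by omega, hd, hc1, hc2, hd1, hd2, hl.par.partner hl.sound hj hne, hne⟩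

/-- Switch one more crossing. -/
def toggle (Z : ℕ → Bool) (l : ℕ) : ℕ → Bool := fun c => Z c ^^ (c == l)

theorem Passage.switch_toggle (Z : ℕ → Bool) (l : ℕ) (p : Passage) :
    p.switch (toggle Z l) = (p.switch Z).switch fun c => c == l := by
  unfold Passage.switch toggle
  cases hZ : Z p.label <;> by_cases hl : p.label = l <;> subst_vars <;> simp [*]

/-- One skein expansion at position `j`: the switch coefficient goes into `M`, the smoothed code
with its factor `X` into `R`. Therefore `F` and `R'` are required only modulo one power of `X` less.
-/
theorem Sorting.switch (hl : Layout f N par a b m cx) {P : LinkDiagram → RingAZ}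
    (hP : IsSkeinPolynomial P) (h : Sorting k f N par a b m cx Z j M R)
    (hb : Bad (fun x => (f x).switch Z) par cx j) (hj : j < N) {c d : ℕ} (hc : cx j = c)
    (hd : cx (par j) = d) {M' R' F : RingA[X]}
    (hM : tr k M' = tr k (M * C (switchCoeff ((f j).switch Z))))
    (hF : ∀ k', k = k' + 1 → tr k' F =
      tr k' (descend (smoothCode (fun x => (f x).switch Z) a b m c d j (par j))))
    (hR : ∀ k', k = k' + 1 → tr k' R' = tr k' (R + M * C (smoothCoeff ((f j).switch Z)) * F)) :
    Sorting k f N par a b m cx (toggle Z (f j).label) (j + 1) M' R' := by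
  obtain ⟨c', d', hc', hd', hcd, hdm, h1, h2, h3, h4, h5, hne⟩ := hb.exists (hl.switch Z) hj
  obtain rfl : c' = c := by omega
  obtain rfl : d' = d := by omega
  have hlab : ∀ x < N, (f x).label = (f j).label → x = j ∨ x = par j := by
    intro x hx hxl
    by_cases hxj : x = j
    · exact Or.inl hxj
    · exact Or.inr (hl.par.eq j hj x hx hxj hxl).symm
  have hfun : (fun x => (f x).switch (toggle Z (f j).label)) =
      fun x => ((f x).switch Z).switch fun c => c == ((f j).switch Z).label := by
    funext x
    rw [Passage.switch_toggle, Passage.label_switch]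
  have hother : ∀ x < N, x ≠ j → x ≠ par j →
      (f x).switch (toggle Z (f j).label) = (f x).switch Z := by
    intro x hx h1 h2
    rw [Passage.switch_toggle]
    refine Passage.switch_of_false ?_
    rw [Passage.label_switch, beq_eq_false_iff_ne]
    exact fun h => (hlab x hx h).elim h1 h2
  have hZother : ∀ x < N, x ≠ j → x ≠ par j → toggle Z (f j).label (f x).label = Z (f x).label := by
    intro x hx h1 h2
    have : ((f x).label == (f j).label) = false :=
      beq_eq_false_iff_ne.2 fun h => (hlab x hx h).elim h1 h2
    simp only [toggle, this, Bool.xor_false]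
  have hpp := hl.par.par_par hj
  refine ⟨?_, ?_, ?_, ?_⟩
  · have he := codeOf_expand hP hcd hdm h1 h2 h3 h4 h5 hb.1 (hl.switch Z).good
    rw [← codeOf_switch] at he
    rw [h.eq, he, hfun]
    have e1 : ∀ s S m₀ T : RingA[X], M * (s * S + X * m₀ * T) + X * R =
        M * s * S + X * (R + M * m₀ * T) := by intros; ring
    rw [e1]
    refine tr_congr_add (tr_congr_mul hM.symm rfl) ?_
    rcases k with _ | k
    · rw [tr_zero_X_mul, tr_zero_X_mul]
    · refine tr_succ_X_mul ?_
      rw [hR k rfl]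
      exact tr_congr_add rfl (tr_congr_mul rfl (hF k rfl).symm)
  -- At `j` the passage is now over; the partner of `j` lies on a later component than its own
  -- partner and cannot be bad; all other passages are unchanged.
  · intro x hx hbx
    have hxN : x < N := by omega
    by_cases hxj : x = j
    · subst hxj
      have hb1 := hbx.1
      have hb2 := hb.1
      rw [hfun] at hb1
      simp only [Passage.switch, beq_self_eq_true, if_true] at hb1 hb2
      split_ifs at hb1 hb2 <;> simp_all
    · by_cases hxp : x = par j
      · have := hbx.2.2
        rw [hxp, hpp] at this
        have := hb.2.2
        omega
      · refine h.sorted x (by omega) ?_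
        simpa only [Bad, hother x hxN hxj hxp] using hbx
  · intro x hx hZx
    by_cases hxj : x = j
    · have := hb.2.2
      rw [hxj]
      omega
    · by_cases hxp : x = par j
      · rw [hxp, hpp]
        have := hb.2.2
        omega
      · rw [hZother x hx hxj hxp] at hZx
        exact h.mixed x hx hZx
  · intro x hx hjx hZx
    by_cases hxp : x = par j
    · rw [hxp, hpp]
      exact hb.2.2
    · rw [hZother x hx (by omega) hxp] at hZx
      exact h.unseen x hx (by omega) hZx

/-- At level zero the smoothings vanish and sorting only multiplies by switch coefficients. A
crossing is unswitched when its bad position is reached, so the coefficients are those of the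
original passages. -/
theorem exists_sorting (hl : Layout f N par a b m cx) {P : LinkDiagram → RingAZ}
    (hP : IsSkeinPolynomial P) (T : ℕ → RingA[X])
    (hT : ∀ x, (Bad f par cx x → T x = C (switchCoeff (f x))) ∧ (¬ Bad f par cx x → T x = 1))
    (n : ℕ) (hn : n ≤ N) :
    ∃ Z, Sorting 0 f N par a b m cx Z n (∏ x ∈ Finset.range n, T x) 0 := by
  induction n with
  | zero => exact ⟨_, by simpa using Sorting.init⟩
  | succ n ih =>
    obtain ⟨Z, hZ⟩ := ih (by omega)
    rw [Finset.prod_range_succ]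
    have hiff := hZ.bad_iff (x := n) (by omega) le_rfl
    by_cases hb : Bad f par cx n
    · have hZn : Z (f n).label = false := by
        by_contra hne
        have := hZ.unseen n (by omega) le_rfl (by simpa using hne)
        have := hb.2.2
        omega
      obtain ⟨c, d, hc, hd, -⟩ := (hiff.2 hb).exists (hl.switch Z) (by omega)
      refine ⟨_, hZ.switch (M' := _) (R' := 0) (F := 0) hl hP (hiff.2 hb) (by omega) hc hd ?_ (by simp) (by simp)⟩
      rw [(hT n).1 hb, Passage.switch_of_false hZn]
    · rw [(hT n).2 hb, mul_one]
      exact ⟨Z, hZ.skip (mt hiff.1 hb)⟩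

/-- Sorted components are evaluated separately. -/
theorem descend_of_sorted (hidx : IsIndex a b m cx) (hpar : IsPar f N par) (hle : ∀ c < m, b c ≤ N)
    (hs : ∀ x < N, ¬ Bad f par cx x) (n : ℕ) (hn : n + 1 ≤ m) :
    descend (codeOf f a b (n + 1)) = descend [seg f (a 0) (b 0)] *
      ∏ c ∈ Finset.range n, (C circleValue * descend [seg f (a (c + 1)) (b (c + 1))]) := by
  induction n with
  | zero => simp [codeOf]
  | succ n ih =>
    rw [codeOf_succ, descend_append, ih (by omega), Finset.prod_range_succ]
    · ring
    · simp [codeOf]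
    · simp
    · intro p hp hp'
      obtain ⟨c, hc, x, hx, hx', rfl⟩ := mem_codeOf.1 hp
      simp only [List.flatten_cons, List.flatten_nil, List.append_nil, mem_seg] at hp'
      obtain ⟨y, hy, hy', hxy⟩ := hp'
      have h1 := hidx.mem c (by omega) x hx hx'
      have h2 := hidx.mem (n + 1) (by omega) y hy hy'
      have hxN : x < N := hx'.trans_le (hle c (by omega))
      have h3 := hpar.eq_of_partner hxN (hy'.trans_le (hle _ (by omega))) hxy
      by_contra ho
      exact hs x hxN ⟨by simpa using ho, by omega, by rw [h3]; omega⟩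

/-- Only crossings of different components are switched during sorting; seen from one component
their passages are unpaired. -/
theorem descend_seg_switch (hl : Layout f N par a b m cx)
    (hZ : ∀ x < N, Z (f x).label = true → cx x ≠ cx (par x)) {c : ℕ} (hc : c < m) :
    descend [seg (fun x => (f x).switch Z) (a c) (b c)] = descend [seg f (a c) (b c)] := by
  rw [seg_switch]
  refine descend_switch Z [seg f (a c) (b c)] fun p hp hZp hpp => ?_
  simp only [List.flatten_cons, List.flatten_nil, List.append_nil, mem_seg] at hp hpp
  obtain ⟨x, hx, hx', rfl⟩ := hp
  obtain ⟨y, hy, hy', hxy⟩ := hpp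
  have hxN := hx'.trans_le (hl.le c hc)
  refine hZ x hxN hZp ?_
  rw [hl.par.eq_of_partner hxN (hy'.trans_le (hl.le c hc)) hxy, hl.index.mem c hc x hx hx',
    hl.index.mem c hc y hy hy']

theorem Sorting.finish (hl : Layout f N par a b m cx) (h : Sorting k f N par a b m cx Z N M R)
    {n : ℕ} (hm : m = n + 1) : tr k (descend (codeOf f a b m)) =
      tr k (M * (descend [seg f (a 0) (b 0)] * ∏ c ∈ Finset.range n,
        (C circleValue * descend [seg f (a (c + 1)) (b (c + 1))])) + X * R) := by
  have hl' := hl.switch Z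
  subst hm
  rw [h.eq, descend_of_sorted hl'.index hl'.par hl'.le h.sorted n le_rfl,
    descend_seg_switch hl h.mixed (by omega)]
  congr 4
  refine Finset.prod_congr rfl fun c hc => ?_
  rw [Finset.mem_range] at hc
  rw [descend_seg_switch hl h.mixed (by omega)]

end Sorting

end Skein

namespace Skein

open Polynomial Function

/-! ### Evaluation of arcs -/

section Arc

variable {f : ℕ → Passage} {N : ℕ} {par : ℕ → ℕ} {a b : ℕ → ℕ} {m : ℕ} {c p q : ℕ}

theorem descend_seg_skip (hpar : IsPar f N par) (hp : p < q) (hq : q ≤ N)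
    (h : (f p).isOver = true ∨ par p ≤ p ∨ q ≤ par p) :
    descend [seg f p q] = descend [seg f (p + 1) q] := by
  rw [seg_cons hp]
  by_cases ho : (f p).isOver = true
  · exact descend_over ho
  · refine descend_unpaired fun hm => ?_
    simp only [List.flatten_cons, List.flatten_nil, List.append_nil, mem_seg] at hm
    obtain ⟨x, hx, hx', hxp⟩ := hm
    have := hpar.eq_of_partner (by omega) (by omega) hxp
    rcases h with h | h | h
    · exact ho h
    · omega
    · omega

theorem seg_split_three {s : ℕ} (hp : p < s) (hs : s < q) :
    seg f p q = f p :: (seg f (p + 1) s ++ f s :: seg f (s + 1) q) := by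
  rw [seg_cons (hp.trans hs), seg_split hp hs]

/-- This makes a table possible: the switched arc and the two arcs of the smoothing are intervals of
positions inside the same component. -/
theorem descend_seg_expand (hpar : IsPar f N par) (hs : Sound f N) (hq : q ≤ N)
    (ho : (f p).isOver = false) (hps : p < par p) (hsq : par p < q) :
    descend [seg f p q] = C (switchCoeff (f p)) * descend [seg f (p + 1) q] +
      C (smoothCoeff (f p)) * descend [seg f (par p + 1) q, seg f (p + 1) (par p)] := by
  have hpN : p < N := by omega
  have hpp := hpar.partner hs hpN (by omega)
  rw [seg_split_three hps hsq, hpp, descend_self ho, ← hpp, ← seg_split (by omega) hsq]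
  rw [mem_seg]
  rintro ⟨x, hx, hx', hxp⟩
  have := hpar.eq_of_partner hpN (by omega) hxp
  omega

theorem good_seg_pair (hpar : IsPar f N par) (hs : Sound f N) (hg : (codeOf f a b m).Good)
    (hc : c < m) (ha : a c ≤ p) (hq : q ≤ b c) (hN : b c ≤ N) (hps : p < par p) (hsq : par p < q) :
    Code.Good [seg f (par p + 1) q, seg f (p + 1) (par p)] := by
  have hpp := hpar.partner hs (show p < N by omega) (by omega)
  have e1 : seg f (a c) (b c) = seg f (a c) p ++ (f p :: (seg f (p + 1) (par p) ++
      (f p).partner :: (seg f (par p + 1) q ++ seg f q (b c)))) := by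
    rw [← hpp, seg_append (by omega) hq, ← seg_split_three hps (by omega), seg_append ha (by omega)]
  rw [codeOf, range_split hc, List.map_append, List.map_cons, e1] at hg
  exact hg.smooth_self

theorem codeOf_two (h0 : a 0 = p) (h0' : b 0 = q) {r s : ℕ} (h1 : a 1 = r) (h1' : b 1 = s) :
    codeOf f a b 2 = [seg f p q, seg f r s] := by
  subst h0 h0' h1 h1'
  rfl

/-- The factor of a passage on the first of two arcs `s + 1, …` and `p + 1, …, s - 1`, for sorting
them at level zero. -/
noncomputable def arcFactor (f : ℕ → Passage) (par : ℕ → ℕ) (p s x : ℕ) : RingA[X] :=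
  if (f x).isOver = false ∧ p < par x ∧ par x < s then C (switchCoeff (f x)) else 1

/-- At level zero, sorting the two arcs costs a product over the positions of the first one. Passing
from `q` to `q + 1` adds a single factor, so a table entry takes constant time. -/
theorem tr_zero_pair {P : LinkDiagram → RingAZ} (hP : IsSkeinPolynomial P) (hpar : IsPar f N par)
    (hs : Sound f N) (hq : q ≤ N) {s : ℕ} (hsq : s < q)
    (hg : Code.Good [seg f (s + 1) q, seg f (p + 1) s]) :
    tr 0 (descend [seg f (s + 1) q, seg f (p + 1) s]) =
      tr 0 ((∏ x ∈ Finset.Ico (s + 1) q, arcFactor f par p s x) *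
        (descend [seg f (s + 1) q] * (C circleValue * descend [seg f (p + 1) s]))) := by
  let a : ℕ → ℕ := fun c => if c = 0 then s + 1 else p + 1
  let b : ℕ → ℕ := fun c => if c = 0 then q else s
  let cx : ℕ → ℤ := fun x => if s + 1 ≤ x ∧ x < q then 0 else if p + 1 ≤ x ∧ x < s then 1 else -1
  have hab : codeOf f a b 2 = [seg f (s + 1) q, seg f (p + 1) s] := codeOf_two rfl rfl rfl rfl
  have hl : Layout f N par a b 2 cx := by
    refine ⟨hs, hpar, ?_, ⟨?_, ?_⟩, by rwa [hab]⟩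
    · intro c hc
      interval_cases c <;> simp [b] <;> omega
    · grind
    · intro x hx
      simp only [cx] at hx
      split_ifs at hx with h1 h2
      · exact ⟨0, by omega, h1⟩
      · exact ⟨1, by omega, h2⟩
      · omega
  have hbad : ∀ x, Bad f par cx x ↔ (s + 1 ≤ x ∧ x < q) ∧ (f x).isOver = false ∧ p < par x ∧ par x < s := by
    intro x
    simp only [Bad, cx]
    grind
  obtain ⟨Z, hZ⟩ := exists_sorting hl hP
    (fun x => if s + 1 ≤ x ∧ x < q then arcFactor f par p s x else 1) (fun x => by
      refine ⟨fun h => ?_, fun h => ?_⟩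
      · rw [hbad] at h
        rw [if_pos h.1, arcFactor, if_pos h.2]
      · rw [hbad] at h
        split_ifs with h1
        · rw [arcFactor, if_neg fun h2 => h ⟨h1, h2⟩]
        · rfl) N le_rfl
  have := hZ.finish hl (n := 1) rfl
  rw [hab] at this
  rw [this, ← Finset.prod_filter]
  have e : Finset.filter (fun x => s + 1 ≤ x ∧ x < q) (Finset.range N) = Finset.Ico (s + 1) q := by
    grind
  rw [e, mul_zero, add_zero]
  simp [a, b]

end Arc

/-! ### Codes as positions -/

theorem exists_positions (D : Code) : ∃ (f : ℕ → Passage) (a b : ℕ → ℕ),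
    codeOf f a b D.length = D ∧ (∀ x (hx : x < D.flatten.length), f x = D.flatten[x]) ∧
    (∀ c, a c = (D.take c).flatten.length) ∧ ∀ c, b c = (D.take (c + 1)).flatten.length := by
  let f : ℕ → Passage := fun x => D.flatten.getD x ⟨0, true, true⟩
  have hf : ∀ x (hx : x < D.flatten.length), f x = D.flatten[x] := fun x hx => by
    simp [f, List.getD_eq_getElem?_getD, List.getElem?_eq_getElem hx]
  refine ⟨f, _, _, ?_, hf, fun _ => rfl, fun _ => rfl⟩
  refine List.ext_getElem (by simp [codeOf]) fun c hc hc' => ?_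
  simp only [codeOf, List.getElem_map, List.getElem_range]
  have e1 : D.take (c + 1) = D.take c ++ [D[c]] := by simp
  have e2 : D.flatten = (D.take c).flatten ++ (D[c] ++ (D.drop (c + 1)).flatten) := by
    conv_lhs => rw [← List.take_append_drop (c + 1) D, e1]
    grind
  have e3 : (D.take (c + 1)).flatten.length = (D.take c).flatten.length + D[c].length := by
    grind
  refine List.ext_getElem (by rw [length_seg, e3]; omega) fun x hx hx' => ?_
  have hlt : (D.take c).flatten.length + x < D.flatten.length := by
    grind
  simp only [seg, List.getElem_map, List.Ico, List.getElem_range']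
  grind

/-- The index of the last interval that contains a position. -/
def indexOf (a b : ℕ → ℕ) : ℕ → ℕ → ℤ
  | 0, _ => -1
  | c + 1, x => if a c ≤ x ∧ x < b c then c else indexOf a b c x

theorem indexOf_nonneg {a b : ℕ → ℕ} {m x : ℕ} (h : 0 ≤ indexOf a b m x) :
    ∃ c < m, a c ≤ x ∧ x < b c := by
  induction m with
  | zero => simp [indexOf] at h
  | succ m ih =>
    rw [indexOf] at h
    grind

theorem disjoint_of_nodup {f : ℕ → Passage} {a b : ℕ → ℕ} {m c d x : ℕ}
    (h : (codeOf f a b m).flatten.Nodup) (hcd : c < d) (hd : d < m) (hc : a c ≤ x ∧ x < b c)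
    (hx : a d ≤ x ∧ x < b d) : False := by
  have := (List.pairwise_iff_getElem.1 (List.nodup_flatten.1 h).2) c d
    (by rw [length_codeOf]; omega) (by rw [length_codeOf]; omega) hcd
  simp only [codeOf, List.getElem_map, List.getElem_range] at this
  exact this (mem_seg.2 ⟨x, hc.1, hc.2, rfl⟩) (mem_seg.2 ⟨x, hx.1, hx.2, rfl⟩)

theorem isIndex_indexOf {f : ℕ → Passage} {a b : ℕ → ℕ} {m : ℕ}
    (h : (codeOf f a b m).flatten.Nodup) : IsIndex a b m (indexOf a b m) := by
  refine ⟨fun c hc x hx hx' => ?_, fun x hx => indexOf_nonneg hx⟩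
  have : ∀ n, c < n → n ≤ m → indexOf a b n x = c := by
    intro n
    induction n with
    | zero => omega
    | succ n ih =>
      intro hcn hnm
      rw [indexOf]
      split_ifs with h1
      · rcases Nat.lt_succ_iff_lt_or_eq.1 hcn with h2 | rfl
        · exact (disjoint_of_nodup h h2 hnm ⟨hx, hx'⟩ h1).elim
        · rfl
      grind
  exact this m hc le_rfl

/-- The last other position below `n` with the same label, or the position itself. -/
def parOf (f : ℕ → Passage) : ℕ → ℕ → ℕ
  | 0, x => x
  | n + 1, x => if (f x).label = (f n).label ∧ x ≠ n then n else parOf f n x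

theorem parOf_spec (f : ℕ → Passage) (n x : ℕ) :
    (parOf f n x = x ∧ ∀ y < n, y ≠ x → (f y).label ≠ (f x).label) ∨
      (parOf f n x < n ∧ parOf f n x ≠ x ∧ (f (parOf f n x)).label = (f x).label) := by
  induction n with
  | zero => simp [parOf]
  | succ n ih =>
    rw [parOf]
    grind

theorem isPar_parOf {f : ℕ → Passage} {N : ℕ} (h : Sound f N) : IsPar f N (parOf f N) := by
  refine ⟨fun x hx => ?_, fun x hx => ?_, fun x hx y hy hyx hl => ?_⟩
  · rcases parOf_spec f N x with ⟨h1, -⟩ | ⟨h1, -⟩ <;> omega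
  · rcases parOf_spec f N x with ⟨h1, -⟩ | ⟨-, -, h1⟩
    · rw [h1]
    · exact h1
  · rcases parOf_spec f N x with ⟨-, h2⟩ | ⟨h1, h2, h3⟩
    · exact (h2 y hy hyx hl).elim
    · refine h.eq h1 hy ?_
      rw [h.partner hx h1 h2.symm h3.symm, h.partner hx hy hyx.symm hl.symm]

end Skein

namespace Skein

open Polynomial Function

variable {inp : ℕ → ℤ} {N Y k n m s₀ : ℕ} {S : Store} {Q : Store → Prop}
  {f : ℕ → Passage} {par a b : ℕ → ℕ} {link : ℕ → Cmd}

/-! ### Loops and tests -/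

infixr:60 " ;; " => Cmd.seq

/-- For all values of `i` from `lo` to `hi - 1`. The number of rounds is kept in `n`. -/
@[simp] def Cmd.loop (i n lo hi : Name) (c : Cmd) : Cmd :=
  .op (.sub n hi lo) ;; .op (.addc i lo 0) ;; .rep n (c ;; .op (.addc i i 1))

/-- A test for equality. -/
@[simp] def Cmd.ifEq (x y : Name) (c d : Cmd) : Cmd := .ifLt x y d (.ifLt y x d c)

/-- A command that only changes a variable that is not used. -/
@[simp] def Cmd.skip (k : ℕ) : Cmd := .op (.const (k, 39) 0)

theorem WP.seq {c d : Cmd} (h : WP inp N Y c (WP inp N Y d Q) S) :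
    WP inp N Y (c ;; d) Q S := h

theorem WP.ifEq {x y : Name} {c d : Cmd} (h : S.v x = S.v y → WP inp N Y c Q S) (h' : S.v x ≠ S.v y → WP inp N Y d Q S) :
    WP inp N Y (.ifEq x y c d) Q S :=
  ⟨fun h1 => h' h1.ne, fun h1 => ⟨fun h2 => h' h2.ne', fun h2 => h (le_antisymm h2 h1)⟩⟩

theorem WP.skip (h : Q { S with v := update S.v (k, 39) 0 }) : WP inp N Y (.skip k) Q S :=
  ⟨by simp, h⟩

/-- All targets of an assignment satisfy `P`. -/
@[simp] def Op.Within (P : ℕ → Name → Prop) : Op → Prop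
  | const x _ => P 0 x
  | add x _ _ => P 0 x
  | sub x _ _ => P 0 x
  | addc x _ _ => P 0 x
  | load x _ _ => P 0 x
  | store α _ _ => P 1 α
  | input x _ => P 0 x
  | pconst x _ => P 2 x
  | padd x _ _ => P 2 x
  | pmul _ x _ _ => P 2 x
  | pload x _ _ _ => P 2 x
  | pstore α _ _ _ => P 3 α

/-- All targets of a command satisfy `P`. -/
@[simp] def Cmd.Within (P : ℕ → Name → Prop) : Cmd → Prop
  | op o => o.Within P
  | seq c d => c.Within P ∧ d.Within P
  | ifLt _ _ c d => c.Within P ∧ d.Within P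
  | rep _ c => c.Within P

theorem Cmd.Within.changes {P : ℕ → Name → Prop} {c : Cmd} (h : c.Within P) :
    ∀ t y, c.Changes t y → P t y := by
  induction c with
  | op o =>
    intro t y hy
    cases o <;> obtain ⟨rfl, rfl⟩ := hy <;> exact h
  | seq c d ihc ihd => exact fun t y hy => hy.elim (ihc h.1 t y) (ihd h.2 t y)
  | ifLt x x' c d ihc ihd => exact fun t y hy => hy.elim (ihc h.1 t y) (ihd h.2 t y)
  | rep x c ihc => exact ihc h

theorem Agree.run {P : ℕ → Name → Prop} {S' : Store} (h : Agree P S S') (o : Op)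
    (ho : o.Within P) : Agree P S (o.run inp S') :=
  h.trans ((o.agree S').mono (Cmd.Within.changes (c := .op o) ho))

theorem Cmd.Within.mono {P P' : ℕ → Name → Prop} {c : Cmd} (h : c.Within P)
    (hP : ∀ t y, P t y → P' t y) : c.Within P' := by
  induction c with
  | op o => cases o <;> exact hP _ _ h
  | seq c d ihc ihd => exact ⟨ihc h.1, ihd h.2⟩
  | ifLt x x' c d ihc ihd => exact ⟨ihc h.1, ihd h.2⟩
  | rep x c ihc => exact ihc h

theorem WP.frame {P : ℕ → Name → Prop} {c : Cmd} (h : WP inp N Y c Q S) (hP : c.Within P) :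
    WP inp N Y c (fun S' => Q S' ∧ Agree P S S') S :=
  h.agree.mono fun _ h => ⟨h.1, h.2.mono hP.changes⟩

/-- The rule for loops with a counter. -/
theorem WP.loop {i n lo hi : Name} {c : Cmd} (a b : ℕ)
    (I : ℕ → Store → Prop) (P : ℕ → Name → Prop) (hlo : S.v lo = a) (hhi : S.v hi = b)
    (hab : a ≤ b) (hb : b ≤ N)
    (hi1 : i ≠ n) (hn : n ≠ lo) (hi2 : c.Within fun t y => t = 0 → y ≠ i) (hP : (Cmd.loop i n lo hi c).Within P)
    (hI : ∀ (j : ℕ) v v' ar pv pa, (∀ y, y ≠ i → y ≠ n → v' y = v y) → I j ⟨v, ar, pv, pa⟩ →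
      I j ⟨v', ar, pv, pa⟩)
    (h0 : I a S)
    (hs : ∀ j, a ≤ j → j < b → ∀ S', I j S' → Agree P S S' → S'.v i = j → WP inp N Y c (I (j + 1)) S')
    (hQ : ∀ S', I b S' → Agree P S S' → Q S') :
    WP inp N Y (.loop i n lo hi c) Q S := by
  obtain ⟨hPn, hPi, hPc, -⟩ := hP
  have hPi : P 0 i := hPi
  have hPn : P 0 n := hPn
  refine ⟨show |S.v hi - S.v lo| ≤ (N : ℤ) by rw [hlo, hhi, abs_le]; omega, ⟨show |(0 : ℤ)| ≤ N by simp, ?_⟩, ?_⟩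
  · simp only [Op.run]
    rw [update_of_ne hn.symm, hlo, abs_le]
    omega
  simp only [Op.run]
  -- After `j` rounds the loop variable is `a + j`. It is advanced after the body, so `I` must not
  -- depend on it or on the number of rounds.
  refine WP.rep (b - a) (fun j S' => I (a + j) S' ∧ S'.v i = ((a + j : ℕ) : ℤ) ∧ Agree P S S') ?_ ?_ ?_ ?_
  · simp only
    rw [update_of_ne hi1.symm, update_self, hlo, hhi]
    omega
  · refine ⟨hI _ S.v _ _ _ _ (fun y h1 h2 => ?_) h0, ?_, ⟨fun y hy => ?_, fun _ _ => rfl, fun _ _ => rfl, fun _ _ => rfl⟩⟩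
    all_goals grind
  · rintro j hj S' ⟨h1, h2, h3⟩
    have := (hs (a + j) (by omega) (by omega) S' h1 h3 h2).agree
    refine this.mono fun S'' ⟨h4, h5⟩ => ?_
    have h6 : S''.v i = ((a + j : ℕ) : ℤ) := (h5.v i fun h => hi2.changes _ _ h rfl rfl).trans h2
    simp only [WP, Op.run, Op.Ok]
    refine ⟨⟨?_, ?_⟩, hI _ S''.v _ _ _ _ (fun y h1 h2 => ?_) h4, ?_, ?_⟩
    · rw [abs_le]
      omega
    · rw [h6, abs_le]
      omega
    · rw [update_of_ne h1]
    · rw [update_self, h6]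
      push_cast
      ring
    · refine (h3.trans (h5.mono hPc.changes)).trans
        ⟨fun y hy => ?_, fun _ _ => rfl, fun _ _ => rfl, fun _ _ => rfl⟩
      grind
  grind

/-! ### Codes in the store -/

/-- The number of an over or under passage. -/
def Passage.height (p : Passage) : ℤ := if p.isOver then 1 else 0

/-- Three arrays describe a sequence of passages. -/
def Shows (lab ov sg : ℕ → ℤ) (f : ℕ → Passage) (n : ℕ) : Prop :=
  ∀ x < n, lab x = (f x).label ∧ ov x = (f x).height ∧ sg x = (f x).sign

/-- The passages stored at a level. -/
def Store.Rows (S : Store) (k : ℕ) (l : List Passage) : Prop :=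
  S.v (k, 0) = l.length ∧ ∀ x (hx : x < l.length), S.a (k, 0) x = l[x].label ∧
    S.a (k, 1) x = l[x].height ∧ S.a (k, 2) x = l[x].sign

/-- The ends of the components stored at a level. -/
def Store.Ends (S : Store) (k : ℕ) (D : Code) : Prop :=
  S.v (k, 1) = D.length ∧ ∀ c < D.length, S.a (k, 3) c = (D.take c).flatten.length ∧
    S.a (k, 4) c = (D.take (c + 1)).flatten.length

theorem Store.Rows.shows {l : List Passage} (h : S.Rows k l)
    (hf : ∀ x (hx : x < l.length), f x = l[x]) :
    Shows (S.a (k, 0)) (S.a (k, 1)) (S.a (k, 2)) f l.length := fun x hx => by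
  rw [hf x hx]
  exact h.2 x hx

theorem Store.Rows.append {S' : Store} {l : List Passage} {p : Passage} (h : S.Rows k l)
    (hv : S'.v (k, 0) = S.v (k, 0) + 1)
    (h0 : S'.a (k, 0) = update (S.a (k, 0)) l.length p.label)
    (h1 : S'.a (k, 1) = update (S.a (k, 1)) l.length p.height)
    (h2 : S'.a (k, 2) = update (S.a (k, 2)) l.length p.sign) : S'.Rows k (l ++ [p]) := by
  refine ⟨by rw [hv, h.1]; simp, fun x hx => ?_⟩
  rw [List.length_append, List.length_singleton] at hx
  rw [h0, h1, h2]
  rcases Nat.lt_succ_iff_lt_or_eq.1 hx with hx | rfl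
  · rw [update_of_ne hx.ne, update_of_ne hx.ne, update_of_ne hx.ne,
      List.getElem_append_left hx]
    exact h.2 x hx
  · simp

theorem Store.Ends.append {S' : Store} {D : Code} {w : List Passage} (h : S.Ends k D)
    (hv : S'.v (k, 1) = S.v (k, 1) + 1)
    (h3 : S'.a (k, 3) = update (S.a (k, 3)) D.length D.flatten.length)
    (h4 : S'.a (k, 4) = update (S.a (k, 4)) D.length (D ++ [w]).flatten.length) :
    S'.Ends k (D ++ [w]) := by
  refine ⟨by rw [hv, h.1]; simp, fun c hc => ?_⟩
  rw [List.length_append, List.length_singleton] at hc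
  rw [h3, h4]
  rcases Nat.lt_succ_iff_lt_or_eq.1 hc with hc | rfl
  · rw [update_of_ne hc.ne, update_of_ne hc.ne, List.take_append_of_le_length hc.le,
      List.take_append_of_le_length hc]
    exact h.2 c hc
  · simp

/-! ### Copying passages to the previous level -/

/-- Append the passages from `lo` to `hi` of level `k + 1`, with the current switches, to level `k`. -/
def copyArc (k : ℕ) (lo hi : Name) : Cmd :=
  .loop (k + 1, 20) (k + 1, 21) lo hi
    (.op (.load (k + 1, 22) (k + 1, 0) (k + 1, 20)) ;; .op (.store (k, 0) (k, 0) (k + 1, 22)) ;;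
      .op (.load (k + 1, 22) (k + 1, 7) (k + 1, 20)) ;; .op (.store (k, 1) (k, 0) (k + 1, 22)) ;;
      .op (.load (k + 1, 22) (k + 1, 8) (k + 1, 20)) ;; .op (.store (k, 2) (k, 0) (k + 1, 22)) ;;
      .op (.addc (k, 0) (k, 0) 1))

theorem copyArc_within (k : ℕ) (lo hi : Name) : (copyArc k lo hi).Within fun t y =>
    (t ≤ 1 ∧ y.1 = k ∧ (t = 1 ∨ y.2 = 0) ∧ y.2 ≤ 2) ∨ (t = 0 ∧ y.1 = k + 1 ∧ 20 ≤ y.2 ∧ y.2 < 23) := by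
  simp [copyArc]

/-- Arrays `7` and `8` hold the current heights and signs, with the switches made so far; the labels
in array `0` never change. -/
theorem copyArc_spec {lo hi : Name} {l : List Passage}
    {a b : ℕ} (hS : S.Rows k l)
    (hf : Shows (S.a (k + 1, 0)) (S.a (k + 1, 7)) (S.a (k + 1, 8)) f n)
    (hlo : S.v lo = a) (hhi : S.v hi = b) (hab : a ≤ b) (hb : b ≤ n) (hn : n ≤ N)
    (hlN : l.length + (b - a) ≤ N) (hne : lo ≠ (k + 1, 21))
    (hQ : ∀ S', S'.Rows k (l ++ seg f a b) → Agree (fun t y =>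
      (t ≤ 1 ∧ y.1 = k ∧ (t = 1 ∨ y.2 = 0) ∧ y.2 ≤ 2) ∨ (t = 0 ∧ y.1 = k + 1 ∧ 20 ≤ y.2 ∧ y.2 < 23)) S S' → Q S') :
    WP inp N Y (copyArc k lo hi) Q S := by
  refine WP.loop a b (fun j S' => S'.Rows k (l ++ seg f a j)) _ hlo hhi hab (hb.trans hn) (by simp)
    hne.symm (by simp) (copyArc_within k lo hi) ?_ (by simpa [seg_self] using hS) ?_ hQ
  · intro j v v' ar pv pa hv h
    exact ⟨(hv _ (by simp) (by simp)).trans h.1, h.2⟩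
  · intro j haj hj S' hR hA hj'
    have e0 : S'.a (k + 1, 0) = S.a (k + 1, 0) := hA.a _
    have e7 : S'.a (k + 1, 7) = S.a (k + 1, 7) := hA.a _
    have e8 : S'.a (k + 1, 8) = S.a (k + 1, 8) := hA.a _
    obtain ⟨g0, g1, g2⟩ := hf j (by omega)
    obtain ⟨L, hL⟩ : ∃ L, L = (l ++ seg f a j).length := ⟨_, rfl⟩
    have hL' : L = l.length + (j - a) := by rw [hL, List.length_append, length_seg]
    have hv := hR.1
    rw [← hL] at hv
    have hN : |(L : ℤ) + 1| ≤ N := by rw [abs_le]; omega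
    have h1 : 1 ≤ N := by omega
    simp [WP, hj', hv, e0, e7, e8, g0, g1, g2, h1, hN]
    rw [show seg f a (j + 1) = seg f a j ++ [f j] by
      rw [seg_split haj (Nat.lt_succ_self j), seg_self], ← List.append_assoc]
    refine hR.append ?_ ?_ ?_ ?_ <;> simp [hv, ← hL]

/-! ### Building a smoothed code at the previous level -/

theorem smoothCode_succ (f : ℕ → Passage) (a b : ℕ → ℕ) (e c d v w : ℕ) :
    smoothCode f a b (e + 1) c d v w = smoothCode f a b e c d v w ++
      if e = d then [] else [(smoothPos a b c d v w e).map f] := by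
  by_cases h : e = d <;> simp [smoothCode, List.range_succ, h]

theorem size_smoothCode_mono (f : ℕ → Passage) (a b : ℕ → ℕ) {e : ℕ} (c d v w : ℕ) (h : e ≤ m) :
    (smoothCode f a b e c d v w).size ≤ (smoothCode f a b m c d v w).size := by
  induction m, h using Nat.le_induction with
  | base => rfl
  | succ m _ ih =>
    rw [smoothCode_succ, Code.size_append]
    omega

/-- Build, at level `k`, the smoothing of a code of level `k + 1`, which is given by intervals of positions. -/
def buildSmooth (k : ℕ) (α β cnt : Name) : Cmd :=
  .op (.const (k, 0) 0) ;; .op (.const (k, 1) 0) ;;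
  .loop (k + 1, 27) (k + 1, 28) (k + 1, 2) cnt
    (.ifEq (k + 1, 27) (k + 1, 41) (.skip (k + 1))
      (.op (.store (k, 3) (k, 1) (k, 0)) ;;
        .op (.load (k + 1, 29) α (k + 1, 27)) ;; .op (.load (k + 1, 30) β (k + 1, 27)) ;;
        .ifEq (k + 1, 27) (k + 1, 40)
          (.op (.load (k + 1, 32) α (k + 1, 41)) ;; .op (.load (k + 1, 33) β (k + 1, 41)) ;;
            .op (.addc (k + 1, 31) (k + 1, 43) 1) ;; .op (.addc (k + 1, 34) (k + 1, 42) 1) ;;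
            copyArc k (k + 1, 29) (k + 1, 42) ;; copyArc k (k + 1, 31) (k + 1, 33) ;;
            copyArc k (k + 1, 32) (k + 1, 43) ;; copyArc k (k + 1, 34) (k + 1, 30))
          (copyArc k (k + 1, 29) (k + 1, 30)) ;;
        .op (.store (k, 4) (k, 1) (k, 0)) ;; .op (.addc (k, 1) (k, 1) 1)))

theorem buildSmooth_within (k : ℕ) (α β cnt : Name) : (buildSmooth k α β cnt).Within fun t y =>
    y.1 = k ∨ (t = 0 ∧ y.1 = k + 1 ∧ 20 ≤ y.2 ∧ y.2 < 40) := by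
  simp [buildSmooth, copyArc]

theorem buildSmooth_spec {α β cnt : Name} {c d v w : ℕ} (hα : α.1 = k + 1) (hβ : β.1 = k + 1)
    (hcnt : cnt.1 = k + 1) (hz : S.v (k + 1, 2) = 0) (hm : S.v cnt = m)
    (hf : Shows (S.a (k + 1, 0)) (S.a (k + 1, 7)) (S.a (k + 1, 8)) f n)
    (ha : ∀ e < m, S.a α e = a e) (hb : ∀ e < m, S.a β e = b e) (hab : ∀ e < m, a e ≤ b e)
    (hbn : ∀ e < m, b e ≤ n) (hn : n ≤ N) (hcd : c < d) (hd : d < m) (hc : S.v (k + 1, 40) = c)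
    (hdv : S.v (k + 1, 41) = d) (hv : S.v (k + 1, 42) = v) (hw : S.v (k + 1, 43) = w)
    (hav : a c ≤ v) (hvb : v < b c) (haw : a d ≤ w) (hwb : w < b d) (hmN : m ≤ N)
    (hsize : (smoothCode f a b m c d v w).size ≤ N)
    (hQ : ∀ S', S'.Rows k (smoothCode f a b m c d v w).flatten → S'.Ends k (smoothCode f a b m c d v w) →
      Agree (fun t y => y.1 = k ∨ (t = 0 ∧ y.1 = k + 1 ∧ 20 ≤ y.2 ∧ y.2 < 40)) S S' → Q S') :
    WP inp N Y (buildSmooth k α β cnt) Q S := by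
  have hvn : v + 1 ≤ N := by have := hbn c (by omega); omega
  have hwn : w + 1 ≤ N := by have := hbn d (by omega); omega
  suffices h : WP inp N Y (buildSmooth k α β cnt) (fun S' =>
      S'.Rows k (smoothCode f a b m c d v w).flatten ∧ S'.Ends k (smoothCode f a b m c d v w)) S from
    (h.frame (buildSmooth_within k α β cnt)).mono fun S' h => hQ S' h.1.1 h.1.2 h.2
  have hα' : ∀ j, α ≠ (k, j) := fun j h => by simp [h] at hα
  have hβ' : ∀ j, β ≠ (k, j) := fun j h => by simp [h] at hβ
  have hcnt' : ∀ j, cnt ≠ (k, j) := fun j h => by simp [h] at hcnt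
  refine ⟨by simp, by simp, ?_⟩
  refine WP.loop 0 m (fun e S' => S'.Rows k (smoothCode f a b e c d v w).flatten ∧
    S'.Ends k (smoothCode f a b e c d v w)) _ (by simp [hz]) (by simp [hm, hcnt'])
    (by simp) hmN (by simp) (by simp)
    (by simp [copyArc])
    (buildSmooth_within k α β cnt).2.2 ?_ ?_ ?_ (fun S' h _ => h)
  · intro j v v' ar pv pa hv h
    exact ⟨⟨(hv _ (by simp) (by simp)).trans h.1.1, h.1.2⟩, (hv _ (by simp) (by simp)).trans h.2.1, h.2.2⟩
  · simp [smoothCode, Store.Rows, Store.Ends]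
  · intro e _ he S' ⟨hR, hE⟩ hA hj
    have e40 : S'.v (k + 1, 40) = c := (hA.v _).trans (by simp [hc])
    have e41 : S'.v (k + 1, 41) = d := (hA.v _).trans (by simp [hdv])
    have e42 : S'.v (k + 1, 42) = v := (hA.v _).trans (by simp [hv])
    have e43 : S'.v (k + 1, 43) = w := (hA.v _).trans (by simp [hw])
    have eα : S'.a α = S.a α := hA.a _ (by simp [hα])
    have eβ : S'.a β = S.a β := hA.a _ (by simp [hβ])
    have e0 : S'.a (k + 1, 0) = S.a (k + 1, 0) := hA.a _
    have e7 : S'.a (k + 1, 7) = S.a (k + 1, 7) := hA.a _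
    have e8 : S'.a (k + 1, 8) = S.a (k + 1, 8) := hA.a _
    have hsz := (size_smoothCode_mono f a b c d v w (Nat.succ_le_of_lt he)).trans hsize
    rw [smoothCode_succ] at hsz ⊢
    refine WP.ifEq (fun heq => ?_) fun hne => ?_
    · rw [hj, e41, Nat.cast_inj] at heq
      rw [if_pos heq, List.append_nil]
      exact WP.skip ⟨⟨by simpa using hR.1, hR.2⟩, by simpa using hE.1, hE.2⟩
    · rw [hj, e41, ne_eq, Nat.cast_inj] at hne
      rw [if_neg hne] at hsz ⊢
      obtain ⟨D, hD⟩ : ∃ D, D = smoothCode f a b e c d v w := ⟨_, rfl⟩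
      rw [← hD] at hR hE hsz ⊢
      have hv0 := hR.1
      have hv1 := hE.1
      -- The end of both branches: whichever arcs were copied, the end of the new component is
      -- recorded and the number of components increased.
      have hfin : ∀ (w' : List Passage) (S₁ : Store), S₁.Rows k (D.flatten ++ w') → D.size + (w'.length + 1) ≤ N →
          Agree (fun t y => (t ≤ 1 ∧ y.1 = k ∧ (t = 1 ∨ y.2 = 0) ∧ y.2 ≤ 2) ∨
            (t = 0 ∧ y.1 = k + 1 ∧ 20 ≤ y.2 ∧ y.2 < 40)) ((Op.store (k, 3) (k, 1) (k, 0)).run inp S') S₁ →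
          WP inp N Y (.op (.store (k, 4) (k, 1) (k, 0)) ;; .op (.addc (k, 1) (k, 1) 1)) (fun S' =>
            S'.Rows k (D ++ [w']).flatten ∧ S'.Ends k (D ++ [w'])) S₁ := by
        intro w' S₁ hR₁ hs₁ hA₁
        have g1 : S₁.v (k, 1) = D.length := (hA₁.v _).trans (by simp [hv1])
        have g3 : S₁.a (k, 3) = update (S'.a (k, 3)) D.length D.flatten.length :=
          (hA₁.a _).trans (by simp [hv1, hv0])
        have g4 : S₁.a (k, 4) = S'.a (k, 4) := (hA₁.a _).trans (by simp)
        unfold Code.size at hs₁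
        refine ⟨show 0 ≤ S₁.v (k, 1) by rw [g1]; omega,
          ⟨show |(1 : ℤ)| ≤ N by rw [abs_le]; omega, ?_⟩, ?_, ?_⟩
        · simp [g1, abs_le]
          omega
        · rw [List.flatten_append, List.flatten_singleton]
          exact ⟨by simpa using hR₁.1, by simpa using hR₁.2⟩
        · refine hE.append ?_ ?_ ?_
          · simp [g1, hv1]
          · simpa using g3
          · have := hR₁.1
            simp only [Op.run, update_self, g4, g1, this]
            simp
      have hsz' : D.size + ((smoothPos a b c d v w e).length + 1) ≤ N := by
        rw [Code.size_append, Code.size_cons, List.length_map] at hsz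
        omega
      have hDs : D.flatten.length ≤ D.size := by simp [Code.size]
      have hbe := hbn e he
      have habe := hab e he
      refine ⟨show 0 ≤ S'.v (k, 1) by rw [hv1]; omega, ?_⟩
      refine ⟨by simp [hj], by simp [hj], ?_⟩
      generalize hS₂ : Op.run inp _ _ = S₂
      replace hS₂ := hS₂.symm
      have hA₂ : Agree (fun t y => t = 0 ∧ y.1 = k + 1 ∧ 29 ≤ y.2 ∧ y.2 < 31)
          ((Op.store (k, 3) (k, 1) (k, 0)).run inp S') S₂ := by
        subst hS₂
        iterate 2 refine Agree.run ?_ _ (by simp)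
        exact .refl _ _
      have f29 : S₂.v (k + 1, 29) = a e := by simp [hS₂, hj, hα', eα, ha e he]
      have f30 : S₂.v (k + 1, 30) = b e := by simp [hS₂, hj, hβ', eβ, hb e he]
      have f27 : S₂.v (k + 1, 27) = e := by simp [hS₂, hj]
      have f40 : S₂.v (k + 1, 40) = c := by simp [hS₂, e40]
      have f41 : S₂.v (k + 1, 41) = d := by simp [hS₂, e41]
      have f42 : S₂.v (k + 1, 42) = v := by simp [hS₂, e42]
      have f43 : S₂.v (k + 1, 43) = w := by simp [hS₂, e43]
      have fα : ∀ e < m, S₂.a α e = a e := by simpa [hS₂, hα', eα] using ha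
      have fβ : ∀ e < m, S₂.a β e = b e := by simpa [hS₂, hβ', eβ] using hb
      have hR₂ : S₂.Rows k D.flatten :=
        ⟨by simpa [hS₂] using hR.1, by simpa [hS₂] using hR.2⟩
      have hf₂ : Shows (S₂.a (k + 1, 0)) (S₂.a (k + 1, 7)) (S₂.a (k + 1, 8)) f n := by
        simpa [hS₂, e0, e7, e8] using hf
      refine WP.ifEq (fun heq => ?_) fun hne' => ?_
      -- The joined component consists of four arcs: the part of `c` before the crossing, the part
      -- of `d` after it, the part of `d` before it, and the rest of `c`.
      · have hec : e = c := by simpa [f27, f40] using heq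
        subst hec
        rw [smoothPos, if_pos rfl] at hsz' ⊢
        simp only [List.length_append, List.Ico.length] at hsz'
        have had := hab d hd
        have hbd := hbn d hd
        have h1 : |(1 : ℤ)| ≤ N := by rw [abs_le]; omega
        refine ⟨by simp [f41], by simp [f41],
          ⟨h1, by simp [f43, abs_le]; omega⟩, ⟨h1, by simp [f42, abs_le]; omega⟩, ?_⟩
        generalize hS₃ : Op.run inp _ _ = S₃
        replace hS₃ := hS₃.symm
        have hA₃ : Agree (fun t y => t = 0 ∧ y.1 = k + 1 ∧ 31 ≤ y.2 ∧ y.2 < 35) S₂ S₃ := by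
          subst hS₃
          repeat' refine Agree.run ?_ _ (by simp)
          exact .refl _ _
        have g32 : S₃.v (k + 1, 32) = a d := by simp [hS₃, f41, fα d hd]
        have g33 : S₃.v (k + 1, 33) = b d := by simp [hS₃, f41, fβ d hd]
        have g31 : S₃.v (k + 1, 31) = (w + 1 : ℕ) := by simp [hS₃, f43]
        have g34 : S₃.v (k + 1, 34) = (v + 1 : ℕ) := by simp [hS₃, f42]
        have g29 := (hA₃.v (k + 1, 29)).trans f29
        have g30 := (hA₃.v (k + 1, 30)).trans f30
        have g42 := (hA₃.v (k + 1, 42)).trans f42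
        have g43 := (hA₃.v (k + 1, 43)).trans f43
        have hR₃ : S₃.Rows k D.flatten := by simpa [hS₃, Store.Rows] using hR₂
        have hf₃ : Shows (S₃.a (k + 1, 0)) (S₃.a (k + 1, 7)) (S₃.a (k + 1, 8)) f n := by
          simpa [hS₃] using hf₂
        have hshow : ∀ {S₁ S₂ : Store}, Agree (fun t y =>
            (t ≤ 1 ∧ y.1 = k ∧ (t = 1 ∨ y.2 = 0) ∧ y.2 ≤ 2) ∨
              (t = 0 ∧ y.1 = k + 1 ∧ 20 ≤ y.2 ∧ y.2 < 23)) S₁ S₂ →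
            Shows (S₁.a (k + 1, 0)) (S₁.a (k + 1, 7)) (S₁.a (k + 1, 8)) f n →
            Shows (S₂.a (k + 1, 0)) (S₂.a (k + 1, 7)) (S₂.a (k + 1, 8)) f n := by
          intro S₁ S₂ hA h
          rwa [hA.a _, hA.a _, hA.a _]
        refine copyArc_spec hR₃ hf₃ g29 g42 hav (by omega) hn (by omega) (by simp) fun S₄ hR₄ hA₄ => ?_
        have hf₄ := hshow hA₄ hf₃
        refine copyArc_spec hR₄ hf₄ ((hA₄.v _).trans g31) ((hA₄.v _).trans g33) hwb hbd hn
          (by simp only [List.length_append, length_seg]; omega) (by simp) fun S₅ hR₅ hA₅ => ?_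
        have hA₅ := hA₄.trans hA₅
        have hf₅ := hshow hA₅ hf₃
        refine copyArc_spec hR₅ hf₅ ((hA₅.v _).trans g32) ((hA₅.v _).trans g43) haw (by omega) hn
          (by simp only [List.length_append, length_seg]; omega) (by simp) fun S₆ hR₆ hA₆ => ?_
        have hA₆ := hA₅.trans hA₆
        have hf₆ := hshow hA₆ hf₃
        refine copyArc_spec hR₆ hf₆ ((hA₆.v _).trans g34) ((hA₆.v _).trans g30) hvb hbe hn
          (by simp only [List.length_append, length_seg]; omega) (by simp) fun S₇ hR₇ hA₇ => ?_
        have hA₇ := hA₆.trans hA₇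
        refine hfin _ S₇ ?_ ?_ ((hA₂.mono ?_).trans ((hA₃.mono ?_).trans (hA₇.mono ?_)))
        · simpa [seg] using hR₇
        · simp
          omega
        · rintro t y ⟨h1, h2, h3, h4⟩
          exact Or.inr ⟨h1, h2, by omega, by omega⟩
        · rintro t y ⟨h1, h2, h3, h4⟩
          exact Or.inr ⟨h1, h2, by omega, by omega⟩
        · rintro t y (h | ⟨h1, h2, h3, h4⟩)
          · exact Or.inl h
          · exact Or.inr ⟨h1, h2, by omega, by omega⟩
      · have hec : e ≠ c := by simpa [f27, f40] using hne'
        rw [smoothPos, if_neg hec] at hsz' ⊢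
        rw [List.Ico.length] at hsz'
        refine copyArc_spec hR₂ hf₂ f29 f30 habe hbe hn (by omega) (by simp) fun S₁ hR₁ hA₁ => ?_
        refine hfin _ S₁ hR₁ ?_ ((hA₂.mono ?_).trans (hA₁.mono ?_))
        · rw [List.length_map, List.Ico.length]
          omega
        all_goals grind

/-! ### Sorting the components by a program -/

/-- The constants, the passages and the pairing are in their places. -/
structure Store.Ready (S : Store) (k : ℕ) (f : ℕ → Passage) (n : ℕ) (par : ℕ → ℕ) : Prop where
  zero : S.v (k, 2) = 0
  two : S.v (k, 3) = 2
  one : S.v (k, 4) = 1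
  negOne : S.v (k, 5) = -1
  count : S.v (k, 0) = n
  shows : Shows (S.a (k, 0)) (S.a (k, 1)) (S.a (k, 2)) f n
  par : ∀ x < n, S.a (k, 5) x = par x

theorem Store.Ready.agree {S' : Store} (h : S.Ready k f n par) {P : ℕ → Name → Prop} (hA : Agree P S S')
    (hP : ∀ j, (j < 20 → ¬ P 0 (k, j)) ∧ (j < 6 → ¬ P 1 (k, j))) : S'.Ready k f n par := by
  refine ⟨?_, ?_, ?_, ?_, ?_, ?_, ?_⟩
  · exact (hA.v _ ((hP 2).1 (by simp))).trans h.zero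
  · exact (hA.v _ ((hP 3).1 (by simp))).trans h.two
  · exact (hA.v _ ((hP 4).1 (by simp))).trans h.one
  · exact (hA.v _ ((hP 5).1 (by simp))).trans h.negOne
  · exact (hA.v _ ((hP 0).1 (by simp))).trans h.count
  · rw [hA.a _ ((hP 0).2 (by simp)), hA.a _ ((hP 1).2 (by simp)), hA.a _ ((hP 2).2 (by simp))]
    exact h.shows
  · rw [hA.a _ ((hP 5).2 (by simp))]
    exact h.par

/-- Set a polynomial variable to the coefficient of the switched diagram for the sign `t`. -/
noncomputable def setSwitch (k : ℕ) (x : Name) (t : Name) : Cmd :=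
  .ifLt (k, 2) t (.op (.pconst x (C (-LaurentPolynomial.T (-2)))))
    (.op (.pconst x (C (-LaurentPolynomial.T 2))))

/-- Set a polynomial variable to the coefficient of the smoothed diagram for the sign `t`. -/
noncomputable def setSmooth (k : ℕ) (x : Name) (t : Name) : Cmd :=
  .ifLt (k, 2) t (.op (.pconst x (C (LaurentPolynomial.T (-1)))))
    (.op (.pconst x (C (LaurentPolynomial.T 1))))

theorem Passage.sign_eq (p : Passage) : p.sign = 1 ∨ p.sign = -1 := by
  unfold Passage.sign
  split <;> simp

theorem setSwitch_spec {x t : Name} (p : Passage)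
    (h0 : S.v (k, 2) = 0) (ht : S.v t = p.sign) (hY : 2 ≤ Y)
    (hQ : Q { S with pv := update S.pv x (C (switchCoeff p)) }) :
    WP inp N Y (setSwitch k x t) Q S := by
  have hb := (Bd.switch p).mono hY
  rw [switchCoeff] at hQ hb
  refine ⟨fun h => ?_, fun h => ?_⟩ <;> rw [h0, ht] at h <;>
    rcases p.sign_eq with h1 | h1 <;> rw [h1] at h hQ hb <;> try omega
  · exact ⟨by simpa using hb, by simpa using hQ⟩
  · exact ⟨by simpa using hb, by simpa using hQ⟩

theorem setSmooth_spec {x t : Name} (p : Passage)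
    (h0 : S.v (k, 2) = 0) (ht : S.v t = p.sign) (hY : 1 ≤ Y)
    (hQ : Q { S with pv := update S.pv x (C (smoothCoeff p)) }) :
    WP inp N Y (setSmooth k x t) Q S := by
  have hb := (Bd.smooth p).mono hY
  rw [smoothCoeff] at hQ hb
  refine ⟨fun h => ?_, fun h => ?_⟩ <;> rw [h0, ht] at h <;>
    rcases p.sign_eq with h1 | h1 <;> rw [h1] at h hQ hb <;> try omega
  · exact ⟨by simpa using hb, by simpa using hQ⟩
  · exact ⟨by simpa using hb, by simpa using hQ⟩

/-- Copy the passages to the working arrays, and forget the components. -/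
def sortInit (k : ℕ) : Cmd :=
  .loop (k, 50) (k, 51) (k, 2) (k, 0)
    (.op (.const (k, 52) (-1)) ;; .op (.store (k, 6) (k, 50) (k, 52)) ;;
      .op (.load (k, 52) (k, 1) (k, 50)) ;; .op (.store (k, 7) (k, 50) (k, 52)) ;;
      .op (.load (k, 52) (k, 2) (k, 50)) ;; .op (.store (k, 8) (k, 50) (k, 52)))

/-- Compute the index of the component of each position. -/
def sortIndex (k : ℕ) (α β cnt : Name) : Cmd :=
  .loop (k, 50) (k, 51) (k, 2) cnt
    (.op (.load (k, 53) α (k, 50)) ;; .op (.load (k, 54) β (k, 50)) ;;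
      .loop (k, 55) (k, 56) (k, 53) (k, 54) (.op (.store (k, 6) (k, 55) (k, 50))))

/-- Switch the crossing at the current position. -/
noncomputable def sortSwitch (k : ℕ) (sub : Cmd) : Cmd :=
  .op (.load (k, 52) (k, 8) (k, 42)) ;; setSmooth k (k, 3) (k, 52) ;; setSwitch k (k, 4) (k, 52) ;; sub ;;
    .op (.pmul k (k, 1) (k, 1) (k, 4)) ;;
    .op (.const (k, 53) 1) ;; .op (.store (k, 7) (k, 42) (k, 53)) ;;
    .op (.const (k, 53) 0) ;; .op (.store (k, 7) (k, 43) (k, 53)) ;;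
    .op (.sub (k, 52) (k, 2) (k, 52)) ;; .op (.store (k, 8) (k, 42) (k, 52)) ;;
    .op (.store (k, 8) (k, 43) (k, 52))

/-- Treat the current position. -/
noncomputable def sortStep (k : ℕ) (sub : Cmd) : Cmd :=
  .op (.load (k, 52) (k, 7) (k, 42)) ;; .ifLt (k, 52) (k, 4)
    (.op (.load (k, 40) (k, 6) (k, 42)) ;; .ifLt (k, 5) (k, 40)
      (.op (.load (k, 43) (k, 5) (k, 42)) ;; .op (.load (k, 41) (k, 6) (k, 43)) ;;
        .ifLt (k, 40) (k, 41) (sortSwitch k sub) (.skip k)) (.skip k)) (.skip k)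

/-- Sort the components that are given by intervals of positions. -/
noncomputable def sortArcs (k : ℕ) (sub : Cmd) (α β cnt : Name) : Cmd :=
  sortInit k ;; sortIndex k α β cnt ;; .op (.pconst (k, 1) 1) ;; .op (.pconst (k, 2) 0) ;;
    .loop (k, 42) (k, 57) (k, 2) (k, 0) (sortStep k sub)

theorem sortInit_within (k : ℕ) : (sortInit k).Within fun t y =>
    y.1 = k ∧ ((t = 0 ∧ 50 ≤ y.2 ∧ y.2 < 60) ∨ (t = 1 ∧ 6 ≤ y.2 ∧ y.2 ≤ 8)) := by
  simp [sortInit]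

theorem sortInit_spec (hS : S.Ready k f n par) (hn : n ≤ N) (hN : 1 ≤ N)
    (hQ : ∀ S', (∀ x < n, S'.a (k, 6) x = -1) →
      Shows (S'.a (k, 0)) (S'.a (k, 7)) (S'.a (k, 8)) f n → Agree (fun t y =>
        y.1 = k ∧ ((t = 0 ∧ 50 ≤ y.2 ∧ y.2 < 60) ∨ (t = 1 ∧ 6 ≤ y.2 ∧ y.2 ≤ 8))) S S' → Q S') :
    WP inp N Y (sortInit k) Q S := by
  refine WP.loop 0 n (fun j S' => (∀ x < j, S'.a (k, 6) x = -1) ∧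
      Shows (S'.a (k, 0)) (S'.a (k, 7)) (S'.a (k, 8)) f j) _ (by simp [hS.zero]) (by simp [hS.count])
    (by simp) hn (by simp) (by simp) (by simp) (sortInit_within k)
    (fun _ _ _ _ _ _ _ h => h) (by simp [Shows]) ?_ (fun S' h hA => hQ S' h.1 h.2 hA)
  intro j _ hj S' ⟨h1, h2⟩ hA hj'
  have e1 : S'.a (k, 1) = S.a (k, 1) := hA.a _
  have e2 : S'.a (k, 2) = S.a (k, 2) := hA.a _
  have e0 : S'.a (k, 0) = S.a (k, 0) := hA.a _
  obtain ⟨g0, g1, g2⟩ := hS.shows j hj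
  simp [WP, hj', e1, e2, g1, g2, hN]
  refine ⟨fun x hx => ?_, fun x hx => ?_⟩
  · grind
  · rcases Nat.lt_succ_iff_lt_or_eq.1 hx with hx | rfl
    · simp [update_of_ne hx.ne]
      exact h2 x hx
    · simp [e0, g0]

theorem sortIndex_within (k : ℕ) (α β cnt : Name) : (sortIndex k α β cnt).Within fun t y =>
    y.1 = k ∧ ((t = 0 ∧ 50 ≤ y.2 ∧ y.2 < 60) ∨ (t = 1 ∧ y.2 = 6)) := by
  simp [sortIndex]

theorem sortIndex_spec {α β cnt : Name} (hα : α ≠ (k, 6)) (hβ : β ≠ (k, 6)) (hz : S.v (k, 2) = 0) (hm : S.v cnt = m)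
    (ha : ∀ e < m, S.a α e = a e) (hb : ∀ e < m, S.a β e = b e) (hab : ∀ e < m, a e ≤ b e)
    (hbn : ∀ e < m, b e ≤ n) (hn : n ≤ N) (hmN : m ≤ N) (h0 : ∀ x < n, S.a (k, 6) x = -1)
    (hQ : ∀ S', (∀ x < n, S'.a (k, 6) x = indexOf a b m x) → Agree (fun t y =>
        y.1 = k ∧ ((t = 0 ∧ 50 ≤ y.2 ∧ y.2 < 60) ∨ (t = 1 ∧ y.2 = 6))) S S' → Q S') :
    WP inp N Y (sortIndex k α β cnt) Q S := by
  refine WP.loop 0 m (fun e S' => ∀ x < n, S'.a (k, 6) x = indexOf a b e x) _ (by simp [hz]) hm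
    (by simp) hmN (by simp) (by simp) (by simp)
    (sortIndex_within k α β cnt) (fun _ _ _ _ _ _ _ h => h) (by simpa [indexOf] using h0) ?_ hQ
  intro e _ he S' h1 hA he'
  have eα : S'.a α = S.a α := hA.a _ (by rintro ⟨h, h'⟩; simp at h'; exact hα (Prod.ext h h'))
  have eβ : S'.a β = S.a β := hA.a _ (by rintro ⟨h, h'⟩; simp at h'; exact hβ (Prod.ext h h'))
  refine ⟨by simp [he'], by simp [he'], ?_⟩
  refine WP.loop (a e) (b e) (fun j S'' => ∀ x < n, S''.a (k, 6) x =
      if a e ≤ x ∧ x < j then (e : ℤ) else indexOf a b e x)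
    (fun t y => y.1 = k ∧ ((t = 0 ∧ 55 ≤ y.2 ∧ y.2 < 60) ∨ (t = 1 ∧ y.2 = 6)))
    (by simp [he', eα, ha e he]) (by simp [he', eβ, hb e he]) (hab e he)
    ((hbn e he).trans hn) (by simp) (by simp) (by simp)
    (by simp) (fun _ _ _ _ _ _ _ h => h) ?_ ?_ ?_
  · intro x hx
    rw [if_neg (by omega)]
    simpa using h1 x hx
  · intro j haj hj S'' h2 hA' hj'
    have e50 : S''.v (k, 50) = e := (hA'.v _).trans (by simp [he'])
    refine ⟨by simp [hj'], fun x hx => ?_⟩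
    simp only [Op.run, update_self, hj', e50, Int.toNat_natCast, update_apply]
    grind
  · intro S'' h2 _ x hx
    rw [h2 x hx, indexOf]

/-- What the treatment of one smoothing may change. -/
@[simp] def subTargets (k t : ℕ) (y : Name) : Prop :=
  y.1 < k ∨ (y.1 = k ∧ ((t = 0 ∧ 20 ≤ y.2 ∧ y.2 < 40) ∨ (t = 2 ∧ (y.2 = 2 ∨ y.2 = 5))))

/-- What sorting may change. -/
@[simp] def sortTargets (k t : ℕ) (y : Name) : Prop :=
  y.1 < k ∨ (y.1 = k ∧ ((t = 0 ∧ 20 ≤ y.2 ∧ y.2 < 60) ∨ (t = 1 ∧ 6 ≤ y.2 ∧ y.2 ≤ 8) ∨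
    (t = 2 ∧ 1 ≤ y.2 ∧ y.2 ≤ 5)))

/-- What the main loop of sorting may change. -/
@[simp] def sortLoopTargets (k t : ℕ) (y : Name) : Prop :=
  y.1 < k ∨ (y.1 = k ∧ ((t = 0 ∧ 20 ≤ y.2 ∧ y.2 < 60) ∨ (t = 1 ∧ 7 ≤ y.2 ∧ y.2 ≤ 8) ∨
    (t = 2 ∧ 1 ≤ y.2 ∧ y.2 ≤ 5)))

theorem sortLoopTargets.sort {t : ℕ} {y : Name} (h : sortLoopTargets k t y) : sortTargets k t y := by
  unfold sortLoopTargets at h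
  unfold sortTargets
  omega

theorem subTargets.sortLoop {t : ℕ} {y : Name} (h : subTargets k t y) : sortLoopTargets k t y := by
  unfold sortLoopTargets
  unfold subTargets at h
  omega

theorem sortLoop_within (k : ℕ) {sub : Cmd} (hsub : sub.Within (subTargets k)) :
    (Cmd.loop (k, 42) (k, 57) (k, 2) (k, 0) (sortStep k sub)).Within (sortLoopTargets k) := by
  have := hsub.mono (P' := sortLoopTargets k) fun t y h => h.sortLoop
  simp [sortStep, sortSwitch, setSwitch, setSmooth, this]

theorem sortArcs_within (k : ℕ) {sub : Cmd} (hsub : sub.Within (subTargets k)) (α β cnt : Name) :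
    (sortArcs k sub α β cnt).Within (sortTargets k) := by
  refine ⟨(sortInit_within k).mono ?_, (sortIndex_within k α β cnt).mono ?_, ?_, ?_,
    (sortLoop_within k hsub).mono fun t y h => h.sort⟩
  · rintro t y h
    unfold sortTargets
    omega
  · rintro t y h
    unfold sortTargets
    omega
  · simp
  · simp

theorem Store.Ready.sort {S' : Store} (h : S.Ready k f n par) (hA : Agree (sortTargets k) S S') : S'.Ready k f n par :=
  h.agree hA fun j => by
    constructor <;> intro hj <;> simp <;> omega

/-- The situation in which a crossing is smoothed. -/
structure Store.Smoothing (S : Store) (k : ℕ) (g : ℕ → Passage) (n : ℕ) (par : ℕ → ℕ) (a b : ℕ → ℕ) (m c d j : ℕ) :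
    Prop where
  layout : Layout g n par a b m (indexOf a b m)
  shows : Shows (S.a (k, 0)) (S.a (k, 7)) (S.a (k, 8)) g n
  hcd : c < d
  hd : d < m
  v40 : S.v (k, 40) = c
  v41 : S.v (k, 41) = d
  v42 : S.v (k, 42) = j
  v43 : S.v (k, 43) = par j
  h1 : a c ≤ j
  h2 : j < b c
  h3 : a d ≤ par j
  h4 : par j < b d
  partner : g (par j) = (g j).partner
  coeff : S.pv (k, 3) = C (smoothCoeff (g j))

/-- What the treatment of one smoothing has to do. -/
def SubSpec (inp : ℕ → ℤ) (N Y k : ℕ) (sub : Cmd) (S₀ : Store) (n : ℕ)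
    (par : ℕ → ℕ) (a b : ℕ → ℕ) (m B : ℕ) : Prop :=
  ∀ (g : ℕ → Passage) (S : Store) (c d j : ℕ), j < n → S.Smoothing k g n par a b m c d j → Agree (sortTargets k) S₀ S →
    Bd (2 * j) (S.pv (k, 1)) → Bd (B + j) (S.pv (k, 2)) →
    WP inp N Y sub (fun S' => Bd (B + (j + 1)) (S'.pv (k, 2)) ∧ ∃ F,
      (∀ k', k = k' + 1 → tr k' F = tr k' (descend (smoothCode g a b m c d j (par j)))) ∧
      (∀ k', k = k' + 1 → tr k' (S'.pv (k, 2)) =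
        tr k' (S.pv (k, 2) + S.pv (k, 1) * C (smoothCoeff (g j)) * F))) S

theorem height_eq_zero {p : Passage} : p.height < 1 ↔ p.isOver = false := by
  unfold Passage.height
  cases p.isOver <;> simp

/-- The program follows `Sorting`: `M` and `R` are kept in the polynomial variables `1` and `2`, and
the set `Z` is visible only through the switched heights and signs in arrays `7` and `8`. -/
theorem sortArcs_spec {sub : Cmd} {α β cnt : Name}
    {B : ℕ} {P : LinkDiagram → RingAZ}
    (hP : IsSkeinPolynomial P) (hS : S.Ready k f n par)
    (hα : α.1 = k ∧ (α.2 < 6 ∨ 8 < α.2)) (hβ : β.1 = k ∧ (β.2 < 6 ∨ 8 < β.2))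
    (hcnt : cnt.1 = k ∧ cnt.2 < 20) (hm : S.v cnt = m)
    (ha : ∀ e < m, S.a α e = a e) (hb : ∀ e < m, S.a β e = b e) (hab : ∀ e < m, a e ≤ b e)
    (hbn : ∀ e < m, b e ≤ n) (hn : n ≤ N) (hmN : m ≤ N) (hN : 1 ≤ N)
    (hs : Sound f n) (hpar : IsPar f n par) (hg : (codeOf f a b m).Good)
    (hsubW : sub.Within (subTargets k)) (hY : 2 * n + 2 ≤ Y)
    (hsub : SubSpec inp N Y k sub S n par a b m B)
    (hQ : ∀ S' Z, Sorting k f n par a b m (indexOf a b m) Z n (S'.pv (k, 1)) (S'.pv (k, 2)) →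
      Bd (2 * n) (S'.pv (k, 1)) → Bd (B + n) (S'.pv (k, 2)) → Agree (sortTargets k) S S' → Q S') :
    WP inp N Y (sortArcs k sub α β cnt) Q S := by
  have hl : Layout f n par a b m (indexOf a b m) :=
    ⟨hs, hpar, hbn, isIndex_indexOf hg.subWF.1, hg⟩
  refine sortInit_spec hS hn hN fun S₁ h6 h7 hA₁ => ?_
  have hA₁' : Agree (sortTargets k) S S₁ := hA₁.mono fun t y h => by unfold sortTargets; omega
  have hS₁ := hS.sort hA₁'
  have hαe : ∀ i, 6 ≤ i → i ≤ 8 → α ≠ (k, i) := by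
    rintro i h h' rfl
    simp at hα
    omega
  have hβe : ∀ i, 6 ≤ i → i ≤ 8 → β ≠ (k, i) := by
    rintro i h h' rfl
    simp at hβ
    omega
  refine sortIndex_spec (n := n) (a := a) (b := b) (m := m) (hαe 6 le_rfl (by simp)) (hβe 6 le_rfl (by simp))
    hS₁.zero ((hA₁.v _ (by omega)).trans hm) ?_ ?_ hab hbn hn hmN h6 fun S₂ h6' hA₂ => ?_
  · rw [hA₁.a _ (by omega)]
    exact ha
  · rw [hA₁.a _ (by omega)]
    exact hb
  have hA₂' : Agree (sortTargets k) S S₂ := hA₁'.trans (hA₂.mono fun t y h => by unfold sortTargets; omega)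
  have hw₂ : Shows (S₂.a (k, 0)) (S₂.a (k, 7)) (S₂.a (k, 8)) f n := by
    rwa [hA₂.a _, hA₂.a _, hA₂.a _]
  refine ⟨Bd.one.mono (by simp), Bd.zero.mono (by simp), ?_⟩
  generalize hS₃ : Op.run inp _ _ = S₃
  replace hS₃ := hS₃.symm
  have hA₃' : Agree (sortTargets k) S S₃ := by
    subst hS₃
    repeat' refine Agree.run ?_ _ (by simp [sortTargets])
    exact hA₂'
  have hR := hS.sort hA₃'
  have hM : S₃.pv (k, 1) = 1 := by simp [hS₃]
  have hR0 : S₃.pv (k, 2) = 0 := by simp [hS₃]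
  have hw₃ : Shows (S₃.a (k, 0)) (S₃.a (k, 7)) (S₃.a (k, 8)) f n := by simpa [hS₃] using hw₂
  have h6₃ : ∀ x < n, S₃.a (k, 6) x = indexOf a b m x := by simpa [hS₃] using h6'
  -- A switch coefficient raises the bound for `M` by two. Adding a smoothed term to `R` at most
  -- doubles the number of monomials allowed and so raises its bound by one.
  refine WP.loop 0 n (fun j S' => ∃ Z, Sorting k f n par a b m (indexOf a b m) Z j (S'.pv (k, 1)) (S'.pv (k, 2)) ∧
      Shows (S'.a (k, 0)) (S'.a (k, 7)) (S'.a (k, 8)) (fun x => (f x).switch Z) n ∧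
      Bd (2 * j) (S'.pv (k, 1)) ∧ Bd (B + j) (S'.pv (k, 2))) (sortLoopTargets k) hR.zero hR.count (by simp) hn
    (by simp) (by simp) ?_ (sortLoop_within k hsubW) (fun _ _ _ _ _ _ _ h => h) ?_ ?_ ?_
  · have := hsubW.mono (P' := fun t y => t = 0 → y ≠ (k, 42)) (by
      rintro t y h rfl rfl
      simp at h)
    simp [sortStep, sortSwitch, setSwitch, setSmooth, this]
  · refine ⟨fun _ => false, ?_, by simpa [Passage.switch] using hw₃, ?_, ?_⟩
    · rw [hM, hR0]
      exact Sorting.init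
    · rw [hM]
      exact Bd.one
    · rw [hR0]
      exact Bd.zero.mono (by simp)
  · rintro j _ hj S' ⟨Z, hZ, hw, hbM, hbR⟩ hA hj'
    have hA' := hA₃'.trans (hA.mono fun t y h => h.sort)
    have hR' := hS.sort hA'
    have h6' : ∀ x < n, S'.a (k, 6) x = indexOf a b m x := by
      rwa [hA.a _]
    -- The three nested tests check the three clauses of `Bad`; if one fails, the position needs no
    -- treatment.
    have hskip : ∀ S'' : Store, S''.a = S'.a → S''.pv = S'.pv → ¬ Bad (fun x => (f x).switch Z) par (indexOf a b m) j →
        WP inp N Y (.skip k) (fun S' => ∃ Z, Sorting k f n par a b m (indexOf a b m) Z (j + 1) (S'.pv (k, 1)) (S'.pv (k, 2)) ∧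
          Shows (S'.a (k, 0)) (S'.a (k, 7)) (S'.a (k, 8)) (fun x => (f x).switch Z) n ∧
          Bd (2 * (j + 1)) (S'.pv (k, 1)) ∧ Bd (B + (j + 1)) (S'.pv (k, 2))) S'' := by
      intro S'' h1 h2 h3
      refine WP.skip ⟨Z, ?_⟩
      simp only [h1, h2]
      exact ⟨hZ.skip h3, hw, hbM.mono (by omega), hbR.mono (by omega)⟩
    obtain ⟨w0, w1, w2⟩ := hw j hj
    beta_reduce at w0 w1 w2
    refine ⟨by simp [hj'], fun hlt => ?_, fun hge => hskip _ rfl rfl fun hb => ?_⟩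
    swap
    · have : ((f j).switch Z).height < 1 := height_eq_zero.2 hb.1
      simp [hR'.one, hj', w1] at hge
      omega
    have ho : ((f j).switch Z).isOver = false := height_eq_zero.1 (by simpa [hR'.one, hj', w1] using hlt)
    refine ⟨by simp [hj'], fun hlt' => ?_, fun hge => hskip _ rfl rfl fun hb => ?_⟩
    swap
    · have := hb.2.1
      simp [hR'.negOne, hj', h6' j hj] at hge
      omega
    have hpos : 0 ≤ indexOf a b m j := by
      simp [hR'.negOne, hj', h6' j hj] at hlt'
      omega
    have hparj := hpar.lt j hj
    refine ⟨by simp [hj'], by simp [hj', hR'.par j hj], fun hlt'' => ?_,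
      fun hge => hskip _ rfl rfl fun hb => ?_⟩
    swap
    · have := hb.2.2
      simp [hj', h6' j hj, hR'.par j hj, h6' _ hparj] at hge
      omega
    have hbad : Bad (fun x => (f x).switch Z) par (indexOf a b m) j := ⟨ho, hpos, by
      simpa [hj', h6' j hj, hR'.par j hj, h6' _ hparj] using hlt''⟩
    obtain ⟨c, d, hc, hd, hcd, hdm, h1, h2, h3, h4, h5, hne⟩ := hbad.exists (hl.switch Z) hj
    refine ⟨by simp [hj'], ?_⟩
    generalize hS₄ : Op.run inp _ _ = S₄
    replace hS₄ := hS₄.symm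
    have v40 : S₄.v (k, 40) = c := by simp [hS₄, hj', h6' j hj, hc]
    have v43 : S₄.v (k, 43) = par j := by simp [hS₄, hj', hR'.par j hj]
    have v41 : S₄.v (k, 41) = d := by simp [hS₄, hj', hR'.par j hj, h6' _ hparj, hd]
    have v42 : S₄.v (k, 42) = j := by simp [hS₄, hj']
    have v52 : S₄.v (k, 52) = ((f j).switch Z).sign := by simp [hS₄, hj', w2]
    have v2 : S₄.v (k, 2) = 0 := by simp [hS₄, hR'.zero]
    have ea : S₄.a = S'.a := by simp [hS₄]
    have epv : S₄.pv = S'.pv := by simp [hS₄]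
    have hA₄ : Agree (sortTargets k) S' S₄ := by
      subst hS₄
      repeat' refine Agree.run ?_ _ (by simp [sortTargets])
      exact .refl _ _
    refine setSmooth_spec ((f j).switch Z) v2 v52 (by omega) ?_
    refine setSwitch_spec ((f j).switch Z) v2 v52 (by omega) ?_
    obtain ⟨S₅, hS₅⟩ : ∃ S₅ : Store, S₅ = ⟨S₄.v, S₄.a, update (update S₄.pv (k, 3)
      (C (smoothCoeff ((f j).switch Z)))) (k, 4) (C (switchCoeff ((f j).switch Z))), S₄.pa⟩ := ⟨_, rfl⟩
    simp only
    rw [← hS₅]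
    have hA₅ : Agree (sortTargets k) S S₅ := (hA'.trans hA₄).trans (by
      rw [hS₅]
      constructor <;> intro y hy <;> simp only
      have : ∀ i, 1 ≤ i → i ≤ 5 → y ≠ (k, i) := by
        rintro i h h' rfl
        exact hy (Or.inr ⟨rfl, Or.inr (Or.inr ⟨rfl, h, h'⟩)⟩)
      rw [update_of_ne (this _ (by simp) (by simp)), update_of_ne (this _ (by simp) (by simp))])
    have p1 : S₅.pv (k, 1) = S'.pv (k, 1) := by simp [hS₅, epv]
    have p2 : S₅.pv (k, 2) = S'.pv (k, 2) := by simp [hS₅, epv]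
    have p4 : S₅.pv (k, 4) = C (switchCoeff ((f j).switch Z)) := by simp [hS₅]
    have e5v : S₅.v = S₄.v := by rw [hS₅]
    have e5a : S₅.a = S'.a := by rw [hS₅, ← ea]
    have hsm : S₅.Smoothing k (fun x => (f x).switch Z) n par a b m c d j :=
      ⟨hl.switch Z, by rw [e5a]; exact hw, hcd, hdm, by rw [e5v, v40], by rw [e5v, v41], by rw [e5v, v42],
        by rw [e5v, v43], h1, h2, h3, h4, h5, by simp [hS₅]⟩
    refine ((hsub _ S₅ c d j hj hsm hA₅ (by rwa [p1]) (by rwa [p2])).frame hsubW).mono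
      fun S₆ ⟨⟨hb₆, F, hF, hRF⟩, hA₆⟩ => ?_
    have q1 : S₆.pv (k, 1) = S'.pv (k, 1) := (hA₆.pv _).trans p1
    have q4 : S₆.pv (k, 4) = C (switchCoeff ((f j).switch Z)) := (hA₆.pv _).trans p4
    have q42 : S₆.v (k, 42) = j := (hA₆.v _).trans (by rw [e5v, v42])
    have q43 : S₆.v (k, 43) = par j := (hA₆.v _).trans (by rw [e5v, v43])
    have q52 : S₆.v (k, 52) = ((f j).switch Z).sign := (hA₆.v _).trans (by rw [e5v, v52])
    have q2 : S₆.v (k, 2) = 0 := (hA₆.v _).trans (by rw [e5v, v2])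
    have a0 : S₆.a (k, 0) = S'.a (k, 0) := (hA₆.a _).trans (by rw [e5a])
    have a7 : S₆.a (k, 7) = S'.a (k, 7) := (hA₆.a _).trans (by rw [e5a])
    have a8 : S₆.a (k, 8) = S'.a (k, 8) := (hA₆.a _).trans (by rw [e5a])
    have hbM' : Bd (2 * (j + 1)) (tr k (S'.pv (k, 1) * C (switchCoeff ((f j).switch Z)))) :=
      ((hbM.mul (Bd.switch _)).tr k).mono (by omega)
    have hsgn : |((f j).switch Z).sign| ≤ (N : ℤ) := by
      rw [Passage.abs_sign]
      exact_mod_cast hN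
    have hN1 : (1 : ℤ) ≤ N := by exact_mod_cast hN
    simp [WP, q1, q4, q42, q43, q52, q2, a0, a7, a8, hsgn, hN]
    refine ⟨hbM'.mono (by omega), toggle Z (f j).label, ?_, ?_, hbM', hb₆⟩
    · refine hZ.switch hl hP hbad hj hc hd (F := F) (tr_tr _ _) hF ?_
      rw [← p1, ← p2]
      exact hRF
    · intro x hx
      obtain ⟨x0, x1, x2⟩ := hw x hx
      beta_reduce at x0 x1 x2
      -- At both passages of the crossing, height and sign are reversed. As the one at `j` was
      -- under, the stored heights become `1` at `j` and `0` at its partner.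
      have hto : ∀ y, (f y).label = (f j).label →
          ((f y).switch (toggle Z (f j).label)).isOver = !((f y).switch Z).isOver ∧
          ((f y).switch (toggle Z (f j).label)).isPos = !((f y).switch Z).isPos := by
        intro y hy
        have : ((f y).switch Z).switch (fun c => c == (f j).label) = ((f y).switch Z).flip :=
          if_pos (by simpa using hy)
        rw [Passage.switch_toggle, this]
        exact ⟨rfl, rfl⟩
      have hno : x ≠ j → x ≠ par j → (f x).switch (toggle Z (f j).label) = (f x).switch Z := by
        intro hxj hxp
        rw [Passage.switch_toggle]
        refine Passage.switch_of_false ?_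
        rw [Passage.label_switch, beq_eq_false_iff_ne]
        exact fun h => hxp (hpar.eq j hj x hx hxj h).symm
      have hp := hto (par j) (hpar.label j hj)
      have h6 := congrArg Passage.isOver h5
      have h7 := congrArg Passage.isPos h5
      rw [Passage.isOver_partner] at h6
      rw [Passage.isPos_partner] at h7
      beta_reduce
      refine ⟨by simpa using x0, ?_, ?_⟩
      · grind [Passage.height, update_apply]
      · grind [Passage.sign, update_apply]
  · rintro S' ⟨Z, hZ, _, hbM, hbR⟩ hA
    exact hQ S' Z hZ hbM hbR (hA₃'.trans (hA.mono fun t y h => h.sort))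

theorem tr_tr_of_le {k' : ℕ} (h : k ≤ k') (f : RingA[X]) : tr k (tr k' f) = tr k f := by
  rw [tr_eq_tr_iff]
  intro j hj
  rw [coeff_tr, if_pos (hj.trans h)]

/-- What the evaluation of a code, stored at level `k`, has to do. -/
def LinkSpec (inp : ℕ → ℤ) (N Y k : ℕ) (link : Cmd) (s : ℕ) : Prop :=
  ∀ (D : Code) (S : Store), D ≠ [] → D.Good → D.size ≤ s → S.Rows k D.flatten → S.Ends k D →
    WP inp N Y link (fun S' => S'.pv (k, 0) = tr k (descend D)) S

/-- Treat one smoothing: evaluate the smoothed code at the previous level. -/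
def subSmooth (link : ℕ → Cmd) (α β cnt : Name) : ℕ → Cmd
  | 0 => .skip 0
  | k + 1 => buildSmooth k α β cnt ;; link k ;; .op (.pmul (k + 1) (k + 1, 5) (k + 1, 1) (k + 1, 3)) ;;
      .op (.pmul (k + 1) (k + 1, 5) (k + 1, 5) (k, 0)) ;; .op (.padd (k + 1, 2) (k + 1, 2) (k + 1, 5))

theorem subSmooth_within (hlink : ∀ k', k = k' + 1 → (link k').Within fun _ y => y.1 ≤ k')
    (α β cnt : Name) : (subSmooth link α β cnt k).Within (subTargets k) := by
  cases k with
  | zero => simp [subSmooth]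
  | succ k =>
    refine ⟨(buildSmooth_within k α β cnt).mono ?_, (hlink k rfl).mono ?_, ?_, ?_, ?_⟩
    · rintro t y h
      unfold subTargets
      omega
    · rintro t y h
      unfold subTargets
      omega
    · simp
    · simp
    · simp

theorem size_codeOf (f g : ℕ → Passage) (a b : ℕ → ℕ) (m : ℕ) :
    (codeOf f a b m).size = (codeOf g a b m).size := by
  simp [Code.size, codeOf, length_seg, Function.comp_def]

/-- The smoothed code is written out at the level below and evaluated there. Its term has size `2 *
n` from `M`, `1` from the smoothing and `2 * s` from the evaluation, which explains the bound. -/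
theorem subSmooth_spec {s : ℕ} (hlink : ∀ k', k = k' + 1 → LinkSpec inp N Y k' (link k') s)
    (hlinkW : ∀ k', k = k' + 1 → (link k').Within fun _ y => y.1 ≤ k') {S₀ : Store} {α β cnt : Name} (hS : S₀.Ready k f n par)
    (hα : α.1 = k ∧ (α.2 < 6 ∨ 8 < α.2)) (hβ : β.1 = k ∧ (β.2 < 6 ∨ 8 < β.2))
    (hcnt : cnt.1 = k ∧ cnt.2 < 20) (hm : S₀.v cnt = m)
    (ha : ∀ e < m, S₀.a α e = a e) (hb : ∀ e < m, S₀.a β e = b e) (hab : ∀ e < m, a e ≤ b e)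
    (hn : n ≤ N) (hmN : m ≤ N) (hs : (codeOf f a b m).size ≤ s) (hsN : s ≤ N)
    (hY : 3 * n + 2 * s + 2 ≤ Y) :
    SubSpec inp N Y k (subSmooth link α β cnt k) S₀ n par a b m (2 * n + 1 + 2 * s) := by
  intro g S c d j hj hsm hA hbM hbR
  cases k with
  -- There is no lower level, and the conditions on `F` and on the new `R` are void.
  | zero => exact WP.skip ⟨hbR.mono (by omega), 0, by simp, by simp⟩
  | succ k =>
    have hR := hS.sort hA
    have hsz := size_smoothCode hsm.hcd hsm.hd hsm.h1 hsm.h2 hsm.h3 hsm.h4 (f := g)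
    rw [size_codeOf g f] at hsz
    refine buildSmooth_spec (f := g) (n := n) (a := a) (b := b) (m := m) (c := c) (d := d) (v := j)
      (w := par j) hα.1 hβ.1 hcnt.1 hR.zero ?_ hsm.shows ?_ ?_ hab hsm.layout.le hn hsm.hcd hsm.hd hsm.v40
      hsm.v41 hsm.v42 hsm.v43 hsm.h1 hsm.h2 hsm.h3 hsm.h4 hmN (by omega) fun S₁ hR₁ hE₁ hA₁ => ?_
    · rw [hA.v _ (by simp [hcnt]), hm]
    · rwa [hA.a _ (by simp [hα]; omega)]
    · rwa [hA.a _ (by simp [hβ]; omega)]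
    set D := smoothCode g a b m c d j (par j) with hD
    have hne : D ≠ [] := by
      rw [hD, smoothCode_split hsm.hcd hsm.hd]
      simp
    have hgood : D.Good := good_smoothCode hsm.hcd hsm.hd hsm.h1 hsm.h2 hsm.h3 hsm.h4 hsm.partner hsm.layout.good
    refine ((hlink k rfl D S₁ hne hgood (by omega) hR₁ hE₁).frame
      (hlinkW k rfl)).mono fun S₂ ⟨hout, hA₂⟩ => ?_
    have p1 : S₂.pv (k + 1, 1) = S.pv (k + 1, 1) := (hA₂.pv _).trans (hA₁.pv _)
    have p2 : S₂.pv (k + 1, 2) = S.pv (k + 1, 2) := (hA₂.pv _).trans (hA₁.pv _)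
    have p3 : S₂.pv (k + 1, 3) = C (smoothCoeff (g j)) :=
      (hA₂.pv _).trans ((hA₁.pv _).trans hsm.coeff)
    have hb1 := (hbM.mul (Bd.smooth (g j))).tr (k + 1)
    have hb2 := (hb1.mul ((Bd.descend D).tr k)).tr (k + 1)
    have hb3 := (hbR.mono (b' := 2 * n + 1 + 2 * s + j) (by omega)).add (hb2.mono (b' := 2 * n + 1 + 2 * s + j) (by omega))
    simp [WP, p1, p2, p3, hout]
    refine ⟨hb1.mono (by omega), hb2.mono (by omega), hb3.mono (by omega), hb3, tr k (descend D), tr_tr _ _, ?_⟩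
    refine tr_congr_add rfl ?_
    rw [tr_tr_of_le (Nat.le_succ k)]
    exact tr_congr_mul (tr_tr_of_le (Nat.le_succ k) _) rfl

/-! ### Preparations -/

/-- Set the constants. -/
def setConsts (k : ℕ) : Cmd :=
  .op (.const (k, 2) 0) ;; .op (.const (k, 3) 2) ;; .op (.const (k, 4) 1) ;; .op (.const (k, 5) (-1))

/-- Compute the pairing of the positions. -/
def setPar (k : ℕ) : Cmd :=
  .loop (k, 50) (k, 51) (k, 2) (k, 0)
    (.op (.load (k, 52) (k, 0) (k, 50)) ;; .op (.store (k, 5) (k, 50) (k, 50)) ;;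
      .loop (k, 53) (k, 54) (k, 2) (k, 0)
        (.op (.load (k, 55) (k, 0) (k, 53)) ;; .ifEq (k, 52) (k, 55)
          (.ifEq (k, 50) (k, 53) (.skip k) (.op (.store (k, 5) (k, 50) (k, 53)))) (.skip k)))

/-- Compute the end of the component of each position. -/
def setEnds (k : ℕ) : Cmd :=
  .loop (k, 50) (k, 51) (k, 2) (k, 1)
    (.op (.load (k, 53) (k, 3) (k, 50)) ;; .op (.load (k, 54) (k, 4) (k, 50)) ;;
      .loop (k, 55) (k, 56) (k, 53) (k, 54) (.op (.store (k, 11) (k, 55) (k, 54))))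

theorem setPar_within (k : ℕ) : (setPar k).Within fun t y =>
    y.1 = k ∧ ((t = 0 ∧ 20 ≤ y.2 ∧ y.2 < 60) ∨ (t = 1 ∧ y.2 = 5)) := by
  simp [setPar]

theorem setPar_spec (hz : S.v (k, 2) = 0) (hc : S.v (k, 0) = n) (hf : Shows (S.a (k, 0)) (S.a (k, 1)) (S.a (k, 2)) f n)
    (hn : n ≤ N)
    (hQ : ∀ S', (∀ x < n, S'.a (k, 5) x = (parOf f n x : ℤ)) → Agree (fun t y =>
      y.1 = k ∧ ((t = 0 ∧ 20 ≤ y.2 ∧ y.2 < 60) ∨ (t = 1 ∧ y.2 = 5))) S S' → Q S') :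
    WP inp N Y (setPar k) Q S := by
  refine WP.loop 0 n (fun j S' => ∀ x < j, S'.a (k, 5) x = parOf f n x) _ (by simp [hz]) hc (by simp) hn
    (by simp) (by simp) (by simp) (setPar_within k)
    (fun _ _ _ _ _ _ _ h => h) (by simp) ?_ hQ
  intro j _ hj S₁ h1 hA₁ hj₁
  have e0 : S₁.a (k, 0) = S.a (k, 0) := hA₁.a _
  have ez : S₁.v (k, 2) = 0 := (hA₁.v _).trans hz
  have ec : S₁.v (k, 0) = n := (hA₁.v _).trans hc
  refine ⟨by simp [hj₁], by simp [hj₁], ?_⟩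
  refine WP.loop 0 n (fun i S' => (∀ x < j, S'.a (k, 5) x = parOf f n x) ∧ S'.a (k, 5) j = parOf f i j)
    (fun t y => y.1 = k ∧ ((t = 0 ∧ (20 ≤ y.2 ∧ y.2 < 40 ∨ 53 ≤ y.2 ∧ y.2 < 60)) ∨ (t = 1 ∧ y.2 = 5)))
    (by simp [ez]) (by simp [ec]) (by simp) hn (by simp) (by simp)
    (by simp)
    (by simp)
    (fun _ _ _ _ _ _ _ h => h) ⟨fun x hx => ?_, by simp [hj₁, parOf]⟩ ?_ ?_
  · simpa [hj₁, hx.ne] using h1 x hx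
  · intro i _ hi S₂ ⟨h2, h3⟩ hA₂ hi₂
    have d0 : S₂.a (k, 0) = S.a (k, 0) := (hA₂.a _).trans (by simp [e0])
    have d50 : S₂.v (k, 50) = j := (hA₂.v _).trans (by simp [hj₁])
    have d52 : S₂.v (k, 52) = (f j).label := (hA₂.v _).trans (by simp [hj₁, e0, (hf j hj).1])
    refine ⟨by simp [hi₂], WP.ifEq (fun heq => ?_) fun hne => ?_⟩
    · have heq : (f j).label = (f i).label := by simpa [hi₂, d0, d52, (hf i hi).1] using heq
      refine WP.ifEq (fun heq' => ?_) fun hne' => ?_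
      · have heq' : j = i := by simpa [hi₂, d50] using heq'
        refine WP.skip ⟨h2, ?_⟩
        rw [parOf, if_neg (fun h => h.2 heq')]
        exact h3
      · have hne' : j ≠ i := by simpa [hi₂, d50] using hne'
        refine ⟨by simp [d50], fun x hx => ?_, ?_⟩
        · simpa [d50, hx.ne] using h2 x hx
        · rw [parOf, if_pos ⟨heq, hne'⟩]
          simp [d50, hi₂]
    · have hne : (f j).label ≠ (f i).label := by simpa [hi₂, d0, d52, (hf i hi).1] using hne
      refine WP.skip ⟨h2, ?_⟩
      rw [parOf, if_neg (fun h => hne h.1)]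
      exact h3
  grind

theorem setEnds_within (k : ℕ) : (setEnds k).Within fun t y =>
    y.1 = k ∧ ((t = 0 ∧ 20 ≤ y.2 ∧ y.2 < 60) ∨ (t = 1 ∧ y.2 = 11)) := by
  simp [setEnds]

theorem setEnds_spec (hz : S.v (k, 2) = 0) (hm : S.v (k, 1) = m)
    (ha : ∀ e < m, S.a (k, 3) e = a e) (hb : ∀ e < m, S.a (k, 4) e = b e) (hab : ∀ e < m, a e ≤ b e)
    (hbn : ∀ e < m, b e ≤ n) (hn : n ≤ N) (hmN : m ≤ N) (hdis : ∀ c < m, ∀ d < m, c < d → b c ≤ a d)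
    (hQ : ∀ S', (∀ c < m, ∀ x, a c ≤ x → x < b c → S'.a (k, 11) x = (b c : ℤ)) → Agree (fun t y =>
      y.1 = k ∧ ((t = 0 ∧ 20 ≤ y.2 ∧ y.2 < 60) ∨ (t = 1 ∧ y.2 = 11))) S S' → Q S') :
    WP inp N Y (setEnds k) Q S := by
  refine WP.loop 0 m (fun e S' => ∀ c < e, ∀ x, a c ≤ x → x < b c → S'.a (k, 11) x = b c) _ (by simp [hz]) hm
    (by simp) hmN (by simp) (by simp) (by simp)
    (setEnds_within k) (fun _ _ _ _ _ _ _ h => h) (by simp) ?_ hQ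
  intro e _ he S' h1 hA he'
  have e3 : S'.a (k, 3) = S.a (k, 3) := hA.a _
  have e4 : S'.a (k, 4) = S.a (k, 4) := hA.a _
  refine ⟨by simp [he'], by simp [he'], ?_⟩
  refine WP.loop (a e) (b e) (fun j S'' => (∀ c < e, ∀ x, a c ≤ x → x < b c → S''.a (k, 11) x = b c) ∧
      ∀ x, a e ≤ x → x < j → S''.a (k, 11) x = b e)
    (fun t y => y.1 = k ∧ ((t = 0 ∧ 55 ≤ y.2 ∧ y.2 < 60) ∨ (t = 1 ∧ y.2 = 11)))
    (by simp [he', e3, ha e he]) (by simp [he', e4, hb e he]) (hab e he)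
    ((hbn e he).trans hn) (by simp) (by simp) (by simp)
    (by simp) (fun _ _ _ _ _ _ _ h => h) ?_ ?_ ?_
  · exact ⟨by simpa using h1, fun x h h' => by omega⟩
  · intro j haj hj S'' ⟨h2, h3⟩ hA' hj'
    have e54 : S''.v (k, 54) = b e := (hA'.v _).trans (by simp [he', e4, hb e he])
    refine ⟨by simp [hj'], fun c hc x hx hx' => ?_, fun x hx hx' => ?_⟩
    · have := hdis c (by omega) e he hc
      simp only [Op.run, update_self, hj', e54, Int.toNat_natCast]
      rw [update_of_ne (by omega)]
      exact h2 c hc x hx hx'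
    · simp only [Op.run, update_self, hj', e54, Int.toNat_natCast, update_apply]
      split_ifs with h4
      · rfl
      · exact h3 x hx (by omega)
  grind

/-! ### The table of the values of arcs -/

/-- Sort the two arcs of a self-crossing `p`. At level zero, the first arc grows by one position from one call
to the next. -/
noncomputable def tableMid (link : ℕ → Cmd) : ℕ → Cmd
  | 0 => .ifLt (0, 64) (0, 70)
      (.op (.load (0, 74) (0, 1) (0, 70)) ;; .ifLt (0, 74) (0, 4)
        (.op (.load (0, 75) (0, 5) (0, 70)) ;; .ifLt (0, 62) (0, 75)
          (.ifLt (0, 75) (0, 64)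
            (.op (.load (0, 76) (0, 2) (0, 70)) ;; setSwitch 0 (0, 4) (0, 76) ;;
              .op (.pmul 0 (0, 1) (0, 1) (0, 4))) (.skip 0)) (.skip 0)) (.skip 0)) (.skip 0)
  | k + 1 => .op (.store (k + 1, 9) (k + 1, 2) (k + 1, 65)) ;; .op (.store (k + 1, 9) (k + 1, 4) (k + 1, 63)) ;;
      .op (.store (k + 1, 10) (k + 1, 2) (k + 1, 72)) ;; .op (.store (k + 1, 10) (k + 1, 4) (k + 1, 64)) ;;
      sortArcs (k + 1) (subSmooth link (k + 1, 9) (k + 1, 10) (k + 1, 3) (k + 1)) (k + 1, 9) (k + 1, 10) (k + 1, 3)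

/-- What `tableMid` may change. -/
@[simp] def midTargets (k t : ℕ) (y : Name) : Prop :=
  y.1 < k ∨ (y.1 = k ∧ ((t = 0 ∧ (20 ≤ y.2 ∧ y.2 < 60 ∨ 74 ≤ y.2 ∧ y.2 < 80)) ∨ (t = 1 ∧ 6 ≤ y.2 ∧ y.2 ≤ 10) ∨
    (t = 2 ∧ 1 ≤ y.2 ∧ y.2 ≤ 5)))

theorem tableMid_within (hlink : ∀ k', k = k' + 1 → (link k').Within fun _ y => y.1 ≤ k') :
    (tableMid link k).Within (midTargets k) := by
  cases k with
  | zero =>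
    simp [tableMid, setSwitch]
  | succ k =>
    refine ⟨?_, ?_, ?_, ?_, (sortArcs_within _ (subSmooth_within hlink _ _ _) _ _ _).mono ?_⟩
    · simp
    · simp
    · simp
    · simp
    · intro t y h
      unfold sortTargets at h
      unfold midTargets
      omega

/-- At level zero the product of switch coefficients is passed on from one entry of the row to the
next, and only the factor of position `q` is new; `h0` and the last clause are the invariant for
this. At higher levels the two arcs are sorted anew. -/
theorem tableMid_spec (hlink : ∀ k', k = k' + 1 → LinkSpec inp N Y k' (link k') s₀)
    (hlinkW : ∀ k', k = k' + 1 → (link k').Within fun _ y => y.1 ≤ k')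
    {P : LinkDiagram → RingAZ} (hP : IsSkeinPolynomial P)
    (hS : S.Ready k f n par)
    (hs : Sound f n) (hpar : IsPar f n par) (hg : (codeOf f a b m).Good) {c p q : ℕ} (hc : c < m)
    (hap : a c ≤ p) (hqb : q + 1 ≤ b c) (hbn : b c ≤ n) (hps : p < par p) (hsq : par p ≤ q)
    (v62 : S.v (k, 62) = p) (v63 : S.v (k, 63) = (p + 1 : ℕ)) (v64 : S.v (k, 64) = par p)
    (v65 : S.v (k, 65) = (par p + 1 : ℕ)) (v70 : S.v (k, 70) = q) (v72 : S.v (k, 72) = (q + 1 : ℕ))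
    (hnN : n + 2 ≤ N) (hns : n ≤ s₀) (hsN : s₀ ≤ N) (hY : 3 * n + 2 * s₀ + 2 ≤ Y)
    (h0 : k = 0 → S.pv (k, 1) = tr 0 (∏ x ∈ Finset.Ico (par p + 1) q, arcFactor f par p (par p) x) ∧
      Bd (2 * q) (S.pv (k, 1)) ∧ S.pv (k, 2) = 0) :
    WP inp N Y (tableMid link k) (fun S' =>
      tr k (descend [seg f (par p + 1) (q + 1), seg f (p + 1) (par p)]) =
        tr k (S'.pv (k, 1) * (descend [seg f (par p + 1) (q + 1)] * (C circleValue * descend [seg f (p + 1) (par p)])) +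
          X * S'.pv (k, 2)) ∧ Bd (2 * n) (S'.pv (k, 1)) ∧ Bd (3 * n + 1 + 2 * s₀) (S'.pv (k, 2)) ∧
      (k = 0 → S'.pv (k, 1) = tr 0 (∏ x ∈ Finset.Ico (par p + 1) (q + 1), arcFactor f par p (par p) x) ∧
        Bd (2 * (q + 1)) (S'.pv (k, 1)) ∧ S'.pv (k, 2) = 0)) S := by
  have hgood := good_seg_pair hpar hs hg hc hap hqb hbn hps (by omega)
  cases k with
  | zero =>
    obtain ⟨e1, e2, e3⟩ := h0 rfl
    have hz := tr_zero_pair hP hpar hs (by omega : q + 1 ≤ n) (by omega) hgood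
    have hfin : ∀ S' : Store, S'.pv (0, 1) = tr 0 (∏ x ∈ Finset.Ico (par p + 1) (q + 1), arcFactor f par p (par p) x) →
        Bd (2 * (q + 1)) (S'.pv (0, 1)) → S'.pv (0, 2) = 0 →
        (tr 0 (descend [seg f (par p + 1) (q + 1), seg f (p + 1) (par p)]) =
        tr 0 (S'.pv (0, 1) * (descend [seg f (par p + 1) (q + 1)] * (C circleValue * descend [seg f (p + 1) (par p)])) +
          X * S'.pv (0, 2)) ∧ Bd (2 * n) (S'.pv (0, 1)) ∧ Bd (3 * n + 1 + 2 * s₀) (S'.pv (0, 2)) ∧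
      (0 = 0 → S'.pv (0, 1) = tr 0 (∏ x ∈ Finset.Ico (par p + 1) (q + 1), arcFactor f par p (par p) x) ∧
        Bd (2 * (q + 1)) (S'.pv (0, 1)) ∧ S'.pv (0, 2) = 0)) := by
      intro S' h1 h2 h3
      refine ⟨?_, h2.mono (by omega), by rw [h3]; exact Bd.zero.mono (by simp), fun _ => ⟨h1, h2, h3⟩⟩
      rw [hz, h3, mul_zero, add_zero, h1]
      exact tr_congr_mul (tr_tr _ _).symm rfl
    have hskip : ∀ S' : Store, S'.pv = S.pv → (par p < q → arcFactor f par p (par p) q = 1) →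
        WP inp N Y (.skip 0) (fun S' =>
        tr 0 (descend [seg f (par p + 1) (q + 1), seg f (p + 1) (par p)]) =
        tr 0 (S'.pv (0, 1) * (descend [seg f (par p + 1) (q + 1)] * (C circleValue * descend [seg f (p + 1) (par p)])) +
          X * S'.pv (0, 2)) ∧ Bd (2 * n) (S'.pv (0, 1)) ∧ Bd (3 * n + 1 + 2 * s₀) (S'.pv (0, 2)) ∧
      (0 = 0 → S'.pv (0, 1) = tr 0 (∏ x ∈ Finset.Ico (par p + 1) (q + 1), arcFactor f par p (par p) x) ∧
        Bd (2 * (q + 1)) (S'.pv (0, 1)) ∧ S'.pv (0, 2) = 0)) S' := by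
      intro S' h1 h2
      refine WP.skip (hfin _ ?_ ?_ ?_)
      · simp only [h1, e1]
        by_cases hlt : par p < q
        · rw [Finset.prod_Ico_succ_top (by omega), h2 hlt, mul_one]
        · rw [Finset.Ico_eq_empty (by omega), Finset.Ico_eq_empty (by omega)]
      · simp only [h1]
        exact e2.mono (by omega)
      · simp only [h1, e3]
    have hqn : q < n := by omega
    obtain ⟨-, g1, g2⟩ := hS.shows q hqn
    refine ⟨fun hlt => ?_, fun hge => hskip _ rfl fun h => ?_⟩
    swap
    · rw [v64, v70] at hge
      omega
    have hlt : par p < q := by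
      rw [v64, v70] at hlt
      omega
    refine ⟨by simp [v70], fun hlt' => ?_, fun hge => hskip _ rfl fun _ => ?_⟩
    swap
    · rw [arcFactor, if_neg]
      rintro ⟨h, -⟩
      have := height_eq_zero.2 h
      simp [hS.one, v70, g1] at hge
      omega
    have ho : (f q).isOver = false := height_eq_zero.1 (by simpa [hS.one, v70, g1] using hlt')
    refine ⟨by simp [v70], fun hlt2 => ⟨fun hlt3 => ?_, fun hge => hskip _ rfl fun _ => ?_⟩,
      fun hge => hskip _ rfl fun _ => ?_⟩
    rotate_left
    · rw [arcFactor, if_neg]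
      rintro ⟨-, -, h⟩
      simp [v64, v70, hS.par q hqn] at hge
      omega
    · rw [arcFactor, if_neg]
      rintro ⟨-, h, -⟩
      simp [v62, v70, hS.par q hqn] at hge
      omega
    have h2 : p < par q := by simpa [v62, v70, hS.par q hqn] using hlt2
    have h3 : par q < par p := by simpa [v64, v70, hS.par q hqn] using hlt3
    refine ⟨by simp [v70], setSwitch_spec (f q) (by simp [hS.zero])
      (by simp [v70, g2]) (by omega) ?_⟩
    have hb := (e2.mul (Bd.switch (f q))).tr 0
    refine ⟨by simpa using hb.mono (by omega), hfin _ ?_ ?_ ?_⟩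
    · simp only [Op.run, update_self]
      rw [update_of_ne (by simp), e1, Finset.prod_Ico_succ_top (by omega)]
      refine tr_congr_mul (tr_tr _ _) ?_
      rw [arcFactor, if_pos ⟨ho, h2, h3⟩]
    · simp only [Op.run, update_self]
      rw [update_of_ne (by simp)]
      exact hb.mono (by omega)
    · simp [e3]
  | succ k =>
    let a' : ℕ → ℕ := fun e => if e = 0 then par p + 1 else p + 1
    let b' : ℕ → ℕ := fun e => if e = 0 then q + 1 else par p
    have hcode : codeOf f a' b' 2 = [seg f (par p + 1) (q + 1), seg f (p + 1) (par p)] := codeOf_two rfl rfl rfl rfl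
    refine ⟨by simp [hS.zero], by simp [hS.one], by simp [hS.zero],
      by simp [hS.one], ?_⟩
    generalize hS₁ : Op.run inp _ _ = S₁
    replace hS₁ := hS₁.symm
    have hA₁ : Agree (fun t y => t = 1 ∧ 6 ≤ y.2) S S₁ := by
      rw [hS₁]
      constructor <;> intro y hy <;> simp only [Op.run]
      grind
    have hR := hS.agree hA₁ (by
      intro j
      constructor <;> intro hj <;> simp
      omega)
    have ha : ∀ e < 2, S₁.a (k + 1, 9) e = a' e := by
      intro e he
      interval_cases e <;> simp [hS₁, hS.zero, hS.one, v65, v63, a']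
    have hb : ∀ e < 2, S₁.a (k + 1, 10) e = b' e := by
      intro e he
      interval_cases e <;> simp [hS₁, hS.zero, hS.one, v72, v64, b']
    have hab : ∀ e < 2, a' e ≤ b' e := by
      intro e he
      interval_cases e <;> simp [a', b'] <;> omega
    have hbn' : ∀ e < 2, b' e ≤ n := by
      intro e he
      interval_cases e <;> simp [b'] <;> omega
    have hsize : (codeOf f a' b' 2).size ≤ s₀ := by
      rw [hcode]
      simp [Code.size, length_seg]
      omega
    have htwo : S₁.v (k + 1, 3) = (2 : ℕ) := hR.two
    have hN2 : 2 ≤ N := by omega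
    refine sortArcs_spec hP hR (by simp) (by simp) (by simp) htwo ha hb hab hbn' (by omega) hN2 (by omega) hs hpar
      (by rwa [hcode]) (subSmooth_within hlinkW _ _ _) (by omega)
      (subSmooth_spec hlink hlinkW hR (by simp) (by simp) (by simp) htwo ha hb hab (by omega) hN2 hsize hsN (by omega))
      fun S₂ Z hZ hbM hbR hA₂ => ⟨?_, hbM, hbR.mono (by omega), by simp⟩
    have := hZ.finish ⟨hs, hpar, hbn', isIndex_indexOf (by rw [hcode]; exact hgood.subWF.1), by rwa [hcode]⟩ (n := 1) rfl
    rw [hcode] at this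
    rw [this]
    simp [a', b']

/-- Combine the values of shorter arcs. -/
noncomputable def tableCombine (k : ℕ) : Cmd :=
  .op (.pload (k, 7) (k, 0) (k, 65) (k, 72)) ;; .op (.pload (k, 8) (k, 0) (k, 63) (k, 64)) ;;
  .op (.pmul k (k, 8) (k, 11) (k, 8)) ;; .op (.pmul k (k, 7) (k, 7) (k, 8)) ;;
  .op (.pmul k (k, 7) (k, 1) (k, 7)) ;; .op (.pmul k (k, 8) (k, 12) (k, 2)) ;;
  .op (.padd (k, 7) (k, 7) (k, 8)) ;; setSmooth k (k, 10) (k, 68) ;; .op (.pmul k (k, 7) (k, 10) (k, 7)) ;;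
  setSwitch k (k, 9) (k, 68) ;; .op (.pmul k (k, 6) (k, 9) (k, 6)) ;; .op (.padd (k, 6) (k, 6) (k, 7))

/-- Compute one entry of the table. -/
noncomputable def tableCell (k : ℕ) (mid : Cmd) : Cmd :=
  .op (.addc (k, 72) (k, 70) 1) ;; .op (.pload (k, 6) (k, 0) (k, 63) (k, 72)) ;;
  .ifLt (k, 67) (k, 4) (.ifLt (k, 62) (k, 64) (.ifLt (k, 64) (k, 72) (mid ;; tableCombine k) (.skip k))
    (.skip k)) (.skip k) ;;
  .op (.pstore (k, 0) (k, 62) (k, 72) (k, 6))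

/-- What the computation of an entry may change. -/
@[simp] def cellTargets (k t : ℕ) (y : Name) : Prop :=
  y.1 < k ∨ (y.1 = k ∧ ((t = 0 ∧ (20 ≤ y.2 ∧ y.2 < 60 ∨ 72 ≤ y.2 ∧ y.2 < 80)) ∨ (t = 1 ∧ 6 ≤ y.2 ∧ y.2 ≤ 10) ∨
    (t = 2 ∧ 1 ≤ y.2 ∧ y.2 ≤ 10) ∨ (t = 3 ∧ y.2 = 0)))

/-- The current row of the table. -/
structure Store.Row (S : Store) (k : ℕ) (f : ℕ → Passage) (par : ℕ → ℕ) (p : ℕ) : Prop where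
  v62 : S.v (k, 62) = p
  v63 : S.v (k, 63) = (p + 1 : ℕ)
  v64 : S.v (k, 64) = par p
  v65 : S.v (k, 65) = (par p + 1 : ℕ)
  v67 : S.v (k, 67) = (f p).height
  v68 : S.v (k, 68) = (f p).sign
  p11 : S.pv (k, 11) = C circleValue
  p12 : S.pv (k, 12) = X

/-- The entries of the table that satisfy `R` are correct. -/
def TableInv (k : ℕ) (f : ℕ → Passage) (a b : ℕ → ℕ) (m : ℕ) (R : ℕ → ℕ → Prop)
    (F : ℕ → ℕ → RingA[X]) : Prop :=
  ∀ c < m, ∀ x y, a c ≤ x → x ≤ y → y ≤ b c → R x y → F x y = tr k (descend [seg f x y])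

theorem size_seg (f : ℕ → Passage) (x y : ℕ) : Code.size [seg f x y] = y - x + 1 := by
  simp [Code.size, length_seg]

theorem tableCombine_within (k : ℕ) : (tableCombine k).Within fun t y => y.1 = k ∧ t = 2 ∧ 6 ≤ y.2 ∧ y.2 ≤ 10 := by
  simp [tableCombine, setSmooth, setSwitch]

/-- Here `D₁` and `D₂` are the two arcs of the smoothing, `G` is their joint value after sorting and
`D₀` is the switched arc. The result is the skein relation at the first passage, truncated after
each product. -/
theorem tableCombine_spec {p q B : ℕ}
    {G D₀ D₁ D₂ : RingA[X]} (hz : S.v (k, 2) = 0) (hrow : S.Row k f par p) (v72 : S.v (k, 72) = (q : ℕ))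
    (h1 : S.pa (k, 0) (par p + 1) q = tr k D₁) (h2 : S.pa (k, 0) (p + 1) (par p) = tr k D₂)
    (h6 : S.pv (k, 6) = tr k D₀) (hG : tr k G = tr k (S.pv (k, 1) * (D₁ * (C circleValue * D₂)) + X * S.pv (k, 2)))
    (hb1 : Bd (2 * (q - (par p + 1) + 1)) D₁) (hb2 : Bd (2 * (par p - (p + 1) + 1)) D₂)
    (hb0 : Bd (2 * (n + 1)) D₀) (hbM : Bd (2 * n) (S.pv (k, 1))) (hbR : Bd B (S.pv (k, 2)))
    (hps : p < par p) (hsq : par p < q) (hqn : q ≤ n) (hnB : 4 * n + 4 ≤ B) (hY : B + 4 ≤ Y)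
    (hQ : ∀ S', S'.pv (k, 6) = tr k (C (switchCoeff (f p)) * D₀ + C (smoothCoeff (f p)) * G) → S'.pa = S.pa →
      Agree (fun t y => y.1 = k ∧ t = 2 ∧ 6 ≤ y.2 ∧ y.2 ≤ 10) S S' → Q S') :
    WP inp N Y (tableCombine k) Q S := by
  suffices h : WP inp N Y (tableCombine k) (fun S' =>
      S'.pv (k, 6) = tr k (C (switchCoeff (f p)) * D₀ + C (smoothCoeff (f p)) * G)) S from
    (h.frame (tableCombine_within k)).mono fun S' h => hQ S' h.1 (funext fun y => h.2.pa y (by simp)) h.2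
  obtain ⟨u₁, hu₁⟩ : ∃ u, u = tr k (C circleValue * tr k D₂) := ⟨_, rfl⟩
  obtain ⟨u₂, hu₂⟩ : ∃ u, u = tr k (tr k D₁ * u₁) := ⟨_, rfl⟩
  obtain ⟨u₃, hu₃⟩ : ∃ u, u = tr k (S.pv (k, 1) * u₂) := ⟨_, rfl⟩
  obtain ⟨u₄, hu₄⟩ : ∃ u, u = tr k (X * S.pv (k, 2)) := ⟨_, rfl⟩
  obtain ⟨u₅, hu₅⟩ : ∃ u, u = u₃ + u₄ := ⟨_, rfl⟩
  obtain ⟨u₆, hu₆⟩ : ∃ u, u = tr k (C (smoothCoeff (f p)) * u₅) := ⟨_, rfl⟩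
  obtain ⟨u₇, hu₇⟩ : ∃ u, u = tr k (C (switchCoeff (f p)) * tr k D₀) := ⟨_, rfl⟩
  have b1 := ((Bd.circle).mul (hb2.tr k)).tr k
  rw [← hu₁] at b1
  have b2 := ((hb1.tr k).mul b1).tr k
  rw [← hu₂] at b2
  have b3 := (hbM.mul b2).tr k
  rw [← hu₃] at b3
  have b4 := (Bd.X.mul hbR).tr k
  rw [← hu₄] at b4
  have b5 := (b3.mono (b' := B) (by omega)).add (b4.mono (b' := B) (by omega))
  rw [← hu₅] at b5
  have b6 := ((Bd.smooth (f p)).mul b5).tr k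
  rw [← hu₆] at b6
  have b7 := ((Bd.switch (f p)).mul (hb0.tr k)).tr k
  rw [← hu₇] at b7
  have b8 := (b7.mono (b' := B + 2) (by omega)).add (b6.mono (b' := B + 2) (by omega))
  refine ⟨by simp only [Op.Ok, hrow.v65, v72]; omega, by simp only [Op.Ok, Op.run, hrow.v63, hrow.v64]; omega, ?_⟩
  generalize hS₁ : Op.run inp _ _ = S₁
  replace hS₁ := hS₁.symm
  have e7 : S₁.pv (k, 7) = tr k D₁ := by simp [hS₁, hrow.v65, v72]; exact_mod_cast h1
  have e8 : S₁.pv (k, 8) = tr k D₂ := by simp [hS₁, hrow.v63, hrow.v64]; exact_mod_cast h2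
  have e6 : S₁.pv (k, 6) = tr k D₀ := by simp [hS₁, h6]
  have e1 : S₁.pv (k, 1) = S.pv (k, 1) := by simp [hS₁]
  have e2 : S₁.pv (k, 2) = S.pv (k, 2) := by simp [hS₁]
  have e11 : S₁.pv (k, 11) = C circleValue := by simp [hS₁, hrow.p11]
  have e12 : S₁.pv (k, 12) = X := by simp [hS₁, hrow.p12]
  have ev : S₁.v = S.v := by simp [hS₁]
  have c1 := b1.mono (b' := Y) (by omega)
  have c2 := b2.mono (b' := Y) (by omega)
  have c3 := b3.mono (b' := Y) (by omega)
  have c4 := b4.mono (b' := Y) (by omega)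
  have c5 := b5.mono (b' := Y) (by omega)
  simp [WP, e7, e8, e1, e2, e11, e12, ← hu₁, ← hu₂, ← hu₃, ← hu₄, ← hu₅, c1, c2, c3, c4, c5]
  refine setSmooth_spec (f p) (by simp [ev, hz]) (by simp [ev, hrow.v68]) (by omega) ?_
  have c6 := b6.mono (b' := Y) (by omega)
  simp [← hu₆, c6]
  refine setSwitch_spec (f p) (by simp [ev, hz]) (by simp [ev, hrow.v68]) (by omega) ?_
  have c7 := b7.mono (b' := Y) (by omega)
  have c8 := b8.mono (b' := Y) (by omega)
  simp [e6, ← hu₇, c7, c8]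
  rw [tr_add, hu₇, hu₆, hu₅, hu₄, hu₃, hu₂, hu₁]
  refine congrArg₂ (· + ·) ?_ ?_
  · exact tr_congr_mul rfl (tr_tr _ _)
  · refine tr_congr_mul rfl ?_
    rw [hG]
    refine tr_congr_add ((tr_tr _ _).trans (tr_congr_mul rfl ((tr_tr _ _).trans (tr_congr_mul (tr_tr _ _)
      ((tr_tr _ _).trans (tr_congr_mul rfl (tr_tr _ _)))))) ) (tr_tr _ _)

theorem tableCell_within {mid : Cmd} (hmid : mid.Within (midTargets k)) :
    (tableCell k mid).Within (cellTargets k) := by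
  have h1 := hmid.mono (P' := cellTargets k) (by
    intro t y h
    unfold midTargets at h
    unfold cellTargets
    omega)
  have h2 := (tableCombine_within k).mono (P' := cellTargets k) (by
    intro t y h
    unfold cellTargets
    omega)
  simp [tableCell, h1, h2]

/-- At level zero, the row also keeps the product of the switch coefficients. -/
def Store.RowProd (S : Store) (k : ℕ) (f : ℕ → Passage) (par : ℕ → ℕ) (p q : ℕ) : Prop :=
  k = 0 → (f p).isOver = false → p < par p →
    S.pv (k, 1) = tr 0 (∏ x ∈ Finset.Ico (par p + 1) q, arcFactor f par p (par p) x) ∧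
      Bd (2 * q) (S.pv (k, 1)) ∧ S.pv (k, 2) = 0

/-- The entry `(p, q + 1)` needs the entries `(p + 1, q + 1)`, `(par p + 1, q + 1)` and `(p + 1, par
p)`. All of them lie in later rows or on the diagonal, which is why rows are computed from the last
to the first. -/
theorem tableCell_spec (hlink : ∀ k', k = k' + 1 → LinkSpec inp N Y k' (link k') s₀)
    (hlinkW : ∀ k', k = k' + 1 → (link k').Within fun _ y => y.1 ≤ k')
    {P : LinkDiagram → RingAZ} (hP : IsSkeinPolynomial P)
    (hS : S.Ready k f n par)
    (hs : Sound f n) (hpar : IsPar f n par) (hg : (codeOf f a b m).Good) {c p q : ℕ} (hc : c < m)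
    (hap : a c ≤ p) (hpq : p ≤ q) (hqb : q + 1 ≤ b c) (hbn : b c ≤ n) (hrow : S.Row k f par p)
    (v70 : S.v (k, 70) = q)
    (hF : TableInv k f a b m (fun x y => x = y ∨ p + 1 ≤ x ∨ (x = p ∧ y ≤ q)) (S.pa (k, 0)))
    (hnN : n + 2 ≤ N) (hns : n ≤ s₀) (hsN : s₀ ≤ N) (hY : 4 * n + 2 * s₀ + 9 ≤ Y)
    (h0 : S.RowProd k f par p q) :
    WP inp N Y (tableCell k (tableMid link k)) (fun S' =>
      TableInv k f a b m (fun x y => x = y ∨ p + 1 ≤ x ∨ (x = p ∧ y ≤ q + 1)) (S'.pa (k, 0)) ∧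
      S'.RowProd k f par p (q + 1)) S := by
  refine ⟨⟨by rw [abs_le]; omega, by rw [v70, abs_le]; omega⟩, by simp [hrow.v63, v70]; omega, ?_⟩
  generalize hS₁ : Op.run inp _ _ = S₁
  replace hS₁ := hS₁.symm
  have hval : S.pa (k, 0) (p + 1) (q + 1) = tr k (descend [seg f (p + 1) (q + 1)]) :=
    hF c hc _ _ (by omega) (by omega) hqb (Or.inr (Or.inl le_rfl))
  have e6 : S₁.pv (k, 6) = tr k (descend [seg f (p + 1) (q + 1)]) := by
    rw [← hval]
    simp [hS₁, hrow.v63, v70]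
  have e72 : S₁.v (k, 72) = (q + 1 : ℕ) := by simp [hS₁, v70]
  have epa : S₁.pa = S.pa := by simp [hS₁]
  have epv : ∀ j, j ≠ 6 → S₁.pv (k, j) = S.pv (k, j) := fun j hj => by simp [hS₁, hj]
  have hA₁ : Agree (fun t y => (t = 0 ∧ y = (k, 72)) ∨ (t = 2 ∧ y = (k, 6))) S S₁ := by
    subst hS₁
    repeat' refine Agree.run ?_ _ (by simp)
    exact .refl _ _
  have hR₁ := hS.agree hA₁ (by
    intro j
    constructor <;> intro hj <;> simp
    omega)
  have hrow₁ : S₁.Row k f par p := by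
    exact ⟨(hA₁.v _).trans hrow.v62, (hA₁.v _).trans hrow.v63, (hA₁.v _).trans hrow.v64, (hA₁.v _).trans hrow.v65,
      (hA₁.v _).trans hrow.v67, (hA₁.v _).trans hrow.v68, (hA₁.pv _).trans hrow.p11, (hA₁.pv _).trans hrow.p12⟩
  have v70₁ : S₁.v (k, 70) = q := (hA₁.v _).trans v70
  have h0₁ : S₁.RowProd k f par p q := by
    intro h h' h''
    rw [epv 1 (by simp), epv 2 (by simp)]
    exact h0 h h' h''
  suffices key : WP inp N Y (.ifLt (k, 67) (k, 4) (.ifLt (k, 62) (k, 64) (.ifLt (k, 64) (k, 72)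
      (tableMid link k ;; tableCombine k) (.skip k)) (.skip k)) (.skip k)) (fun S' =>
        S'.pv (k, 6) = tr k (descend [seg f p (q + 1)]) ∧ S'.pa (k, 0) = S.pa (k, 0) ∧ S'.v (k, 62) = p ∧
          S'.v (k, 72) = (q + 1 : ℕ) ∧
          S'.RowProd k f par p (q + 1)) S₁ by
    refine WP.seq (WP.mono key fun S₂ h => ?_)
    obtain ⟨i1, i2, i3, i4, i5⟩ := h
    refine ⟨by simp [i3, i4]; omega, fun c' hc' x y hx hxy hy hR => ?_, by simpa [Store.RowProd] using i5⟩
    simp only [Op.run, update_self, i1, i2, i3, i4, Int.toNat_natCast]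
    by_cases hxp : x = p
    · subst hxp
      rw [update_self]
      by_cases hyq : y = q + 1
      · rw [hyq, update_self]
      · rw [update_of_ne hyq]
        exact hF c' hc' x y hx hxy hy (by omega)
    · rw [update_of_ne hxp]
      exact hF c' hc' x y hx hxy hy (by omega)
  -- If the first passage is over, or its partner is not ahead inside the arc, then it can be
  -- dropped and the entry is copied from the next row. The product at level zero is then not
  -- extended, since its range is still empty.
  have hskip : (p < par p → (f p).isOver = false → q + 1 ≤ par p) →
      WP inp N Y (.skip k) (fun S' =>
        S'.pv (k, 6) = tr k (descend [seg f p (q + 1)]) ∧ S'.pa (k, 0) = S.pa (k, 0) ∧ S'.v (k, 62) = p ∧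
          S'.v (k, 72) = (q + 1 : ℕ) ∧
          S'.RowProd k f par p (q + 1)) S₁ := by
    intro h
    refine WP.skip ⟨?_, by simp only [epa], by simp [hrow₁.v62], by simp [e72], ?_⟩
    · simp only [e6]
      rw [descend_seg_skip (p := p) hpar (by omega) (by omega)]
      grind
    · intro hk h1 h2
      have h3 := h h2 h1
      obtain ⟨g1, g2, g3⟩ := h0₁ hk h1 h2
      simp only
      refine ⟨?_, g2.mono (by omega), g3⟩
      rw [g1, Finset.Ico_eq_empty (by omega), Finset.Ico_eq_empty (by omega)]
  refine ⟨fun hlt => ⟨fun hlt2 => ⟨fun hlt3 => ?_, fun hge => hskip ?_⟩, fun hge => hskip ?_⟩, fun hge => hskip ?_⟩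
  rotate_left
  · rw [hrow₁.v64, e72] at hge
    omega
  · rw [hrow₁.v62, hrow₁.v64] at hge
    omega
  · rw [hrow₁.v67, hR₁.one] at hge
    intro _ h
    have := height_eq_zero.2 h
    omega
  rw [hrow₁.v67, hR₁.one, height_eq_zero] at hlt
  rw [hrow₁.v62, hrow₁.v64, Nat.cast_lt] at hlt2
  rw [hrow₁.v64, e72, Nat.cast_lt] at hlt3
  refine ((tableMid_spec hlink hlinkW hP hR₁ hs hpar hg hc hap hqb hbn hlt2 (by omega) hrow₁.v62 hrow₁.v63 hrow₁.v64
    hrow₁.v65 v70₁ e72 hnN hns hsN (by omega) fun hk => h0₁ hk hlt hlt2).frame (tableMid_within hlinkW)).mono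
      fun S₂ ⟨⟨hG, hbM, hbR, h0₂⟩, hA₂⟩ => ?_
  have hrow₂ : S₂.Row k f par p := by
    exact ⟨(hA₂.v _).trans hrow₁.v62, (hA₂.v _).trans hrow₁.v63, (hA₂.v _).trans hrow₁.v64, (hA₂.v _).trans hrow₁.v65,
      (hA₂.v _).trans hrow₁.v67, (hA₂.v _).trans hrow₁.v68, (hA₂.pv _).trans hrow₁.p11, (hA₂.pv _).trans hrow₁.p12⟩
  have epa₂ : S₂.pa (k, 0) = S.pa (k, 0) := (hA₂.pa _).trans (by rw [epa])
  have v72₂ : S₂.v (k, 72) = (q + 1 : ℕ) := (hA₂.v _).trans e72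
  refine tableCombine_spec (n := n) (B := 4 * n + 2 * s₀ + 5) (D₀ := descend [seg f (p + 1) (q + 1)])
    (D₁ := descend [seg f (par p + 1) (q + 1)])
    (D₂ := descend [seg f (p + 1) (par p)]) ((hA₂.v _).trans hR₁.zero) hrow₂ v72₂
    ?_ ?_ ((hA₂.pv _).trans e6) hG ?_ ?_ ?_ hbM (hbR.mono (by omega)) hlt2 hlt3 (by omega)
    (by omega) (by omega) fun S₃ q6 qpa hA₃ => ?_
  · rw [epa₂]
    exact hF c hc _ _ (by omega) (by omega) hqb (Or.inr (Or.inl (by omega)))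
  · rw [epa₂]
    exact hF c hc _ _ (by omega) (by omega) (by omega) (Or.inr (Or.inl le_rfl))
  · rw [← size_seg f]
    exact Bd.descend _
  · rw [← size_seg f]
    exact Bd.descend _
  · refine (Bd.descend _).mono ?_
    rw [size_seg]
    omega
  · refine ⟨?_, by rw [qpa, epa₂], (hA₃.v _).trans hrow₂.v62, (hA₃.v _).trans v72₂, ?_⟩
    · rw [q6, descend_seg_expand hpar hs (by omega) hlt hlt2 hlt3]
    · intro hk _ _
      rw [hA₃.pv _, hA₃.pv _]
      exact h0₂ hk

/-- Compute one row of the table, the last rows first. -/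
noncomputable def tableRow (k : ℕ) (mid : Cmd) : Cmd :=
  .op (.sub (k, 62) (k, 0) (k, 60)) ;; .op (.addc (k, 62) (k, 62) (-1)) ;; .op (.addc (k, 63) (k, 62) 1) ;;
  .op (.load (k, 64) (k, 5) (k, 62)) ;; .op (.addc (k, 65) (k, 64) 1) ;; .op (.load (k, 66) (k, 11) (k, 62)) ;;
  .op (.load (k, 67) (k, 1) (k, 62)) ;; .op (.load (k, 68) (k, 2) (k, 62)) ;;
  .op (.pconst (k, 1) 1) ;; .op (.pconst (k, 2) 0) ;;
  .loop (k, 70) (k, 71) (k, 62) (k, 66) (tableCell k mid)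

/-- Compute the table of the values of arcs. -/
noncomputable def arcTable (k : ℕ) (mid : Cmd) : Cmd :=
  .op (.pconst (k, 11) (C circleValue)) ;; .op (.pconst (k, 12) X) ;; .op (.pconst (k, 13) 1) ;;
  .op (.addc (k, 74) (k, 0) 1) ;;
  .loop (k, 60) (k, 61) (k, 2) (k, 74) (.op (.pstore (k, 0) (k, 60) (k, 60) (k, 13))) ;;
  .loop (k, 60) (k, 61) (k, 2) (k, 0) (tableRow k mid)

/-- What the computation of a row may change. -/
@[simp] def rowTargets (k t : ℕ) (y : Name) : Prop :=
  y.1 < k ∨ (y.1 = k ∧ ((t = 0 ∧ (20 ≤ y.2 ∧ y.2 < 60 ∨ 61 ≤ y.2 ∧ y.2 < 80)) ∨ (t = 1 ∧ 6 ≤ y.2 ∧ y.2 ≤ 10) ∨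
    (t = 2 ∧ 1 ≤ y.2 ∧ y.2 ≤ 10) ∨ (t = 3 ∧ y.2 = 0)))

/-- What the computation of the table may change. -/
@[simp] def tableTargets (k t : ℕ) (y : Name) : Prop :=
  y.1 < k ∨ (y.1 = k ∧ ((t = 0 ∧ 20 ≤ y.2 ∧ y.2 < 80) ∨ (t = 1 ∧ 6 ≤ y.2 ∧ y.2 ≤ 10) ∨
    (t = 2 ∧ 1 ≤ y.2 ∧ y.2 ≤ 13) ∨ (t = 3 ∧ y.2 = 0)))

theorem tableRowLoop_within {mid : Cmd} (hmid : mid.Within (midTargets k)) :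
    (Cmd.loop (k, 70) (k, 71) (k, 62) (k, 66) (tableCell k mid)).Within fun t y => cellTargets k t y ∨
      (t = 0 ∧ y.1 = k ∧ 70 ≤ y.2 ∧ y.2 ≤ 71) := by
  have := (tableCell_within hmid).mono (P' := fun t y => cellTargets k t y ∨
      (t = 0 ∧ y.1 = k ∧ 70 ≤ y.2 ∧ y.2 ≤ 71)) fun t y h => Or.inl h
  simpa using this

theorem tableRow_within {mid : Cmd} (hmid : mid.Within (midTargets k)) :
    (tableRow k mid).Within (rowTargets k) := by
  have := (tableRowLoop_within hmid).mono (P' := rowTargets k) (by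
    intro t y h
    unfold cellTargets at h
    unfold rowTargets
    omega)
  simpa [tableRow] using this

theorem tableRow_spec (hlink : ∀ k', k = k' + 1 → LinkSpec inp N Y k' (link k') s₀)
    (hlinkW : ∀ k', k = k' + 1 → (link k').Within fun _ y => y.1 ≤ k')
    {P : LinkDiagram → RingAZ} (hP : IsSkeinPolynomial P)
    (hS : S.Ready k f n par)
    (hs : Sound f n) (hpar : IsPar f n par) (hg : (codeOf f a b m).Good) {c p : ℕ} (hc : c < m)
    (hap : a c ≤ p) (hpb : p < b c) (hbn : b c ≤ n) (v60 : S.v (k, 60) = (n - (p + 1) : ℕ))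
    (hcend : ∀ c < m, ∀ x, a c ≤ x → x < b c → S.a (k, 11) x = (b c : ℤ))
    (p11 : S.pv (k, 11) = C circleValue) (p12 : S.pv (k, 12) = X)
    (hF : TableInv k f a b m (fun x y => x = y ∨ p + 1 ≤ x) (S.pa (k, 0)))
    (hnN : n + 2 ≤ N) (hns : n ≤ s₀) (hsN : s₀ ≤ N) (hY : 4 * n + 2 * s₀ + 9 ≤ Y) :
    WP inp N Y (tableRow k (tableMid link k)) (fun S' =>
      TableInv k f a b m (fun x y => x = y ∨ p ≤ x) (S'.pa (k, 0))) S := by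
  have hpn : p < n := by omega
  have hparp := hpar.lt p hpn
  -- The loop counts upwards while the rows go downwards, so row `p` belongs to the counter value `n
  -- - (p + 1)`.
  have eqp : (n : ℤ) - ((n - (p + 1) : ℕ) : ℤ) + -1 = p := by omega
  have o1 : |(n : ℤ) - ((n - (p + 1) : ℕ) : ℤ)| ≤ N := by rw [abs_le]; omega
  have o2 : |(-1 : ℤ)| ≤ N := by rw [abs_le]; omega
  have o3 : |(p : ℤ)| ≤ N := by rw [abs_le]; omega
  have o4 : |(1 : ℤ)| ≤ N := by rw [abs_le]; omega
  have o5 : |(p : ℤ) + 1| ≤ N := by rw [abs_le]; omega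
  have o6 : |(par p : ℤ) + 1| ≤ N := by rw [abs_le]; omega
  obtain ⟨-, g1, g2⟩ := hS.shows p hpn
  unfold tableRow
  refine ⟨by simpa [hS.count, v60] using o1, ⟨o2, by simpa [hS.count, v60, eqp] using o3⟩,
    ⟨o4, by simpa [hS.count, v60, eqp] using o5⟩, by simp [hS.count, v60, eqp],
    ⟨o4, by simpa [hS.count, v60, eqp, hS.par p hpn] using o6⟩, by simp [hS.count, v60, eqp],
    by simp [hS.count, v60, eqp], by simp [hS.count, v60, eqp],
    Bd.one.mono (by simp), Bd.zero.mono (by simp), ?_⟩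
  generalize hS₁ : Op.run inp _ _ = S₁
  replace hS₁ := hS₁.symm
  have v62 : S₁.v (k, 62) = p := by simp [hS₁, hS.count, v60, eqp]
  have v63 : S₁.v (k, 63) = (p + 1 : ℕ) := by simp [hS₁, hS.count, v60, eqp]
  have v64 : S₁.v (k, 64) = par p := by simp [hS₁, hS.count, v60, eqp, hS.par p hpn]
  have v65 : S₁.v (k, 65) = (par p + 1 : ℕ) := by simp [hS₁, hS.count, v60, eqp, hS.par p hpn]
  have v66 : S₁.v (k, 66) = b c := by simp [hS₁, hS.count, v60, eqp, hcend c hc p hap hpb]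
  have v67 : S₁.v (k, 67) = (f p).height := by simp [hS₁, hS.count, v60, eqp, g1]
  have v68 : S₁.v (k, 68) = (f p).sign := by simp [hS₁, hS.count, v60, eqp, g2]
  have q11 : S₁.pv (k, 11) = C circleValue := by simp [hS₁, p11]
  have q12 : S₁.pv (k, 12) = X := by simp [hS₁, p12]
  have q1 : S₁.pv (k, 1) = 1 := by simp [hS₁]
  have q2 : S₁.pv (k, 2) = 0 := by simp [hS₁]
  have epa : S₁.pa = S.pa := by simp [hS₁]
  have hR : S₁.Ready k f n par := by
    exact ⟨by simp [hS₁, hS.zero], by simp [hS₁, hS.two], by simp [hS₁, hS.one], by simp [hS₁, hS.negOne],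
      by simp [hS₁, hS.count], by simpa [hS₁] using hS.shows, by simpa [hS₁] using hS.par⟩
  have hmid : (tableMid link k).Within (midTargets k) := tableMid_within hlinkW
  refine WP.loop p (b c) (fun q S' => TableInv k f a b m (fun x y => x = y ∨ p + 1 ≤ x ∨ (x = p ∧ y ≤ q)) (S'.pa (k, 0)) ∧
    S'.RowProd k f par p q) _ v62 v66 hpb.le (by omega) (by simp) (by simp) ?_ (tableRowLoop_within hmid)
    (fun _ _ _ _ _ _ _ h => h) ⟨?_, ?_⟩ ?_ ?_
  · refine (tableCell_within hmid).mono ?_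
    rintro t y h rfl rfl
    simp at h
  · intro c' hc' x y hx hxy hy hR
    rw [epa]
    exact hF c' hc' x y hx hxy hy (by omega)
  · rintro rfl _ hpp
    rw [q1, q2, Finset.Ico_eq_empty (by omega), Finset.prod_empty, ← C_1, tr_C]
    exact ⟨rfl, by rw [C_1]; exact Bd.one.mono (by simp), rfl⟩
  · rintro q hpq hqb S' ⟨hF', h0⟩ hA hq
    refine tableCell_spec hlink hlinkW hP (hR.agree hA ?_) hs hpar hg hc hap hpq hqb hbn ?_ hq hF' hnN hns hsN hY h0
    · intro j
      constructor <;> intro hj <;> simp <;> omega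
    · exact ⟨(hA.v _).trans v62, (hA.v _).trans v63, (hA.v _).trans v64, (hA.v _).trans v65, (hA.v _).trans v67,
        (hA.v _).trans v68, (hA.pv _).trans q11, (hA.pv _).trans q12⟩
  · rintro S' ⟨hF', -⟩ _ c' hc' x y hx hxy hy hR
    refine hF' c' hc' x y hx hxy hy ?_
    grind

theorem arcTable_within {mid : Cmd} (hmid : mid.Within (midTargets k)) :
    (arcTable k mid).Within (tableTargets k) := by
  have := (tableRow_within hmid).mono (P' := tableTargets k) (by
    intro t y h
    unfold rowTargets at h
    unfold tableTargets
    omega)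
  simpa [arcTable] using this

theorem arcTable_spec (hlink : ∀ k', k = k' + 1 → LinkSpec inp N Y k' (link k') s₀)
    (hlinkW : ∀ k', k = k' + 1 → (link k').Within fun _ y => y.1 ≤ k')
    {P : LinkDiagram → RingAZ} (hP : IsSkeinPolynomial P)
    (hS : S.Ready k f n par)
    (hs : Sound f n) (hpar : IsPar f n par) (hg : (codeOf f a b m).Good)
    (hbn : ∀ c < m, b c ≤ n) (hcover : ∀ x < n, ∃ c < m, a c ≤ x ∧ x < b c)
    (hcend : ∀ c < m, ∀ x, a c ≤ x → x < b c → S.a (k, 11) x = (b c : ℤ))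
    (hnN : n + 2 ≤ N) (hns : n ≤ s₀) (hsN : s₀ ≤ N) (hY : 4 * n + 2 * s₀ + 9 ≤ Y)
    (hQ : ∀ S', TableInv k f a b m (fun _ _ => True) (S'.pa (k, 0)) → S'.pv (k, 11) = C circleValue →
      S'.pv (k, 12) = X → Agree (tableTargets k) S S' → Q S') :
    WP inp N Y (arcTable k (tableMid link k)) Q S := by
  have hmid : (tableMid link k).Within (midTargets k) := tableMid_within hlinkW
  suffices h : WP inp N Y (arcTable k (tableMid link k)) (fun S' =>
      TableInv k f a b m (fun _ _ => True) (S'.pa (k, 0)) ∧ S'.pv (k, 11) = C circleValue ∧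
      S'.pv (k, 12) = X) S from
    (h.frame (arcTable_within hmid)).mono fun S' h => hQ S' h.1.1 h.1.2.1 h.1.2.2 h.2
  refine ⟨Bd.circle.mono (by omega), Bd.X.mono (by simp), Bd.one.mono (by simp),
    ⟨by rw [abs_le]; omega, by simp [hS.count, abs_le]; omega⟩, ?_⟩
  generalize hS₁ : Op.run inp _ _ = S₁
  replace hS₁ := hS₁.symm
  have p11 : S₁.pv (k, 11) = C circleValue := by simp [hS₁]
  have p12 : S₁.pv (k, 12) = X := by simp [hS₁]
  have p13 : S₁.pv (k, 13) = 1 := by simp [hS₁]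
  have v74 : S₁.v (k, 74) = (n + 1 : ℕ) := by simp [hS₁, hS.count]
  have ea : S₁.a = S.a := by simp [hS₁]
  have hR : S₁.Ready k f n par := by
    exact ⟨by simp [hS₁, hS.zero], by simp [hS₁, hS.two], by simp [hS₁, hS.one], by simp [hS₁, hS.negOne],
      by simp [hS₁, hS.count], by simpa [hS₁] using hS.shows, by simpa [hS₁] using hS.par⟩
  -- Empty arcs have value `1`. Their ends run from `0` to `n`, so there are `n + 1` of them.
  refine WP.loop 0 (n + 1) (fun j S' => ∀ x < j, S'.pa (k, 0) x x = 1)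
    (fun t y => y.1 = k ∧ ((t = 0 ∧ 60 ≤ y.2 ∧ y.2 ≤ 61) ∨ (t = 3 ∧ y.2 = 0))) hR.zero v74 (by simp) (by omega)
    (by simp) (by simp) (by simp) (by simp)
    (fun _ _ _ _ _ _ _ h => h) (by simp) ?_ ?_
  · intro j _ hj S' h hA hj'
    have e13 : S'.pv (k, 13) = 1 := (hA.pv _).trans p13
    refine ⟨by simp [hj'], fun x (hx : x < j + 1) => ?_⟩
    simp only [Op.run, hj', update_self, Int.toNat_natCast, e13]
    by_cases hxj : x = j
    · rw [hxj, update_self, update_self]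
    · rw [update_of_ne hxj]
      exact h x (by omega)
  intro S₂ hdiag hA₂
  have hR₂ : S₂.Ready k f n par := hR.agree hA₂ (by
    intro j
    constructor <;> intro hj <;> simp
    omega)
  have e11 : S₂.pv (k, 11) = C circleValue := (hA₂.pv _).trans p11
  have e12 : S₂.pv (k, 12) = X := (hA₂.pv _).trans p12
  have ea₂ : S₂.a (k, 11) = S.a (k, 11) := (hA₂.a _).trans (by rw [ea])
  refine WP.loop 0 n (fun j S' => TableInv k f a b m (fun x y => x = y ∨ n - j ≤ x) (S'.pa (k, 0)))
    (fun t y => rowTargets k t y ∨ (t = 0 ∧ y = (k, 60))) hR₂.zero hR₂.count (by simp) (by omega) (by simp) (by simp)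
    ?_ ?_ (fun _ _ _ _ _ _ _ h => h) ?_ ?_ ?_
  · refine (tableRow_within hmid).mono ?_
    rintro t y h rfl rfl
    simp at h
  · have := (tableRow_within hmid).mono (P' := fun t y => rowTargets k t y ∨ (t = 0 ∧ y = (k, 60))) fun t y h => Or.inl h
    simpa using this
  · intro c hc x y hx hxy hy hR
    have := hbn c hc
    obtain rfl : x = y := by omega
    rw [hdiag x (by omega), seg_self, descend_circle, ← C_1, tr_C]
  · intro j _ hj S' hF hA hj'
    obtain ⟨c, hc, h1, h2⟩ := hcover (n - (j + 1)) (by omega)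
    have hR' : S'.Ready k f n par := hR₂.agree hA (by
      intro j
      constructor <;> intro hj <;> simp <;> omega)
    refine tableRow_spec hlink hlinkW hP hR' hs hpar hg hc h1 h2 (hbn c hc) ?_ ?_ ((hA.pv _).trans e11)
      ((hA.pv _).trans e12) ?_ hnN hns hsN hY
    · rw [hj']
      omega
    · rw [hA.a _, ea₂]
      exact hcend
    · rwa [show n - (j + 1) + 1 = n - j by omega]
  · intro S' hF hA
    refine ⟨fun c hc x y hx hxy hy _ => hF c hc x y hx hxy hy (by omega), (hA.pv _).trans e11,
      (hA.pv _).trans e12⟩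

/-! ### The evaluation of a code -/

/-- Multiply the values of the components. -/
noncomputable def multiplyArcs (k : ℕ) : Cmd :=
  .op (.load (k, 62) (k, 3) (k, 2)) ;; .op (.load (k, 63) (k, 4) (k, 2)) ;;
  .op (.pload (k, 6) (k, 0) (k, 62) (k, 63)) ;; .op (.pmul k (k, 7) (k, 1) (k, 6)) ;;
  .loop (k, 60) (k, 61) (k, 4) (k, 1)
    (.op (.load (k, 62) (k, 3) (k, 60)) ;; .op (.load (k, 63) (k, 4) (k, 60)) ;;
      .op (.pload (k, 6) (k, 0) (k, 62) (k, 63)) ;; .op (.pmul k (k, 6) (k, 11) (k, 6)) ;;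
      .op (.pmul k (k, 7) (k, 7) (k, 6))) ;;
  .op (.pmul k (k, 8) (k, 12) (k, 2)) ;; .op (.padd (k, 0) (k, 7) (k, 8))

/-- Evaluate the code that is stored at level `k`, with the help of the program for the previous level. -/
noncomputable def evalStep (k : ℕ) (link : ℕ → Cmd) : Cmd :=
  setConsts k ;; setPar k ;; setEnds k ;; arcTable k (tableMid link k) ;;
  sortArcs k (subSmooth link (k, 3) (k, 4) (k, 1) k) (k, 3) (k, 4) (k, 1) ;; multiplyArcs k

/-- Evaluate the code that is stored at level `k`. -/
noncomputable def evalCode : ℕ → Cmd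
  | 0 => evalStep 0 fun _ => .skip 0
  | k + 1 => evalStep (k + 1) fun _ => evalCode k

/-- The sorted components are stacked, so their values, read from the table, are multiplied, with
one `circleValue` for each component after the first. The collected smoothings `X * R` are added at
the end. -/
theorem multiplyArcs_spec {e : ℕ → ℕ}
    {G : RingA[X]} (hS : S.Ready k f n par) (hm : S.v (k, 1) = (m + 1 : ℕ))
    (ha : ∀ c < m + 1, S.a (k, 3) c = e c) (hb : ∀ c < m + 1, S.a (k, 4) c = e (c + 1))
    (he : ∀ c, e c ≤ e (c + 1)) (hen : e (m + 1) = n)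
    (hF : TableInv k f e (fun c => e (c + 1)) (m + 1) (fun _ _ => True) (S.pa (k, 0)))
    (p11 : S.pv (k, 11) = C circleValue) (p12 : S.pv (k, 12) = X) (hbM : Bd (2 * n) (S.pv (k, 1)))
    (hbR : Bd (3 * n + 1 + 2 * s₀) (S.pv (k, 2)))
    (hG : tr k G = tr k (S.pv (k, 1) * (descend [seg f (e 0) (e 1)] * ∏ c ∈ Finset.range m,
        (C circleValue * descend [seg f (e (c + 1)) (e (c + 1 + 1))])) + X * S.pv (k, 2)))
    (hs : n + m + 1 ≤ s₀) (hsN : s₀ + 2 ≤ N) (hY : 8 * s₀ + 9 ≤ Y) :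
    WP inp N Y (multiplyArcs k) (fun S' => S'.pv (k, 0) = tr k G) S := by
  have hmono : Monotone e := monotone_nat_of_le_succ he
  have h1n : e 1 ≤ n := by rw [← hen]; exact hmono (by omega)
  have hval0 : S.pa (k, 0) (e 0) (e 1) = tr k (descend [seg f (e 0) (e 1)]) :=
    hF 0 (by omega) _ _ le_rfl (he 0) le_rfl trivial
  obtain ⟨u, hu⟩ : ∃ u, u = tr k (S.pv (k, 1) * tr k (descend [seg f (e 0) (e 1)])) := ⟨_, rfl⟩
  have bd0 := ((hbM.mul ((Bd.descend [seg f (e 0) (e 1)]).tr k)).tr k).mono (b' := 2 * n + 2 * e 1 + 3) (by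
    rw [size_seg]
    omega)
  rw [← hu] at bd0
  have a0 := ha 0 (by omega)
  have b0 := hb 0 (by omega)
  refine ⟨by simp [hS.zero], by simp [hS.zero], by simp [hS.zero, a0, b0],
    ?_, ?_⟩
  · have := bd0.mono (b' := Y) (by omega)
    simpa [hS.zero, a0, b0, hval0, ← hu] using this
  generalize hS₁ : Op.run inp _ _ = S₁
  replace hS₁ := hS₁.symm
  have q7 : S₁.pv (k, 7) = u := by simp [hS₁, hS.zero, a0, b0, hval0, ← hu]
  have q11 : S₁.pv (k, 11) = C circleValue := by simp [hS₁, p11]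
  have q12 : S₁.pv (k, 12) = X := by simp [hS₁, p12]
  have q2 : S₁.pv (k, 2) = S.pv (k, 2) := by simp [hS₁]
  have ea : S₁.a = S.a := by simp [hS₁]
  have epa : S₁.pa = S.pa := by simp [hS₁]
  have v4 : S₁.v (k, 4) = (1 : ℕ) := by simp [hS₁, hS.one]
  have v1 : S₁.v (k, 1) = (m + 1 : ℕ) := by simp [hS₁, hm]
  -- Component `0` has been entered before without a circle, so the loop starts at `1`. A component
  -- of length `l` raises the bound by `2 * (l + 1)` for its value and by `1` for the circle; hence
  -- the terms `2 * e c` and `3 * c`.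
  refine WP.loop 1 (m + 1) (fun c S' => S'.pv (k, 7) = tr k (S.pv (k, 1) * (descend [seg f (e 0) (e 1)] *
      ∏ c ∈ Finset.range (c - 1), (C circleValue * descend [seg f (e (c + 1)) (e (c + 1 + 1))]))) ∧
      Bd (2 * n + 2 * e c + 3 * c) (S'.pv (k, 7)))
    (fun t y => y.1 = k ∧ ((t = 0 ∧ 60 ≤ y.2 ∧ y.2 ≤ 63) ∨ (t = 2 ∧ 6 ≤ y.2 ∧ y.2 ≤ 7))) v4 v1 (by omega) (by omega)
    (by simp) (by simp) (by simp) (by simp)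
    (fun _ _ _ _ _ _ _ h => h) ?_ ?_ ?_
  · refine ⟨?_, by rw [q7]; exact bd0⟩
    rw [q7, hu]
    simp only [Nat.sub_self, Finset.range_zero, Finset.prod_empty, mul_one]
    exact tr_congr_mul rfl (tr_tr _ _)
  · rintro c hc1 hcm S' ⟨h7, hb7⟩ hA hc
    have hcn : e (c + 1) ≤ n := by rw [← hen]; exact hmono hcm
    have hec := he c
    have d3 : S'.a (k, 3) c = e c := by rw [hA.a _, ea, ha c hcm]
    have d4 : S'.a (k, 4) c = (e (c + 1) : ℕ) := by rw [hA.a _, ea, hb c hcm]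
    have dF : S'.pa (k, 0) (e c) (e (c + 1)) = tr k (descend [seg f (e c) (e (c + 1))]) := by
      rw [hA.pa _, epa]
      exact hF c hcm _ _ le_rfl (he c) le_rfl trivial
    have d11 : S'.pv (k, 11) = C circleValue := (hA.pv _).trans q11
    obtain ⟨t, ht⟩ : ∃ t, t = tr k (C circleValue * tr k (descend [seg f (e c) (e (c + 1))])) := ⟨_, rfl⟩
    obtain ⟨u', hu'⟩ : ∃ u, u = tr k (S'.pv (k, 7) * t) := ⟨_, rfl⟩
    have bt := (Bd.circle.mul ((Bd.descend [seg f (e c) (e (c + 1))]).tr k)).tr k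
    rw [← ht, size_seg] at bt
    have bu := ((hb7.mul bt).tr k).mono (b' := 2 * n + 2 * e (c + 1) + 3 * (c + 1)) (by omega)
    rw [← hu'] at bu
    have bt' := bt.mono (b' := Y) (by omega)
    have bu' := bu.mono (b' := Y) (by omega)
    simp [WP, hc, d3, d4, dF, d11, ← ht, ← hu', bt', bu']
    refine ⟨?_, bu⟩
    rw [hu', h7, ht]
    obtain ⟨c, rfl⟩ : ∃ c', c = c' + 1 := ⟨c - 1, by omega⟩
    simp only [Nat.add_sub_cancel]
    have hassoc (M D A B : RingA[X]) : M * (D * (A * B)) = M * (D * A) * B := by ring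
    rw [Finset.prod_range_succ, hassoc]
    exact tr_congr_mul (tr_tr _ _) ((tr_tr _ _).trans (tr_congr_mul rfl (tr_tr _ _)))
  · rintro S' ⟨h7, hb7⟩ hA
    have d12 : S'.pv (k, 12) = X := (hA.pv _).trans q12
    have d2 : S'.pv (k, 2) = S.pv (k, 2) := (hA.pv _).trans q2
    obtain ⟨t, ht⟩ : ∃ t, t = tr k (X * S.pv (k, 2)) := ⟨_, rfl⟩
    have bt := (Bd.X.mul hbR).tr k
    rw [← ht] at bt
    rw [hen] at hb7
    have bs := (hb7.mono (b' := Y - 1) (by omega)).add (bt.mono (b' := Y - 1) (by omega))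
    rw [Nat.sub_add_cancel (by omega)] at bs
    have bt' := bt.mono (b' := Y) (by omega)
    simp [WP, d12, d2, ← ht, bt', bs]
    rw [hG, tr_add, h7, ht]
    rfl

theorem exists_interval {e : ℕ → ℕ} (h0 : e 0 = 0) (m x : ℕ) (hx : x < e m) :
    ∃ c < m, e c ≤ x ∧ x < e (c + 1) := by
  induction m with
  | zero => omega
  | succ m ih =>
    grind

theorem evalStep_within (hlinkW : ∀ k', k = k' + 1 → (link k').Within fun _ y => y.1 ≤ k') :
    (evalStep k link).Within fun _ y => y.1 ≤ k := by
  refine ⟨?_, (setPar_within k).mono ?_, (setEnds_within k).mono ?_, (arcTable_within (tableMid_within hlinkW)).mono ?_,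
    (sortArcs_within k (subSmooth_within hlinkW _ _ _) _ _ _).mono ?_, ?_⟩
  · simp [setConsts]
  · intro t y h
    omega
  · intro t y h
    omega
  · intro t y h
    unfold tableTargets at h
    omega
  · intro t y h
    unfold sortTargets at h
    omega
  · simp [multiplyArcs]

/-- The table treats crossings inside components, the sorting those between components. Both use the
evaluation at the previous level only for smoothings that join two words. -/
theorem evalStep_spec (hlink : ∀ k', k = k' + 1 → LinkSpec inp N Y k' (link k') s₀)
    (hlinkW : ∀ k', k = k' + 1 → (link k').Within fun _ y => y.1 ≤ k')
    {P : LinkDiagram → RingAZ} (hP : IsSkeinPolynomial P) (hsN : s₀ + 2 ≤ N) (hY : 8 * s₀ + 9 ≤ Y) :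
    LinkSpec inp N Y k (evalStep k link) s₀ := by
  intro D S hne hgood hsize hrows hends
  obtain ⟨f, a, b, hcode, hf, ha, hb⟩ := exists_positions D
  obtain rfl : b = fun c => a (c + 1) := funext fun c => by rw [ha, hb]
  have hmono : ∀ c, a c ≤ a (c + 1) := fun c => by
    grind
  have hm1 : 1 ≤ D.length := List.length_pos_iff.2 hne
  obtain ⟨m, hm⟩ : ∃ m, D.length = m + 1 := ⟨D.length - 1, by omega⟩
  obtain ⟨n, hn⟩ : ∃ n, n = D.flatten.length := ⟨_, rfl⟩
  have hsz : n + m + 1 ≤ s₀ := by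
    unfold Code.size at hsize
    omega
  have han : a (m + 1) = n := by rw [ha, ← hm, List.take_length, hn]
  have ha0 : a 0 = 0 := by simp [ha]
  have hmono' : Monotone a := monotone_nat_of_le_succ hmono
  rw [hm] at hcode
  have hg : (codeOf f a (fun c => a (c + 1)) (m + 1)).Good := by rwa [hcode]
  have hsound : Sound f n := by
    have : (List.range n).map f = D.flatten := by
      refine List.ext_getElem (by simp [hn]) fun x hx hx' => ?_
      simp [hf x hx']
    unfold Sound
    rw [this]
    exact hgood.subWF
  have hpar := isPar_parOf hsound
  have h1 : |(1 : ℤ)| ≤ N := by rw [abs_le]; omega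
  have hbn : ∀ c < m + 1, a (c + 1) ≤ n := fun c hc => by rw [← han]; exact hmono' hc
  have hshow := hrows.shows hf
  have hends3 : ∀ c < m + 1, S.a (k, 3) c = a c := fun c hc => by rw [(hends.2 c (by omega)).1, ha]
  have hends4 : ∀ c < m + 1, S.a (k, 4) c = a (c + 1) := fun c hc => by rw [(hends.2 c (by omega)).2, ha]
  rw [← hn] at hshow
  refine ⟨by simp, by simp; omega, by simp; omega, by simp; omega, ?_⟩
  generalize hS₁ : Op.run inp _ _ = S₁
  replace hS₁ := hS₁.symm
  have z2 : S₁.v (k, 2) = 0 := by simp [hS₁]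
  have z3 : S₁.v (k, 3) = 2 := by simp [hS₁]
  have z4 : S₁.v (k, 4) = 1 := by simp [hS₁]
  have z5 : S₁.v (k, 5) = -1 := by simp [hS₁]
  have z0 : S₁.v (k, 0) = n := by simp [hS₁, hrows.1, hn]
  have z1 : S₁.v (k, 1) = (m + 1 : ℕ) := by simp only [hS₁, Op.run]; simp [hends.1, hm]
  have ea : S₁.a = S.a := by simp [hS₁]
  refine setPar_spec (f := f) (n := n) z2 z0 (by rwa [ea]) (by omega) fun S₂ hp₂ hA₂ => ?_
  have hR₂ : S₂.Ready k f n (parOf f n) := by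
    refine ⟨?_, ?_, ?_, ?_, ?_, ?_, hp₂⟩
    · exact (hA₂.v _).trans z2
    · exact (hA₂.v _).trans z3
    · exact (hA₂.v _).trans z4
    · exact (hA₂.v _).trans z5
    · exact (hA₂.v _).trans z0
    · rwa [hA₂.a _, hA₂.a _, hA₂.a _, ea]
  have v1₂ : S₂.v (k, 1) = (m + 1 : ℕ) := (hA₂.v _).trans z1
  have a3₂ : S₂.a (k, 3) = S.a (k, 3) := (hA₂.a _).trans (by rw [ea])
  have a4₂ : S₂.a (k, 4) = S.a (k, 4) := (hA₂.a _).trans (by rw [ea])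
  refine setEnds_spec (n := n) (m := m + 1) (a := a) (b := fun c => a (c + 1)) hR₂.zero v1₂ (by rwa [a3₂])
    (by rwa [a4₂]) (fun c _ => hmono c) hbn (by omega) (by omega) (fun c _ d _ hcd => hmono' hcd) fun S₃ hc₃ hA₃ => ?_
  have hR₃ := hR₂.agree hA₃ (by
    intro j
    constructor <;> intro hj <;> simp <;> omega)
  refine arcTable_spec hlink hlinkW hP hR₃ hsound hpar hg hbn
    (fun x hx => exists_interval ha0 (m + 1) x (by rwa [han])) hc₃ (by omega) (by omega) (by omega) (by omega)
    fun S₄ hF₄ p11 p12 hA₄ => ?_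
  have hR₄ := hR₃.agree hA₄ (by
    intro j
    constructor <;> intro hj <;> simp <;> omega)
  have v1₄ : S₄.v (k, 1) = (m + 1 : ℕ) :=
    (hA₄.v _).trans ((hA₃.v _).trans v1₂)
  have a3₄ : ∀ c < m + 1, S₄.a (k, 3) c = a c := by
    rwa [hA₄.a _, hA₃.a _, a3₂]
  have a4₄ : ∀ c < m + 1, S₄.a (k, 4) c = a (c + 1) := by
    rwa [hA₄.a _, hA₃.a _, a4₂]
  have hsub := subSmooth_spec (inp := inp) (N := N) (Y := Y) (s := s₀) hlink hlinkW hR₄ (α := (k, 3)) (β := (k, 4)) (cnt := (k, 1))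
    (by simp) (by simp) (by simp) v1₄ a3₄ a4₄ (fun c _ => hmono c) (by omega) (by omega) (by rwa [hcode]) (by omega)
    (by omega)
  refine sortArcs_spec hP hR₄ (by simp) (by simp) (by simp) v1₄ a3₄ a4₄ (fun c _ => hmono c) hbn (by omega) (by omega)
    (by omega) hsound hpar hg (subSmooth_within hlinkW _ _ _) (by omega) hsub fun S₅ Z hZ hbM hbR hA₅ => ?_
  have hR₅ := hR₄.sort hA₅
  refine multiplyArcs_spec (n := n) (m := m) (s₀ := s₀) (e := a) hR₅
    ((hA₅.v _).trans v1₄) ?_ ?_ hmono han ?_ ?_ ?_ hbM (hbR.mono (by omega)) ?_ hsz hsN hY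
  · rwa [hA₅.a _]
  · rwa [hA₅.a _]
  · rwa [hA₅.pa _]
  · exact (hA₅.pv _).trans p11
  · exact (hA₅.pv _).trans p12
  · have := hZ.finish ⟨hsound, hpar, hbn, isIndex_indexOf hg.subWF.1, hg⟩ (n := m) rfl
    rw [hcode] at this
    exact this

/-- A recursive call leaves the names of higher levels alone, so the variables and tables of the
caller survive it. -/
theorem evalCode_within (k : ℕ) : (evalCode k).Within fun _ y => y.1 ≤ k := by
  induction k with
  | zero => exact evalStep_within (by simp)
  | succ k ih =>
    refine evalStep_within ?_
    rintro k' h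
    obtain rfl : k = k' := by omega
    exact ih

theorem evalCode_spec {P : LinkDiagram → RingAZ} (hP : IsSkeinPolynomial P) (hsN : s₀ + 2 ≤ N)
    (hY : 8 * s₀ + 9 ≤ Y) (k : ℕ) : LinkSpec inp N Y k (evalCode k) s₀ := by
  induction k with
  | zero => exact evalStep_spec (by simp) (by simp) hP hsN hY
  | succ k ih =>
    refine evalStep_spec ?_ ?_ hP hsN hY
    · rintro k' h
      obtain rfl : k = k' := by omega
      exact ih
    · rintro k' h
      obtain rfl : k = k' := by omega
      exact evalCode_within k

/-- Two loops run over the table and a third over the positions to be sorted; the recursive call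
stands inside all three. Building a smoothed code inside them has depth two and does not raise the
total. At level zero the third loop is absent from the table. -/
theorem deg_evalCode (k : ℕ) : (evalCode k).deg ≤ 2 + 3 * k := by
  induction k with
  | zero =>
    simp [evalCode, evalStep, setConsts, setPar, setEnds, arcTable, tableRow, tableCell, tableCombine, tableMid,
      sortArcs, sortInit, sortIndex, sortStep, sortSwitch, subSmooth, multiplyArcs,
      setSwitch, setSmooth, Cmd.deg]
  | succ k ih =>
    simp [evalCode, evalStep, setConsts, setPar, setEnds, arcTable, tableRow, tableCell, tableCombine, tableMid,
      sortArcs, sortInit, sortIndex, sortStep, sortSwitch, subSmooth, buildSmooth, copyArc, multiplyArcs,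
      setSwitch, setSmooth, Cmd.deg]
    omega

/-! ### Reading the input -/

/-- The input for one component. -/
def encodeWord (w : List Passage) : List ℤ := (w.length : ℤ) :: w.flatMap Passage.encode

/-- The place in the input where a component starts. -/
def wordStart (D : Code) (c : ℕ) : ℕ := 1 + ((D.take c).flatMap encodeWord).length

theorem flatMap_split {α β : Type} (f : α → List β) (l : List α) {c : ℕ} (hc : c < l.length) :
    l.flatMap f = (l.take c).flatMap f ++ (f l[c] ++ (l.drop (c + 1)).flatMap f) := by
  rw [← List.flatMap_cons, ← List.flatMap_append, ← List.drop_eq_getElem_cons hc, List.take_append_drop]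

theorem length_flatMap_encode (w : List Passage) : (w.flatMap Passage.encode).length = 3 * w.length := by
  induction w with
  | nil => rfl
  | cons p w ih =>
    rw [List.flatMap_cons, List.length_append, ih]
    simp [Passage.encode]
    omega

theorem length_encodeWord (w : List Passage) : (encodeWord w).length = 3 * w.length + 1 := by
  rw [encodeWord, List.length_cons, length_flatMap_encode]

theorem wordStart_succ {D : Code} {c : ℕ} (hc : c < D.length) :
    wordStart D (c + 1) = wordStart D c + (3 * D[c].length + 1) := by
  rw [wordStart, List.take_succ_eq_append_getElem hc, List.flatMap_append, List.length_append, wordStart,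
    List.flatMap_singleton, length_encodeWord]
  omega

/-- One cell for the number of components, one for the length of each earlier word, and three for
each earlier passage. -/
theorem wordStart_eq (D : Code) {c : ℕ} (hc : c ≤ D.length) :
    wordStart D c = 1 + c + 3 * (D.take c).flatten.length := by
  induction c with
  | zero => simp [wordStart]
  | succ c ih =>
    rw [wordStart_succ hc, ih (by omega), List.take_succ_eq_append_getElem hc, List.flatten_append, List.length_append,
      List.flatten_singleton]
    omega

theorem getD_encode_length (D : LinkDiagram) {c : ℕ} (hc : c < D.code.length) :
    D.encode.getD (wordStart D.code c) 0 = D.code[c].length := by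
  change ((D.com : ℤ) :: D.code.flatMap encodeWord).getD _ 0 = _
  rw [wordStart, add_comm, List.getD_cons_succ, flatMap_split _ _ hc, List.getD_append_right _ _ _ _ le_rfl, Nat.sub_self]
  rfl

theorem getD_encode_passage (D : LinkDiagram) {c : ℕ} (hc : c < D.code.length) {j : ℕ}
    (hj : j < D.code[c].length) {t : ℕ} (ht : t < 3) :
    D.encode.getD (wordStart D.code c + 1 + (3 * j + t)) 0 = D.code[c][j].encode.getD t 0 := by
  have hs := flatMap_split encodeWord _ hc
  generalize D.code[c] = w at hj hs ⊢
  change ((D.com : ℤ) :: D.code.flatMap encodeWord).getD _ 0 = _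
  rw [wordStart, show 1 + ((D.code.take c).flatMap encodeWord).length + 1 + (3 * j + t) =
    ((D.code.take c).flatMap encodeWord).length + (3 * j + t + 1) + 1 by omega, List.getD_cons_succ, hs,
    List.getD_append_right _ _ _ _ (by omega), Nat.add_sub_cancel_left, encodeWord, List.cons_append,
    List.getD_cons_succ, flatMap_split _ _ hj, List.append_assoc, List.getD_append_right, List.append_assoc, List.getD_append]
  · rw [length_flatMap_encode, List.length_take, Nat.min_eq_left hj.le, Nat.add_sub_cancel_left]
  · rw [length_flatMap_encode, List.length_take, Nat.min_eq_left hj.le, Nat.add_sub_cancel_left]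
    exact ht
  · rw [length_flatMap_encode, List.length_take, Nat.min_eq_left hj.le]
    omega

/-- Read the passages of a component. -/
def readWord (k : ℕ) : Cmd :=
  .loop (k, 56) (k, 57) (k, 2) (k, 52)
    (.op (.input (k, 58) (k, 50)) ;; .op (.store (k, 0) (k, 0) (k, 58)) ;; .op (.addc (k, 50) (k, 50) 1) ;;
      .op (.input (k, 58) (k, 50)) ;; .op (.store (k, 1) (k, 0) (k, 58)) ;; .op (.addc (k, 50) (k, 50) 1) ;;
      .op (.input (k, 58) (k, 50)) ;; .op (.store (k, 2) (k, 0) (k, 58)) ;; .op (.addc (k, 50) (k, 50) 1) ;;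
      .op (.addc (k, 0) (k, 0) 1))

/-- Read the input into the arrays of level `k`. -/
def readInput (k : ℕ) : Cmd :=
  .op (.const (k, 2) 0) ;; .op (.input (k, 51) (k, 2)) ;; .op (.const (k, 50) 1) ;;
  .loop (k, 54) (k, 55) (k, 2) (k, 51)
    (.op (.store (k, 3) (k, 1) (k, 0)) ;; .op (.input (k, 52) (k, 50)) ;; .op (.addc (k, 50) (k, 50) 1) ;;
      readWord k ;; .op (.store (k, 4) (k, 1) (k, 0)) ;; .op (.addc (k, 1) (k, 1) 1))

theorem deg_readInput (k : ℕ) : (readInput k).deg ≤ 2 := by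
  simp [readInput, readWord, Cmd.deg]

/-- What the reading of a component may change. -/
@[simp] def ReadTargets (k t : ℕ) (y : Name) : Prop :=
  y.1 = k ∧ ((t = 0 ∧ (y.2 = 0 ∨ y.2 = 50 ∨ 56 ≤ y.2 ∧ y.2 ≤ 58)) ∨ t = 1 ∧ y.2 ≤ 2)

theorem readWord_within (k : ℕ) : (readWord k).Within (ReadTargets k) := by
  simp [readWord]

theorem readWord_spec {l w : List Passage} {p : ℕ} (hS : S.Rows k l)
    (h2 : S.v (k, 2) = 0) (h52 : S.v (k, 52) = w.length) (h50 : S.v (k, 50) = p)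
    (hinp : ∀ j (hj : j < w.length) t, t < 3 → inp (p + (3 * j + t)) = w[j].encode.getD t 0)
    (hp : p + 3 * w.length ≤ N) (hl : l.length + w.length ≤ N) :
    WP inp N Y (readWord k) (fun S' => S'.Rows k (l ++ w) ∧ S'.v (k, 50) = (p + 3 * w.length : ℕ)) S := by
  refine WP.loop 0 w.length (fun j S' => S'.Rows k (l ++ w.take j) ∧ S'.v (k, 50) = (p + 3 * j : ℕ)) _ (by simpa using h2)
    h52 (by omega) (by omega) (by simp) (by simp) (by simp) (readWord_within k) ?_ ?_ ?_ ?_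
  · intro j v v' ar pv pa hv h
    exact ⟨⟨(hv _ (by simp) (by simp)).trans h.1.1, h.1.2⟩, (hv _ (by simp) (by simp)).trans h.2⟩
  · simpa [h50] using hS
  · rintro j - hj S' ⟨hR, h50'⟩ - -
    have hv := hR.1
    obtain ⟨L, hL⟩ : ∃ L, L = (l ++ w.take j).length := ⟨_, rfl⟩
    have hL' : L = l.length + j := by rw [hL, List.length_append, List.length_take, Nat.min_eq_left hj.le]
    rw [← hL] at hv
    have i0 := hinp j hj 0 (by simp)
    have i1 := hinp j hj 1 (by simp)
    have i2 := hinp j hj 2 (by simp)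
    simp only [Passage.encode, List.getD_cons_zero, List.getD_cons_succ] at i0 i1 i2
    obtain ⟨q, hq⟩ : ∃ q, q = p + 3 * j := ⟨_, rfl⟩
    rw [← hq] at h50'
    rw [show p + (3 * j + 0) = q by omega] at i0
    rw [show p + (3 * j + 1) = q + 1 by omega] at i1
    rw [show p + (3 * j + 2) = q + 2 by omega] at i2
    have t1 : ((q : ℤ) + 1).toNat = q + 1 := by omega
    have t2 : ((q : ℤ) + 1 + 1).toNat = q + 2 := by omega
    have b1 : |(q : ℤ) + 1| ≤ N := by rw [abs_le]; omega
    have b2 : |(q : ℤ) + 1 + 1| ≤ N := by rw [abs_le]; omega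
    have b3 : |(q : ℤ) + 1 + 1 + 1| ≤ N := by rw [abs_le]; omega
    have b4 : |(L : ℤ) + 1| ≤ N := by rw [abs_le]; omega
    have h1 : 1 ≤ N := by omega
    have p1 : (0 : ℤ) ≤ q + 1 := by omega
    have p2 : (0 : ℤ) ≤ q + 1 + 1 := by omega
    simp [WP, h50', hv, t1, t2, b1, b2, b3, b4, h1, p1, p2]
    refine ⟨?_, by omega⟩
    rw [List.take_succ_eq_append_getElem hj, ← List.append_assoc]
    refine hR.append ?_ ?_ ?_ ?_ <;> simp [hv, ← hL, i0, i1, i2, Passage.height, Passage.sign]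
  grind

theorem readInput_spec (D : LinkDiagram) (h0 : S.v (k, 0) = 0) (h1 : S.v (k, 1) = 0)
    (hinp : ∀ y, inp y = D.encode.getD y 0) (hN : 1 + D.com + 3 * D.code.flatten.length ≤ N)
    (hQ : ∀ S', S'.Rows k D.code.flatten → S'.Ends k D.code → Q S') :
    WP inp N Y (readInput k) Q S := by
  have e0 : inp 0 = D.code.length := (hinp 0).trans rfl
  have hcom : D.com = D.code.length := rfl
  have hN1 : |(1 : ℤ)| ≤ N := by rw [abs_le]; omega
  have hlen : ∀ c, (D.code.take c).flatten.length ≤ D.code.flatten.length := fun c =>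
    ((List.take_sublist c D.code).flatten).length_le
  refine ⟨by simp, by simp, hN1, ?_⟩
  generalize hS₁ : Op.run inp _ _ = S₁
  replace hS₁ := hS₁.symm
  have z0 : S₁.v (k, 0) = 0 := by simp [hS₁, h0]
  have z1 : S₁.v (k, 1) = 0 := by simp [hS₁, h1]
  have z2 : S₁.v (k, 2) = 0 := by simp [hS₁]
  have z50 : S₁.v (k, 50) = 1 := by simp [hS₁]
  have z51 : S₁.v (k, 51) = D.code.length := by simp [hS₁, e0]
  refine WP.loop 0 D.code.length (fun c S' => S'.Rows k (D.code.take c).flatten ∧ S'.Ends k (D.code.take c) ∧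
      S'.v (k, 50) = wordStart D.code c)
    (fun t y => y.1 = k ∧ (t = 0 ∧ y.2 ≠ 2 ∨ t = 1)) (by simpa using z2) z51 (by omega) (by omega) (by simp) (by simp)
    ?_ ?_ ?_ ?_ ?_ ?_
  · simp [readWord]
  · simp [readWord]
  · intro j v v' ar pv pa hv h
    exact ⟨⟨(hv _ (by simp) (by simp)).trans h.1.1, h.1.2⟩, ⟨(hv _ (by simp) (by simp)).trans h.2.1.1, h.2.1.2⟩,
      (hv _ (by simp) (by simp)).trans h.2.2⟩
  · simp [Store.Rows, Store.Ends, z0, z1, z50, wordStart]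
  · rintro c - hc S' ⟨hR, hE, h50⟩ hA -
    have v2 : S'.v (k, 2) = 0 := (hA.v _).trans z2
    have hv0 := hR.1
    have hv1 := hE.1
    rw [List.length_take, Nat.min_eq_left hc.le] at hv1
    obtain ⟨w, hw⟩ : ∃ w, w = D.code[c] := ⟨_, rfl⟩
    obtain ⟨q, hq⟩ : ∃ q, q = wordStart D.code c := ⟨_, rfl⟩
    obtain ⟨L, hL⟩ : ∃ L, L = (D.code.take c).flatten := ⟨_, rfl⟩
    have hsucc : D.code.take (c + 1) = D.code.take c ++ [w] := by
      rw [hw, List.take_succ_eq_append_getElem hc]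
    have hLw : L.length + w.length ≤ D.code.flatten.length := by
      grind
    have hqv : q = 1 + c + 3 * L.length := by rw [hq, wordStart_eq D.code hc.le, hL]
    have hq' : wordStart D.code (c + 1) = q + 1 + 3 * w.length := by
      rw [wordStart_succ hc, ← hq, ← hw]
      omega
    have hi : inp q = w.length := by rw [hinp, hq, getD_encode_length D hc, hw]
    rw [← hq] at h50
    rw [← hL] at hR hv0
    have b1 : |(q : ℤ) + 1| ≤ N := by rw [abs_le]; omega
    have hrun := readWord_spec (inp := inp) (N := N) (Y := Y) (k := k) (l := L) (w := w) (p := q + 1)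
      (S := (Op.addc (k, 50) (k, 50) 1).run inp ((Op.input (k, 52) (k, 50)).run inp
        ((Op.store (k, 3) (k, 1) (k, 0)).run inp S')))
      (by simpa [Store.Rows] using hR) (by simp [v2]) (by simp [h50, hi])
      (by simp [h50]) (fun j hj t ht => by
        rw [hinp, hq]
        subst hw
        exact getD_encode_passage D hc hj ht) (by omega) (by omega)
    refine ⟨by simp [hv1], by simp [h50], ⟨hN1, by simpa [h50] using b1⟩, ?_⟩
    refine WP.seq ((hrun.frame (readWord_within k)).mono ?_)
    rintro S'' ⟨⟨hR', h50'⟩, hA'⟩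
    have w1 : S''.v (k, 1) = c := by
      rw [hA'.v _]
      simp [hv1]
    have a3 : S''.a (k, 3) = update (S'.a (k, 3)) c L.length := by
      rw [hA'.a _]
      simp [hv1, hv0]
    have a4 : S''.a (k, 4) = S'.a (k, 4) := by
      rw [hA'.a _]
      simp
    have w0 := hR'.1
    have b2 : |(c : ℤ) + 1| ≤ N := by rw [abs_le]; omega
    refine ⟨by simp [w1], ⟨hN1, by simpa [w1] using b2⟩, ?_⟩
    have hflat : (D.code.take (c + 1)).flatten = L ++ w := by
      rw [hsucc, hL]
      simp
    have hcl : (D.code.take c).length = c := by rw [List.length_take, Nat.min_eq_left hc.le]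
    refine ⟨?_, ?_, ?_⟩
    · rw [hflat]
      simpa [Store.Rows] using hR'
    · rw [hsucc]
      refine hE.append ?_ ?_ ?_
      · simp [w1, hv1]
      · simp [a3, hcl, hL]
      · rw [← hsucc, hflat, hcl]
        simp [w1, w0, a4]
    · rw [hq']
      simp [h50']
  grind

/-! ### The program -/

/-- By well-formedness a passage is determined by its crossing and by whether it goes over. -/
theorem LinkDiagram.length_flatten_le (D : LinkDiagram) : D.code.flatten.length ≤ 2 * D.numCrossings := by
  rw [← List.toFinset_card_of_nodup D.wellFormed.1, mul_comm, LinkDiagram.numCrossings, ← Fintype.card_bool,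
    ← Finset.card_univ, ← Finset.card_product]
  refine Finset.card_le_card_of_injOn (fun p => (p.label, p.isOver)) (fun p hp => ?_) fun p hp q hq h => ?_
  · simp only [Finset.coe_product, Finset.coe_univ, Set.mem_prod, Set.mem_univ, and_true, Finset.mem_coe]
    exact List.mem_toFinset.2 (List.mem_map_of_mem (List.mem_toFinset.1 hp))
  · rw [Prod.mk.injEq] at h
    rcases D.wellFormed.2.2 q (List.mem_toFinset.1 hq) p (List.mem_toFinset.1 hp) h.1.symm with h' | h'
    · exact h'
    · rw [h'] at h
      simp [Passage.partner] at h

theorem LinkDiagram.abs_encode_le {D : LinkDiagram} (hD : D.Numbered) (hN : 1 + D.com + 3 * D.code.flatten.length ≤ N)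
    (hn : D.numCrossings ≤ N) (y : ℕ) :
    |D.encode.getD y 0| ≤ N := by
  have key : ∀ x ∈ D.encode, |x| ≤ N := by
    intro x hx
    rcases List.mem_cons.1 hx with rfl | hx
    · rw [abs_le]
      omega
    obtain ⟨w, hw, hx⟩ := List.mem_flatMap.1 hx
    rcases List.mem_cons.1 hx with rfl | hx
    · have := (List.sublist_flatten_of_mem hw).length_le
      rw [abs_le]
      omega
    obtain ⟨p, hp, hx⟩ := List.mem_flatMap.1 hx
    have hlab := hD p.label (List.mem_toFinset.2 (List.mem_map_of_mem (List.mem_flatten_of_mem hw hp)))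
    simp only [Passage.encode, List.mem_cons, List.not_mem_nil, or_false] at hx
    rw [abs_le]
    rcases hx with rfl | rfl | rfl
    · omega
    · split_ifs <;> omega
    · split_ifs <;> omega
  by_cases hy : y < D.encode.length
  · rw [List.getD_eq_getElem _ _ hy]
    exact key _ (List.getElem_mem hy)
  · rw [List.getD_eq_default _ _ (by omega)]
    simp

theorem LinkDiagram.input_sizeLE {D : LinkDiagram} {B : ℕ} (h : ∀ y, |D.encode.getD y 0| ≤ B) : D.input.SizeLE B := by
  refine ⟨fun r => by simp [LinkDiagram.input], fun r => ?_, fun r e he => absurd rfl he, fun r e he => absurd rfl he⟩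
  simp only [LinkDiagram.input]
  split_ifs
  · exact h _
  · simp

theorem LinkDiagram.input_repr (i K : ℕ) {D : LinkDiagram} {B : ℕ} (h : ∀ y, |D.encode.getD y 0| ≤ B) :
    Store.Repr i K B (fun y => D.encode.getD y 0) 0 ⟨0, 0, 0, 0⟩ D.input where
  counter _ := rfl
  reg _ := rfl
  mem α _ y := by
    simp only [LinkDiagram.input]
    exact if_neg (not_le.2 (cell_neg i K α y))
  input y := by simp [LinkDiagram.input]
  preg _ _ _ := by simp [LinkDiagram.input]
  pmem _ _ _ _ _ _ := by simp [LinkDiagram.input]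
  size := input_sizeLE h

/-- Read a diagram and compute the coefficient `i`, which is then moved to the first register. -/
noncomputable def coeffProgram (i K : ℕ) : Program :=
  .seq ((readInput i ;; evalCode i).compile i K 0)
    (.seq (.instr (.polyConst 1 0)) (.instr (.polyAdd 0 (polyVarReg i (i, 0) i) 1)))

theorem coeffProgram_spec (h : ∃ P, IsSkeinPolynomial P) {i K B : ℕ} (hK : (readInput i ;; evalCode i).Fits i K)
    (hL : Large i K N Y B) {D : LinkDiagram} (hD : D.Numbered)
    (hN : 7 * D.numCrossings + 2 ≤ N) (hY : 24 * D.numCrossings + 9 ≤ Y) (hcom : D.com ≤ D.numCrossings) :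
    ∃ t S, Exec (State.SizeLE B) (coeffProgram i K) D.input t S ∧ t ≤ (readInput i ;; evalCode i).cost i K N + 2 ∧
      S.polyReg 0 = homflyptCoeff i D := by
  obtain ⟨P, hP⟩ := h
  have hlen := D.length_flatten_le
  have hcl : D.com = D.code.length := rfl
  have hin := LinkDiagram.abs_encode_le (N := N) hD (by omega) (by omega)
  have hinB : ∀ y, |D.encode.getD y 0| ≤ B := fun y => (hin y).trans (by exact_mod_cast hL.le)
  -- The size of the code is at most `2 * n` passages and `n` components; the bound on components is
  -- where `com ≤ n` enters.
  have hspec := evalCode_spec (inp := fun y => D.encode.getD y 0) (N := N) (Y := Y) hP (s₀ := 3 * D.numCrossings)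
    (by omega) (by omega) i
  have hwp : WP (fun y => D.encode.getD y 0) N Y (readInput i ;; evalCode i)
      (fun S => S.pv (i, 0) = tr i (descend D.code)) ⟨0, 0, 0, 0⟩ := by
    refine WP.seq (readInput_spec D rfl rfl (fun _ => rfl) (by omega) fun S' hR hE => ?_)
    refine hspec D.code S' D.nonempty D.pw.good ?_ hR hE
    unfold Code.size
    omega
  obtain ⟨S, σ, cnt, t, hexec, hS, hrepr, -, ht, -⟩ := Cmd.simulate hL hin _ _ _ _ _ 0 hK
    (LinkDiagram.input_repr i K hinB) ⟨by simp, by simp, fun _ => Bd.zero.mono (Nat.zero_le _),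
      fun _ _ _ => Bd.zero.mono (Nat.zero_le _)⟩ hwp
  have hout : σ.polyReg (polyVarReg i (i, 0) i) = homflyptCoeff i D := by
    rw [hrepr.preg _ i le_rfl, hS, coeff_tr, if_pos le_rfl, homflyptCoeff_eq ⟨P, hP⟩]
  have h1 : State.SizeLE B ((Instr.polyConst 1 0).run σ) := hrepr.size.setPolyReg fun e he => absurd rfl he
  have hr := polyVarReg_ge i (i, 0) i
  have h2 : ((Instr.polyConst 1 0).run σ).polyReg (polyVarReg i (i, 0) i) +
      ((Instr.polyConst 1 0).run σ).polyReg 1 = homflyptCoeff i D := by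
    simp only [Instr.run]
    rw [update_of_ne (by omega), update_self, add_zero, hout]
  refine ⟨_, _, hexec.seq (.seq (.instr h1) (.instr (h1.setPolyReg ?_))), Nat.add_le_add_right ht 2, ?_⟩
  · rw [h2, ← hout]
    exact hrepr.size.2.2.1 _
  · simp only [Instr.run, update_self]
    exact h2

theorem exists_program (i : ℕ) : ∃ (p : Program) (C d : ℕ), ∀ D : LinkDiagram,
    D.Numbered → D.com ≤ D.numCrossings → ∃ (t : ℕ) (S : State),
      D.input.SizeLE (C * D.numCrossings ^ d) ∧ Exec (State.SizeLE (C * D.numCrossings ^ d)) p D.input t S ∧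
      t ≤ C * D.numCrossings ^ (2 + 3 * i) ∧ S.polyReg 0 = homflyptCoeff i D := by
  obtain ⟨K, hK⟩ := Cmd.exists_fits i (readInput i ;; evalCode i)
  obtain ⟨C, hC⟩ := Cmd.cost_le i K (readInput i ;; evalCode i)
  have hone {D : LinkDiagram} (hcom : D.com ≤ D.numCrossings) : 1 ≤ D.numCrossings :=
    (List.length_pos_iff.2 D.nonempty).trans_le hcom
  have hdeg : (readInput i ;; evalCode i).deg ≤ 2 + 3 * i :=
    max_le ((deg_readInput i).trans (by omega)) (deg_evalCode i)
  -- The term with `K` pays for addresses, which are quadratic in `n`; `i + 200` covers the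
  -- polynomials and small constants; the last term is the running time for loops of at most `9 * n`
  -- rounds.
  obtain ⟨C', hC'⟩ : ∃ C', C' = 400 * K + i + 200 + C * 9 ^ (2 + 3 * i) := ⟨_, rfl⟩
  -- The required bounds are `7 * n + 2` for integers and `24 * n + 9` for polynomials; as `n` is at
  -- least `1`, they are below `9 * n` and `33 * n`.
  have hlarge (n : ℕ) (hn : 1 ≤ n) : Large i K (9 * n) (33 * n) (C' * n ^ 2) := by
    have h2 : n ≤ n ^ 2 := Nat.le_self_pow (by simp) n
    have h3 : (400 * K + i + 200) * n ^ 2 ≤ C' * n ^ 2 := Nat.mul_le_mul_right _ (by omega)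
    have h4 : i ≤ i * n ^ 2 := Nat.le_mul_of_pos_right _ (by positivity)
    have h5 : K * n ≤ K * n ^ 2 := Nat.mul_le_mul_left _ h2
    have h6 : K * 1 ≤ K * n ^ 2 := Nat.mul_le_mul_left _ (hn.trans h2)
    refine ⟨?_, ?_, by omega, ?_⟩ <;> nlinarith
  -- Without a skein polynomial all coefficients are zero by definition, and one instruction
  -- suffices.
  by_cases h : ∃ P, IsSkeinPolynomial P
  · refine ⟨coeffProgram i K, C', 2, fun D hD hcom => ?_⟩
    have hn := hone hcom
    have hlen := D.length_flatten_le
    have hL := hlarge _ hn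
    obtain ⟨t, S, hexec, ht, hS⟩ := coeffProgram_spec h hK hL hD (by omega) (by omega) hcom
    refine ⟨t, S, LinkDiagram.input_sizeLE fun y => ?_, hexec, ht.trans ?_, hS⟩
    · exact (LinkDiagram.abs_encode_le hD (N := 9 * D.numCrossings) (by omega) (by omega) y).trans
        (by exact_mod_cast hL.le)
    · have h1 := hC (9 * D.numCrossings) (by omega)
      have h2 : (9 * D.numCrossings) ^ (readInput i ;; evalCode i).deg ≤ 9 ^ (2 + 3 * i) * D.numCrossings ^ (2 + 3 * i) := by
        rw [← mul_pow]
        exact Nat.pow_le_pow_right (by omega) hdeg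
      have h3 : 1 ≤ D.numCrossings ^ (2 + 3 * i) := Nat.one_le_pow _ _ hn
      have h4 := Nat.mul_le_mul_left C h2
      calc _ ≤ C * (9 ^ (2 + 3 * i) * D.numCrossings ^ (2 + 3 * i)) + 2 * D.numCrossings ^ (2 + 3 * i) :=
          Nat.add_le_add (h1.trans h4) (Nat.le_mul_of_pos_right 2 h3)
        _ = (2 + C * 9 ^ (2 + 3 * i)) * D.numCrossings ^ (2 + 3 * i) := by ring
        _ ≤ _ := Nat.mul_le_mul_right _ (by omega)
  · refine ⟨.instr (.polyConst 0 0), C', 2, fun D hD hcom => ?_⟩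
    have hn := hone hcom
    have hlen := D.length_flatten_le
    have hL := hlarge _ hn
    have hin : D.input.SizeLE (C' * D.numCrossings ^ 2) := LinkDiagram.input_sizeLE fun y =>
      (LinkDiagram.abs_encode_le hD (N := 9 * D.numCrossings) (by omega) (by omega) y).trans (by exact_mod_cast hL.le)
    refine ⟨1, _, hin, .instr (hin.setPolyReg fun e he => absurd rfl he), ?_, ?_⟩
    · exact Nat.one_le_iff_ne_zero.2 (Nat.mul_ne_zero (by omega) (by positivity))
    · simp [Instr.run, homflyptCoeff, normalizedHomflypt, homflypt, h]

end Skein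

theorem theorem1p1 :
    (∀ D : Skein.LinkDiagram, ∃ M : ℕ, Skein.normalizedHomflypt D =
      ∑ i ∈ Finset.range (M + 1),
        LaurentPolynomial.C (Skein.homflyptCoeff i D) * Skein.zPow (2 * (i : ℤ))) ∧
    ∀ i : ℕ, ∃ (p : Skein.Program) (C d : ℕ), ∀ D : Skein.LinkDiagram,
      D.Numbered → D.com ≤ D.numCrossings →
        ∃ (t : ℕ) (S : Skein.State),
          D.input.SizeLE (C * D.numCrossings ^ d) ∧
          Skein.Exec (Skein.State.SizeLE (C * D.numCrossings ^ d)) p D.input t S ∧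
          t ≤ C * D.numCrossings ^ (2 + 3 * i) ∧
          S.polyReg 0 = Skein.homflyptCoeff i D :=
  ⟨Skein.normalizedHomflypt_expansion, Skein.exists_program⟩
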